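/- **Setting.** Let $\frac1{\sqrt2}<\sigma<\frac{\sqrt3+1}{2\sqrt2}$ and $\nu>0$. Put $G_k(x)=\frac{e^{-k|x|}}{4\pi|x|}$ and let $V$ be the space of $u\in L^2(\mathbb R^3)$ of the form $u=\phi_u+q_uG_0$ with $\nabla\phi_u\in L^2$, $q_u\in\mathbb C$ (the *charge* of $u$; the charge of a function that has this form locally is defined in the same way, componentwise for vectors). A solution on $[0,T]$ of $i\dot u=H_{\alpha(u)}u$, $\alpha(u)=-\nu|q_u|^{2\sigma}$, is a map $u:[0,T]\to V$, continuous in $L^2$, with $$\tfrac{d}{dt}\,\Re(iu(t),v)_{L^2}=\Re(\nabla\phi_{u},\nabla\phi_v)_{L^2}-\nu|q_u|^{2\sigma}\Re(q_u\overline{q_v})\qquad\forall v\in V .$$ Complex functions are identified with pairs $(\Re,\Im)$, then complexified; $J=\begin{pmatrix}0&-1\\1&0\end{pmatrix}$; $p\cdot q=p_1q_1+p_2q_2$ on $\mathbb C^2$; $\Omega(u,v)=\int(u_2v_1-u_1v_2)\,dx$; $(u,v)_{L^2}=\int u\cdot\bar v$; $w=1+\frac1{|x|}$, $\|f\|_{L^\infty_{w^{-1}}}=\|f/w\|_{L^\infty}$.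 For $\omega>0$ let $$q_\omega=\Big(\tfrac{\sqrt\omega}{4\pi\nu}\Big)^{1/2\sigma},\quad \Phi_\omega=(q_\omega G_{\sqrt\omega},0),\quad \Delta=\tfrac12\tfrac{d}{d\omega}\|\Phi_\omega\|_{L^2}^2,\quad \xi=2\sigma\sqrt{1-\sigma^2}\,\omega,$$ $$\Psi=G_{\sqrt{\omega-\xi}}\begin{pmatrix}1\\ i\end{pmatrix}-\tfrac{1+\sqrt{1-\sigma^2}}{\sigma}\,G_{\sqrt{\omega+\xi}}\begin{pmatrix}1\\-i\end{pmatrix},\qquad \Psi^*=(\Psi_1,-\Psi_2),\qquad \kappa=\Omega(\Psi,\Psi^*)=(\Psi,J\Psi)_{L^2}.$$ These are the eigenfunctions for $\pm i\xi$ of $L=\begin{pmatrix}0&L_2\\-L_1&0\end{pmatrix}$, where $L_j=-\Delta_x+\omega$ with point interaction of strength $\alpha_1=-(2\sigma+1)\frac{\sqrt\omega}{4\pi}$, $\alpha_2=-\frac{\sqrt\omega}{4\pi}$. Let $$P^0f=\tfrac1\Delta\Omega\big(f,\tfrac{d\Phi_\omega}{d\omega}\big)J\Phi_\omega-\tfrac1\Delta\Omega(f,J\Phi_\omega)\tfrac{d\Phi_\omega}{d\omega},\quad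 P^1f=\tfrac1\kappa\Omega(f,\Psi^*)\Psi-\tfrac1\kappa\Omega(f,\Psi)\Psi^*,\quad P^c=1-P^0-P^1 .$$ Let $N_2(\cdot,\cdot)$, $N_3(\cdot,\cdot,\cdot)$ be the symmetric multilinear forms (extended $\mathbb C$-multilinearly) whose diagonals are the quadratic and cubic Taylor terms of $q\mapsto\nu|q_\omega+q|^{2\sigma}(q_\omega+q)$ at $q=0$, $N_2(q)=N_2(q,q)$. Put $$Z_{20}=\tfrac1\kappa JN_2(q_\Psi)\cdot\overline{q_{J\Psi}},\quad Z_{11}=\tfrac2\kappa JN_2(q_\Psi,q_{\Psi^*})\cdot\overline{q_{J\Psi}},\quad Z_{02}=\tfrac1\kappa JN_2(q_{\Psi^*})\cdot\overline{q_{J\Psi}},$$ $$Z_{21}=\tfrac3\kappa JN_3(q_{\Psi^*},q_\Psi,q_\Psi)\cdot\overline{q_{J\Psi}}-\tfrac1{\Delta\kappa}\Big[\big(\tfrac{d\Psi^*}{d\omega},J\Psi\big)_{L^2}JN_2(q_\Psi)\cdot q_{\Phi_\omega}+(\Psi^*,\Psi)_{L^2}JN_2(q_\Psi)\cdot q_{J\frac{d\Phi_\omega}{d\omega}}+2\|\Psi\|_{L^2}^2JN_2(q_\Psi,q_{\Psi^*})\cdot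 q_{J\frac{d\Phi_\omega}{d\omega}}\Big],$$ $$Z'_{10}=\tfrac{2}{\bar\kappa}N_2(q_{\Psi^*},q_\Psi),\qquad Z'_{01}=\tfrac2{\bar\kappa}N_2(q_\Psi).$$ For a frozen frequency $\omega_T>0$ write $L_T,\xi_T,P^0_T,P^1_T,P^c_T$ for the above objects at $\omega_T$, let $S\delta$ ($S\in\mathbb C^2$) be the point source $v\mapsto S\cdot q_v$, and with $N_2,\Psi,\Psi^*$ taken at $\omega$ set $$a_{20}=-(L_T-2i\xi_T-0)^{-1}P^c_T\big(JN_2(q_\Psi)\delta\big),\quad a_{11}=-L_T^{-1}P^c_T\big(2JN_2(q_\Psi,q_{\Psi^*})\delta\big),\quad a_{02}=\overline{a_{20}}.$$ (Explicitly $a_{20}=P^c_Tu$, where $u$ is the combination of $G_{\sqrt{\omega_T+2\xi_T}}(1,-i)$ and $G_{i\sqrt{2\xi_T-\omega_T}}(1,i)$ whose components satisfy $\alpha_jq_{u_j}-\phi_{u_j}(0)=(N_2(q_\Psi))_j$ with $\alpha_j=\alpha_j(\omega_T)$; and $a_{11}=P^c_T(q\,G_{\sqrt{\omega_T}},0)$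 with $(\alpha_1+\frac{\sqrt{\omega_T}}{4\pi})q=2N_2(q_\Psi,q_{\Psi^*})_1$.) Finally $$Z'_{21}=q_{a_{11}}\cdot\overline{Z'_{10}}+q_{a_{20}}\cdot\overline{Z'_{01}},\qquad iK=Z_{21}+Z'_{21}+\tfrac i\xi Z_{20}Z_{11}-\tfrac i\xi|Z_{11}|^2-\tfrac{2i}{3\xi}|Z_{02}|^2,$$ with $Z'_{21}=Z'_{21}(\omega;\omega_T)$, $K=K(\omega;\omega_T)$, and $K_T=K(\omega_T;\omega_T)$. **Proposition.** Let $I=[\omega_-,\omega_+]\subset(0,\infty)$, $\omega_-<\omega_+$. There are $\delta,C>0$, depending only on $\sigma,\nu,I$, such that for every $\omega_T\in I$ there are $C^1$ coefficients $c_{ij}=c_{ij}(\omega)$ on $I$ (for the fixed $\omega_T$), bounded by $C$, with the following property. Let $T>0$ and let $$u(t)=e^{i\Theta(t)}\big(\Phi_{\omega(t)}+z(t)\Psi+\overline{z(t)}\Psi^*+f(t)\big),\qquad \Theta(t)=\int_0^t\omega\,ds+\gamma(t),$$ be a solution on $[0,T]$ with $\omega,\gamma\in C^1([0,T])$, $\omega(t)\in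 I$, $\omega(T)=\omega_T$, and $P^0f(t)=P^1f(t)=0$ ($\Psi,\Psi^*,P^0,P^1$ at $\omega(t)$). Put $$z_1=z+c_{20}z^2+c_{11}z\bar z+c_{02}\bar z^2+c_{30}z^3+c_{12}z\bar z^2+c_{03}\bar z^3,\qquad c_{ij}=c_{ij}(\omega(t)).$$ Let $t\in[0,T]$ with $|z(t)|+\|f(t)\|_{L^\infty_{w^{-1}}}\le\delta$, and split $f=g+h$, $g=(P^0_T+P^1_T)f$, $h=P^c_Tf$, and $h=h_1+k+k_1$ with $k=a_{20}z^2+a_{11}z\bar z+a_{02}\bar z^2$ (the $a_{ij}$ at $\omega=\omega(t)$) and an arbitrary $k_1\in L^\infty_{w^{-1}}$. Then $z_1$ is differentiable at $t$ and $$\dot z_1=i\xi z_1+iK|z_1|^2z_1+\widehat Z_R,$$ where, with $r=g+P^c_Th_1+P^c_Tk_1$, $$\widehat Z_R=(q_r\cdot\overline{Z'_{10}})\,z+(q_r\cdot\overline{Z'_{01}})\,\bar z+Z_R,\qquad |Z_R|\le C\big(|z|^2+\|f\|_{L^\infty_{w^{-1}}}\big)^2 .$$ Moreover, if $|\omega_T-\omega(t)|\le\delta$,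 then $$\big|\dot z_1-i\xi z_1-iK_T|z_1|^2z_1\big|\le C\Big[\big(|z|^2+\|f\|_{L^\infty_{w^{-1}}}\big)^2+|z|\,|\omega_T-\omega|\big(|z|^2+\|h\|_{L^\infty_{w^{-1}}}\big)+|z|\,\|P^c_Tk_1\|_{L^\infty_{w^{-1}}}+|z|\,\|P^c_Th_1\|_{L^\infty_{w^{-1}}}\Big].$$ Here $\xi,K,Z'_{10},Z'_{01}$ are taken at $\omega(t)$. -/

import Mathlib

/-! Nonlinear Schroedinger equation in dimension three with a power nonlinearity concentrated
at the origin: energy space, standing waves, linearization, modulation of solutions, and the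
coefficients of the equation of the discrete mode. -/

noncomputable section

namespace ConcNLS

open MeasureTheory Complex ComplexConjugate

/-- The physical space. -/
abbrev E3 := EuclideanSpace ℝ (Fin 3)

/-- Fields with two complex components: the complexification of the real pair
`(Re u, Im u)`. -/
abbrev Field2 := E3 → Fin 2 → ℂ

/-! ### Energy space, energy form, charges -/

/-- The function `exp (-k |x|) / (4 π |x|)`. -/
def Gk (k : ℂ) (x : E3) : ℂ := exp (-k * (‖x‖ : ℂ)) / (4 * Real.pi * ‖x‖)

/-- The function `1 / (4 π |x|)`. -/
def G0 (x : E3) : ℂ := 1 / (4 * Real.pi * ‖x‖)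

/-- `g` is the weak gradient of `φ` on the whole space. -/
def HasWeakGrad (φ : E3 → ℂ) (g : Fin 3 → E3 → ℂ) : Prop :=
  LocallyIntegrable φ volume ∧ (∀ i, LocallyIntegrable (g i) volume) ∧
    ∀ η : E3 → ℝ, ContDiff ℝ ((⊤ : ℕ∞) : WithTop ℕ∞) η → HasCompactSupport η → ∀ i : Fin 3,
      ∫ x, φ x * ((fderiv ℝ η x (EuclideanSpace.single i 1) : ℝ) : ℂ)
        = -∫ x, g i x * ((η x : ℝ) : ℂ)

/-- An element `u = φ + q G0` of the energy space `V`: `u` is square integrable, `q` is its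
charge, and `grad` is the (square integrable) weak gradient of its regular part `φ`. -/
structure EnergySpace where
  toFun : E3 → ℂ
  charge : ℂ
  grad : Fin 3 → E3 → ℂ
  memLp : MemLp toFun 2 volume
  grad_memLp : ∀ i, MemLp (grad i) 2 volume
  weakGrad : HasWeakGrad (fun x => toFun x - charge * G0 x) grad

/-- The form of the nonlinear operator: `Re (∇φ_u, ∇φ_v) - ν |q_u|^(2σ) Re (q_u conj q_v)`. -/
def energyForm (σ ν : ℝ) (u v : EnergySpace) : ℝ :=
  (∑ i : Fin 3, ∫ x, u.grad i x * conj (v.grad i x)).re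
    - ν * ‖u.charge‖ ^ (2 * σ) * (u.charge * conj v.charge).re

/-- `u` is a (weak) solution on `[0, T]` of `i du/dt = H_{α(u)} u`, `α(u) = -ν |q_u|^(2σ)`:
it takes values in the energy space, is continuous in `L²`, and
`(i du/dt, v) = energyForm u v` for every `v` in the energy space. -/
def IsSolution (σ ν T : ℝ) (u : ℝ → EnergySpace) : Prop :=
  (∀ t ∈ Set.Icc 0 T, Filter.Tendsto
    (fun s => eLpNorm (fun x => (u s).toFun x - (u t).toFun x) 2 volume)
    (nhdsWithin t (Set.Icc 0 T)) (nhds 0)) ∧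
  ∀ v : EnergySpace, ∀ t ∈ Set.Icc 0 T,
    HasDerivWithinAt (fun s => (∫ x, I * (u s).toFun x * conj (v.toFun x)).re)
      (energyForm σ ν (u t) v) (Set.Icc 0 T) t

/-- `q` is the charge of `u`: locally, `u - q G0` has a square integrable weak gradient. -/
def HasCharge (u : E3 → ℂ) (q : ℂ) : Prop :=
  ∃ g : Fin 3 → E3 → ℂ,
    (∀ i, ∀ K : Set E3, IsCompact K → MemLp (g i) 2 (volume.restrict K)) ∧
    HasWeakGrad (fun x => u x - q * G0 x) g

open Classical in
/-- The charge of a scalar function (it is unique when it exists). -/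
def charge (u : E3 → ℂ) : ℂ := if h : ∃ q, HasCharge u q then h.choose else 0

/-- The charge vector of a two-component field. -/
def chargeV (u : Field2) : Fin 2 → ℂ := fun i => charge (fun x => u x i)

/-- Fields in the weighted space `L^∞_{w⁻¹}`, `w = 1 + 1 / |x|`. -/
def MemW (f : Field2) : Prop :=
  AEStronglyMeasurable f volume ∧
    eLpNorm (fun x => ‖f x‖ / (1 + 1 / ‖x‖)) ⊤ volume < ⊤

/-- The norm of `L^∞_{w⁻¹}`, i.e. the essential supremum of `|f| / w`. -/
def wNorm (f : Field2) : ℝ := (eLpNorm (fun x => ‖f x‖ / (1 + 1 / ‖x‖)) ⊤ volume).toReal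

/-! ### Algebra of two-component vectors -/

/-- The bilinear product of `ℂ²`. -/
def dot (p q : Fin 2 → ℂ) : ℂ := p 0 * q 0 + p 1 * q 1

/-- Componentwise complex conjugation. -/
def cj (p : Fin 2 → ℂ) : Fin 2 → ℂ := fun i => conj (p i)

/-- The matrix `J = [[0, -1], [1, 0]]`, i.e. multiplication by `i` on pairs `(Re u, Im u)`. -/
def J (p : Fin 2 → ℂ) : Fin 2 → ℂ := ![-p 1, p 0]

/-- The pair `(Re c, Im c)`. -/
def toVec (c : ℂ) : Fin 2 → ℂ := ![(c.re : ℂ), (c.im : ℂ)]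

/-- The Hermitian `L²` product of two-component fields. -/
def ip (u v : Field2) : ℂ := ∫ x, dot (u x) (cj (v x))

/-- The bilinear symplectic form `∫ (u₂ v₁ - u₁ v₂)`. -/
def Om (u v : Field2) : ℂ := ∫ x, dot (u x) (J (v x))

/-! ### Standing waves and the discrete spectrum of the linearization -/

/-- The frequency `ξ = 2 σ √(1 - σ²) ω`. -/
def xi (σ ω : ℝ) : ℝ := 2 * σ * √(1 - σ ^ 2) * ω

/-- The charge `q_ω = (√ω / (4 π ν))^(1 / (2σ))` of the standing wave. -/
def qSol (σ ν ω : ℝ) : ℝ := (√ω / (4 * Real.pi * ν)) ^ (1 / (2 * σ))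

/-- The standing wave profile `Φ_ω` as the pair `(Φ_ω, 0)`. -/
def Phi (σ ν ω : ℝ) : Field2 := fun x => ![(qSol σ ν ω : ℂ) * Gk (√ω : ℝ) x, 0]

/-- The derivative `dΦ_ω / dω`. -/
def dPhi (σ ν ω : ℝ) : Field2 := fun x => deriv (fun s : ℝ => Phi σ ν s x) ω

/-- `Δ = (1/2) d/dω ‖Φ_ω‖²`. -/
def Delta (σ ν ω : ℝ) : ℝ :=
  deriv (fun s : ℝ => (1 / 2) * ∫ x, ‖Phi σ ν s x 0‖ ^ 2) ω

/-- The eigenfunction `Ψ` of the linearization `L = [[0, L₂], [-L₁, 0]]` for the eigenvalue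
`i ξ`; here `L_j = -Laplacian + ω` with the point interactions of strength
`α₁ = -(2σ+1) √ω/(4π)`, `α₂ = -√ω/(4π)`. -/
def Psi (σ ω : ℝ) : Field2 := fun x =>
  Gk (√(ω - xi σ ω) : ℝ) x • ![1, I]
    + ((-(1 + √(1 - σ ^ 2)) / σ : ℝ) : ℂ) • Gk (√(ω + xi σ ω) : ℝ) x • ![1, -I]

/-- The eigenfunction `Ψ* = (Ψ₁, -Ψ₂)` for the eigenvalue `-i ξ`. -/
def PsiStar (σ ω : ℝ) : Field2 := fun x => ![Psi σ ω x 0, -Psi σ ω x 1]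

/-- The derivative `dΨ* / dω`. -/
def dPsiStar (σ ω : ℝ) : Field2 := fun x => deriv (fun s : ℝ => PsiStar σ s x) ω

/-- `κ = Ω(Ψ, Ψ*)`, which is the Hermitian product `(Ψ, JΨ)`. -/
def kappa (σ ω : ℝ) : ℂ := Om (Psi σ ω) (PsiStar σ ω)

/-- Symplectic projection onto the generalized kernel, spanned by `JΦ` and `dΦ/dω`. -/
def P0 (σ ν ω : ℝ) (f : Field2) : Field2 := fun x =>
  (Om f (dPhi σ ν ω) / Delta σ ν ω) • J (Phi σ ν ω x)
    - (Om f (fun y => J (Phi σ ν ω y)) / Delta σ ν ω) • dPhi σ ν ω x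

/-- Symplectic projection onto the span of `Ψ` and `Ψ*`. -/
def P1 (σ ω : ℝ) (f : Field2) : Field2 := fun x =>
  (Om f (PsiStar σ ω) / kappa σ ω) • Psi σ ω x
    - (Om f (Psi σ ω) / kappa σ ω) • PsiStar σ ω x

/-- Symplectic projection onto the continuous spectral subspace. -/
def Pc (σ ν ω : ℝ) (f : Field2) : Field2 := fun x => f x - P0 σ ν ω f x - P1 σ ω f x

/-! ### Modulated solutions -/

/-- The phase `Θ(t) = ∫₀ᵗ ω + γ(t)`. -/
def phase (ω γ : ℝ → ℝ) (t : ℝ) : ℝ := (∫ s in (0 : ℝ)..t, ω s) + γ t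

/-- The component `f` of a state `u` in `u = e^{iΘ} (Φ_ω + z Ψ + conj z Ψ* + f)`. -/
def fPart (σ ν : ℝ) (u : E3 → ℂ) (θ ω : ℝ) (z : ℂ) : Field2 := fun x =>
  toVec (exp (-I * θ) * u x) - Phi σ ν ω x - (z • Psi σ ω x + conj z • PsiStar σ ω x)

/-- The modulation Ansatz on `[0, T]`: `u` is a solution, `ω > 0` and `γ` are continuously
differentiable, and in `u = e^{iΘ} (Φ_ω + z Ψ + conj z Ψ* + f)` the component `f` lies at every
time in the continuous spectral subspace at `ω(t)` (so that the whole fluctuation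
`z Ψ + conj z Ψ* + f` is symplectically orthogonal to the generalized kernel). -/
structure IsModulated (σ ν T : ℝ) (u : ℝ → EnergySpace) (ω γ : ℝ → ℝ) (z : ℝ → ℂ) : Prop where
  sol : IsSolution σ ν T u
  omega_pos : ∀ t ∈ Set.Icc 0 T, 0 < ω t
  omega_C1 : ContDiffOn ℝ 1 ω (Set.Icc 0 T)
  gamma_C1 : ContDiffOn ℝ 1 γ (Set.Icc 0 T)
  orth0 : ∀ t ∈ Set.Icc 0 T,
    P0 σ ν (ω t) (fPart σ ν (u t).toFun (phase ω γ t) (ω t) (z t)) = 0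
  orth1 : ∀ t ∈ Set.Icc 0 T,
    P1 σ (ω t) (fPart σ ν (u t).toFun (phase ω γ t) (ω t) (z t)) = 0

/-! ### Taylor terms of the nonlinearity and coefficients of the equation of `z` -/

/-- Quadratic term (polarized) of `q ↦ ν |q_ω + q|^(2σ) (q_ω + q)` at `q = 0`. -/
def N2 (σ ν ω : ℝ) (p q : Fin 2 → ℂ) : Fin 2 → ℂ :=
  let Q : ℝ := qSol σ ν ω
  let e : Fin 2 → ℂ := ![(Q : ℂ), 0]
  let b₁ : ℂ := ((ν * σ * Q ^ (2 * (σ - 1)) : ℝ) : ℂ)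
  let b₂ : ℂ := ((ν * (2 * (σ - 1) * σ) * Q ^ (2 * (σ - 2)) : ℝ) : ℂ)
  b₁ • (dot p q • e + dot e p • q + dot e q • p) + (b₂ * dot e p * dot e q) • e

/-- Cubic term (polarized) of `q ↦ ν |q_ω + q|^(2σ) (q_ω + q)` at `q = 0`. -/
def N3 (σ ν ω : ℝ) (p q r : Fin 2 → ℂ) : Fin 2 → ℂ :=
  let Q : ℝ := qSol σ ν ω
  let e : Fin 2 → ℂ := ![(Q : ℂ), 0]
  let b₁ : ℂ := ((ν * σ * Q ^ (2 * (σ - 1)) / 3 : ℝ) : ℂ)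
  let b₂ : ℂ := ((ν * (2 * (σ - 1) * σ) * Q ^ (2 * (σ - 2)) / 3 : ℝ) : ℂ)
  let b₃ : ℂ := ((ν * (4 / 3 * (σ - 2) * (σ - 1) * σ) * Q ^ (2 * (σ - 3)) : ℝ) : ℂ)
  b₁ • (dot p q • r + dot q r • p + dot r p • q)
    + b₂ • ((dot e p * dot e q) • r + (dot e q * dot e r) • p + (dot e r * dot e p) • q)
    + (b₂ * (dot e p * dot q r + dot e q * dot r p + dot e r * dot p q)) • e
    + (b₃ * dot e p * dot e q * dot e r) • e

/-- The charge of `Ψ`. -/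
def qPsi (σ ω : ℝ) : Fin 2 → ℂ := chargeV (Psi σ ω)

/-- The charge of `Ψ*`. -/
def qPsiStar (σ ω : ℝ) : Fin 2 → ℂ := chargeV (PsiStar σ ω)

def Z20 (σ ν ω : ℝ) : ℂ :=
  (1 / kappa σ ω) * dot (J (N2 σ ν ω (qPsi σ ω) (qPsi σ ω))) (cj (J (qPsi σ ω)))

def Z11 (σ ν ω : ℝ) : ℂ :=
  (2 / kappa σ ω) * dot (J (N2 σ ν ω (qPsi σ ω) (qPsiStar σ ω))) (cj (J (qPsi σ ω)))

def Z02 (σ ν ω : ℝ) : ℂ :=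
  (1 / kappa σ ω) * dot (J (N2 σ ν ω (qPsiStar σ ω) (qPsiStar σ ω))) (cj (J (qPsi σ ω)))

def Z21 (σ ν ω : ℝ) : ℂ :=
  (3 / kappa σ ω)
      * dot (J (N3 σ ν ω (qPsiStar σ ω) (qPsi σ ω) (qPsi σ ω))) (cj (J (qPsi σ ω)))
    - (1 / (Delta σ ν ω * kappa σ ω)) *
      (ip (dPsiStar σ ω) (fun x => J (Psi σ ω x))
          * dot (J (N2 σ ν ω (qPsi σ ω) (qPsi σ ω))) (chargeV (Phi σ ν ω))
        + ip (PsiStar σ ω) (Psi σ ω)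
          * dot (J (N2 σ ν ω (qPsi σ ω) (qPsi σ ω))) (J (chargeV (dPhi σ ν ω)))
        + 2 * ip (Psi σ ω) (Psi σ ω)
          * dot (J (N2 σ ν ω (qPsi σ ω) (qPsiStar σ ω))) (J (chargeV (dPhi σ ν ω))))

/-- The vector `Z'₁₀`: the term `z q_f` of the equation of `z` is `z (q_f · conj Z'₁₀)`. -/
def Z10' (σ ν ω : ℝ) : Fin 2 → ℂ :=
  (2 / conj (kappa σ ω)) • N2 σ ν ω (qPsiStar σ ω) (qPsi σ ω)

/-- The vector `Z'₀₁`: the term `conj z q_f` of the equation of `z` is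
`conj z (q_f · conj Z'₀₁)`. -/
def Z01' (σ ν ω : ℝ) : Fin 2 → ℂ :=
  (2 / conj (kappa σ ω)) • N2 σ ν ω (qPsi σ ω) (qPsi σ ω)

/-! ### The quadratic correction `k = a₂₀ z² + a₁₁ z conj z + a₀₂ (conj z)²` of `h` -/

/-- For `u = c₀ G_{k₊} (1, -i) + c₁ G_{k₋} (1, i)` this matrix sends `(c₀, c₁)` to the vector
`(α_j q_j - φ_j(0))_j`, where `q_j` is the charge and `φ_j(0)` is the value at the origin of the
regular part of the component `u_j`. -/
def boundaryMatrix (σ ω : ℝ) (kp km : ℂ) : Matrix (Fin 2) (Fin 2) ℂ :=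
  let α₁ : ℂ := ((-(2 * σ + 1) * √ω / (4 * Real.pi) : ℝ) : ℂ)
  let α₂ : ℂ := ((-√ω / (4 * Real.pi) : ℝ) : ℂ)
  !![α₁ + kp / (4 * Real.pi), α₁ + km / (4 * Real.pi);
    -I * (α₂ + kp / (4 * Real.pi)), I * (α₂ + km / (4 * Real.pi))]

/-- The field `-(L - 2iξ - 0)⁻¹ (J M δ)`, where `L` is the linearization at `ω` and `J M δ` is
the point source `v ↦ J M · q_v`. Off the origin it solves `L u = 2iξ u`, with the
square roots `√(ω + 2ξ)` and `√(ω - 2ξ + i0) = i √(2ξ - ω)`; at the origin it satisfies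
`α_j q_j - φ_j(0) = M_j`. -/
def outgoing (σ ω : ℝ) (M : Fin 2 → ℂ) : Field2 := fun x =>
  let kp : ℂ := (√(ω + 2 * xi σ ω) : ℝ)
  let km : ℂ := I * (√(2 * xi σ ω - ω) : ℝ)
  let c : Fin 2 → ℂ := (boundaryMatrix σ ω kp km)⁻¹.mulVec M
  c 0 • Gk kp x • ![1, -I] + c 1 • Gk km x • ![1, I]

/-- The field `-L⁻¹ (J (m, 0) δ)`: the solution `(u₁, 0)` of `L₁ u₁ = m δ`, i.e.
`u₁ = q G_{√ω}` with `(α₁ + √ω / (4π)) q = m`. -/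
def static (σ ω : ℝ) (m : ℂ) : Field2 := fun x =>
  ![-(4 * Real.pi * m / (2 * σ * √ω : ℝ)) * Gk (√ω : ℝ) x, 0]

/-- `a₂₀ = -(L_T - 2iξ_T - 0)⁻¹ P^c_T (J N₂(q_Ψ) δ)`. The operators are frozen at `ωT`, the
source is taken at `ω`; the projection commutes with the resolvent. -/
def a20 (σ ν ωT ω : ℝ) : Field2 :=
  Pc σ ν ωT (outgoing σ ωT (N2 σ ν ω (qPsi σ ω) (qPsi σ ω)))

/-- `a₁₁ = -L_T⁻¹ P^c_T (2 J N₂(q_Ψ, q_Ψ*) δ)`; the second component of `N₂(q_Ψ, q_Ψ*)` is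
zero. -/
def a11 (σ ν ωT ω : ℝ) : Field2 :=
  Pc σ ν ωT (static σ ωT (2 * N2 σ ν ω (qPsi σ ω) (qPsiStar σ ω) 0))

/-- `a₀₂ = conj a₂₀`. -/
def a02 (σ ν ωT ω : ℝ) : Field2 := fun x => cj (a20 σ ν ωT ω x)

/-- The correction `k`. -/
def kCorr (σ ν ωT ω : ℝ) (z : ℂ) : Field2 := fun x =>
  z ^ 2 • a20 σ ν ωT ω x + (z * conj z) • a11 σ ν ωT ω x + (conj z) ^ 2 • a02 σ ν ωT ω x

/-- `Z'₂₁`, the resonant cubic coefficient produced by `k`. -/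
def Z21' (σ ν ωT ω : ℝ) : ℂ :=
  dot (chargeV (a11 σ ν ωT ω)) (cj (Z10' σ ν ω))
    + dot (chargeV (a20 σ ν ωT ω)) (cj (Z01' σ ν ω))

/-- The coefficient `iK`. -/
def iK (σ ν ωT ω : ℝ) : ℂ :=
  Z21 σ ν ω + Z21' σ ν ωT ω + I / xi σ ω * Z20 σ ν ω * Z11 σ ν ω
    - I / xi σ ω * (‖Z11 σ ν ω‖ : ℂ) ^ 2 - 2 * I / (3 * xi σ ω) * (‖Z02 σ ν ω‖ : ℂ) ^ 2

/-- The change of variable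
`z + c₂₀ z² + c₁₁ z conj z + c₀₂ (conj z)² + c₃₀ z³ + c₁₂ z (conj z)² + c₀₃ (conj z)³`. -/
def newVar (c20 c11 c02 c30 c12 c03 : ℂ) (z : ℂ) : ℂ :=
  z + c20 * z ^ 2 + c11 * (z * conj z) + c02 * conj z ^ 2
    + c30 * z ^ 3 + c12 * (z * conj z ^ 2) + c03 * conj z ^ 3

end ConcNLS

end

open ConcNLS

/-! ### Radial calculus: profiles, weak gradients, and the charge as a functional. -/

noncomputable section

namespace ConcNLS

open MeasureTheory Complex ComplexConjugate Set

/-! ### Radial integrals and exponential profiles -/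

/-! Everything is reduced to finitely many scalar moments of the solution. Since (σ ∓ √(1-σ²))² = 1
∓ 2σ√(1-σ²), the decay rates √(ω∓ξ) of Ψ are constant multiples a0√ω, b0√ω of √ω. So Φ, dΦ/dω, Ψ, Ψ*
and dΨ*/dω are combinations of the profiles `ek n k` with k proportional to √ω. All their mutual
pairings are elementary integrals, and all coefficients are constants times powers of √ω and q_ω.

A solution is only weak, but `(c₀ + c₁ r) exp (-k r) / (4π r)` lies in the energy space. Integrating
by parts against it (`energySpace_grad_test`) turns the weak equation into an ordinary differential
equation for its moments, in which the nonlinearity is seen only through the charge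
(`weak_pairing`). The rate may move with ω(t): `ek` is differentiable in L² with respect to k, and u
need only be continuous in L² (`moving_pairing`).

The conditions P⁰f = 0 and P¹f = 0 become identities between moments. Two of them involve only ω and
the moments (`constraint_re`, `constraint_im`); the third expresses z by ω and the moments
(`constraint_z`). Differentiating them gives the equations of ω and γ (`modulation_eq_re`,
`modulation_eq_im`), and shows that z is differentiable with an exact equation
(`hasDerivWithinAt_z_moments`). No regularity of z or f is used.

Orders are counted in ρ = (|z|² + ‖f‖)^{1/2}: z has order 1 and f has order 2. The charge is
controlled by the weighted norm (`exists_charge_bound`), so the charge fluctuation is a first order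
part from z plus the second order charge of f, and the nonlinearity is expanded up to order 4
(`exists_Nplus_bound`, `State.wt_N`). The equations of ω and γ are a linear system that is diagonal
up to order 1, which gives their leading quadratic terms (`State.wt_modulation`). Insertion yields
the equation of z with all quadratic and cubic coefficients and the terms linear in q_f
(`State.wt_z_equation`).

Splitting q_f into the charge of k and that of the remainder r moves quadratic terms in z into the
cubic coefficients, which produces Z'₂₁. A monomial z^m z̄^n rotates with frequency (m-n)ξ, so every
quadratic or cubic monomial except z²z̄ can be removed by dividing by a nonzero multiple of iξ. The
surviving coefficient is iK (`wt_normal_form`, `iK_eq`, `State.wt_new_equation`).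

For the last estimate, r = f - k because the frozen projection is idempotent and fixes k
(`remainder_decomposition`). The part g is of size |ω_T - ω| ‖f‖, since the projections of f vanish
at ω(t) and depend Lipschitz continuously on the frequency (`exists_discrete_bound`), and K is
Lipschitz in ω. Uniformity in ω_T needs only boundedness in the frozen variable, which is what
`Good` records. -/

lemma integrable_radial {F : Type*} [NormedAddCommGroup F] [NormedSpace ℝ F] {f : ℝ → F} :
    Integrable (fun x : E3 => f ‖x‖) ↔ IntegrableOn (fun r : ℝ => r ^ 2 • f r) (Ioi 0) := by
  have := integrable_fun_norm_addHaar (E := E3) volume (f := f)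
  simpa using this

lemma integral_radial {F : Type*} [NormedAddCommGroup F] [NormedSpace ℝ F] (f : ℝ → F) :
    ∫ x : E3, f ‖x‖ = (4 * Real.pi) • ∫ r in Ioi (0 : ℝ), r ^ 2 • f r := by
  have := integral_fun_norm_addHaar (E := E3) volume f
  rw [this]
  have hv : (volume : Measure E3).real (Metric.ball 0 1) = Real.pi * 4 / 3 := by
    rw [Measure.real, EuclideanSpace.volume_ball_fin_three]
    simp
    positivity
  rw [hv]
  simp only [finrank_euclideanSpace, Fintype.card_fin, Nat.reduceSub]
  rw [← Nat.cast_smul_eq_nsmul ℝ, smul_smul]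
  congr 1
  push_cast; ring

lemma ae_ne_zero : ∀ᵐ x : E3, x ≠ 0 := by
  simp [ae_iff]

lemma ae_norm_pos : ∀ᵐ x : E3, 0 < ‖x‖ := by
  filter_upwards [ae_ne_zero] with x hx using norm_pos_iff.2 hx

/-- The profile `|x|^(n-1) exp (-k |x|) / (4 π)`. -/
def ek (n : ℕ) (k : ℂ) (x : E3) : ℂ :=
  (‖x‖ : ℂ) ^ n * exp (-k * (‖x‖ : ℂ)) / (4 * Real.pi * ‖x‖)

lemma Gk_eq (k : ℂ) : Gk k = ek 0 k := by
  funext x; simp [Gk, ek]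

lemma measurable_ek (n : ℕ) (k : ℂ) : Measurable (ek n k) := by
  unfold ek; fun_prop

lemma norm_ek (n : ℕ) (k : ℂ) (x : E3) :
    ‖ek n k x‖ = ‖x‖ ^ n * Real.exp (-k.re * ‖x‖) / (4 * Real.pi * ‖x‖) := by
  simp [ek, Complex.norm_exp, abs_of_pos Real.pi_pos]

/-- The real version of `ek`. -/
def er (n : ℕ) (k : ℝ) (x : E3) : ℝ := ‖x‖ ^ n * Real.exp (-k * ‖x‖) / (4 * Real.pi * ‖x‖)

lemma ofReal_er (n : ℕ) (k : ℝ) (x : E3) : ((er n k x : ℝ) : ℂ) = ek n (k : ℂ) x := by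
  simp [er, ek]

lemma norm_ek_eq_er (n : ℕ) (k : ℂ) (x : E3) : ‖ek n k x‖ = er n k.re x := norm_ek n k x

lemma er_nonneg (n : ℕ) (k : ℝ) (x : E3) : 0 ≤ er n k x := by unfold er; positivity

lemma conj_ek (n : ℕ) (k : ℂ) (x : E3) : conj (ek n k x) = ek n (conj k) x := by
  simp [ek, ← Complex.exp_conj, Complex.conj_ofNat]

lemma integrableOn_pow_mul_exp (n : ℕ) {k : ℂ} (hk : 0 < k.re) :
    IntegrableOn (fun r : ℝ => (r : ℂ) ^ n * exp (-k * r)) (Ioi 0) := by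
  have h1 : IntegrableOn (fun r : ℝ => r ^ (n : ℝ) * Real.exp (-k.re * r)) (Ioi 0) := by
    have := integrableOn_rpow_mul_exp_neg_mul_rpow (p := 1) (s := n) (b := k.re)
      (by have : (0:ℝ) ≤ n := n.cast_nonneg; linarith) one_pos hk
    simpa using this
  refine Integrable.mono' h1 (by fun_prop) ?_
  refine (ae_restrict_iff' measurableSet_Ioi).2 (Filter.Eventually.of_forall fun r hr => ?_)
  have hr' : (0:ℝ) < r := hr
  simp [Complex.norm_exp, abs_of_pos hr']

lemma integral_pow_mul_exp (n : ℕ) {k : ℝ} (hk : 0 < k) :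
    ∫ r in Ioi (0 : ℝ), (r : ℂ) ^ n * exp (-k * r) = n.factorial / (k : ℂ) ^ (n + 1) := by
  have := integral_cpow_mul_exp_neg_mul_Ioi (a := (n : ℂ) + 1) (r := k) (by simp; positivity) hk
  simp only [add_sub_cancel_right, cpow_natCast] at this
  rw [show (fun r : ℝ => (r : ℂ) ^ n * exp (-k * r)) = fun r : ℝ => (r : ℂ) ^ n * exp (-(k * r)) by
    funext r; ring_nf]
  rw [this, Complex.Gamma_nat_eq_factorial]
  rw [show ((n : ℂ) + 1) = ((n + 1 : ℕ) : ℂ) by push_cast; ring, cpow_natCast]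
  rw [one_div, inv_pow]; ring

/-- In dimension three the Jacobian r² cancels the two singularities 1/r, so the radial integrand is
r^(n+m) exp(-(k+l) r) up to the constant 1/(4π)². Only the sum of the two rates has to have positive
real part, so one factor may be `G0` or a constant. -/
lemma ek_mul_ek_integrable (n m : ℕ) {k l : ℂ} (h : 0 < (k + l).re) :
    Integrable (fun x => ek n k x * ek m l x) := by
  have := (integrableOn_pow_mul_exp (n + m) h).const_mul (1 / (4 * Real.pi : ℂ) ^ 2)
  have h2 : Integrable (fun x : E3 => (fun r : ℝ => ((r : ℂ) ^ n * exp (-k * (r : ℂ)) / (4 * Real.pi * r)) *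
      ((r : ℂ) ^ m * exp (-l * (r : ℂ)) / (4 * Real.pi * r))) ‖x‖) := by
    refine integrable_radial (f := fun r : ℝ =>
      ((r : ℂ) ^ n * exp (-k * (r : ℂ)) / (4 * Real.pi * r)) *
      ((r : ℂ) ^ m * exp (-l * (r : ℂ)) / (4 * Real.pi * r))).2 ?_
    refine this.congr ?_
    refine (ae_restrict_iff' measurableSet_Ioi).2 (Filter.Eventually.of_forall fun r hr => ?_)
    have hr' : (r : ℂ) ≠ 0 := by exact_mod_cast ne_of_gt hr
    have hpi : (Real.pi : ℂ) ≠ 0 := by exact_mod_cast Real.pi_ne_zero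
    simp only [real_smul, ofReal_pow]
    rw [show -(k + l) * (r : ℂ) = -k * r + -l * r by ring, Complex.exp_add, pow_add]
    field_simp
  exact h2

lemma integral_ek_mul_ek (n m : ℕ) {k l : ℝ} (h : 0 < k + l) :
    ∫ x, ek n k x * ek m l x = (n + m).factorial / (4 * Real.pi * (k + l) ^ (n + m + 1)) := by
  have h1 := integral_pow_mul_exp (n + m) h
  have h2 := integral_radial (fun r : ℝ => ((r : ℂ) ^ n * exp (-(k:ℂ) * (r : ℂ)) / (4 * Real.pi * r)) *
      ((r : ℂ) ^ m * exp (-(l : ℂ) * (r : ℂ)) / (4 * Real.pi * r)))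
  have hpi : (Real.pi : ℂ) ≠ 0 := by exact_mod_cast Real.pi_ne_zero
  have h3 : ∀ r ∈ Ioi (0:ℝ), r ^ 2 • (((r : ℂ) ^ n * exp (-(k:ℂ) * (r : ℂ)) / (4 * Real.pi * r)) *
      ((r : ℂ) ^ m * exp (-(l : ℂ) * (r : ℂ)) / (4 * Real.pi * r))) =
      1 / (4 * Real.pi : ℂ) ^ 2 * ((r : ℂ) ^ (n + m) * exp (-((k + l : ℝ) : ℂ) * r)) := by
    intro r hr
    have hr' : (r : ℂ) ≠ 0 := by exact_mod_cast ne_of_gt hr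
    simp only [real_smul, ofReal_pow]
    rw [show -((k + l : ℝ) : ℂ) * (r : ℂ) = -k * r + -l * r by push_cast; ring,
      Complex.exp_add, pow_add]
    field_simp
  rw [setIntegral_congr_fun measurableSet_Ioi h3, integral_const_mul, h1] at h2
  refine h2.trans ?_
  have hkl : (k : ℂ) + l ≠ 0 := by exact_mod_cast h.ne'
  simp only [real_smul]
  push_cast
  field_simp

lemma memLp_ek (n : ℕ) {k : ℂ} (hk : 0 < k.re) : MemLp (ek n k) 2 volume := by
  rw [memLp_two_iff_integrable_sq_norm (measurable_ek n k).aestronglyMeasurable]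
  have := (ek_mul_ek_integrable n n (k := k) (l := conj k) (by simp; linarith)).norm
  refine this.congr (Filter.Eventually.of_forall fun x => ?_)
  simp [← conj_ek, sq]

/-- The weight. -/
def wt (x : E3) : ℝ := 1 + 1 / ‖x‖

lemma wt_pos (x : E3) : 0 < wt x := by unfold wt; positivity

/-- The weight itself is a combination of profiles with rate zero: 1 = 4π `er 1 0` and 1/|x| = 4π
`er 0 0`. The product formula for profiles therefore applies. -/
lemma wt_er_integrable (n : ℕ) {k : ℝ} (hk : 0 < k) : Integrable (fun x => wt x * er n k x) := by
  have h1 := (ek_mul_ek_integrable n 1 (k := k) (l := 0) (by simpa)).norm.const_mul (4 * Real.pi)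
  have h2 := (ek_mul_ek_integrable n 0 (k := k) (l := 0) (by simpa)).norm.const_mul (4 * Real.pi)
  refine (h1.add h2).congr ?_
  filter_upwards [ae_norm_pos] with x hx
  simp only [Pi.add_apply, norm_mul, norm_ek_eq_er, ofReal_re, zero_re]
  have e1 : er 1 0 x = 1 / (4 * Real.pi) := by unfold er; field_simp; simp
  have e0 : er 0 0 x = 1 / (4 * Real.pi * ‖x‖) := by unfold er; simp
  rw [e0, e1, wt]
  field_simp

lemma er_anti (n : ℕ) {k l : ℝ} (h : l ≤ k) (x : E3) : er n k x ≤ er n l x := by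
  unfold er
  gcongr

end ConcNLS
end

noncomputable section

namespace ConcNLS

open MeasureTheory Complex ComplexConjugate Set Filter Topology
open scoped ContDiff

/-! ### Cut-offs away from the origin and infinity -/

lemma deriv_smoothTransition_eq_zero {y : ℝ} (h : y < 0 ∨ 1 < y) :
    deriv Real.smoothTransition y = 0 := by
  rcases h with h | h
  · have : Real.smoothTransition =ᶠ[𝓝 y] fun _ => 0 := by
      filter_upwards [gt_mem_nhds h] with z hz using Real.smoothTransition.zero_of_nonpos hz.le
    rw [this.deriv_eq]; simp
  · have : Real.smoothTransition =ᶠ[𝓝 y] fun _ => 1 := by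
      filter_upwards [lt_mem_nhds h] with z hz using Real.smoothTransition.one_of_one_le hz.le
    rw [this.deriv_eq]; simp

lemma exists_bound_deriv_smoothTransition :
    ∃ C > 0, ∀ y, |deriv Real.smoothTransition y| ≤ C := by
  have hc : Continuous (deriv Real.smoothTransition) :=
    (Real.smoothTransition.contDiff (n := 1)).continuous_deriv le_rfl
  obtain ⟨C, hC⟩ := (isCompact_Icc (a := (0:ℝ)) (b := 1)).exists_bound_of_continuousOn hc.continuousOn
  refine ⟨max C 1, by positivity, fun y => ?_⟩
  by_cases hy : y ∈ Icc (0:ℝ) 1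
  · exact (hC y hy).trans (le_max_left _ _)
  · rw [deriv_smoothTransition_eq_zero]
    · simp
    · simp only [mem_Icc, not_and_or, not_le] at hy; exact hy

/-- A smooth cut-off to the annulus `1 / N ≤ r ≤ 2 N`. -/
def cutoff (N : ℝ) (r : ℝ) : ℝ :=
  Real.smoothTransition (N * r - 1) * Real.smoothTransition (2 - r / N)

lemma contDiff_cutoff (N : ℝ) : ContDiff ℝ ∞ (cutoff N) := by
  unfold cutoff
  exact (Real.smoothTransition.contDiff.comp (by fun_prop)).mul
    (Real.smoothTransition.contDiff.comp (by fun_prop))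

lemma cutoff_nonneg (N r : ℝ) : 0 ≤ cutoff N r :=
  mul_nonneg (Real.smoothTransition.nonneg _) (Real.smoothTransition.nonneg _)

lemma cutoff_le_one (N r : ℝ) : cutoff N r ≤ 1 :=
  mul_le_one₀ (Real.smoothTransition.le_one _) (Real.smoothTransition.nonneg _)
    (Real.smoothTransition.le_one _)

lemma cutoff_eq_zero_left {N r : ℝ} (h : N * r ≤ 1) : cutoff N r = 0 := by
  unfold cutoff; rw [Real.smoothTransition.zero_of_nonpos (by linarith)]; simp

lemma cutoff_eq_zero_right {N r : ℝ} (hN : 0 < N) (h : 2 * N ≤ r) : cutoff N r = 0 := by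
  unfold cutoff
  have : 2 ≤ r / N := by rwa [le_div_iff₀ hN]
  rw [Real.smoothTransition.zero_of_nonpos (x := 2 - r / N) (by linarith)]; simp

lemma cutoff_eq_one {N r : ℝ} (hN : 0 < N) (h1 : 2 ≤ N * r) (h2 : r ≤ N) : cutoff N r = 1 := by
  unfold cutoff
  have : r / N ≤ 1 := by rwa [div_le_one hN]
  rw [Real.smoothTransition.one_of_one_le (by linarith),
    Real.smoothTransition.one_of_one_le (by linarith)]; simp

lemma cutoff_eventually_eq_one {r : ℝ} (hr : 0 < r) :
    ∀ᶠ n : ℕ in atTop, cutoff n r = 1 ∧ deriv (cutoff n) r = 0 := by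
  -- The term 4/r gives n s ≥ 2 for s > r/2, and 2r gives s ≤ n for s < 2r. The cut-off is thus 1 on
  -- a neighbourhood of r, so its derivative vanishes there too.
  filter_upwards [(tendsto_natCast_atTop_atTop (R := ℝ)).eventually_ge_atTop (4 / r + 2 * r + 1)]
    with n hn
  have h4 : 0 < 4 / r := by positivity
  have hn0 : (0:ℝ) < n := by linarith
  have key : ∀ s ∈ Ioo (r / 2) (2 * r), cutoff n s = 1 := by
    intro s hs
    refine cutoff_eq_one hn0 ?_ (by linarith [hs.2])
    have h5 : 4 / r * (r / 2) = 2 := by field_simp; norm_num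
    have : 4 / r * (r / 2) ≤ n * s := by
      apply mul_le_mul (by linarith) hs.1.le (by positivity) hn0.le
    linarith
  refine ⟨key r ⟨by linarith, by linarith⟩, ?_⟩
  have : cutoff n =ᶠ[𝓝 r] fun _ => 1 := by
    filter_upwards [Ioo_mem_nhds (show r / 2 < r by linarith) (show r < 2 * r by linarith)] with s hs
      using key s hs
  rw [this.deriv_eq]; simp

/-- The inner factor varies only where r ≤ 2/N with slope of order N, the outer one only where r ≤
2N with slope of order 1/N; both slopes are at most a constant times 1/r. This bound does not depend
on N, which is what dominated convergence needs. -/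
lemma exists_bound_deriv_cutoff :
    ∃ C > 0, ∀ N r : ℝ, 0 < N → 0 < r → |deriv (cutoff N) r| ≤ C / r := by
  obtain ⟨C, hC0, hC⟩ := exists_bound_deriv_smoothTransition
  refine ⟨4 * C, by positivity, fun N r hN hr => ?_⟩
  have hS : ∀ y, HasDerivAt Real.smoothTransition (deriv Real.smoothTransition y) y := fun y =>
    ((Real.smoothTransition.contDiff (n := 1)).differentiable (by simp) y).hasDerivAt
  have h1 : HasDerivAt (fun r => Real.smoothTransition (N * r - 1))
      (deriv Real.smoothTransition (N * r - 1) * N) r :=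
    (hS _).comp r (by simpa using ((hasDerivAt_id r).const_mul N).sub_const 1)
  have h2 : HasDerivAt (fun r => Real.smoothTransition (2 - r / N))
      (deriv Real.smoothTransition (2 - r / N) * (-(1 / N))) r :=
    (hS _).comp r (by simpa using ((hasDerivAt_id r).div_const N).const_sub 2)
  have hd : deriv (cutoff N) r = _ := (h1.mul h2).deriv
  rw [hd]
  have b1 : |deriv Real.smoothTransition (N * r - 1) * N| ≤ 2 * C / r := by
    by_cases h : N * r - 1 ≤ 1
    · rw [abs_mul, abs_of_pos hN]
      have : N ≤ 2 / r := by rw [le_div_iff₀ hr]; linarith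
      calc _ ≤ C * (2 / r) := mul_le_mul (hC _) this hN.le hC0.le
        _ = _ := by ring
    · rw [deriv_smoothTransition_eq_zero (Or.inr (by linarith))]; simp; positivity
  have b2 : |deriv Real.smoothTransition (2 - r / N) * (-(1 / N))| ≤ 2 * C / r := by
    by_cases h : 0 ≤ 2 - r / N
    · rw [abs_mul, abs_neg, abs_of_pos (show 0 < 1 / N by positivity)]
      have : 1 / N ≤ 2 / r := by
        rw [div_le_div_iff₀ hN hr]
        have := (div_le_iff₀ hN).1 (show r / N ≤ 2 by linarith)
        linarith
      calc _ ≤ C * (2 / r) := mul_le_mul (hC _) this (by positivity) hC0.le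
        _ = _ := by ring
    · rw [deriv_smoothTransition_eq_zero (Or.inl (by linarith))]; simp; positivity
  have c1 : |Real.smoothTransition (2 - r / N)| ≤ 1 := by
    rw [abs_of_nonneg (Real.smoothTransition.nonneg _)]; exact Real.smoothTransition.le_one _
  have c2 : |Real.smoothTransition (N * r - 1)| ≤ 1 := by
    rw [abs_of_nonneg (Real.smoothTransition.nonneg _)]; exact Real.smoothTransition.le_one _
  have hp : 0 ≤ 2 * C / r := by positivity
  calc _ ≤ 2 * C / r * 1 + 1 * (2 * C / r) := by
        refine (abs_add_le _ _).trans (add_le_add ?_ ?_)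
        · rw [abs_mul]; exact mul_le_mul b1 c1 (abs_nonneg _) hp
        · rw [abs_mul]; exact mul_le_mul c2 b2 (abs_nonneg _) one_pos.le
    _ = 4 * C / r := by ring

/-! ### Radial functions -/

lemma hasFDerivAt_radial {F : Type*} [NormedAddCommGroup F] [NormedSpace ℝ F] {m : ℝ → F} {m' : F}
    {x : E3} (hx : x ≠ 0) (hm : HasDerivAt m m' ‖x‖) :
    HasFDerivAt (fun y : E3 => m ‖y‖)
      (((‖x‖⁻¹ : ℝ) • innerSL ℝ x).smulRight m') x := by
  have h1 : HasFDerivAt (fun y : E3 => ‖y‖) ((‖x‖⁻¹ : ℝ) • innerSL ℝ x) x := by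
    have hn : ‖x‖ ≠ 0 := norm_ne_zero_iff.2 hx
    have h2 := (hasStrictFDerivAt_norm_sq x).hasFDerivAt.sqrt (pow_ne_zero 2 hn)
    simp only [Real.sqrt_sq (norm_nonneg _)] at h2
    refine h2.congr_fderiv ?_
    ext v
    simp
    field_simp
  have := hm.hasFDerivAt.comp x h1
  refine this.congr_fderiv ?_
  ext v
  simp [smul_smul]

lemma contDiff_radial {F : Type*} [NormedAddCommGroup F] [NormedSpace ℝ F] {m : ℝ → F} {n : ℕ∞}
    (hm : ContDiffOn ℝ n m (Ioi 0)) {ε : ℝ} (hε : 0 < ε) (h0 : ∀ r < ε, m r = 0) :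
    ContDiff ℝ n (fun x : E3 => m ‖x‖) := by
  rw [contDiff_iff_contDiffAt]
  intro x
  by_cases hx : x = 0
  · have : (fun x : E3 => m ‖x‖) =ᶠ[𝓝 x] fun _ => 0 := by
      have : ∀ᶠ y : E3 in 𝓝 x, ‖y‖ < ε :=
        continuous_norm.continuousAt.eventually_lt continuousAt_const (by simpa [hx])
      filter_upwards [this] with y hy using h0 _ hy
    exact contDiffAt_const.congr_of_eventuallyEq this
  · exact (hm.contDiffAt (Ioi_mem_nhds (norm_pos_iff.2 hx))).comp x (contDiffAt_norm ℝ hx)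

/-- Supplies one integrable majorant for test functions; it remains integrable after division by
|x|. -/
lemma exists_exp_bound {F : Type*} [NormedAddCommGroup F] {η : E3 → F} (hη : Continuous η)
    (hc : HasCompactSupport η) : ∃ B ≥ 0, ∀ x, ‖η x‖ ≤ B * Real.exp (-‖x‖) := by
  have h1 : HasCompactSupport (fun x => ‖η x‖ * Real.exp ‖x‖) := by
    have := hc.norm.mul_right (f' := fun x : E3 => Real.exp ‖x‖)
    exact this
  obtain ⟨B, hB⟩ := h1.exists_bound_of_continuous (by fun_prop)
  refine ⟨max B 0, le_max_right _ _, fun x => ?_⟩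
  have h2 := (le_abs_self _).trans (hB x)
  rw [Real.exp_neg, ← div_eq_mul_inv, le_div_iff₀ (Real.exp_pos _)]
  exact h2.trans (le_max_left _ _)

lemma integrable_exp_neg_norm : Integrable (fun x : E3 => Real.exp (-‖x‖)) := by
  refine ((wt_er_integrable 1 one_pos).const_mul (4 * Real.pi)).mono'
    (by fun_prop) ?_
  filter_upwards [ae_norm_pos] with x hx
  have hw : 1 ≤ wt x := by unfold wt; have : 0 ≤ 1 / ‖x‖ := by positivity
                           linarith
  have : er 1 1 x = Real.exp (-‖x‖) / (4 * Real.pi) := by unfold er; field_simp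
  rw [this, Real.norm_of_nonneg (Real.exp_pos _).le]
  have h3 : 4 * Real.pi * (wt x * (Real.exp (-‖x‖) / (4 * Real.pi))) = wt x * Real.exp (-‖x‖) := by
    field_simp
  rw [h3]
  exact le_mul_of_one_le_left (Real.exp_pos _).le hw

lemma integrable_exp_neg_norm_div : Integrable (fun x : E3 => Real.exp (-‖x‖) / ‖x‖) := by
  refine ((wt_er_integrable 1 one_pos).const_mul (4 * Real.pi)).mono'
    (Measurable.aestronglyMeasurable (by fun_prop)) ?_
  filter_upwards [ae_norm_pos] with x hx
  have hw : 1 / ‖x‖ ≤ wt x := by unfold wt; linarith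
  have : er 1 1 x = Real.exp (-‖x‖) / (4 * Real.pi) := by unfold er; field_simp
  rw [this, Real.norm_of_nonneg (by positivity)]
  have h3 : 4 * Real.pi * (wt x * (Real.exp (-‖x‖) / (4 * Real.pi))) = wt x * Real.exp (-‖x‖) := by
    field_simp
  rw [h3, div_eq_mul_one_div, mul_comm]
  gcongr

end ConcNLS
end

noncomputable section

namespace ConcNLS

open MeasureTheory Complex ComplexConjugate Set Filter Topology
open scoped ContDiff

/-! ### Weak gradients of radial functions -/

lemma fderiv_ofReal_comp {η : E3 → ℝ} (hη : Differentiable ℝ η) (x v : E3) :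
    fderiv ℝ (fun y => ((η y : ℝ) : ℂ)) x v = ((fderiv ℝ η x v : ℝ) : ℂ) := by
  have := (ofRealCLM.hasFDerivAt.comp x (hη x).hasFDerivAt).fderiv
  have h2 : (fun y => ((η y : ℝ) : ℂ)) = (ofRealCLM ∘ η) := rfl
  rw [h2, this]; simp

lemma abs_coord_le (x : E3) (i : Fin 3) : |x i| ≤ ‖x‖ := by
  have := PiLp.norm_apply_le x i
  simpa using this

lemma coord_div_norm_le (x : E3) (i : Fin 3) : |x i / ‖x‖| ≤ 1 := by
  rw [abs_div, abs_norm]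
  exact div_le_one_of_le₀ (abs_coord_le x i) (norm_nonneg _)

/-- The origin is negligible for weak derivatives of such a function. After multiplication by the
cut-off the classical integration by parts applies; the error carries the derivative of the cut-off,
which is at most C/|x|, locally integrable in dimension three, and tends to zero pointwise.
Dominated convergence removes the cut-off. -/
lemma hasWeakGrad_radial {F D : ℝ → ℂ} (hF : ContDiffOn ℝ 1 F (Ioi 0))
    (hD : ∀ r > 0, HasDerivAt F (D r) r) (hFm : Measurable F) (hDm : Measurable D) {M : ℝ}
    (hFM : ∀ r > 0, ‖F r‖ ≤ M) (hDM : ∀ r > 0, ‖D r‖ ≤ M) :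
    HasWeakGrad (fun x : E3 => F ‖x‖) (fun i x => D ‖x‖ * ((x i / ‖x‖ : ℝ) : ℂ)) := by
  have hM : 0 ≤ M := (norm_nonneg _).trans (hFM 1 one_pos)
  have mF : Measurable (fun x : E3 => F ‖x‖) := hFm.comp measurable_norm
  have mD : ∀ i, Measurable (fun x : E3 => D ‖x‖ * ((x i / ‖x‖ : ℝ) : ℂ)) := fun i =>
    (hDm.comp measurable_norm).mul (measurable_ofReal.comp (by fun_prop))
  refine ⟨(locallyIntegrable_const M).mono mF.aestronglyMeasurable ?_, fun i =>
    (locallyIntegrable_const M).mono (mD i).aestronglyMeasurable ?_, ?_⟩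
  · filter_upwards [ae_norm_pos] with x hx
    exact (hFM _ hx).trans (le_abs_self M)
  · filter_upwards [ae_norm_pos] with x hx
    rw [norm_mul, norm_real, Real.norm_eq_abs]
    exact (mul_le_mul (hDM _ hx) (coord_div_norm_le x i) (abs_nonneg _) hM).trans
      (by rw [mul_one]; exact le_abs_self M)
  intro η hη hηc i
  obtain ⟨C, hC0, hC⟩ := exists_bound_deriv_cutoff
  set v : E3 := EuclideanSpace.single i 1 with hv
  set φ : ℕ → E3 → ℂ := fun n x => (cutoff n ‖x‖ : ℂ) * F ‖x‖ with hφ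
  have hcd : ∀ n : ℕ, ContDiff ℝ ∞ (fun r => ((cutoff n r : ℝ) : ℂ)) := fun n =>
    ofRealCLM.contDiff.comp (contDiff_cutoff n)
  have hφC : ∀ n : ℕ, 0 < n → ContDiff ℝ 1 (φ n) := by
    intro n hn
    have hn' : (0:ℝ) < n := by exact_mod_cast hn
    have := contDiff_radial (m := fun r => (cutoff n r : ℂ) * F r) (n := 1)
      ((((hcd n).of_le (by exact_mod_cast le_top)).contDiffOn).mul hF) (ε := 1 / n) (by positivity)
      (fun r hr => by
        rw [cutoff_eq_zero_left]; simp
        rw [lt_div_iff₀ hn'] at hr; linarith)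
    exact this
  set d : ℕ → E3 → ℂ := fun n x =>
    (((deriv (cutoff n) ‖x‖ : ℝ) : ℂ) * F ‖x‖ + (cutoff n ‖x‖ : ℂ) * D ‖x‖) * ((x i / ‖x‖ : ℝ) : ℂ)
    with hd
  have hφd : ∀ n : ℕ, 0 < n → ∀ x ≠ 0, fderiv ℝ (φ n) x v = d n x := by
    intro n hn x hx
    have hx' := norm_pos_iff.2 hx
    have h1 : HasDerivAt (fun r => ((cutoff n r : ℝ) : ℂ)) ((deriv (cutoff n) ‖x‖ : ℝ) : ℂ) ‖x‖ :=
      (((contDiff_cutoff n).differentiable (by simp) ‖x‖).hasDerivAt).ofReal_comp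
    have h2 := hasFDerivAt_radial hx (h1.mul (hD _ hx'))
    have h3 : fderiv ℝ (φ n) x = _ := h2.fderiv
    rw [h3, hd, hv]
    simp [EuclideanSpace.inner_single_right]
    ring
  have hηd : Differentiable ℝ η := hη.differentiable (by simp)
  have cη' : Continuous (fun x => fderiv ℝ η x v) := (hη.continuous_fderiv (by simp)).clm_apply continuous_const
  have sη' : HasCompactSupport (fun x => fderiv ℝ η x v) := hηc.fderiv_apply (𝕜 := ℝ) v
  obtain ⟨B, hB0, hB⟩ := exists_exp_bound hη.continuous hηc
  obtain ⟨B', hB'0, hB'⟩ := exists_exp_bound cη' sη'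
  have hibp : ∀ n : ℕ, 0 < n → ∫ x, φ n x * ((fderiv ℝ η x v : ℝ) : ℂ) = -∫ x, d n x * ((η x : ℝ) : ℂ) := by
    intro n hn
    have hsη : HasCompactSupport (fun x => ((η x : ℝ) : ℂ)) := hηc.comp_left (g := ofReal) (by simp)
    have hηc' : Continuous (fun x => ((η x : ℝ) : ℂ)) := continuous_ofReal.comp hη.continuous
    have hsη' : HasCompactSupport (fun x => ((fderiv ℝ η x v : ℝ) : ℂ)) := sη'.comp_left (g := ofReal) (by simp)
    have cφ := (hφC n hn).continuous
    have cφ' : Continuous (fun x => fderiv ℝ (φ n) x v) :=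
      ((hφC n hn).continuous_fderiv (by simp)).clm_apply continuous_const
    have := integral_mul_fderiv_eq_neg_fderiv_mul_of_integrable (μ := (volume : Measure E3)) (f := φ n)
      (g := fun x => ((η x : ℝ) : ℂ)) (v := v)
      ((cφ'.mul hηc').integrable_of_hasCompactSupport hsη.mul_left)
      (by
        simp only [fderiv_ofReal_comp hηd]
        exact (cφ.mul (continuous_ofReal.comp cη')).integrable_of_hasCompactSupport hsη'.mul_left)
      ((cφ.mul hηc').integrable_of_hasCompactSupport hsη.mul_left)
      (fun x _ => (hφC n hn).differentiable (by simp) x)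
      (fun x _ => (ofRealCLM.differentiableAt.comp x (hηd x)))
    simp only [fderiv_ofReal_comp hηd] at this
    rw [this]
    congr 1
    refine integral_congr_ae ?_
    filter_upwards [ae_ne_zero] with x hx
    rw [hφd n hn x hx]
  have hnorm_cut : ∀ (n : ℕ) (r : ℝ), ‖((cutoff n r : ℝ) : ℂ)‖ ≤ 1 := fun n r => by
    rw [norm_real, Real.norm_of_nonneg (cutoff_nonneg _ _)]; exact cutoff_le_one _ _
  have mcut : ∀ n : ℕ, Measurable (fun x : E3 => ((cutoff n ‖x‖ : ℝ) : ℂ)) := fun n =>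
    measurable_ofReal.comp ((contDiff_cutoff n).continuous.measurable.comp measurable_norm)
  have mcut' : ∀ n : ℕ, Measurable (fun x : E3 => ((deriv (cutoff n) ‖x‖ : ℝ) : ℂ)) := fun n =>
    measurable_ofReal.comp ((measurable_deriv _).comp measurable_norm)
  have L1 : Tendsto (fun n : ℕ => ∫ x, φ n x * ((fderiv ℝ η x v : ℝ) : ℂ)) atTop
      (𝓝 (∫ x, F ‖x‖ * ((fderiv ℝ η x v : ℝ) : ℂ))) := by
    refine tendsto_integral_of_dominated_convergence
      (fun x => M * (B' * Real.exp (-‖x‖))) (fun n => ?_)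
      ((integrable_exp_neg_norm.const_mul B').const_mul M) (fun n => ?_) ?_
    · exact (((mcut n).mul mF).mul (measurable_ofReal.comp cη'.measurable)).aestronglyMeasurable
    · filter_upwards [ae_norm_pos] with x hx
      rw [norm_mul, norm_mul, norm_real (fderiv ℝ η x v)]
      exact mul_le_mul ((mul_le_mul (hnorm_cut _ _) (hFM _ hx) (norm_nonneg _) zero_le_one).trans
        (by simp)) (hB' x) (norm_nonneg _) hM
    · filter_upwards [ae_norm_pos] with x hx
      refine Tendsto.mul_const _ ?_
      refine tendsto_const_nhds.congr' ?_
      filter_upwards [cutoff_eventually_eq_one hx] with n hn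
      simp [hφ, hn.1]
  -- The index is shifted by one because the bound on the derivative of the cut-off requires a
  -- positive parameter.
  have L2 : Tendsto (fun n : ℕ => ∫ x, d (n + 1) x * ((η x : ℝ) : ℂ)) atTop
      (𝓝 (∫ x, D ‖x‖ * ((x i / ‖x‖ : ℝ) : ℂ) * ((η x : ℝ) : ℂ))) := by
    refine tendsto_integral_of_dominated_convergence
      (fun x => C * M * B * (Real.exp (-‖x‖) / ‖x‖) + M * B * Real.exp (-‖x‖)) (fun n => ?_)
      ((integrable_exp_neg_norm_div.const_mul _).add (integrable_exp_neg_norm.const_mul _))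
      (fun n => ?_) ?_
    · refine Measurable.aestronglyMeasurable ?_
      refine ((((mcut' _).mul mF).add ((mcut _).mul (hDm.comp measurable_norm))).mul
        (measurable_ofReal.comp (by fun_prop))).mul (measurable_ofReal.comp hη.continuous.measurable)
    · filter_upwards [ae_norm_pos] with x hx
      rw [norm_mul, norm_mul, norm_real (η x), norm_real (x i / ‖x‖)]
      have h1 : ‖((deriv (cutoff (n + 1 : ℕ)) ‖x‖ : ℝ) : ℂ) * F ‖x‖ + (cutoff (n + 1 : ℕ) ‖x‖ : ℂ) * D ‖x‖‖
          ≤ C / ‖x‖ * M + M := by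
        refine (norm_add_le _ _).trans (add_le_add ?_ ?_)
        · rw [norm_mul, norm_real]
          exact mul_le_mul (hC _ _ (by positivity) hx) (hFM _ hx) (norm_nonneg _) (by positivity)
        · rw [norm_mul]
          exact (mul_le_mul (hnorm_cut _ _) (hDM _ hx) (norm_nonneg _) zero_le_one).trans (by simp)
      have hb : 0 ≤ C / ‖x‖ * M + M := by positivity
      calc _ ≤ (C / ‖x‖ * M + M) * 1 * (B * Real.exp (-‖x‖)) :=
            mul_le_mul (mul_le_mul h1 (coord_div_norm_le x i) (abs_nonneg _) hb) (hB x)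
              (norm_nonneg _) (by positivity)
        _ = _ := by ring
    · filter_upwards [ae_norm_pos] with x hx
      refine Tendsto.mul_const _ ?_
      refine tendsto_const_nhds.congr' ?_
      filter_upwards [(tendsto_add_atTop_nat 1).eventually (cutoff_eventually_eq_one hx)] with n hn
      simp only [hd, hn.1, hn.2]; simp
  have L1' := (tendsto_add_atTop_iff_nat 1).2 L1
  refine tendsto_nhds_unique L1' ?_
  simp only [hibp _ (Nat.succ_pos _)]
  exact L2.neg

/-! ### Divergence identity against radial vector fields -/

lemma memLp_inv_one_add_sq : MemLp (fun x : E3 => 1 / (1 + ‖x‖ ^ 2)) 2 volume := by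
  rw [memLp_two_iff_integrable_sq (Measurable.aestronglyMeasurable (by fun_prop))]
  refine integrable_radial (f := fun r : ℝ => (1 / (1 + r ^ 2)) ^ 2).2 ?_
  refine (integrable_inv_one_add_sq.integrableOn).mono'
    (Measurable.aestronglyMeasurable (by fun_prop)) (ae_of_all _ fun r => ?_)
  have : 0 < 1 + r ^ 2 := by positivity
  rw [Real.norm_of_nonneg (by positivity), smul_eq_mul, div_pow, one_pow, mul_one_div,
    div_le_iff₀ (by positivity)]
  field_simp
  nlinarith

lemma memLp_inv_mul_one_add_sq : MemLp (fun x : E3 => 1 / (‖x‖ * (1 + ‖x‖ ^ 2))) 2 volume := by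
  rw [memLp_two_iff_integrable_sq (Measurable.aestronglyMeasurable (by fun_prop))]
  refine integrable_radial (f := fun r : ℝ => (1 / (r * (1 + r ^ 2))) ^ 2).2 ?_
  refine (integrable_inv_one_add_sq.integrableOn).mono'
    (Measurable.aestronglyMeasurable (by fun_prop)) ?_
  refine (ae_restrict_iff' measurableSet_Ioi).2 (ae_of_all _ fun r hr => ?_)
  have hr' : 0 < r := hr
  rw [Real.norm_of_nonneg (by positivity), smul_eq_mul, div_pow, one_pow, mul_one_div,
    div_le_iff₀ (by positivity)]
  field_simp
  nlinarith [sq_nonneg r]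

lemma integrable_inv_sq_mul : Integrable (fun x : E3 => 1 / (‖x‖ ^ 2 * (1 + ‖x‖ ^ 2))) := by
  refine integrable_radial (f := fun r : ℝ => 1 / (r ^ 2 * (1 + r ^ 2))).2 ?_
  refine (integrable_inv_one_add_sq.integrableOn).mono'
    (Measurable.aestronglyMeasurable (by fun_prop)) ?_
  refine (ae_restrict_iff' measurableSet_Ioi).2 (ae_of_all _ fun r hr => ?_)
  have hr' : 0 < r := hr
  rw [Real.norm_of_nonneg (by positivity), smul_eq_mul]
  field_simp
  rfl

lemma sum_coord_sq (x : E3) : ∑ i, x i ^ 2 = ‖x‖ ^ 2 := by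
  rw [EuclideanSpace.norm_eq, Real.sq_sqrt (by positivity)]
  simp

/-- The field x m(|x|) has divergence 3m + r m', so this is the weak gradient tested with that field
after a cut-off near the origin and infinity. The decay M/(r(1+r²)) makes the field square
integrable against the gradient. It also makes the divergence square integrable against u and
integrable against the singular part 1/r. -/
lemma energySpace_div_identity (u : EnergySpace) {m m' : ℝ → ℝ} (hm : ContDiffOn ℝ ∞ m (Ioi 0))
    (hm' : ∀ r > 0, HasDerivAt m (m' r) r) (hmm : Measurable m) (hmm' : Measurable m') {M : ℝ}
    (hM : ∀ r > 0, |m r| ≤ M / (r * (1 + r ^ 2)))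
    (hM' : ∀ r > 0, |3 * m r + r * m' r| ≤ M / (r * (1 + r ^ 2))) :
    ∑ i, ∫ x, u.grad i x * ((x i * m ‖x‖ : ℝ) : ℂ)
      = -∫ x, (u.toFun x - u.charge * G0 x) * ((3 * m ‖x‖ + ‖x‖ * m' ‖x‖ : ℝ) : ℂ) := by
  obtain ⟨C, hC0, hC⟩ := exists_bound_deriv_cutoff
  have hM0 : 0 ≤ M := by
    have := (abs_nonneg _).trans (hM 1 one_pos)
    norm_num at this; linarith
  set η : ℕ → Fin 3 → E3 → ℝ := fun n i x => x i * (cutoff n ‖x‖ * m ‖x‖) with hη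
  set φ : E3 → ℂ := fun x => u.toFun x - u.charge * G0 x with hφ
  have hηC : ∀ n : ℕ, 0 < n → ∀ i, ContDiff ℝ ∞ (η n i) := by
    intro n hn i
    have hn' : (0:ℝ) < n := by exact_mod_cast hn
    refine ContDiff.mul (by fun_prop) ?_
    exact contDiff_radial (m := fun r => cutoff n r * m r) (n := ⊤)
      ((contDiff_cutoff n).contDiffOn.mul hm) (ε := 1 / n) (by positivity)
      (fun r hr => by
        rw [cutoff_eq_zero_left]; simp
        rw [lt_div_iff₀ hn'] at hr; linarith)
  have hηs : ∀ n : ℕ, 0 < n → ∀ i, HasCompactSupport (η n i) := by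
    intro n hn i
    have hn' : (0:ℝ) < n := by exact_mod_cast hn
    refine HasCompactSupport.intro (isCompact_closedBall (0 : E3) (2 * n)) fun x hx => ?_
    simp only [Metric.mem_closedBall, dist_zero_right, not_le] at hx
    simp [hη, cutoff_eq_zero_right hn' hx.le]
  set d : ℕ → E3 → ℝ := fun n x => cutoff n ‖x‖ * (3 * m ‖x‖ + ‖x‖ * m' ‖x‖)
    + deriv (cutoff n) ‖x‖ * (‖x‖ * m ‖x‖) with hd
  have hηd : ∀ n : ℕ, ∀ x ≠ 0, ∀ i, fderiv ℝ (η n i) x (EuclideanSpace.single i 1)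
      = cutoff n ‖x‖ * m ‖x‖ + x i ^ 2 * (‖x‖⁻¹ * (deriv (cutoff n) ‖x‖ * m ‖x‖ + cutoff n ‖x‖ * m' ‖x‖)) := by
    intro n x hx i
    have hx' := norm_pos_iff.2 hx
    have h1 : HasDerivAt (cutoff n) (deriv (cutoff n) ‖x‖) ‖x‖ :=
      ((contDiff_cutoff n).differentiable (by simp) ‖x‖).hasDerivAt
    have h2 := hasFDerivAt_radial hx (h1.mul (hm' _ hx'))
    have h3 : HasFDerivAt (fun y : E3 => y i) (EuclideanSpace.proj i : E3 →L[ℝ] ℝ) x :=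
      (EuclideanSpace.proj i : E3 →L[ℝ] ℝ).hasFDerivAt
    have h4 : fderiv ℝ (η n i) x = _ := (h3.mul h2).fderiv
    rw [h4]
    simp [EuclideanSpace.inner_single_right]
    ring
  have hw := u.weakGrad
  have hlφ : LocallyIntegrable φ volume := hw.1
  have hsum : ∀ n : ℕ, 0 < n →
      ∑ i, ∫ x, u.grad i x * ((η n i x : ℝ) : ℂ) = -∫ x, φ x * ((d n x : ℝ) : ℂ) := by
    intro n hn
    have h1 : ∀ i, ∫ x, u.grad i x * ((η n i x : ℝ) : ℂ)
        = -∫ x, φ x * ((fderiv ℝ (η n i) x (EuclideanSpace.single i 1) : ℝ) : ℂ) := by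
      intro i
      rw [hw.2.2 (η n i) (hηC n hn i) (hηs n hn i) i, neg_neg]
    simp only [h1]
    rw [Finset.sum_neg_distrib, ← integral_finsetSum]
    · congr 1
      refine integral_congr_ae ?_
      filter_upwards [ae_ne_zero] with x hx
      rw [← Finset.mul_sum, ← ofReal_sum]
      congr 2
      simp only [hηd n x hx]
      rw [Finset.sum_add_distrib, ← Finset.sum_mul _ _ (_ * (_ + _)), sum_coord_sq, Finset.sum_const]
      have hx' := norm_ne_zero_iff.2 hx
      simp only [Finset.card_univ, Fintype.card_fin, hd]
      field_simp
      simp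
      ring
    · intro i _
      have hc : Continuous (fun x => ((fderiv ℝ (η n i) x (EuclideanSpace.single i 1) : ℝ) : ℂ)) :=
        continuous_ofReal.comp (((hηC n hn i).continuous_fderiv (by simp)).clm_apply continuous_const)
      have hs : HasCompactSupport
          (fun x => ((fderiv ℝ (η n i) x (EuclideanSpace.single i 1) : ℝ) : ℂ)) :=
        ((hηs n hn i).fderiv_apply (𝕜 := ℝ) _).comp_left (g := ofReal) (by simp)
      have := hlφ.integrable_smul_right_of_hasCompactSupport hc hs
      simpa [smul_eq_mul] using this
  have hx1 : ∀ x : E3, 0 < ‖x‖ → ∀ i, |x i * m ‖x‖| ≤ M * (1 / (1 + ‖x‖ ^ 2)) := by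
    intro x hx i
    rw [abs_mul]
    calc _ ≤ ‖x‖ * (M / (‖x‖ * (1 + ‖x‖ ^ 2))) :=
          mul_le_mul (abs_coord_le x i) (hM _ hx) (abs_nonneg _) hx.le
      _ = _ := by field_simp
  have mcut : ∀ n : ℕ, Measurable (fun x : E3 => cutoff n ‖x‖) := fun n =>
    (contDiff_cutoff n).continuous.measurable.comp measurable_norm
  have mcut' : ∀ n : ℕ, Measurable (fun x : E3 => deriv (cutoff n) ‖x‖) := fun n =>
    (measurable_deriv _).comp measurable_norm
  have mm : Measurable (fun x : E3 => m ‖x‖) := hmm.comp measurable_norm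
  have mm' : Measurable (fun x : E3 => m' ‖x‖) := hmm'.comp measurable_norm
  have L1 : Tendsto (fun n : ℕ => ∑ i, ∫ x, u.grad i x * ((η n i x : ℝ) : ℂ)) atTop
      (𝓝 (∑ i, ∫ x, u.grad i x * ((x i * m ‖x‖ : ℝ) : ℂ))) := by
    refine tendsto_finsetSum _ fun i _ => ?_
    refine tendsto_integral_of_dominated_convergence
      (fun x => M * (‖u.grad i x‖ * (1 / (1 + ‖x‖ ^ 2)))) (fun n => ?_) ?_ (fun n => ?_) ?_
    · refine (u.grad_memLp i).aestronglyMeasurable.mul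
        (measurable_ofReal.comp ?_).aestronglyMeasurable
      exact Measurable.mul (by fun_prop) ((mcut n).mul mm)
    · exact ((u.grad_memLp i).norm.integrable_mul memLp_inv_one_add_sq).const_mul M
    · filter_upwards [ae_norm_pos] with x hx
      rw [norm_mul, norm_real, Real.norm_eq_abs]
      have : |η n i x| ≤ M * (1 / (1 + ‖x‖ ^ 2)) := by
        have e : η n i x = cutoff n ‖x‖ * (x i * m ‖x‖) := by simp only [hη]; ring
        rw [e, abs_mul, abs_of_nonneg (cutoff_nonneg _ _)]
        exact (mul_le_mul (cutoff_le_one _ _) (hx1 x hx i) (abs_nonneg _) zero_le_one).trans (by simp)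
      calc _ ≤ ‖u.grad i x‖ * (M * (1 / (1 + ‖x‖ ^ 2))) := by gcongr
        _ = _ := by ring
    · filter_upwards [ae_norm_pos] with x hx
      refine Tendsto.const_mul _ ?_
      refine tendsto_const_nhds.congr' ?_
      filter_upwards [cutoff_eventually_eq_one hx] with n hn
      simp [hη, hn.1]
  have hφb : ∀ x, ‖φ x‖ ≤ ‖u.toFun x‖ + ‖u.charge‖ * (1 / ‖x‖) := by
    intro x
    refine (norm_sub_le _ _).trans (add_le_add le_rfl ?_)
    rw [norm_mul]
    refine mul_le_mul_of_nonneg_left ?_ (norm_nonneg _)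
    simp only [G0, norm_div, norm_mul, norm_one, norm_real, abs_norm, Real.norm_eq_abs,
      abs_of_pos Real.pi_pos, RCLike.norm_ofNat]
    by_cases h0 : ‖x‖ = 0
    · simp [h0]
    · have h0' : 0 < ‖x‖ := lt_of_le_of_ne (norm_nonneg _) (Ne.symm h0)
      apply one_div_le_one_div_of_le h0'
      have := Real.pi_gt_three
      nlinarith
  have hint : Integrable (fun x : E3 => ((1 + C) * M) * (‖u.toFun x‖ * (1 / (‖x‖ * (1 + ‖x‖ ^ 2)))
      + ‖u.charge‖ * (1 / (‖x‖ ^ 2 * (1 + ‖x‖ ^ 2))))) :=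
    ((u.memLp.norm.integrable_mul memLp_inv_mul_one_add_sq).add
      (integrable_inv_sq_mul.const_mul _)).const_mul _
  have L2 : Tendsto (fun n : ℕ => ∫ x, φ x * ((d (n + 1) x : ℝ) : ℂ)) atTop
      (𝓝 (∫ x, φ x * ((3 * m ‖x‖ + ‖x‖ * m' ‖x‖ : ℝ) : ℂ))) := by
    refine tendsto_integral_of_dominated_convergence _ (fun n => ?_) hint (fun n => ?_) ?_
    · refine hlφ.aestronglyMeasurable.mul (measurable_ofReal.comp ?_).aestronglyMeasurable
      exact ((mcut _).mul ((mm.const_mul _).add (measurable_norm.mul mm'))).add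
        ((mcut' _).mul (measurable_norm.mul mm))
    · filter_upwards [ae_norm_pos] with x hx
      rw [norm_mul, norm_real, Real.norm_eq_abs]
      have hdb : |d (n + 1) x| ≤ (1 + C) * M / (‖x‖ * (1 + ‖x‖ ^ 2)) := by
        simp only [hd]
        have e1 : |cutoff (n + 1 : ℕ) ‖x‖ * (3 * m ‖x‖ + ‖x‖ * m' ‖x‖)| ≤ M / (‖x‖ * (1 + ‖x‖ ^ 2)) := by
          rw [abs_mul, abs_of_nonneg (cutoff_nonneg _ _)]
          exact (mul_le_mul (cutoff_le_one _ _) (hM' _ hx) (abs_nonneg _) zero_le_one).trans (by simp)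
        have e2 : |deriv (cutoff (n + 1 : ℕ)) ‖x‖ * (‖x‖ * m ‖x‖)| ≤ C * M / (‖x‖ * (1 + ‖x‖ ^ 2)) := by
          rw [abs_mul, abs_mul, abs_norm]
          calc _ ≤ C / ‖x‖ * (‖x‖ * (M / (‖x‖ * (1 + ‖x‖ ^ 2)))) :=
                mul_le_mul (hC _ _ (by positivity) hx)
                  (mul_le_mul_of_nonneg_left (hM _ hx) hx.le) (by positivity) (by positivity)
            _ = _ := by field_simp
        refine (abs_add_le _ _).trans ((add_le_add e1 e2).trans (le_of_eq ?_))
        ring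
      calc _ ≤ (‖u.toFun x‖ + ‖u.charge‖ * (1 / ‖x‖)) * ((1 + C) * M / (‖x‖ * (1 + ‖x‖ ^ 2))) :=
            mul_le_mul (hφb x) hdb (abs_nonneg _) (by positivity)
        _ = _ := by field_simp
    · filter_upwards [ae_norm_pos] with x hx
      refine Tendsto.const_mul _ ?_
      refine tendsto_const_nhds.congr' ?_
      filter_upwards [(tendsto_add_atTop_nat 1).eventually (cutoff_eventually_eq_one hx)] with n hn
      simp only [hd, hn.1, hn.2]; simp
  have L1' := (tendsto_add_atTop_iff_nat 1).2 L1
  refine tendsto_nhds_unique L1' ?_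
  simp only [hsum _ (Nat.succ_pos _)]
  exact L2.neg

end ConcNLS
end

noncomputable section

namespace ConcNLS

open MeasureTheory Complex ComplexConjugate Set Filter Topology
open scoped ContDiff

/-! ### Profiles `p(r) / (4 π r)`: charges and test elements of the energy space -/

/-- The expression vanishes at 0 and has derivative r p''(r), of size at most M r. It is the
numerator of the derivative of (p - p(0))/r, which is therefore bounded near the origin. -/
lemma norm_sub_linear_le {F : Type*} [NormedAddCommGroup F] [NormedSpace ℝ F] {p p1 p2 : ℝ → F}
    (h1 : ∀ r, HasDerivAt p (p1 r) r) (h2 : ∀ r, HasDerivAt p1 (p2 r) r) {M : ℝ}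
    (hM : ∀ r ≥ 0, ‖p2 r‖ ≤ M) {r : ℝ} (hr : 0 ≤ r) :
    ‖r • p1 r - p r + p 0‖ ≤ M * r ^ 2 := by
  have hM0 : 0 ≤ M := (norm_nonneg _).trans (hM 0 le_rfl)
  have hd : ∀ s, HasDerivAt (fun s => s • p1 s - p s + p 0) (s • p2 s) s := by
    intro s
    have := (((hasDerivAt_id s).smul (h2 s)).sub (h1 s)).add_const (p 0)
    refine this.congr_deriv ?_
    simp
  have := (convex_Icc (0:ℝ) r).norm_image_sub_le_of_norm_hasDerivWithin_le
    (f := fun s => s • p1 s - p s + p 0) (f' := fun s => s • p2 s) (C := M * r)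
    (fun s _ => (hd s).hasDerivWithinAt) (fun s hs => by
      rw [norm_smul, Real.norm_of_nonneg hs.1, mul_comm]
      exact mul_le_mul (hM s hs.1) hs.2 hs.1 hM0) (left_mem_Icc.2 hr) (right_mem_Icc.2 hr)
  simp only [zero_smul, zero_sub, neg_add_cancel, sub_zero, Real.norm_of_nonneg hr] at this
  calc _ ≤ M * r * r := this
    _ = _ := by ring

/-- After removal of p(0) `G0` the function is (p(r) - p(0))/(4π r). It is bounded by the bound on
p', and its derivative by the bound on p'' through `norm_sub_linear_le`, so `hasWeakGrad_radial`
applies. -/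
lemma hasCharge_profile {p p1 p2 : ℝ → ℂ} (h1 : ∀ r, HasDerivAt p (p1 r) r)
    (h2 : ∀ r, HasDerivAt p1 (p2 r) r) {M : ℝ} (hM1 : ∀ r ≥ 0, ‖p1 r‖ ≤ M)
    (hM : ∀ r ≥ 0, ‖p2 r‖ ≤ M) :
    HasCharge (fun x => p ‖x‖ / (4 * Real.pi * ‖x‖)) (p 0) := by
  have hM0 : 0 ≤ M := (norm_nonneg _).trans (hM 0 le_rfl)
  have cp : Continuous p := continuous_iff_continuousAt.2 fun r => (h1 r).continuousAt
  have cp1 : Continuous p1 := continuous_iff_continuousAt.2 fun r => (h2 r).continuousAt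
  have h4 : ∀ r : ℝ, 0 < r → (4 * Real.pi * r : ℂ) ≠ 0 := fun r hr => by
    have := Real.pi_pos
    exact_mod_cast (by positivity : (4 * Real.pi * r) ≠ 0)
  set F : ℝ → ℂ := fun r => (p r - p 0) / (4 * Real.pi * r)
  set D : ℝ → ℂ := fun r => (r * p1 r - p r + p 0) / (4 * Real.pi * r ^ 2)
  have mD : Measurable D := by
    have := cp.measurable; have := cp1.measurable
    fun_prop
  have mF : Measurable F := by
    have := cp.measurable
    fun_prop
  have hFD : ∀ r > 0, HasDerivAt F (D r) r := by
    intro r hr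
    have hc : HasDerivAt (fun r : ℝ => (4 * Real.pi * r : ℂ)) (4 * Real.pi) r := by
      simpa using (ofRealCLM.hasDerivAt (x := r)).const_mul (4 * Real.pi : ℂ)
    have := ((h1 r).sub_const (p 0)).div hc (h4 r hr)
    refine this.congr_deriv ?_
    have := h4 r hr
    have hr' : (r : ℂ) ≠ 0 := by exact_mod_cast hr.ne'
    have hpi : (Real.pi : ℂ) ≠ 0 := by exact_mod_cast Real.pi_ne_zero
    simp only [D]
    field_simp
    ring
  have hnum : ∀ r > 0, ‖D r‖ ≤ M := by
    intro r hr
    have := norm_sub_linear_le h1 h2 hM hr.le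
    simp only [real_smul] at this
    simp only [D, norm_div, norm_mul, norm_pow, norm_real, Real.norm_eq_abs, abs_of_pos hr,
      abs_of_pos Real.pi_pos, RCLike.norm_ofNat]
    rw [div_le_iff₀ (by have := Real.pi_pos; positivity)]
    refine this.trans (mul_le_mul_of_nonneg_left ?_ hM0)
    have := Real.pi_gt_three
    nlinarith [sq_nonneg r]
  have hFM : ∀ r > 0, ‖F r‖ ≤ M := by
    intro r hr
    have := (convex_Icc (0:ℝ) r).norm_image_sub_le_of_norm_hasDerivWithin_le
      (f := p) (f' := p1) (C := M) (fun s _ => (h1 s).hasDerivWithinAt) (fun s hs => hM1 s hs.1)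
      (left_mem_Icc.2 hr.le) (right_mem_Icc.2 hr.le)
    simp only [sub_zero, Real.norm_of_nonneg hr.le] at this
    simp only [F, norm_div, norm_mul, norm_real, Real.norm_eq_abs, abs_of_pos hr,
      abs_of_pos Real.pi_pos, RCLike.norm_ofNat]
    rw [div_le_iff₀ (by have := Real.pi_pos; positivity)]
    refine this.trans (mul_le_mul_of_nonneg_left ?_ hM0)
    have := Real.pi_gt_three
    nlinarith
  have hF1 : ContDiffOn ℝ 1 F (Ioi 0) := by
    have hd : ∀ r ∈ Ioi (0:ℝ), deriv F r = D r := fun r hr => (hFD r hr).deriv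
    rw [show (1 : WithTop ℕ∞) = 0 + 1 by simp, contDiffOn_succ_iff_deriv_of_isOpen isOpen_Ioi]
    refine ⟨fun r hr => (hFD r hr).differentiableAt.differentiableWithinAt, by simp, ?_⟩
    rw [contDiffOn_zero]
    refine ContinuousOn.congr ?_ hd
    refine ContinuousOn.div (by fun_prop) (by fun_prop) fun r hr => ?_
    have h0 := h4 r hr
    rw [pow_two, ← mul_assoc]
    exact mul_ne_zero h0 (by exact_mod_cast (ne_of_gt hr))
  have hg := hasWeakGrad_radial hF1 hFD mF mD hFM hnum
  refine ⟨fun i x => D ‖x‖ * ((x i / ‖x‖ : ℝ) : ℂ), fun i K hK => ?_, ?_⟩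
  rotate_left
  · convert hg using 2 with x
    simp only [F, G0]
    ring
  · have : IsFiniteMeasure (volume.restrict K) := ⟨by simpa using hK.measure_lt_top⟩
    refine MemLp.of_bound (C := M) ?_ ?_
    · exact ((mD.comp measurable_norm).mul (measurable_ofReal.comp (by fun_prop))).aestronglyMeasurable
    · refine ae_restrict_of_ae ?_
      filter_upwards [ae_norm_pos] with x hx
      rw [norm_mul, norm_real, Real.norm_eq_abs]
      exact (mul_le_mul (hnum _ hx) (coord_div_norm_le x i) (abs_nonneg _) hM0).trans (by simp)

/-- The case of vanishing real part is included: the outgoing field contains a purely oscillating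
exponent. -/
lemma hasCharge_ek_zero {k : ℂ} (hk : 0 ≤ k.re) : HasCharge (ek 0 k) 1 := by
  have hc : ∀ r : ℝ, HasDerivAt (fun r : ℝ => -k * (r : ℂ)) (-k) r := fun r => by
    simpa using (ofRealCLM.hasDerivAt (x := r)).const_mul (-k)
  have e1 : ∀ r : ℝ, HasDerivAt (fun r : ℝ => exp (-k * (r : ℂ))) (-k * exp (-k * (r : ℂ))) r := fun r => by
    have := (hc r).cexp
    exact this.congr_deriv (by ring)
  have hb : ∀ r ≥ (0:ℝ), ‖exp (-k * (r : ℂ))‖ ≤ 1 := fun r hr => by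
    rw [Complex.norm_exp]
    simp; positivity
  have := hasCharge_profile (p := fun r => exp (-k * (r : ℂ))) (p1 := fun r => -k * exp (-k * (r : ℂ)))
    (p2 := fun r => -k * (-k * exp (-k * (r : ℂ)))) e1 (fun r => (e1 r).const_mul (-k))
    (M := ‖k‖ + ‖k‖ ^ 2) (fun r hr => by
      rw [norm_mul, norm_neg]
      nlinarith [hb r hr, norm_nonneg k, norm_nonneg (exp (-k * (r : ℂ)))]) (fun r hr => by
      rw [norm_mul, norm_mul, norm_neg]
      have := hb r hr
      have h2 : ‖k‖ * (‖k‖ * ‖exp (-k * (r : ℂ))‖) ≤ ‖k‖ * (‖k‖ * 1) := by gcongr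
      nlinarith [norm_nonneg k])
  unfold ek
  simpa using this

/-! ### Real profiles `(c₀ + c₁ r) exp (-k r)` -/

lemma pow_mul_exp_le (n : ℕ) {k r : ℝ} (hk : 0 < k) (hr : 0 ≤ r) :
    r ^ n * Real.exp (-k * r) ≤ n.factorial / k ^ n := by
  have := Real.pow_div_factorial_le_exp (x := k * r) (by positivity) n
  rw [neg_mul, Real.exp_neg, ← div_eq_mul_inv, div_le_div_iff₀ (Real.exp_pos _) (by positivity)]
  rw [div_le_iff₀ (by positivity), mul_pow] at this
  linarith

variable (c₀ c₁ k : ℝ)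

/-- The profile `(c₀ + c₁ r) exp (-k r)`. -/
def pr (r : ℝ) : ℝ := (c₀ + c₁ * r) * Real.exp (-k * r)
/-- The first derivative of `pr`. -/
def pr' (r : ℝ) : ℝ := (c₁ - k * c₀ - k * c₁ * r) * Real.exp (-k * r)
/-- The second derivative of `pr`. -/
def pr'' (r : ℝ) : ℝ := (k ^ 2 * c₀ - 2 * k * c₁ + k ^ 2 * c₁ * r) * Real.exp (-k * r)
/-- The numerator of the derivative of `(pr r - pr 0) / (4 π r)`. -/
def prh (r : ℝ) : ℝ := r * pr' c₀ c₁ k r - pr c₀ c₁ k r + c₀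

lemma hasDerivAt_affine_mul_exp (a b r : ℝ) :
    HasDerivAt (fun r : ℝ => (a + b * r) * Real.exp (-k * r)) ((b - k * a - k * b * r) * Real.exp (-k * r)) r := by
  have h1 : HasDerivAt (fun r : ℝ => Real.exp (-k * r)) (Real.exp (-k * r) * (-k)) r := by
    simpa using (((hasDerivAt_id r).const_mul (-k)).exp)
  have h2 : HasDerivAt (fun r : ℝ => a + b * r) b r := by
    simpa using ((hasDerivAt_id r).const_mul b).const_add a
  exact (h2.mul h1).congr_deriv (by ring)

lemma hasDerivAt_pr (r : ℝ) : HasDerivAt (pr c₀ c₁ k) (pr' c₀ c₁ k r) r :=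
  hasDerivAt_affine_mul_exp k c₀ c₁ r

lemma hasDerivAt_pr' (r : ℝ) : HasDerivAt (pr' c₀ c₁ k) (pr'' c₀ c₁ k r) r := by
  have := hasDerivAt_affine_mul_exp k (c₁ - k * c₀) (-(k * c₁)) r
  have e : pr' c₀ c₁ k = fun r : ℝ => ((c₁ - k * c₀) + -(k * c₁) * r) * Real.exp (-k * r) := by
    funext r; simp only [pr']; ring
  rw [e]
  exact this.congr_deriv (by simp only [pr'']; ring)

lemma exists_bound_affine (a b : ℝ) {k : ℝ} (hk : 0 < k) (n : ℕ) :
    ∃ M, ∀ r ≥ 0, |r ^ n * ((a + b * r) * Real.exp (-k * r))| ≤ M := by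
  refine ⟨|a| * (n.factorial / k ^ n) + |b| * ((n + 1).factorial / k ^ (n + 1)), fun r hr => ?_⟩
  have h1 := pow_mul_exp_le n hk hr
  have h2 := pow_mul_exp_le (n + 1) hk hr
  have e : r ^ n * ((a + b * r) * Real.exp (-k * r))
      = a * (r ^ n * Real.exp (-k * r)) + b * (r ^ (n + 1) * Real.exp (-k * r)) := by ring
  rw [e]
  refine (abs_add_le _ _).trans ?_
  rw [abs_mul a, abs_mul b, abs_of_nonneg (a := r ^ n * Real.exp (-k * r)) (by positivity),
    abs_of_nonneg (a := r ^ (n + 1) * Real.exp (-k * r)) (by positivity)]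
  gcongr

/-- Quadratic vanishing at the origin (`norm_sub_linear_le`) and boundedness at infinity are
combined. Divided by 4π r², this makes the gradient of the regular part square integrable on the
whole space, not only locally. -/
lemma prh_bound {k : ℝ} (hk : 0 < k) : ∃ A, ∀ r ≥ 0, |prh c₀ c₁ k r| * (1 + r ^ 2) ≤ A * r ^ 2 := by
  obtain ⟨A, hA⟩ := exists_bound_affine (k ^ 2 * c₀ - 2 * k * c₁) (k ^ 2 * c₁) hk 0
  obtain ⟨B, hB⟩ := exists_bound_affine (c₁ - k * c₀) (-(k * c₁)) hk 1
  obtain ⟨B', hB'⟩ := exists_bound_affine c₀ c₁ hk 0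
  have h1 : ∀ r ≥ 0, |prh c₀ c₁ k r| ≤ A * r ^ 2 := by
    intro r hr
    have := norm_sub_linear_le (hasDerivAt_pr c₀ c₁ k) (hasDerivAt_pr' c₀ c₁ k) (M := A)
      (fun r hr => by simpa [pr''] using hA r hr) hr
    simpa [prh, pr] using this
  have h2 : ∀ r ≥ 0, |prh c₀ c₁ k r| ≤ B + B' + |c₀| := by
    intro r hr
    have e1 := hB r hr
    have e2 := hB' r hr
    unfold prh
    refine (abs_add_le _ _).trans (add_le_add ((abs_sub _ _).trans (add_le_add ?_ ?_)) le_rfl)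
    · refine (le_of_eq ?_).trans e1
      congr 1; simp only [pr']; ring
    · refine (le_of_eq ?_).trans e2
      congr 1; simp only [pr]; ring
  refine ⟨A + (B + B' + |c₀|), fun r hr => ?_⟩
  nlinarith [h1 r hr, mul_le_mul_of_nonneg_right (h2 r hr) (sq_nonneg r)]

/-- The radial function with profile `(c₀ + c₁ r) exp (-k r)`. -/
def rf (x : E3) : ℝ := c₀ * er 0 k x + c₁ * er 1 k x

lemma rf_eq (x : E3) : rf c₀ c₁ k x = pr c₀ c₁ k ‖x‖ / (4 * Real.pi * ‖x‖) := by
  simp only [rf, er, pr]; ring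

lemma memLp_rf {k : ℝ} (hk : 0 < k) : MemLp (fun x => ((rf c₀ c₁ k x : ℝ) : ℂ)) 2 volume := by
  have := ((memLp_ek 0 (k := k) (by simpa)).const_mul (c₀ : ℂ)).add
    ((memLp_ek 1 (k := k) (by simpa)).const_mul (c₁ : ℂ))
  refine this.ae_eq (ae_of_all _ fun x => ?_)
  simp [rf, ofReal_er]

/-- The radial derivative of `rf - c₀ G0`. -/
def rfD (r : ℝ) : ℝ := prh c₀ c₁ k r / (4 * Real.pi * r ^ 2)

lemma continuous_pr : Continuous (pr c₀ c₁ k) := by unfold pr; fun_prop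
lemma continuous_pr'' : Continuous (pr'' c₀ c₁ k) := by unfold pr''; fun_prop
lemma contDiff_prh : ContDiff ℝ ∞ (prh c₀ c₁ k) := by unfold prh pr pr'; fun_prop

lemma rfD_bound {k : ℝ} (hk : 0 < k) : ∃ A, ∀ r > 0, |rfD c₀ c₁ k r| ≤ A * (1 / (1 + r ^ 2)) := by
  obtain ⟨A, hA⟩ := prh_bound c₀ c₁ hk
  refine ⟨A, fun r hr => ?_⟩
  have hA0 : 0 ≤ A := by
    have := (mul_nonneg (abs_nonneg _) (by positivity)).trans (hA 1 zero_le_one)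
    simpa using this
  have h := hA r hr.le
  have hpi := Real.pi_gt_three
  rw [rfD, abs_div, abs_of_pos (a := 4 * Real.pi * r ^ 2) (by positivity), mul_one_div,
    div_le_div_iff₀ (by positivity) (by positivity)]
  refine h.trans (mul_le_mul_of_nonneg_left ?_ hA0)
  nlinarith [sq_nonneg r]

lemma measurable_rfD : Measurable (rfD c₀ c₁ k) := by
  have := (contDiff_prh c₀ c₁ k).continuous.measurable
  unfold rfD; fun_prop

lemma hasWeakGrad_rf {k : ℝ} (hk : 0 < k) :
    HasWeakGrad (fun x => ((rf c₀ c₁ k x : ℝ) : ℂ) - (c₀ : ℂ) * G0 x)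
      (fun i x => ((rfD c₀ c₁ k ‖x‖ : ℝ) : ℂ) * ((x i / ‖x‖ : ℝ) : ℂ)) := by
  obtain ⟨A, hA⟩ := rfD_bound c₀ c₁ hk
  obtain ⟨B, hB⟩ := exists_bound_affine (c₁ - k * c₀) (-(k * c₁)) hk 0
  have hB' : ∀ r ≥ 0, |pr' c₀ c₁ k r| ≤ B := fun r hr => by
    have := hB r hr
    simp only [pow_zero, one_mul] at this
    refine (le_of_eq ?_).trans this
    congr 1; simp only [pr']; ring
  have hB0 : 0 ≤ B := (abs_nonneg _).trans (hB' 0 le_rfl)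
  have hA0 : 0 ≤ A := by
    have := (abs_nonneg _).trans (hA 1 one_pos); norm_num at this; linarith
  set F : ℝ → ℝ := fun r => (pr c₀ c₁ k r - c₀) / (4 * Real.pi * r) with hF
  have hFD : ∀ r > 0, HasDerivAt F (rfD c₀ c₁ k r) r := by
    intro r hr
    have hc : HasDerivAt (fun r : ℝ => 4 * Real.pi * r) (4 * Real.pi) r := by
      simpa using (hasDerivAt_id r).const_mul (4 * Real.pi)
    have := ((hasDerivAt_pr c₀ c₁ k r).sub_const c₀).div hc (by have := Real.pi_pos; positivity)
    refine this.congr_deriv ?_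
    have hpi := Real.pi_pos
    simp only [rfD, prh]
    field_simp
    ring
  have hFc : ContDiffOn ℝ 1 F (Ioi 0) := by
    have : ContDiff ℝ 1 (pr c₀ c₁ k) := by unfold pr; fun_prop
    refine ContDiffOn.div (by fun_prop) (by fun_prop) fun r hr => ?_
    have hpi := Real.pi_pos
    have hr' : (0:ℝ) < r := hr
    positivity
  have hFb : ∀ r > 0, |F r| ≤ B := by
    intro r hr
    have := (convex_Icc (0:ℝ) r).norm_image_sub_le_of_norm_hasDerivWithin_le
      (f := pr c₀ c₁ k) (f' := pr' c₀ c₁ k) (C := B)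
      (fun s _ => (hasDerivAt_pr c₀ c₁ k s).hasDerivWithinAt) (fun s hs => hB' s hs.1)
      (left_mem_Icc.2 hr.le) (right_mem_Icc.2 hr.le)
    have e : pr c₀ c₁ k 0 = c₀ := by simp [pr]
    rw [e, sub_zero, Real.norm_eq_abs, Real.norm_of_nonneg hr.le] at this
    have hpi := Real.pi_gt_three
    simp only [F]
    rw [abs_div, abs_of_pos (a := 4 * Real.pi * r) (by positivity), div_le_iff₀ (by positivity)]
    refine this.trans (mul_le_mul_of_nonneg_left ?_ hB0)
    nlinarith
  have mF : Measurable F := by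
    have := (continuous_pr c₀ c₁ k).measurable
    fun_prop
  have := hasWeakGrad_radial (F := fun r => ((F r : ℝ) : ℂ)) (D := fun r => ((rfD c₀ c₁ k r : ℝ) : ℂ))
    (M := A + B) (ofRealCLM.contDiff.comp_contDiffOn hFc) (fun r hr => (hFD r hr).ofReal_comp)
    (measurable_ofReal.comp mF) (measurable_ofReal.comp (measurable_rfD c₀ c₁ k))
    (fun r hr => by rw [norm_real, Real.norm_eq_abs]; linarith [hFb r hr])
    (fun r hr => by
      rw [norm_real, Real.norm_eq_abs]
      have h1 := hA r hr
      have : 1 / (1 + r ^ 2) ≤ 1 := by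
        rw [div_le_one (by positivity)]; nlinarith
      nlinarith)
  convert this using 2 with x
  rw [rf_eq]
  simp only [F, G0]
  push_cast
  ring

lemma memLp_rf_grad {k : ℝ} (hk : 0 < k) (i : Fin 3) :
    MemLp (fun x : E3 => ((rfD c₀ c₁ k ‖x‖ : ℝ) : ℂ) * ((x i / ‖x‖ : ℝ) : ℂ)) 2 volume := by
  obtain ⟨A, hA⟩ := rfD_bound c₀ c₁ hk
  refine (memLp_inv_one_add_sq.const_mul A).mono ?_ ?_
  · exact ((measurable_ofReal.comp ((measurable_rfD c₀ c₁ k).comp measurable_norm)).mul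
      (measurable_ofReal.comp (by fun_prop))).aestronglyMeasurable
  · filter_upwards [ae_norm_pos] with x hx
    rw [norm_mul, norm_real, norm_real, Real.norm_eq_abs, Real.norm_eq_abs, Real.norm_eq_abs]
    have h1 := hA _ hx
    exact (mul_le_mul (h1.trans (le_abs_self _)) (coord_div_norm_le x i) (abs_nonneg _)
      (abs_nonneg _)).trans (by simp)

lemma HasWeakGrad.const_mul {φ : E3 → ℂ} {g : Fin 3 → E3 → ℂ} (h : HasWeakGrad φ g) (s : ℂ) :
    HasWeakGrad (fun x => s * φ x) (fun i x => s * g i x) := by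
  refine ⟨h.1.smul s, fun i => (h.2.1 i).smul s, fun η hη hc i => ?_⟩
  simp only [mul_assoc, integral_const_mul]
  rw [h.2.2 η hη hc i]; ring

/-- The element `s • rf` of the energy space. -/
def testElem (s : ℂ) {k : ℝ} (hk : 0 < k) : EnergySpace where
  toFun x := s * ((rf c₀ c₁ k x : ℝ) : ℂ)
  charge := s * c₀
  grad i x := s * (((rfD c₀ c₁ k ‖x‖ : ℝ) : ℂ) * ((x i / ‖x‖ : ℝ) : ℂ))
  memLp := (memLp_rf c₀ c₁ hk).const_mul s
  grad_memLp i := (memLp_rf_grad c₀ c₁ hk i).const_mul s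
  weakGrad := by
    convert (hasWeakGrad_rf c₀ c₁ hk).const_mul s using 2
    ring

/-- Away from the origin the Laplacian of p(r)/(4π r) is p''(r)/(4π r), and the coefficients here
are those of p'' for p = (c₀ + c₁ r) exp(-kr). The value obtained is -p'(0)/(4π), the boundary term
at the origin. -/
lemma integral_rf'' {k : ℝ} (hk : 0 < k) :
    Integrable (fun x : E3 => G0 x * ((rf (k ^ 2 * c₀ - 2 * k * c₁) (k ^ 2 * c₁) k x : ℝ) : ℂ)) ∧
    ∫ x : E3, G0 x * ((rf (k ^ 2 * c₀ - 2 * k * c₁) (k ^ 2 * c₁) k x : ℝ) : ℂ)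
      = ((k * c₀ - c₁) / (4 * Real.pi) : ℝ) := by
  have hG : ∀ x : E3, G0 x = ek 0 ((0 : ℝ) : ℂ) x := fun x => by simp [G0, ek]
  have h0 := ek_mul_ek_integrable 0 0 (k := ((0:ℝ):ℂ)) (l := k) (by simpa)
  have h1 := ek_mul_ek_integrable 0 1 (k := ((0:ℝ):ℂ)) (l := k) (by simpa)
  have e : ∀ x : E3, G0 x * ((rf (k ^ 2 * c₀ - 2 * k * c₁) (k ^ 2 * c₁) k x : ℝ) : ℂ) =
      (k ^ 2 * c₀ - 2 * k * c₁ : ℝ) * (ek 0 ((0 : ℝ) : ℂ) x * ek 0 k x)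
        + (k ^ 2 * c₁ : ℝ) * (ek 0 ((0 : ℝ) : ℂ) x * ek 1 k x) := fun x => by
    rw [hG]; simp only [rf, ofReal_add, ofReal_mul, ofReal_er]; ring
  simp only [e]
  refine ⟨(h0.const_mul _).add (h1.const_mul _), ?_⟩
  rw [integral_add (h0.const_mul _) (h1.const_mul _), integral_const_mul, integral_const_mul,
    integral_ek_mul_ek 0 0 (by simpa), integral_ek_mul_ek 0 1 (by simpa)]
  have hpi : (Real.pi : ℂ) ≠ 0 := by exact_mod_cast Real.pi_ne_zero
  have hk' : (k : ℂ) ≠ 0 := by exact_mod_cast hk.ne'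
  push_cast
  simp
  field_simp
  ring

/-- This is the one integration by parts against the solution. The gradient of the regular part of
the test profile is a radial field x m(|x|); its divergence is p''/(4π r), and the singular part of
u is evaluated by `integral_rf''`. The gradient form is thereby replaced by an L² pairing and a term
in the charge alone. -/
lemma energySpace_grad_test (u : EnergySpace) {k : ℝ} (hk : 0 < k) :
    ∑ i, ∫ x, u.grad i x * (((rfD c₀ c₁ k ‖x‖ : ℝ) : ℂ) * ((x i / ‖x‖ : ℝ) : ℂ))
      = -(∫ x, u.toFun x * ((rf (k ^ 2 * c₀ - 2 * k * c₁) (k ^ 2 * c₁) k x : ℝ) : ℂ))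
        + u.charge * ((k * c₀ - c₁) / (4 * Real.pi) : ℝ) := by
  have hpi := Real.pi_pos
  obtain ⟨A, hA⟩ := rfD_bound c₀ c₁ hk
  obtain ⟨B0, hB0⟩ := exists_bound_affine (k ^ 2 * c₀ - 2 * k * c₁) (k ^ 2 * c₁) hk 0
  obtain ⟨B2, hB2⟩ := exists_bound_affine (k ^ 2 * c₀ - 2 * k * c₁) (k ^ 2 * c₁) hk 2
  -- Here m = `prh`/(4π r³) and the derivative of `prh` is r p''(r); this gives the two terms of m'.
  have key := energySpace_div_identity u (m := fun r => rfD c₀ c₁ k r / r)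
    (m' := fun r => pr'' c₀ c₁ k r / (4 * Real.pi * r ^ 2) - 3 * prh c₀ c₁ k r / (4 * Real.pi * r ^ 4))
    (M := A + (B0 + B2)) ?_ ?_ ?_ ?_ ?_ ?_
  rotate_left
  · unfold rfD
    refine ContDiffOn.div (ContDiffOn.div (contDiff_prh _ _ _).contDiffOn (by fun_prop) ?_)
      (by fun_prop) ?_
    · intro r hr; have hr' : (0:ℝ) < r := hr; positivity
    · intro r hr; have hr' : (0:ℝ) < r := hr; positivity
  · intro r hr
    have h1 : HasDerivAt (prh c₀ c₁ k) (r * pr'' c₀ c₁ k r) r := by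
      have := (((hasDerivAt_id r).mul (hasDerivAt_pr' c₀ c₁ k r)).sub (hasDerivAt_pr c₀ c₁ k r)).add_const c₀
      refine this.congr_deriv ?_
      simp
    have h2 : HasDerivAt (fun r : ℝ => 4 * Real.pi * r ^ 2) (4 * Real.pi * (2 * r)) r := by
      simpa using ((hasDerivAt_pow 2 r).const_mul (4 * Real.pi))
    have h3 := (h1.div h2 (by positivity)).div (hasDerivAt_id r) hr.ne'
    refine h3.congr_deriv ?_
    simp only [id, Pi.div_apply]
    field_simp
    ring
  · exact (measurable_rfD _ _ _).div measurable_id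
  · have := (continuous_pr'' c₀ c₁ k).measurable
    have := (contDiff_prh c₀ c₁ k).continuous.measurable
    fun_prop
  · intro r hr
    have h1 := hA r hr
    have hB0' := (abs_nonneg _).trans (hB0 0 le_rfl)
    have hB2' := (abs_nonneg _).trans (hB2 0 le_rfl)
    rw [abs_div, abs_of_pos hr, div_le_div_iff₀ hr (by positivity)]
    rw [mul_one_div, le_div_iff₀ (by positivity)] at h1
    nlinarith
  · intro r hr
    have e : 3 * (rfD c₀ c₁ k r / r) + r * (pr'' c₀ c₁ k r / (4 * Real.pi * r ^ 2)
        - 3 * prh c₀ c₁ k r / (4 * Real.pi * r ^ 4)) = pr'' c₀ c₁ k r / (4 * Real.pi * r) := by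
      simp only [rfD]; field_simp; ring
    have hA0 : 0 ≤ A := by
      have := (abs_nonneg _).trans (hA 1 one_pos); norm_num at this; linarith
    have h0 : |pr'' c₀ c₁ k r| ≤ B0 := by simpa [pr''] using hB0 r hr.le
    have h2 : r ^ 2 * |pr'' c₀ c₁ k r| ≤ B2 := by
      have := hB2 r hr.le
      rw [abs_mul, abs_of_nonneg (sq_nonneg r)] at this
      exact this
    simp only [e]
    rw [abs_div, abs_of_pos (a := 4 * Real.pi * r) (by positivity), div_le_div_iff₀ (by positivity) (by positivity)]
    have hpi3 := Real.pi_gt_three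
    have hs : 0 ≤ A + (B0 + B2) := by
      have hB0' := (abs_nonneg _).trans (hB0 0 le_rfl)
      have hB2' := (abs_nonneg _).trans (hB2 0 le_rfl)
      linarith
    calc |pr'' c₀ c₁ k r| * (r * (1 + r ^ 2)) = r * (|pr'' c₀ c₁ k r| + r ^ 2 * |pr'' c₀ c₁ k r|) := by ring
      _ ≤ r * (A + (B0 + B2)) := mul_le_mul_of_nonneg_left (by linarith) hr.le
      _ ≤ (A + (B0 + B2)) * (4 * Real.pi * r) := by nlinarith [mul_nonneg hs hr.le]
  have e1 : ∀ (i : Fin 3) (x : E3), ((rfD c₀ c₁ k ‖x‖ : ℝ) : ℂ) * ((x i / ‖x‖ : ℝ) : ℂ)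
      = ((x i * (rfD c₀ c₁ k ‖x‖ / ‖x‖) : ℝ) : ℂ) := fun i x => by push_cast; ring
  simp only [e1]
  rw [key]
  have hu : Integrable (fun x => u.toFun x * ((rf (k ^ 2 * c₀ - 2 * k * c₁) (k ^ 2 * c₁) k x : ℝ) : ℂ)) :=
    u.memLp.integrable_mul (memLp_rf (k ^ 2 * c₀ - 2 * k * c₁) (k ^ 2 * c₁) hk)
  obtain ⟨hG, hGi⟩ := integral_rf'' c₀ c₁ hk
  have e2 : ∫ x, (u.toFun x - u.charge * G0 x) * ((3 * (rfD c₀ c₁ k ‖x‖ / ‖x‖) + ‖x‖ *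
      (pr'' c₀ c₁ k ‖x‖ / (4 * Real.pi * ‖x‖ ^ 2) - 3 * prh c₀ c₁ k ‖x‖ / (4 * Real.pi * ‖x‖ ^ 4)) : ℝ) : ℂ)
      = ∫ x, (u.toFun x * ((rf (k ^ 2 * c₀ - 2 * k * c₁) (k ^ 2 * c₁) k x : ℝ) : ℂ)
        - u.charge * (G0 x * ((rf (k ^ 2 * c₀ - 2 * k * c₁) (k ^ 2 * c₁) k x : ℝ) : ℂ))) := by
    refine integral_congr_ae ?_
    filter_upwards [ae_norm_pos] with x hx
    have e3 : 3 * (rfD c₀ c₁ k ‖x‖ / ‖x‖) + ‖x‖ * (pr'' c₀ c₁ k ‖x‖ / (4 * Real.pi * ‖x‖ ^ 2)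
        - 3 * prh c₀ c₁ k ‖x‖ / (4 * Real.pi * ‖x‖ ^ 4))
        = rf (k ^ 2 * c₀ - 2 * k * c₁) (k ^ 2 * c₁) k x := by
      rw [rf_eq, rfD]
      have : pr (k ^ 2 * c₀ - 2 * k * c₁) (k ^ 2 * c₁) k ‖x‖ = pr'' c₀ c₁ k ‖x‖ := rfl
      rw [this]
      field_simp; ring
    rw [e3]; ring
  rw [e2, integral_sub hu (hG.const_mul _), integral_const_mul, hGi]
  ring

end ConcNLS
end

noncomputable section

namespace ConcNLS

open MeasureTheory Complex ComplexConjugate Set Filter Topology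
open scoped ContDiff

/-! ### Uniqueness of the charge and its bound by the weighted norm -/

/-- The divergence of the field `y S(2 - |y|²)`, as a function of `|y|`. -/
def bumpDiv (s : ℝ) : ℝ :=
  3 * Real.smoothTransition (2 - s ^ 2) - 2 * s ^ 2 * deriv Real.smoothTransition (2 - s ^ 2)

lemma continuous_bumpDiv : Continuous bumpDiv := by
  have h1 := Real.smoothTransition.continuous
  have h2 : Continuous (deriv Real.smoothTransition) :=
    (Real.smoothTransition.contDiff (n := 1)).continuous_deriv le_rfl
  unfold bumpDiv
  fun_prop

lemma bumpDiv_eq_zero {s : ℝ} (h : 2 < s) : bumpDiv s = 0 := by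
  have : 2 - s ^ 2 < 0 := by nlinarith
  rw [bumpDiv, Real.smoothTransition.zero_of_nonpos this.le, deriv_smoothTransition_eq_zero (Or.inl this)]
  simp

lemma integral_scaled (f : ℝ → ℝ) {r : ℝ} (hr : 0 < r) :
    ∫ x : E3, 1 / (4 * Real.pi * ‖x‖) * f (‖x‖ / r) = r ^ 2 * ∫ s in Ioi (0 : ℝ), s * f s := by
  have h := integral_radial (fun s => 1 / (4 * Real.pi * s) * f (s / r))
  rw [h, smul_eq_mul, ← integral_const_mul]
  have hpi := Real.pi_pos
  have h2 : ∀ s ∈ Ioi (0:ℝ), 4 * Real.pi * (s ^ 2 • (1 / (4 * Real.pi * s) * f (s / r)))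
      = (fun y => r * (y * f y)) (r⁻¹ * s) := by
    intro s hs
    have hs' : (0:ℝ) < s := hs
    simp only [smul_eq_mul]
    rw [inv_mul_eq_div]
    field_simp
  rw [setIntegral_congr_fun measurableSet_Ioi h2,
    integral_comp_mul_left_Ioi (fun y => r * (y * f y)) 0 (inv_pos.2 hr), integral_const_mul]
  simp
  ring

/-- The normalizing constant of the charge functional. -/
def bumpConst : ℝ := ∫ s in Ioi (0 : ℝ), s * bumpDiv s

lemma setIntegral_Ioi_eq_interval {f : ℝ → ℝ} (hf : ∀ s, 2 < s → f s = 0) :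
    ∫ s in Ioi (0 : ℝ), f s = ∫ s in (0:ℝ)..2, f s := by
  rw [intervalIntegral.integral_of_le (by norm_num)]
  refine setIntegral_eq_of_subset_of_forall_sdiff_eq_zero measurableSet_Ioi Ioc_subset_Ioi_self ?_
  intro s hs
  refine hf s ?_
  simp only [Set.mem_sdiff, mem_Ioi, mem_Ioc, not_and, not_le] at hs
  exact hs.2 hs.1

/-- With S the cut-off factor, s times the divergence equals s S plus the exact derivative of s² S.
The latter integrates to zero since S vanishes at s = 2, and what remains is the integral of a
nonnegative function that is positive at s = 1. -/
lemma bumpConst_pos : 0 < bumpConst := by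
  unfold bumpConst
  rw [setIntegral_Ioi_eq_interval (fun s hs => by rw [bumpDiv_eq_zero hs, mul_zero])]
  have cS := Real.smoothTransition.continuous
  have cS' : Continuous (deriv Real.smoothTransition) :=
    (Real.smoothTransition.contDiff (n := 1)).continuous_deriv le_rfl
  have hd : ∀ s : ℝ, HasDerivAt (fun s => s ^ 2 * Real.smoothTransition (2 - s ^ 2))
      (2 * s * Real.smoothTransition (2 - s ^ 2)
        - 2 * s ^ 3 * deriv Real.smoothTransition (2 - s ^ 2)) s := by
    intro s
    have hS : HasDerivAt Real.smoothTransition (deriv Real.smoothTransition (2 - s ^ 2)) (2 - s ^ 2) :=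
      ((Real.smoothTransition.contDiff (n := 1)).differentiable (by simp) _).hasDerivAt
    have h1 : HasDerivAt (fun s : ℝ => 2 - s ^ 2) (-(2 * s)) s := by
      simpa using (hasDerivAt_pow 2 s).const_sub 2
    have := (hasDerivAt_pow 2 s).mul (hS.comp s h1)
    refine this.congr_deriv ?_
    simp
    ring
  have e : ∀ s, s * bumpDiv s = s * Real.smoothTransition (2 - s ^ 2)
      + (2 * s * Real.smoothTransition (2 - s ^ 2)
        - 2 * s ^ 3 * deriv Real.smoothTransition (2 - s ^ 2)) := by
    intro s; unfold bumpDiv; ring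
  have c1 : Continuous fun s : ℝ => s * Real.smoothTransition (2 - s ^ 2) := by fun_prop
  have c2 : Continuous fun s : ℝ => 2 * s * Real.smoothTransition (2 - s ^ 2)
        - 2 * s ^ 3 * deriv Real.smoothTransition (2 - s ^ 2) := by fun_prop
  simp only [e]
  rw [intervalIntegral.integral_add (c1.intervalIntegrable _ _) (c2.intervalIntegrable _ _),
    intervalIntegral.integral_eq_sub_of_hasDerivAt (fun s _ => hd s) (c2.intervalIntegrable _ _)]
  rw [Real.smoothTransition.zero_of_nonpos (x := 2 - 2 ^ 2) (by norm_num)]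
  simp only [mul_zero, ne_eq, OfNat.ofNat_ne_zero, not_false_eq_true, zero_pow, zero_mul, sub_self, add_zero]
  refine intervalIntegral.integral_pos (by norm_num) c1.continuousOn (fun s hs => ?_) ⟨1, by norm_num, ?_⟩
  · exact mul_nonneg hs.1.le (Real.smoothTransition.nonneg _)
  · rw [one_mul]; exact Real.smoothTransition.pos_of_pos (by norm_num)

lemma hasCompactSupport_scaled {r : ℝ} (hr : 0 < r) :
    HasCompactSupport (fun x : E3 => bumpDiv (‖x‖ / r)) := by
  refine HasCompactSupport.intro (isCompact_closedBall (0 : E3) (2 * r)) fun x hx => ?_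
  simp only [Metric.mem_closedBall, dist_zero_right, not_le] at hx
  exact bumpDiv_eq_zero (by rwa [lt_div_iff₀ hr])

lemma continuous_scaled (r : ℝ) : Continuous (fun x : E3 => bumpDiv (‖x‖ / r)) :=
  continuous_bumpDiv.comp (by fun_prop)

lemma integrable_G0_mul_scaled {r : ℝ} (hr : 0 < r) :
    Integrable (fun x : E3 => 1 / (4 * Real.pi * ‖x‖) * bumpDiv (‖x‖ / r)) := by
  obtain ⟨B, hB0, hB⟩ := exists_exp_bound (continuous_scaled r) (hasCompactSupport_scaled hr)
  have hpi := Real.pi_gt_three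
  refine (integrable_exp_neg_norm_div.const_mul B).mono' (Measurable.aestronglyMeasurable ?_) ?_
  · exact Measurable.mul (by fun_prop) (continuous_scaled r).measurable
  · filter_upwards [ae_norm_pos] with x hx
    rw [norm_mul, Real.norm_of_nonneg (r := 1 / _) (by positivity)]
    have h1 := hB x
    calc _ ≤ 1 / ‖x‖ * (B * Real.exp (-‖x‖)) := by
          refine mul_le_mul (one_div_le_one_div_of_le hx ?_) h1 (norm_nonneg _) (by positivity)
          nlinarith
      _ = _ := by ring

lemma bump_functional_regular {φ : E3 → ℂ} {g : Fin 3 → E3 → ℂ} (hφ : HasWeakGrad φ g) {r : ℝ}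
    (hr : 0 < r) :
    ∫ x, φ x * ((bumpDiv (‖x‖ / r) : ℝ) : ℂ)
      = -∑ i, ∫ x, g i x * ((x i * Real.smoothTransition (2 - ‖x‖ ^ 2 / r ^ 2) : ℝ) : ℂ) := by
  set η : Fin 3 → E3 → ℝ := fun i x => x i * Real.smoothTransition (2 - ‖x‖ ^ 2 / r ^ 2) with hη
  have hS : ∀ y, HasDerivAt Real.smoothTransition (deriv Real.smoothTransition y) y := fun y =>
    ((Real.smoothTransition.contDiff (n := 1)).differentiable (by simp) y).hasDerivAt
  have hηC : ∀ i, ContDiff ℝ ∞ (η i) := by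
    intro i
    have h1 : ContDiff ℝ ∞ (fun x : E3 => ‖x‖ ^ 2) := contDiff_norm_sq ℝ
    exact ContDiff.mul (by fun_prop) (Real.smoothTransition.contDiff.comp
      (contDiff_const.sub (h1.div_const _)))
  have hηs : ∀ i, HasCompactSupport (η i) := by
    intro i
    refine HasCompactSupport.intro (isCompact_closedBall (0 : E3) (2 * r)) fun x hx => ?_
    simp only [Metric.mem_closedBall, dist_zero_right, not_le] at hx
    have : 2 ≤ ‖x‖ ^ 2 / r ^ 2 := by
      rw [le_div_iff₀ (by positivity)]; nlinarith
    simp only [hη]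
    rw [Real.smoothTransition.zero_of_nonpos (by linarith), mul_zero]
  have hd : ∀ (x : E3) i, fderiv ℝ (η i) x (EuclideanSpace.single i 1)
      = Real.smoothTransition (2 - ‖x‖ ^ 2 / r ^ 2)
        - x i ^ 2 * (2 / r ^ 2 * deriv Real.smoothTransition (2 - ‖x‖ ^ 2 / r ^ 2)) := by
    intro x i
    have h2 : HasFDerivAt (fun y : E3 => 2 - ‖y‖ ^ 2 / r ^ 2) _ x :=
      (((hasStrictFDerivAt_norm_sq x).hasFDerivAt).mul_const ((r ^ 2)⁻¹)).const_sub 2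
    have h3 : HasFDerivAt (fun y : E3 => y i) (EuclideanSpace.proj i : E3 →L[ℝ] ℝ) x :=
      (EuclideanSpace.proj i : E3 →L[ℝ] ℝ).hasFDerivAt
    have h4 : fderiv ℝ (η i) x = _ := (h3.mul ((hS _).hasFDerivAt.comp x h2)).fderiv
    rw [h4]
    simp [EuclideanSpace.inner_single_right]
    ring
  have h1 : ∀ i, ∫ x, g i x * ((η i x : ℝ) : ℂ)
      = -∫ x, φ x * ((fderiv ℝ (η i) x (EuclideanSpace.single i 1) : ℝ) : ℂ) := by
    intro i
    rw [hφ.2.2 (η i) (hηC i) (hηs i) i, neg_neg]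
  simp only [hη] at h1
  simp only [h1, Finset.sum_neg_distrib, neg_neg]
  rw [← integral_finsetSum]
  · refine integral_congr_ae (ae_of_all _ fun x => ?_)
    simp only
    rw [← Finset.mul_sum, ← ofReal_sum]
    congr 2
    have : ∀ i, (fderiv ℝ (fun x : E3 => x i * Real.smoothTransition (2 - ‖x‖ ^ 2 / r ^ 2)) x)
        (EuclideanSpace.single i 1) = _ := hd x
    simp only [this]
    rw [Finset.sum_sub_distrib, ← Finset.sum_mul _ _ (2 / r ^ 2 * _), sum_coord_sq]
    simp [bumpDiv, div_pow]
    ring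
  · intro i _
    have hc : Continuous (fun x => ((fderiv ℝ (η i) x (EuclideanSpace.single i 1) : ℝ) : ℂ)) :=
      continuous_ofReal.comp (((hηC i).continuous_fderiv (by simp)).clm_apply continuous_const)
    have hs : HasCompactSupport
        (fun x => ((fderiv ℝ (η i) x (EuclideanSpace.single i 1) : ℝ) : ℂ)) :=
      ((hηs i).fderiv_apply (𝕜 := ℝ) _).comp_left (g := ofReal) (by simp)
    have := hφ.1.integrable_smul_right_of_hasCompactSupport hc hs
    simpa [smul_eq_mul] using this

/-- A square integrable gradient on a ball of radius 2r, tested with a field of size r, contributes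
r · r^{3/2} = r^{5/2} by Cauchy–Schwarz. This is smaller than the exact r² contributed by `G0`.
Cauchy–Schwarz is used in the pointwise form 2r|g| ≤ r^{5/2}|g|² + r^{-1/2}, integrated over the
ball. -/
lemma bump_functional_small {φ : E3 → ℂ} {g : Fin 3 → E3 → ℂ} (hφ : HasWeakGrad φ g)
    (hg : ∀ i, ∀ K : Set E3, IsCompact K → MemLp (g i) 2 (volume.restrict K)) :
    ∃ C, ∀ r : ℝ, 0 < r → r ≤ 1 → ‖∫ x, φ x * ((bumpDiv (‖x‖ / r) : ℝ) : ℂ)‖ ≤ C * (r ^ 2 * √r) := by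
  set K := Metric.closedBall (0 : E3) 2
  have hK : IsCompact K := isCompact_closedBall _ _
  have hsq : ∀ i, IntegrableOn (fun x => ‖g i x‖ ^ 2) K := fun i => (hg i K hK).integrable_norm_pow (by simp)
  set V : ℝ := (volume : Measure E3).real (Metric.ball 0 1)
  set A : Fin 3 → ℝ := fun i => ∫ x in K, ‖g i x‖ ^ 2
  refine ⟨∑ i, (A i + 8 * V), fun r hr hr1 => ?_⟩
  rw [bump_functional_regular hφ hr, norm_neg, Finset.sum_mul]
  refine (norm_sum_le _ _).trans (Finset.sum_le_sum fun i _ => ?_)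
  have hsr : 0 < √r := Real.sqrt_pos.2 hr
  have hsr2 : √r * √r = r := Real.mul_self_sqrt hr.le
  set B := Metric.closedBall (0 : E3) (2 * r)
  have hBK : B ⊆ K := Metric.closedBall_subset_closedBall (by linarith)
  have hB : IsCompact B := isCompact_closedBall _ _
  have hbound : ∀ x, ‖g i x * ((x i * Real.smoothTransition (2 - ‖x‖ ^ 2 / r ^ 2) : ℝ) : ℂ)‖
      ≤ B.indicator (fun x => (r ^ 2 * √r) * ‖g i x‖ ^ 2 + √r / r) x := by
    intro x
    by_cases hx : x ∈ B
    · rw [indicator_of_mem hx, norm_mul, norm_real, Real.norm_eq_abs, abs_mul,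
        abs_of_nonneg (Real.smoothTransition.nonneg _)]
      have hx' : ‖x‖ ≤ 2 * r := by simpa [B] using hx
      have h1 : |x i| * Real.smoothTransition (2 - ‖x‖ ^ 2 / r ^ 2) ≤ 2 * r :=
        (mul_le_mul ((abs_coord_le x i).trans hx') (Real.smoothTransition.le_one _)
          (Real.smoothTransition.nonneg _) (by linarith)).trans (by simp)
      calc _ ≤ ‖g i x‖ * (2 * r) := by gcongr
        _ ≤ _ := by
          have h2 : √r / r = 1 / √r := by rw [div_eq_div_iff hr.ne' hsr.ne']; linarith
          rw [h2]
          have h3 : 0 ≤ (r * √r * ‖g i x‖ - 1) ^ 2 / √r := by positivity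
          have h4 : (r * √r * ‖g i x‖ - 1) ^ 2 / √r
              = r ^ 2 * √r * ‖g i x‖ ^ 2 + 1 / √r - ‖g i x‖ * (2 * r) := by
            field_simp
            ring
          linarith
    · rw [indicator_of_notMem hx]
      have hx' : 2 * r < ‖x‖ := by simpa [B] using hx
      have : 2 ≤ ‖x‖ ^ 2 / r ^ 2 := by
        rw [le_div_iff₀ (by positivity)]; nlinarith
      rw [Real.smoothTransition.zero_of_nonpos (by linarith)]; simp
  have hfin : volume B ≠ ⊤ := hB.measure_lt_top.ne
  have hi1 : IntegrableOn (fun x => (r ^ 2 * √r) * ‖g i x‖ ^ 2) B := ((hsq i).mono_set hBK).const_mul _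
  have hi2 : IntegrableOn (fun _ : E3 => √r / r) B := integrableOn_const hfin
  refine (norm_integral_le_of_norm_le ((hi1.add hi2).integrable_indicator measurableSet_closedBall)
    (ae_of_all _ hbound)).trans ?_
  rw [integral_indicator measurableSet_closedBall]
  have hvol : volume.real B = 8 * r ^ 3 * V := by
    simp only [B, V, Measure.real]
    rw [Measure.addHaar_closedBall _ _ (by positivity), ENNReal.toReal_mul,
      ENNReal.toReal_ofReal (by positivity)]
    simp only [finrank_euclideanSpace, Fintype.card_fin]
    ring
  have hA : ∫ x in B, ‖g i x‖ ^ 2 ≤ A i :=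
    setIntegral_mono_set (hsq i) (ae_of_all _ fun x => by positivity) (LE.le.eventuallyLE hBK)
  have : ∫ x in B, ((r ^ 2 * √r) * ‖g i x‖ ^ 2 + √r / r) = (r ^ 2 * √r) * (∫ x in B, ‖g i x‖ ^ 2)
      + √r / r * (8 * r ^ 3 * V) := by
    rw [integral_add hi1 hi2, integral_const_mul, setIntegral_const, hvol, smul_eq_mul, mul_comm (√r / r)]
  refine this.le.trans ?_
  have e : √r / r * (8 * r ^ 3 * V) = 8 * V * (r ^ 2 * √r) := by field_simp
  rw [e]
  nlinarith [mul_le_mul_of_nonneg_left hA (show 0 ≤ r ^ 2 * √r by positivity)]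

/-- A formula for the charge as a limit of integrals: the singular part contributes the constant at
every scale, the regular part is O(√r). Uniqueness of the charge and its bound by the weighted norm
both follow from it. -/
lemma bump_functional_tendsto {u : E3 → ℂ} {q : ℂ} (h : HasCharge u q) :
    Tendsto (fun r : ℝ => ((r ^ 2)⁻¹ : ℝ) * ∫ x, u x * ((bumpDiv (‖x‖ / r) : ℝ) : ℂ)) (𝓝[>] 0)
      (𝓝 (bumpConst * q)) := by
  obtain ⟨g, hg, hw⟩ := id h
  obtain ⟨C, hC⟩ := bump_functional_small hw hg
  rw [tendsto_iff_norm_sub_tendsto_zero]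
  refine squeeze_zero' (g := fun r => C * √r) (Eventually.of_forall fun _ => norm_nonneg _) ?_ ?_
  · filter_upwards [Ioc_mem_nhdsGT (show (0:ℝ) < 1 by norm_num)] with r hr
    have hr0 := hr.1
    have e1 : ∫ x, u x * ((bumpDiv (‖x‖ / r) : ℝ) : ℂ)
        = (∫ x, (u x - q * G0 x) * ((bumpDiv (‖x‖ / r) : ℝ) : ℂ)) + q * (r ^ 2 * bumpConst : ℝ) := by
      have i1 : Integrable (fun x => (u x - q * G0 x) * ((bumpDiv (‖x‖ / r) : ℝ) : ℂ)) := by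
        have := hw.1.integrable_smul_right_of_hasCompactSupport
          (continuous_ofReal.comp (continuous_scaled r))
          ((hasCompactSupport_scaled hr0).comp_left (g := ofReal) (by simp))
        simpa [smul_eq_mul] using this
      have i2 : Integrable (fun x : E3 => ((1 / (4 * Real.pi * ‖x‖) * bumpDiv (‖x‖ / r) : ℝ) : ℂ)) :=
        (integrable_G0_mul_scaled hr0).ofReal (𝕜 := ℂ)
      rw [bumpConst, ← integral_scaled bumpDiv hr0, ← integral_complex_ofReal, ← integral_const_mul,
        ← integral_add i1 (i2.const_mul q)]
      refine integral_congr_ae (ae_of_all _ fun x => ?_)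
      simp [G0]
      ring
    rw [e1]
    have hr2 : (r : ℂ) ≠ 0 := by exact_mod_cast hr0.ne'
    have e2 : ∀ X : ℂ, ((r ^ 2)⁻¹ : ℝ) * (X + q * (r ^ 2 * bumpConst : ℝ)) - bumpConst * q
        = ((r ^ 2)⁻¹ : ℝ) * X := by
      intro X; push_cast; field_simp; ring
    rw [e2, norm_mul, norm_real, Real.norm_of_nonneg (by positivity), inv_mul_le_iff₀ (by positivity)]
    refine (hC r hr0 hr.2).trans (le_of_eq (by ring))
  · have : Tendsto (fun r : ℝ => C * √r) (𝓝[>] 0) (𝓝 (C * √0)) :=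
      ((Real.continuous_sqrt.tendsto 0).mono_left nhdsWithin_le_nhds).const_mul C
    simpa using this

lemma HasCharge.unique {u : E3 → ℂ} {p q : ℂ} (hp : HasCharge u p) (hq : HasCharge u q) : p = q := by
  have := tendsto_nhds_unique (bump_functional_tendsto hp) (bump_functional_tendsto hq)
  have hc : (bumpConst : ℂ) ≠ 0 := by exact_mod_cast bumpConst_pos.ne'
  exact mul_left_cancel₀ hc this

lemma HasCharge.charge_eq {u : E3 → ℂ} {q : ℂ} (h : HasCharge u q) : charge u = q := by
  have hex : ∃ q, HasCharge u q := ⟨q, h⟩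
  rw [charge, dif_pos hex]
  exact hex.choose_spec.unique h

/-- On the unit ball the weight is at most 2/|x|, which scales like `G0`. The rescaled functional is
thus bounded independently of r, and the bound passes to the limit. The restriction r ≤ 1/2 keeps
the support inside the unit ball. -/
lemma exists_charge_bound : ∃ C > 0, ∀ (u : E3 → ℂ) (q : ℂ) (M : ℝ), HasCharge u q →
    (∀ᵐ x, ‖u x‖ ≤ M * wt x) → ‖q‖ ≤ C * M := by
  set c' := ∫ s in Ioi (0 : ℝ), s * |bumpDiv s| with hc'
  have hc0 : 0 ≤ c' := setIntegral_nonneg measurableSet_Ioi fun s hs =>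
    mul_nonneg (le_of_lt hs) (abs_nonneg _)
  have hpi := Real.pi_pos
  refine ⟨(8 * Real.pi * c' + 1) / bumpConst, div_pos (by positivity) bumpConst_pos,
    fun u q M h hM => ?_⟩
  have hM0 : 0 ≤ M := by
    obtain ⟨x, hx⟩ := hM.exists
    exact nonneg_of_mul_nonneg_left ((norm_nonneg _).trans hx) (wt_pos x)
  have h1 := (bump_functional_tendsto h).norm
  have h2 : ‖(bumpConst : ℂ) * q‖ ≤ 8 * Real.pi * c' * M := by
    refine le_of_tendsto h1 ?_
    filter_upwards [Ioc_mem_nhdsGT (show (0:ℝ) < 1 / 2 by norm_num)] with r hr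
    have hr0 := hr.1
    have i2 : Integrable (fun x : E3 => 1 / (4 * Real.pi * ‖x‖) * |bumpDiv (‖x‖ / r)|) := by
      refine (integrable_G0_mul_scaled hr0).norm.congr (ae_of_all _ fun x => ?_)
      simp [abs_of_pos hpi]
    have h3 := norm_integral_le_of_norm_le (i2.const_mul (8 * Real.pi * M))
      (f := fun x => u x * ((bumpDiv (‖x‖ / r) : ℝ) : ℂ)) ?_
    · rw [integral_const_mul, integral_scaled (fun s => |bumpDiv s|) hr0] at h3
      rw [norm_mul, norm_real, Real.norm_of_nonneg (by positivity), inv_mul_le_iff₀ (by positivity)]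
      refine h3.trans (le_of_eq ?_)
      rw [← hc']; ring
    · filter_upwards [hM, ae_norm_pos] with x hx hx0
      rw [norm_mul, norm_real, Real.norm_eq_abs]
      by_cases hxr : 2 < ‖x‖ / r
      · rw [bumpDiv_eq_zero hxr]; simp
      · have hx1 : ‖x‖ ≤ 1 := by
          have := (div_le_iff₀ hr0).1 (not_lt.1 hxr)
          linarith [hr.2]
        have hw : wt x ≤ 2 / ‖x‖ := by
          unfold wt
          rw [le_div_iff₀ hx0]
          field_simp
          linarith
        calc _ ≤ M * wt x * |bumpDiv (‖x‖ / r)| := by gcongr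
          _ ≤ M * (2 / ‖x‖) * |bumpDiv (‖x‖ / r)| := by gcongr
          _ = _ := by field_simp; ring
  rw [norm_mul, norm_real, Real.norm_of_nonneg bumpConst_pos.le] at h2
  rw [div_mul_eq_mul_div, le_div_iff₀ bumpConst_pos]
  nlinarith

/-! ### Linearity of the charge -/

lemma HasWeakGrad.add {φ ψ : E3 → ℂ} {g h : Fin 3 → E3 → ℂ} (hφ : HasWeakGrad φ g)
    (hψ : HasWeakGrad ψ h) : HasWeakGrad (fun x => φ x + ψ x) (fun i x => g i x + h i x) := by
  refine ⟨hφ.1.add hψ.1, fun i => (hφ.2.1 i).add (hψ.2.1 i), fun η hη hc i => ?_⟩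
  have c1 : Continuous (fun x => ((fderiv ℝ η x (EuclideanSpace.single i 1) : ℝ) : ℂ)) :=
    continuous_ofReal.comp ((hη.continuous_fderiv (by simp)).clm_apply continuous_const)
  have s1 : HasCompactSupport (fun x => ((fderiv ℝ η x (EuclideanSpace.single i 1) : ℝ) : ℂ)) :=
    (hc.fderiv_apply (𝕜 := ℝ) _).comp_left (g := ofReal) (by simp)
  have c2 : Continuous (fun x => ((η x : ℝ) : ℂ)) := continuous_ofReal.comp hη.continuous
  have s2 : HasCompactSupport (fun x => ((η x : ℝ) : ℂ)) := hc.comp_left (g := ofReal) (by simp)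
  have e1 := hφ.1.integrable_smul_right_of_hasCompactSupport c1 s1
  have e2 := hψ.1.integrable_smul_right_of_hasCompactSupport c1 s1
  have e3 := (hφ.2.1 i).integrable_smul_right_of_hasCompactSupport c2 s2
  have e4 := (hψ.2.1 i).integrable_smul_right_of_hasCompactSupport c2 s2
  simp only [smul_eq_mul] at e1 e2 e3 e4
  simp only [add_mul]
  rw [integral_add e1 e2, integral_add e3 e4, hφ.2.2 η hη hc i, hψ.2.2 η hη hc i]
  ring

lemma HasWeakGrad.conj {φ : E3 → ℂ} {g : Fin 3 → E3 → ℂ} (h : HasWeakGrad φ g) :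
    HasWeakGrad (fun x => conj (φ x)) (fun i x => conj (g i x)) := by
  have hl : ∀ f : E3 → ℂ, LocallyIntegrable f volume → LocallyIntegrable (fun x => conj (f x)) volume := by
    intro f hf
    refine hf.mono (Complex.continuous_conj.comp_aestronglyMeasurable hf.aestronglyMeasurable)
      (ae_of_all _ fun x => by simp)
  refine ⟨hl _ h.1, fun i => hl _ (h.2.1 i), fun η hη hc i => ?_⟩
  have := congrArg conj (h.2.2 η hη hc i)
  rw [map_neg, ← integral_conj, ← integral_conj] at this
  simpa using this

lemma HasCharge.add {u v : E3 → ℂ} {p q : ℂ} (hu : HasCharge u p) (hv : HasCharge v q) :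
    HasCharge (fun x => u x + v x) (p + q) := by
  obtain ⟨g, hg, hwg⟩ := hu
  obtain ⟨h, hh, hwh⟩ := hv
  refine ⟨fun i x => g i x + h i x, fun i K hK => (hg i K hK).add (hh i K hK), ?_⟩
  convert hwg.add hwh using 2
  ring

lemma HasCharge.const_mul {u : E3 → ℂ} {p : ℂ} (hu : HasCharge u p) (s : ℂ) :
    HasCharge (fun x => s * u x) (s * p) := by
  obtain ⟨g, hg, hwg⟩ := hu
  refine ⟨fun i x => s * g i x, fun i K hK => (hg i K hK).const_mul s, ?_⟩
  convert hwg.const_mul s using 2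
  ring

lemma conj_G0 (x : E3) : conj (G0 x) = G0 x := by
  simp [G0, Complex.conj_ofNat]

lemma HasCharge.conj {u : E3 → ℂ} {p : ℂ} (hu : HasCharge u p) :
    HasCharge (fun x => conj (u x)) (conj p) := by
  obtain ⟨g, hg, hwg⟩ := hu
  refine ⟨fun i x => (starRingEnd ℂ) (g i x), fun i K hK => (hg i K hK).star, ?_⟩
  convert hwg.conj using 2
  simp [conj_G0]

lemma HasCharge.sub {u v : E3 → ℂ} {p q : ℂ} (hu : HasCharge u p) (hv : HasCharge v q) :
    HasCharge (fun x => u x - v x) (p - q) := by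
  have := hu.add (hv.const_mul (-1))
  simpa [sub_eq_add_neg] using this

lemma HasCharge.zero : HasCharge (fun _ => 0) 0 := by
  have := (hasCharge_ek_zero (k := 0) le_rfl).const_mul 0
  simpa using this

lemma HasCharge.re {u : E3 → ℂ} {p : ℂ} (hu : HasCharge u p) :
    HasCharge (fun x => ((u x).re : ℂ)) (p.re : ℂ) := by
  have := (hu.add hu.conj).const_mul (1 / 2)
  simp only [Complex.add_conj] at this
  convert this using 1
  · funext x; push_cast; ring
  · push_cast; ring

lemma HasCharge.im {u : E3 → ℂ} {p : ℂ} (hu : HasCharge u p) :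
    HasCharge (fun x => ((u x).im : ℂ)) (p.im : ℂ) := by
  have := (hu.const_mul (-I)).re
  simpa using this

lemma EnergySpace.hasCharge (u : EnergySpace) : HasCharge u.toFun u.charge :=
  ⟨u.grad, fun i K _ => (u.grad_memLp i).restrict K, u.weakGrad⟩

lemma hasCharge_ek_one {k : ℝ} (hk : 0 < k) : HasCharge (ek 1 (k : ℂ)) 0 := by
  have := (testElem 0 1 1 hk).hasCharge
  have e : (testElem 0 1 1 hk).toFun = ek 1 (k : ℂ) := by
    funext x; simp [testElem, rf, ofReal_er]
  have e2 : (testElem 0 1 1 hk).charge = 0 := by simp [testElem]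
  rwa [e, e2] at this

end ConcNLS
end

/-! ### Moment equations of weak solutions. -/

noncomputable section

namespace ConcNLS

open MeasureTheory Complex ComplexConjugate Set Filter Topology

/-! ### The weak equation tested with exponential profiles -/

/-- The nonlinearity `ν |q|^(2σ) q`. -/
def Nq (σ ν : ℝ) (q : ℂ) : ℂ := ((ν * ‖q‖ ^ (2 * σ) : ℝ) : ℂ) * q

/-- The bilinear pairing of a scalar function with `ek n k`. -/
def pe (n : ℕ) (k : ℝ) (u : E3 → ℂ) : ℂ := ∫ x, u x * ek n (k : ℂ) x

lemma integrable_mul_ek {u : E3 → ℂ} (hu : MemLp u 2 volume) (n : ℕ) {k : ℝ} (hk : 0 < k) :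
    Integrable (fun x => u x * ek n (k : ℂ) x) :=
  hu.integrable_mul (memLp_ek n (by simpa))

/-- The pairing with `rf`. -/
lemma integral_mul_rf {u : E3 → ℂ} (hu : MemLp u 2 volume) (c₀ c₁ : ℝ) {k : ℝ} (hk : 0 < k) :
    ∫ x, u x * ((rf c₀ c₁ k x : ℝ) : ℂ) = c₀ * pe 0 k u + c₁ * pe 1 k u := by
  have h0 := integrable_mul_ek hu 0 hk
  have h1 := integrable_mul_ek hu 1 hk
  have e : ∀ x, u x * ((rf c₀ c₁ k x : ℝ) : ℂ) = c₀ * (u x * ek 0 (k : ℂ) x) + c₁ * (u x * ek 1 (k : ℂ) x) := by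
    intro x; simp only [rf, ofReal_add, ofReal_mul, ofReal_er]; ring
  simp only [e]
  rw [integral_add (h0.const_mul _) (h1.const_mul _), integral_const_mul, integral_const_mul]
  rfl

/-- The energy form against the profile `rf c₀ c₁ k`, before taking real parts. -/
def Wf (σ ν : ℝ) (c₀ c₁ k : ℝ) (u : EnergySpace) : ℂ :=
  -((k ^ 2 * c₀ - 2 * k * c₁ : ℝ) * pe 0 k u.toFun + (k ^ 2 * c₁ : ℝ) * pe 1 k u.toFun)
    + u.charge * ((k * c₀ - c₁) / (4 * Real.pi) : ℝ) - c₀ * Nq σ ν u.charge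

lemma energyForm_testElem (σ ν c₀ c₁ : ℝ) (s : ℂ) {k : ℝ} (hk : 0 < k) (u : EnergySpace) :
    energyForm σ ν u (testElem c₀ c₁ s hk) = (conj s * Wf σ ν c₀ c₁ k u).re := by
  have h1 : ∑ i : Fin 3, ∫ x, u.grad i x * conj ((testElem c₀ c₁ s hk).grad i x)
      = conj s * ∑ i, ∫ x, u.grad i x * (((rfD c₀ c₁ k ‖x‖ : ℝ) : ℂ) * ((x i / ‖x‖ : ℝ) : ℂ)) := by
    rw [Finset.mul_sum]
    refine Finset.sum_congr rfl fun i _ => ?_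
    rw [← integral_const_mul]
    congr 1; funext x
    simp [testElem]
    ring
  rw [energyForm, h1, energySpace_grad_test c₀ c₁ u hk, integral_mul_rf u.memLp _ _ hk]
  have e : conj s * Wf σ ν c₀ c₁ k u = conj s * (-((k ^ 2 * c₀ - 2 * k * c₁ : ℝ) * pe 0 k u.toFun
      + (k ^ 2 * c₁ : ℝ) * pe 1 k u.toFun) + u.charge * ((k * c₀ - c₁) / (4 * Real.pi) : ℝ))
      - ((ν * ‖u.charge‖ ^ (2 * σ) : ℝ) : ℂ) * (u.charge * conj (s * c₀)) := by
    simp only [Wf, Nq, map_mul, conj_ofReal]; ring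
  rw [e, sub_re, re_ofReal_mul]
  rfl

/-- The equation only gives derivatives of real parts. Testing with the profile and with i times the
profile provides minus the imaginary part and the real part of the complex moment, which are then
reassembled. -/
lemma weak_pairing {σ ν T : ℝ} {u : ℝ → EnergySpace} (h : IsSolution σ ν T u) (c₀ c₁ : ℝ) {k : ℝ}
    (hk : 0 < k) {t : ℝ} (ht : t ∈ Icc 0 T) :
    HasDerivWithinAt (fun s => ∫ x, (u s).toFun x * ((rf c₀ c₁ k x : ℝ) : ℂ))
      (-I * Wf σ ν c₀ c₁ k (u t)) (Icc 0 T) t := by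
  have hB : ∀ (s : ℂ) (r : ℝ), (∫ x, I * (u r).toFun x * conj ((testElem c₀ c₁ s hk).toFun x)).re
      = (I * conj s * ∫ x, (u r).toFun x * ((rf c₀ c₁ k x : ℝ) : ℂ)).re := by
    intro s r
    rw [← integral_const_mul]
    congr 2; funext x
    simp [testElem]
    ring
  have h1 := h.2 (testElem c₀ c₁ 1 hk) t ht
  have h2 := h.2 (testElem c₀ c₁ I hk) t ht
  simp only [hB, energyForm_testElem] at h1 h2
  simp at h1 h2
  have h3 := (h2.ofReal_comp).add ((h1.ofReal_comp).const_mul (-I))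
  refine (h3.congr_deriv ?_).congr_of_eventuallyEq (Eventually.of_forall fun s => ?_) ?_
  · apply Complex.ext <;> simp
  · apply Complex.ext <;> simp
  · apply Complex.ext <;> simp

/-! ### Differentiability in `L²` with respect to the decay rate -/

/-- Each derivative in the rate costs one factor -|x|. The exponential in the Taylor remainder is at
most exp(k₀|x|/2), which is paid for by halving the rate of the majorant. -/
lemma ek_taylor (n : ℕ) {k₀ k : ℝ} (hk : |k - k₀| ≤ k₀ / 2) (x : E3) :
    ‖ek n (k : ℂ) x - ek n (k₀ : ℂ) x - (((k - k₀ : ℝ)) : ℂ) * (-ek (n + 1) (k₀ : ℂ) x)‖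
      ≤ (k - k₀) ^ 2 * er (n + 2) (k₀ / 2) x := by
  have h := norm_exp_sub_sum_le_norm_mul_exp (((-(k - k₀) * ‖x‖ : ℝ)) : ℂ) 2
  simp only [Finset.sum_range_succ, Finset.sum_range_zero, pow_zero, Nat.factorial, pow_one, norm_real,
    Real.norm_eq_abs] at h
  have e : ek n (k : ℂ) x - ek n (k₀ : ℂ) x - (((k - k₀ : ℝ)) : ℂ) * (-ek (n + 1) (k₀ : ℂ) x)
      = ek n (k₀ : ℂ) x * (exp ((-(k - k₀) * ‖x‖ : ℝ) : ℂ) - (1 + ((-(k - k₀) * ‖x‖ : ℝ) : ℂ))) := by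
    have e1 : exp (-(k : ℂ) * ‖x‖) = exp (-(k₀ : ℂ) * ‖x‖) * exp ((-(k - k₀) * ‖x‖ : ℝ) : ℂ) := by
      rw [← Complex.exp_add]; congr 1; push_cast; ring
    simp only [ek, e1]
    push_cast
    ring
  rw [e, norm_mul, norm_ek_eq_er, ofReal_re]
  simp only [Nat.cast_one, div_one, zero_add, Nat.succ_eq_add_one, mul_one] at h
  have h2 : ‖exp ((-(k - k₀) * ‖x‖ : ℝ) : ℂ) - (1 + ((-(k - k₀) * ‖x‖ : ℝ) : ℂ))‖
      ≤ ((k - k₀) * ‖x‖) ^ 2 * Real.exp (k₀ / 2 * ‖x‖) := by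
    refine le_trans (by simpa using h) ?_
    refine mul_le_mul (le_of_eq ?_) (Real.exp_le_exp.2 ?_) (Real.exp_pos _).le (by positivity)
    · rw [← sq_abs ((k - k₀) * ‖x‖)]
      congr 1
      simp only [abs_mul, abs_norm, abs_sub_comm]
    · rw [abs_sub_comm] at hk
      exact mul_le_mul_of_nonneg_right hk (norm_nonneg _)
  refine (mul_le_mul_of_nonneg_left h2 (er_nonneg _ _ _)).trans (le_of_eq ?_)
  have e2 : Real.exp (-(k₀ / 2) * ‖x‖) = Real.exp (-k₀ * ‖x‖) * Real.exp (k₀ / 2 * ‖x‖) := by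
    rw [← Real.exp_add]; congr 1; ring
  simp only [er, e2]
  ring

/-- The `L²` class of `ek n k`. -/
def ekLp (n : ℕ) (k : ℝ) : Lp ℂ 2 (volume : Measure E3) :=
  if h : 0 < k then (memLp_ek n (k := (k : ℂ)) (by simpa)).toLp else 0

lemma coeFn_ekLp (n : ℕ) {k : ℝ} (hk : 0 < k) : ekLp n k =ᵐ[volume] ek n (k : ℂ) := by
  rw [ekLp, dif_pos hk]; exact MemLp.coeFn_toLp _

lemma hasDerivAt_ekLp (n : ℕ) {k₀ : ℝ} (hk₀ : 0 < k₀) :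
    HasDerivAt (ekLp n) (-ekLp (n + 1) k₀) k₀ := by
  rw [hasDerivAt_iff_isLittleO]
  refine Asymptotics.IsBigO.trans_isLittleO (g := fun k => ‖k - k₀‖ ^ 2) ?_
    (Asymptotics.isLittleO_pow_sub_sub k₀ one_lt_two)
  refine Asymptotics.IsBigO.of_bound ‖ekLp (n + 2) (k₀ / 2)‖ ?_
  filter_upwards [Metric.ball_mem_nhds k₀ (half_pos hk₀)] with k hk
  have hk' : |k - k₀| ≤ k₀ / 2 := (by simpa [Real.dist_eq] using hk : |k - k₀| < k₀ / 2).le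
  have hkp : 0 < k := by have := (abs_le.1 hk').1; linarith
  have hm : ‖ekLp n k - ekLp n k₀ - (k - k₀) • (-ekLp (n + 1) k₀)‖
      ≤ (k - k₀) ^ 2 * ‖ekLp (n + 2) (k₀ / 2)‖ := by
    refine Lp.norm_le_mul_norm_of_ae_le_mul ?_
    filter_upwards [coeFn_ekLp n hkp, coeFn_ekLp n hk₀, coeFn_ekLp (n + 1) hk₀,
      coeFn_ekLp (n + 2) (half_pos hk₀), Lp.coeFn_sub (ekLp n k) (ekLp n k₀),
      Lp.coeFn_sub (ekLp n k - ekLp n k₀) ((k - k₀) • (-ekLp (n + 1) k₀)),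
      Lp.coeFn_smul (k - k₀) (-ekLp (n + 1) k₀), Lp.coeFn_neg (ekLp (n + 1) k₀)]
      with x h1 h2 h3 h4 h5 h6 h7 h8
    rw [h6, Pi.sub_apply, h5, Pi.sub_apply, h7, Pi.smul_apply, h8, Pi.neg_apply, h1, h2, h3, h4,
      real_smul, norm_ek_eq_er]
    have := ek_taylor n hk' x
    simpa using this
  rw [Real.norm_of_nonneg (by positivity), Real.norm_eq_abs, sq_abs, mul_comm]
  exact hm

lemma conj_ek_real (n : ℕ) (k : ℝ) (x : E3) : conj (ek n (k : ℂ) x) = ek n (k : ℂ) x := by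
  rw [conj_ek, conj_ofReal]

lemma pe_eq_inner (n : ℕ) {k : ℝ} (hk : 0 < k) {u : E3 → ℂ} (hu : MemLp u 2 volume) :
    pe n k u = inner ℂ (ekLp n k) (hu.toLp u) := by
  rw [L2.inner_def, pe]
  refine integral_congr_ae ?_
  filter_upwards [coeFn_ekLp n hk, hu.coeFn_toLp] with x h1 h2
  rw [h1, h2]
  simp [conj_ek_real]

lemma IsSolution.continuous_toLp {σ ν T : ℝ} {u : ℝ → EnergySpace} (h : IsSolution σ ν T u) {t : ℝ}
    (ht : t ∈ Icc 0 T) :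
    ContinuousWithinAt (fun s => (u s).memLp.toLp (u s).toFun) (Icc 0 T) t := by
  have := h.1 t ht
  exact (Lp.tendsto_Lp_iff_tendsto_eLpNorm'' (fun s => (u s).toFun) (fun s => (u s).memLp)
    (u t).toFun (u t).memLp).2 this

/-- A product rule in which one factor is merely continuous. The pairing is split at the rate frozen
at time t: the frozen part is differentiable by assumption. In the rest the profile difference
vanishes at time t, so its difference quotient pairs the L² quotient of the profile with u(s), and
continuity of u in L² suffices. -/
lemma moving_pairing {σ ν T : ℝ} {u : ℝ → EnergySpace} (h : IsSolution σ ν T u) (n : ℕ) {k : ℝ → ℝ}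
    {t k' : ℝ} (ht : t ∈ Icc 0 T) (hk : 0 < k t) (hk' : HasDerivWithinAt k k' (Icc 0 T) t) {d : ℂ}
    (hd : HasDerivWithinAt (fun s => pe n (k t) (u s).toFun) d (Icc 0 T) t) :
    HasDerivWithinAt (fun s => pe n (k s) (u s).toFun) (d - k' * pe (n + 1) (k t) (u t).toFun)
      (Icc 0 T) t := by
  set S := Icc (0:ℝ) T
  set U : ℝ → Lp ℂ 2 (volume : Measure E3) := fun s => (u s).memLp.toLp (u s).toFun with hU
  have hE : HasDerivWithinAt (fun s => ekLp n (k s)) (k' • (-ekLp (n + 1) (k t))) S t :=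
    (hasDerivAt_ekLp n hk).scomp_hasDerivWithinAt t hk'
  have hR : HasDerivWithinAt (fun s => inner ℂ (ekLp n (k s) - ekLp n (k t)) (U s))
      (inner ℂ (k' • (-ekLp (n + 1) (k t))) (U t)) S t := by
    rw [hasDerivWithinAt_iff_tendsto_slope] at hE ⊢
    have hc : Tendsto U (𝓝[S \ {t}] t) (𝓝 (U t)) :=
      (h.continuous_toLp ht).mono_left (nhdsWithin_mono _ sdiff_subset)
    refine (hE.inner hc).congr' (Eventually.of_forall fun s => ?_)
    simp only [slope, vsub_eq_sub, sub_self, inner_zero_left, sub_zero]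
    rw [real_smul, RCLike.real_smul_eq_coe_smul (K := ℂ) (s - t)⁻¹ (ekLp n (k s) - ekLp n (k t)),
      inner_smul_left]
    simp
  have hpos : ∀ᶠ s in 𝓝[S] t, 0 < k s := hk'.continuousWithinAt.eventually (lt_mem_nhds hk)
  have h3 := hd.add hR
  refine (h3.congr_deriv ?_).congr_of_eventuallyEq ?_ ?_
  · rw [pe_eq_inner (n + 1) hk (u t).memLp, inner_smul_left_eq_smul, inner_neg_left]
    simp [hU]
    ring
  · filter_upwards [hpos] with s hs
    simp only [Pi.add_apply]
    rw [pe_eq_inner n hs (u s).memLp, pe_eq_inner n hk (u s).memLp, ← inner_add_left]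
    congr 1; abel
  · simp

lemma hasDerivWithinAt_phase {ω γ : ℝ → ℝ} {T t γ' : ℝ} (hω : ContinuousOn ω (Icc 0 T))
    (ht : t ∈ Icc 0 T) (hγ : HasDerivWithinAt γ γ' (Icc 0 T) t) :
    HasDerivWithinAt (phase ω γ) (ω t + γ') (Icc 0 T) t := by
  have : Fact (t ∈ Icc 0 T) := ⟨ht⟩
  have hi : IntervalIntegrable ω volume 0 t :=
    (hω.mono (by rw [uIcc_of_le ht.1]; exact Icc_subset_Icc_right ht.2)).intervalIntegrable
  have := intervalIntegral.integral_hasDerivWithinAt_right (s := Icc 0 T) (t := Icc 0 T) hi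
    (hω.stronglyMeasurableAtFilter_nhdsWithin measurableSet_Icc t) (hω t ht)
  exact this.add hγ

/-- The modulated pairing `∫ e^{-iθ} u ek n k`. -/
def mp (n : ℕ) (k θ : ℝ) (u : E3 → ℂ) : ℂ := exp (-I * θ) * pe n k u

lemma Nq_phase (σ ν θ : ℝ) (q : ℂ) : Nq σ ν (exp (-I * θ) * q) = exp (-I * θ) * Nq σ ν q := by
  have : ‖exp (-I * (θ : ℂ))‖ = 1 := by rw [Complex.norm_exp]; simp
  rw [Nq, Nq, norm_mul, this, one_mul]; ring

lemma hasDerivWithinAt_exp_phase {θ : ℝ → ℝ} {θ' t : ℝ} {S : Set ℝ} (h : HasDerivWithinAt θ θ' S t) :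
    HasDerivWithinAt (fun s => exp (-I * (θ s : ℂ))) (-I * θ' * exp (-I * (θ t : ℂ))) S t := by
  have := (h.ofReal_comp.const_mul (-I)).cexp
  exact this.congr_deriv (by ring)

lemma hasDerivWithinAt_mp_zero {σ ν T : ℝ} {u : ℝ → EnergySpace} (h : IsSolution σ ν T u) {k θ : ℝ → ℝ}
    {t k' θ' : ℝ} (ht : t ∈ Icc 0 T) (hk : 0 < k t) (hk' : HasDerivWithinAt k k' (Icc 0 T) t)
    (hθ : HasDerivWithinAt θ θ' (Icc 0 T) t) :
    HasDerivWithinAt (fun s => mp 0 (k s) (θ s) (u s).toFun)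
      (-I * θ' * mp 0 (k t) (θ t) (u t).toFun
        - I * (-(k t) ^ 2 * mp 0 (k t) (θ t) (u t).toFun
          + exp (-I * θ t) * (u t).charge * (k t / (4 * Real.pi))
          - Nq σ ν (exp (-I * θ t) * (u t).charge))
        - k' * mp 1 (k t) (θ t) (u t).toFun) (Icc 0 T) t := by
  have h1 := weak_pairing h 1 0 hk ht
  simp only [integral_mul_rf (u _).memLp 1 0 hk, ofReal_one, one_mul, ofReal_zero, zero_mul, add_zero] at h1
  have h2 := (hasDerivWithinAt_exp_phase hθ).mul (moving_pairing h 0 ht hk hk' h1)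
  refine h2.congr_deriv ?_
  rw [Nq_phase]
  simp only [mp, Wf]
  push_cast
  ring

/-- The test profile r exp(-kr)/(4π r) has charge zero, so the nonlinearity does not enter; only the
derivative of the profile at the origin sees the charge. -/
lemma hasDerivWithinAt_mp_one {σ ν T : ℝ} {u : ℝ → EnergySpace} (h : IsSolution σ ν T u) {k θ : ℝ → ℝ}
    {t k' θ' : ℝ} (ht : t ∈ Icc 0 T) (hk : 0 < k t) (hk' : HasDerivWithinAt k k' (Icc 0 T) t)
    (hθ : HasDerivWithinAt θ θ' (Icc 0 T) t) :
    HasDerivWithinAt (fun s => mp 1 (k s) (θ s) (u s).toFun)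
      (-I * θ' * mp 1 (k t) (θ t) (u t).toFun
        - I * (2 * k t * mp 0 (k t) (θ t) (u t).toFun - (k t) ^ 2 * mp 1 (k t) (θ t) (u t).toFun
          - exp (-I * θ t) * (u t).charge / (4 * Real.pi))
        - k' * mp 2 (k t) (θ t) (u t).toFun) (Icc 0 T) t := by
  have h1 := weak_pairing h 0 1 hk ht
  simp only [integral_mul_rf (u _).memLp 0 1 hk, ofReal_one, one_mul, ofReal_zero, zero_mul, zero_add] at h1
  have h2 := (hasDerivWithinAt_exp_phase hθ).mul (moving_pairing h 1 ht hk hk' h1)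
  refine h2.congr_deriv ?_
  simp only [mp, Wf]
  push_cast
  ring

end ConcNLS
end

/-! ### Weighted space, explicit discrete spectrum, and symplectic projections. -/

noncomputable section

namespace ConcNLS

open MeasureTheory Complex ComplexConjugate Set Filter Topology

/-! ### The weighted space -/

lemma MemW.ae_le {f : Field2} (h : MemW f) : ∀ᵐ x, ‖f x‖ ≤ wNorm f * wt x := by
  have h1 := ae_le_eLpNormEssSup (f := fun x => ‖f x‖ / (1 + 1 / ‖x‖)) (μ := (volume : Measure E3))
  have h2 := h.2
  filter_upwards [h1] with x hx
  rw [← eLpNorm_exponent_top] at hx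
  have h3 := ENNReal.toReal_mono h2.ne hx
  have h4 : ‖‖f x‖ / wt x‖ ≤ wNorm f := by
    rw [toReal_enorm] at h3; exact h3
  rw [Real.norm_of_nonneg (div_nonneg (norm_nonneg _) (wt_pos x).le)] at h4
  exact (div_le_iff₀ (wt_pos x)).1 h4

lemma memW_of_bound {f : Field2} (hf : AEStronglyMeasurable f volume) {M : ℝ} (hM : 0 ≤ M)
    (h : ∀ᵐ x, ‖f x‖ ≤ M * wt x) : MemW f ∧ wNorm f ≤ M := by
  have h1 : eLpNorm (fun x => ‖f x‖ / (1 + 1 / ‖x‖)) ⊤ volume ≤ ENNReal.ofReal M := by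
    rw [eLpNorm_exponent_top]
    refine eLpNormEssSup_le_of_ae_bound ?_
    filter_upwards [h] with x hx
    change ‖‖f x‖ / wt x‖ ≤ M
    rw [Real.norm_of_nonneg (div_nonneg (norm_nonneg _) (wt_pos x).le)]
    exact (div_le_iff₀ (wt_pos x)).2 hx
  refine ⟨⟨hf, h1.trans_lt ENNReal.ofReal_lt_top⟩, ?_⟩
  exact (ENNReal.toReal_mono ENNReal.ofReal_ne_top h1).trans (ENNReal.toReal_ofReal hM).le

lemma wNorm_nonneg (f : Field2) : 0 ≤ wNorm f := ENNReal.toReal_nonneg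

lemma MemW.add {f g : Field2} (hf : MemW f) (hg : MemW g) :
    MemW (fun x => f x + g x) ∧ wNorm (fun x => f x + g x) ≤ wNorm f + wNorm g := by
  refine memW_of_bound (hf.1.add hg.1) (add_nonneg (wNorm_nonneg f) (wNorm_nonneg g)) ?_
  filter_upwards [hf.ae_le, hg.ae_le] with x h1 h2
  exact (norm_add_le _ _).trans (by linarith)

lemma MemW.smul {f : Field2} (hf : MemW f) (c : ℂ) :
    MemW (fun x => c • f x) ∧ wNorm (fun x => c • f x) ≤ ‖c‖ * wNorm f := by
  refine memW_of_bound (hf.1.const_smul c) (mul_nonneg (norm_nonneg c) (wNorm_nonneg f)) ?_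
  filter_upwards [hf.ae_le] with x h1
  change ‖c • f x‖ ≤ _
  rw [norm_smul, mul_assoc]
  exact mul_le_mul_of_nonneg_left h1 (norm_nonneg _)

/-- Fields which can be integrated against all decaying profiles. -/
def Pairable (f : Field2) : Prop :=
  ∀ (i : Fin 2) (n : ℕ) (k : ℝ), 0 < k → Integrable (fun x => f x i * ek n (k : ℂ) x)

lemma MemW.ae_le_apply {f : Field2} (h : MemW f) (i : Fin 2) : ∀ᵐ x, ‖f x i‖ ≤ wNorm f * wt x := by
  filter_upwards [h.ae_le] with x hx
  exact (norm_le_pi_norm (f x) i).trans hx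

lemma aesm_apply {f : Field2} (h : AEStronglyMeasurable f volume) (i : Fin 2) :
    AEStronglyMeasurable (fun x => f x i) volume :=
  (continuous_apply i).comp_aestronglyMeasurable h

lemma MemW.mul_ek_bound {f : Field2} (h : MemW f) (i : Fin 2) (n : ℕ) (k : ℝ) :
    ∀ᵐ x, ‖f x i * ek n (k : ℂ) x‖ ≤ wNorm f * (wt x * er n k x) := by
  filter_upwards [h.ae_le_apply i] with x hx
  rw [norm_mul, norm_ek_eq_er, ofReal_re, ← mul_assoc]
  exact mul_le_mul_of_nonneg_right hx (er_nonneg _ _ _)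

lemma MemW.pairable {f : Field2} (h : MemW f) : Pairable f := fun i n k hk =>
  ((wt_er_integrable n hk).const_mul (wNorm f)).mono'
    ((aesm_apply h.1 i).mul (measurable_ek n k).aestronglyMeasurable) (h.mul_ek_bound i n k)

/-- The `L¹` norm of `w ek n k`. -/
def wInt (n : ℕ) (k : ℝ) : ℝ := ∫ x, wt x * er n k x

lemma MemW.pe_le {f : Field2} (h : MemW f) (i : Fin 2) (n : ℕ) {k : ℝ} (hk : 0 < k) :
    ‖pe n k (fun x => f x i)‖ ≤ wNorm f * wInt n k := by
  have := norm_integral_le_of_norm_le ((wt_er_integrable n hk).const_mul (wNorm f)) (h.mul_ek_bound i n k)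
  rwa [integral_const_mul] at this

lemma wInt_nonneg (n : ℕ) (k : ℝ) : 0 ≤ wInt n k :=
  integral_nonneg fun x => mul_nonneg (wt_pos x).le (er_nonneg _ _ _)

lemma wInt_anti (n : ℕ) {k l : ℝ} (hl : 0 < l) (h : l ≤ k) : wInt n k ≤ wInt n l :=
  integral_mono (wt_er_integrable n (hl.trans_le h)) (wt_er_integrable n hl) fun x =>
    mul_le_mul_of_nonneg_left (er_anti n h x) (wt_pos x).le

lemma Pairable.add {f g : Field2} (hf : Pairable f) (hg : Pairable g) : Pairable (fun x => f x + g x) := by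
  intro i n k hk
  refine ((hf i n k hk).add (hg i n k hk)).congr (ae_of_all _ fun x => ?_)
  simp [add_mul]

lemma Pairable.smul {f : Field2} (hf : Pairable f) (c : ℂ) : Pairable (fun x => c • f x) := by
  intro i n k hk
  refine ((hf i n k hk).const_mul c).congr (ae_of_all _ fun x => ?_)
  simp [mul_assoc]

lemma Pairable.pe_add {f g : Field2} (hf : Pairable f) (hg : Pairable g) (i : Fin 2) (n : ℕ) {k : ℝ}
    (hk : 0 < k) : pe n k (fun x => (f x + g x) i) = pe n k (fun x => f x i) + pe n k (fun x => g x i) := by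
  simp only [pe, Pi.add_apply, add_mul]
  exact integral_add (hf i n k hk) (hg i n k hk)

lemma pe_const_mul (n : ℕ) (k : ℝ) (c : ℂ) (u : E3 → ℂ) : pe n k (fun x => c * u x) = c * pe n k u := by
  simp only [pe, mul_assoc, integral_const_mul]

lemma pe_add {u v : E3 → ℂ} {n : ℕ} {k : ℝ} (hu : Integrable (fun x => u x * ek n (k : ℂ) x))
    (hv : Integrable (fun x => v x * ek n (k : ℂ) x)) :
    pe n k (fun x => u x + v x) = pe n k u + pe n k v := by
  simp only [pe, add_mul]; exact integral_add hu hv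

lemma pe_sub {u v : E3 → ℂ} {n : ℕ} {k : ℝ} (hu : Integrable (fun x => u x * ek n (k : ℂ) x))
    (hv : Integrable (fun x => v x * ek n (k : ℂ) x)) :
    pe n k (fun x => u x - v x) = pe n k u - pe n k v := by
  simp only [pe, sub_mul]; exact integral_sub hu hv

lemma pe_ek (n m : ℕ) {k l : ℝ} (hk : 0 < k) (hl : 0 < l) :
    pe n k (ek m (l : ℂ)) = (n + m).factorial / (4 * Real.pi * (k + l) ^ (n + m + 1)) := by
  rw [pe, integral_ek_mul_ek m n (by positivity), add_comm m n, add_comm (l : ℂ)]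

/-! ### Parameters -/

/-- The part of the range of `σ` which the algebra uses. -/
def Adm (σ : ℝ) : Prop := 1 / √2 < σ ∧ σ < 1

lemma adm_of_range {σ : ℝ} (h₁ : 1 / √2 < σ) (h₂ : σ < (√3 + 1) / (2 * √2)) : Adm σ := by
  refine ⟨h₁, h₂.trans ?_⟩
  rw [div_lt_one (by positivity)]
  have h3 : √3 ^ 2 = 3 := Real.sq_sqrt (by norm_num)
  have h2 : √2 ^ 2 = 2 := Real.sq_sqrt (by norm_num)
  have p3 := Real.sqrt_nonneg 3
  have p2 := Real.sqrt_nonneg 2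
  have : √3 < 1.8 := by rw [Real.sqrt_lt' (by norm_num)]; norm_num
  have : 1.4 < √2 := by rw [Real.lt_sqrt (by norm_num)]; norm_num
  linarith

/-- `√(1 - σ²)`. -/
def cs (σ : ℝ) : ℝ := √(1 - σ ^ 2)
/-- The ratio of the two charges of `Ψ`. -/
def Cc (σ : ℝ) : ℝ := (1 + cs σ) / σ
/-- `√(ω - ξ) / √ω`. -/
def a0 (σ : ℝ) : ℝ := σ - cs σ
/-- `√(ω + ξ) / √ω`. -/
def b0 (σ : ℝ) : ℝ := σ + cs σ

namespace Adm

variable {σ : ℝ} (h : Adm σ)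
include h

lemma pos : 0 < σ := lt_trans (by positivity) h.1

lemma sq_gt : 1 / 2 < σ ^ 2 := by
  have h2 : (1 / √2) ^ 2 = 1 / 2 := by rw [div_pow, Real.sq_sqrt (by norm_num)]; norm_num
  rw [← h2]
  exact pow_lt_pow_left₀ h.1 (by positivity) (by norm_num)

lemma cs_sq : cs σ ^ 2 = 1 - σ ^ 2 := Real.sq_sqrt (by nlinarith [h.pos, h.2])

lemma cs_pos : 0 < cs σ := Real.sqrt_pos.2 (by nlinarith [h.pos, h.2])

lemma a0_pos : 0 < a0 σ := by
  have : cs σ < σ := by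
    have h1 := h.sq_gt
    have h2 := h.cs_sq
    have := h.pos
    have := h.cs_pos
    nlinarith
  unfold a0; linarith

lemma b0_pos : 0 < b0 σ := add_pos h.pos h.cs_pos

lemma Cc_pos : 0 < Cc σ := div_pos (by linarith [h.cs_pos]) h.pos

lemma Cc_mul : Cc σ * σ = 1 + cs σ := div_mul_cancel₀ _ h.pos.ne'

lemma one_lt_Cc : 1 < Cc σ := by
  rw [Cc, lt_div_iff₀ h.pos]; linarith [h.2, h.cs_pos]

/-- Equivalent to 1/(a0+1) = Cc/(b0+1), that is, to the orthogonality of the first component of Ψ to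
Φ. -/
lemma b0_add_one : b0 σ + 1 = Cc σ * (a0 σ + 1) := by
  have h1 := h.cs_sq
  have h2 := h.Cc_mul
  have h3 := h.pos
  apply mul_right_cancel₀ h3.ne'
  unfold a0 b0
  linear_combination (-(σ - cs σ + 1)) * h2 + h1

/-- The boundary condition of the point interaction α₁ at the origin for the first component of Ψ,
divided by √ω/(4π). The next identity, `a0_add`, is the one of α₂ for the second component. -/
lemma a0_sub : a0 σ - Cc σ * b0 σ = (2 * σ + 1) * (1 - Cc σ) := by
  have h1 := h.cs_sq
  have h2 := h.Cc_mul
  have h3 := h.pos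
  apply mul_right_cancel₀ h3.ne'
  unfold a0 b0
  linear_combination (-(σ + cs σ) + (2 * σ + 1)) * h2 - h1

lemma a0_add : a0 σ + Cc σ * b0 σ = 1 + Cc σ := by
  have h1 := h.cs_sq
  have h2 := h.Cc_mul
  have h3 := h.pos
  apply mul_right_cancel₀ h3.ne'
  unfold a0 b0
  linear_combination ((σ + cs σ) - 1) * h2 + h1

/-- With c = √(1-σ²) one has Cc² (1 - c) = 1 + c, so the sign is that of b0 (1-c) - a0 (1+c) =
2c(1-σ), which is positive. This is what makes κ nonzero. -/
lemma kappa0_pos : 0 < 1 / a0 σ - Cc σ ^ 2 / b0 σ := by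
  have h1 := h.cs_sq
  have h3 := h.pos
  have h4 := h.a0_pos
  have h5 := h.b0_pos
  have h6 := h.cs_pos
  rw [sub_pos, div_lt_div_iff₀ h5 h4, one_mul]
  have h7 : Cc σ ^ 2 * (1 - cs σ) = 1 + cs σ := by
    have : Cc σ ^ 2 * σ ^ 2 = (1 + cs σ) ^ 2 := by rw [← mul_pow, h.Cc_mul]
    have h8 : (1 + cs σ) ≠ 0 := by linarith
    apply mul_right_cancel₀ h8
    nlinarith
  have h9 : cs σ < 1 := by nlinarith
  have h10 : 0 < 1 - cs σ := by linarith
  have : Cc σ ^ 2 * a0 σ * (1 - cs σ) < b0 σ * (1 - cs σ) := by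
    have e1 : Cc σ ^ 2 * a0 σ * (1 - cs σ) = (1 + cs σ) * a0 σ := by rw [← h7]; ring
    rw [e1]; unfold a0 b0
    nlinarith [h.2, mul_pos h6 (sub_pos.2 h.2)]
  exact lt_of_mul_lt_mul_right this h10.le

end Adm

variable {σ ν ω : ℝ}

/-- Here ω - ξ is ω times a perfect square because σ² + (1-σ²) = 1. The bound σ > 1/√2 makes a0
positive and thus selects the root. Consequently every decay rate is a fixed multiple of √ω. -/
lemma sqrt_sub_xi (h : Adm σ) (hω : 0 < ω) : √(ω - xi σ ω) = a0 σ * √ω := by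
  have e : ω - xi σ ω = (a0 σ * √ω) ^ 2 := by
    rw [mul_pow, Real.sq_sqrt hω.le]
    have h1 := h.cs_sq
    change ω - 2 * σ * cs σ * ω = _
    unfold a0
    linear_combination (-ω) * h1
  rw [e, Real.sqrt_sq (mul_nonneg h.a0_pos.le (Real.sqrt_nonneg _))]

lemma sqrt_add_xi (h : Adm σ) (hω : 0 < ω) : √(ω + xi σ ω) = b0 σ * √ω := by
  have e : ω + xi σ ω = (b0 σ * √ω) ^ 2 := by
    rw [mul_pow, Real.sq_sqrt hω.le]
    have h1 := h.cs_sq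
    change ω + 2 * σ * cs σ * ω = _
    unfold b0
    linear_combination (-ω) * h1
  rw [e, Real.sqrt_sq (mul_nonneg h.b0_pos.le (Real.sqrt_nonneg _))]

lemma xi_pos (h : Adm σ) (hω : 0 < ω) : 0 < xi σ ω := by
  have := h.pos; have := h.cs_pos
  change 0 < 2 * σ * cs σ * ω
  positivity

lemma qSol_pos (hν : 0 < ν) (hω : 0 < ω) : 0 < qSol σ ν ω := by
  have := Real.pi_pos
  unfold qSol; positivity

lemma qSol_pow (h : Adm σ) (hν : 0 < ν) (hω : 0 < ω) :
    ν * qSol σ ν ω ^ (2 * σ) = √ω / (4 * Real.pi) := by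
  have := Real.pi_pos; have := h.pos
  have h0 : 0 ≤ √ω / (4 * Real.pi * ν) := by positivity
  rw [qSol, ← Real.rpow_mul h0, one_div_mul_cancel (by positivity), Real.rpow_one]
  field_simp

lemma hasDerivAt_sqrt' (hω : 0 < ω) : HasDerivAt Real.sqrt (1 / (2 * √ω)) ω :=
  Real.hasDerivAt_sqrt hω.ne'

lemma hasDerivAt_qSol (h : Adm σ) (hν : 0 < ν) (hω : 0 < ω) :
    HasDerivAt (qSol σ ν) (qSol σ ν ω / (4 * σ * ω)) ω := by
  have hpi := Real.pi_pos
  have hσ := h.pos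
  have hs : 0 < √ω := Real.sqrt_pos.2 hω
  have h0 : 0 < √ω / (4 * Real.pi * ν) := by positivity
  have h1 := ((hasDerivAt_sqrt' hω).div_const (4 * Real.pi * ν)).rpow_const (p := 1 / (2 * σ)) (Or.inl h0.ne')
  refine h1.congr_deriv ?_
  rw [Real.rpow_sub_one h0.ne', qSol]
  have h2 : √ω * √ω = ω := Real.mul_self_sqrt hω.le
  field_simp
  rw [show √ω ^ 2 = ω by rw [sq, h2]]
  field_simp
  ring

/-! ### The fields in terms of profiles -/

/-- The derivative of `√ω`-scaled profiles. -/
lemma hasDerivAt_ek_sqrt (n : ℕ) (c : ℝ) (hω : 0 < ω) (x : E3) :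
    HasDerivAt (fun s : ℝ => ek n ((c * √s : ℝ) : ℂ) x)
      (-(c / (2 * √ω) : ℝ) * ek (n + 1) ((c * √ω : ℝ) : ℂ) x) ω := by
  have h1 : HasDerivAt (fun s : ℝ => -((c * √s : ℝ) : ℂ) * (‖x‖ : ℂ))
      (-((c * (1 / (2 * √ω)) : ℝ) : ℂ) * (‖x‖ : ℂ)) ω :=
    ((((hasDerivAt_sqrt' hω).const_mul c).ofReal_comp).neg).mul_const _
  have h2 := (h1.cexp.const_mul ((‖x‖ : ℂ) ^ n)).div_const (4 * Real.pi * ‖x‖)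
  refine h2.congr_deriv ?_
  simp only [ek]
  push_cast
  ring

lemma Phi_eq (x : E3) : Phi σ ν ω x = ![(qSol σ ν ω : ℂ) * ek 0 ((√ω : ℝ) : ℂ) x, 0] := by
  simp [Phi, Gk_eq]

lemma dPhi_eq (h : Adm σ) (hν : 0 < ν) (hω : 0 < ω) (x : E3) :
    dPhi σ ν ω x = ![((qSol σ ν ω / (4 * σ * ω) : ℝ) : ℂ) * ek 0 ((√ω : ℝ) : ℂ) x
      - ((qSol σ ν ω / (2 * √ω) : ℝ) : ℂ) * ek 1 ((√ω : ℝ) : ℂ) x, 0] := by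
  refine HasDerivAt.deriv ?_
  rw [hasDerivAt_pi]
  intro i
  fin_cases i
  · have h1 := hasDerivAt_ek_sqrt 0 1 hω x
    simp only [one_mul] at h1
    have h2 := (hasDerivAt_qSol h hν hω).ofReal_comp.mul h1
    simp only [Phi_eq]
    refine h2.congr_deriv ?_
    simp
    ring
  · simp only [Phi_eq]
    simpa using hasDerivAt_const ω (0 : ℂ)

lemma Psi_eq (h : Adm σ) (hω : 0 < ω) (x : E3) :
    Psi σ ω x = ![ek 0 ((a0 σ * √ω : ℝ) : ℂ) x - Cc σ * ek 0 ((b0 σ * √ω : ℝ) : ℂ) x,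
      I * (ek 0 ((a0 σ * √ω : ℝ) : ℂ) x + Cc σ * ek 0 ((b0 σ * √ω : ℝ) : ℂ) x)] := by
  have e : (-(1 + √(1 - σ ^ 2)) / σ : ℝ) = -Cc σ := by unfold Cc cs; ring
  rw [Psi, sqrt_sub_xi h hω, sqrt_add_xi h hω, e, Gk_eq, Gk_eq]
  funext i
  fin_cases i
  · simp; ring
  · simp; ring

lemma PsiStar_eq (h : Adm σ) (hω : 0 < ω) (x : E3) :
    PsiStar σ ω x = ![ek 0 ((a0 σ * √ω : ℝ) : ℂ) x - Cc σ * ek 0 ((b0 σ * √ω : ℝ) : ℂ) x,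
      -I * (ek 0 ((a0 σ * √ω : ℝ) : ℂ) x + Cc σ * ek 0 ((b0 σ * √ω : ℝ) : ℂ) x)] := by
  rw [PsiStar, Psi_eq h hω]
  simp

lemma dPsiStar_eq (h : Adm σ) (hω : 0 < ω) (x : E3) :
    dPsiStar σ ω x =
      ![-((a0 σ / (2 * √ω) : ℝ) : ℂ) * ek 1 ((a0 σ * √ω : ℝ) : ℂ) x
          - Cc σ * (-((b0 σ / (2 * √ω) : ℝ) : ℂ) * ek 1 ((b0 σ * √ω : ℝ) : ℂ) x),
        -I * (-((a0 σ / (2 * √ω) : ℝ) : ℂ) * ek 1 ((a0 σ * √ω : ℝ) : ℂ) x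
          + Cc σ * (-((b0 σ / (2 * √ω) : ℝ) : ℂ) * ek 1 ((b0 σ * √ω : ℝ) : ℂ) x))] := by
  refine HasDerivAt.deriv ?_
  have hev : (fun s : ℝ => PsiStar σ s x) =ᶠ[𝓝 ω] fun s =>
      ![ek 0 ((a0 σ * √s : ℝ) : ℂ) x - Cc σ * ek 0 ((b0 σ * √s : ℝ) : ℂ) x,
      -I * (ek 0 ((a0 σ * √s : ℝ) : ℂ) x + Cc σ * ek 0 ((b0 σ * √s : ℝ) : ℂ) x)] := by
    filter_upwards [lt_mem_nhds hω] with s hs using PsiStar_eq h hs x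
  refine HasDerivAt.congr_of_eventuallyEq ?_ hev
  rw [hasDerivAt_pi]
  have ha := hasDerivAt_ek_sqrt 0 (a0 σ) hω x
  have hb := hasDerivAt_ek_sqrt 0 (b0 σ) hω x
  intro i
  fin_cases i
  · exact ha.sub (hb.const_mul _)
  · exact (ha.add (hb.const_mul _)).const_mul _

/-! ### The symplectic form against the basic fields -/

variable {f : Field2}

lemma Om_JPhi : Om f (fun y => J (Phi σ ν ω y)) = -(qSol σ ν ω * pe 0 √ω (fun x => f x 0)) := by
  simp only [Om, Phi_eq, pe]
  rw [← integral_const_mul, ← integral_neg]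
  congr 1; funext x
  simp [dot, J]; ring

lemma Om_dPhi (h : Adm σ) (hν : 0 < ν) (hω : 0 < ω) (hf : Pairable f) :
    Om f (dPhi σ ν ω) = ((qSol σ ν ω / (4 * σ * ω) : ℝ) : ℂ) * pe 0 √ω (fun x => f x 1)
      - ((qSol σ ν ω / (2 * √ω) : ℝ) : ℂ) * pe 1 √ω (fun x => f x 1) := by
  have hs : 0 < √ω := Real.sqrt_pos.2 hω
  simp only [Om, dPhi_eq h hν hω, pe]
  rw [← integral_const_mul, ← integral_const_mul, ← integral_sub ((hf 1 0 _ hs).const_mul _)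
    ((hf 1 1 _ hs).const_mul _)]
  congr 1; funext x
  simp [dot, J]; ring

/-- The pairing of `f` with the field `(A - C B, -i (A + C B))` built from two profiles. -/
lemma Om_star_form (hf : Pairable f) (n : ℕ) {a b : ℝ} (ha : 0 < a) (hb : 0 < b) (p q s : ℂ) :
    Om f (fun x => ![p * ek n (a : ℂ) x - q * ek n (b : ℂ) x,
        s * (p * ek n (a : ℂ) x + q * ek n (b : ℂ) x)])
      = -s * (p * pe n a (fun x => f x 0) + q * pe n b (fun x => f x 0))
        + (p * pe n a (fun x => f x 1) - q * pe n b (fun x => f x 1)) := by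
  have i1 := (hf 0 n a ha).const_mul (-s * p)
  have i2 := (hf 0 n b hb).const_mul (-s * q)
  have i3 := (hf 1 n a ha).const_mul p
  have i4 := (hf 1 n b hb).const_mul (-q)
  simp only [Om]
  have e : ∀ x, dot (f x) (J ![p * ek n (a : ℂ) x - q * ek n (b : ℂ) x,
        s * (p * ek n (a : ℂ) x + q * ek n (b : ℂ) x)])
      = (-s * p * (f x 0 * ek n (a : ℂ) x) + -s * q * (f x 0 * ek n (b : ℂ) x))
        + (p * (f x 1 * ek n (a : ℂ) x) + -q * (f x 1 * ek n (b : ℂ) x)) := by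
    intro x; simp [dot, J]; ring
  simp only [e]
  have i12 : Integrable (fun x => -s * p * (f x 0 * ek n (a : ℂ) x) + -s * q * (f x 0 * ek n (b : ℂ) x)) :=
    i1.add i2
  have i34 : Integrable (fun x => p * (f x 1 * ek n (a : ℂ) x) + -q * (f x 1 * ek n (b : ℂ) x)) := i3.add i4
  rw [integral_add i12 i34, integral_add i1 i2, integral_add i3 i4]
  simp only [integral_const_mul, pe]
  ring

lemma Om_PsiStar (h : Adm σ) (hω : 0 < ω) (hf : Pairable f) :
    Om f (PsiStar σ ω) = I * (pe 0 (a0 σ * √ω) (fun x => f x 0) + Cc σ * pe 0 (b0 σ * √ω) (fun x => f x 0))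
      + (pe 0 (a0 σ * √ω) (fun x => f x 1) - Cc σ * pe 0 (b0 σ * √ω) (fun x => f x 1)) := by
  have hs : 0 < √ω := Real.sqrt_pos.2 hω
  have := Om_star_form hf 0 (mul_pos h.a0_pos hs) (mul_pos h.b0_pos hs) 1 (Cc σ) (-I)
  simp only [one_mul, neg_neg] at this
  rw [← this]
  congr 1; funext x
  rw [PsiStar_eq h hω]

lemma Om_Psi (h : Adm σ) (hω : 0 < ω) (hf : Pairable f) :
    Om f (Psi σ ω) = -I * (pe 0 (a0 σ * √ω) (fun x => f x 0) + Cc σ * pe 0 (b0 σ * √ω) (fun x => f x 0))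
      + (pe 0 (a0 σ * √ω) (fun x => f x 1) - Cc σ * pe 0 (b0 σ * √ω) (fun x => f x 1)) := by
  have hs : 0 < √ω := Real.sqrt_pos.2 hω
  have := Om_star_form hf 0 (mul_pos h.a0_pos hs) (mul_pos h.b0_pos hs) 1 (Cc σ) I
  simp only [one_mul] at this
  rw [← this]
  congr 1; funext x
  rw [Psi_eq h hω]

lemma Om_dPsiStar (h : Adm σ) (hω : 0 < ω) (hf : Pairable f) :
    Om f (dPsiStar σ ω) =
      I * (-((a0 σ / (2 * √ω) : ℝ) : ℂ) * pe 1 (a0 σ * √ω) (fun x => f x 0)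
        + Cc σ * -((b0 σ / (2 * √ω) : ℝ) : ℂ) * pe 1 (b0 σ * √ω) (fun x => f x 0))
      + (-((a0 σ / (2 * √ω) : ℝ) : ℂ) * pe 1 (a0 σ * √ω) (fun x => f x 1)
        - Cc σ * -((b0 σ / (2 * √ω) : ℝ) : ℂ) * pe 1 (b0 σ * √ω) (fun x => f x 1)) := by
  have hs : 0 < √ω := Real.sqrt_pos.2 hω
  have := Om_star_form hf 1 (mul_pos h.a0_pos hs) (mul_pos h.b0_pos hs)
    (-((a0 σ / (2 * √ω) : ℝ) : ℂ)) (Cc σ * -((b0 σ / (2 * √ω) : ℝ) : ℂ)) (-I)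
  simp only [neg_neg] at this
  rw [← this]
  congr 1; funext x
  rw [dPsiStar_eq h hω]
  simp only [mul_assoc]

end ConcNLS
end

noncomputable section

namespace ConcNLS

open MeasureTheory Complex ComplexConjugate Set Filter Topology

variable {σ ν ω : ℝ}

/-! ### Pairings of the basic fields -/

lemma integrable_ek_mul (n m : ℕ) {k l : ℝ} (hk : 0 < k) (hl : 0 < l) :
    Integrable (fun x => ek m (l : ℂ) x * ek n (k : ℂ) x) :=
  ek_mul_ek_integrable m n (by simp; positivity)

lemma pairable_JPhi (hω : 0 < ω) : Pairable (fun x => J (Phi σ ν ω x)) := by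
  have hs : 0 < √ω := Real.sqrt_pos.2 hω
  intro i n k hk
  fin_cases i
  · simp [Phi_eq, J]
  · refine ((integrable_ek_mul n 0 hk hs).const_mul (qSol σ ν ω : ℂ)).congr (ae_of_all _ fun x => ?_)
    simp [Phi_eq, J, mul_assoc]

lemma pe_JPhi_zero (n : ℕ) (k : ℝ) : pe n k (fun x => J (Phi σ ν ω x) 0) = 0 := by
  simp [pe, Phi_eq, J]

lemma pe_JPhi_one (hω : 0 < ω) (n : ℕ) {k : ℝ} (hk : 0 < k) :
    pe n k (fun x => J (Phi σ ν ω x) 1)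
      = qSol σ ν ω * (n.factorial / (4 * Real.pi * ((k + √ω : ℝ) : ℂ) ^ (n + 1))) := by
  have hs : 0 < √ω := Real.sqrt_pos.2 hω
  have : (fun x => J (Phi σ ν ω x) 1) = fun x => (qSol σ ν ω : ℂ) * ek 0 ((√ω : ℝ) : ℂ) x := by
    funext x; simp [Phi_eq, J]
  rw [this, pe_const_mul, pe_ek n 0 hk hs]
  simp

lemma pairable_dPhi (h : Adm σ) (hν : 0 < ν) (hω : 0 < ω) : Pairable (dPhi σ ν ω) := by
  have hs : 0 < √ω := Real.sqrt_pos.2 hω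
  intro i n k hk
  fin_cases i
  · refine (((integrable_ek_mul n 0 hk hs).const_mul ((qSol σ ν ω / (4 * σ * ω) : ℝ) : ℂ)).sub
      ((integrable_ek_mul n 1 hk hs).const_mul ((qSol σ ν ω / (2 * √ω) : ℝ) : ℂ))).congr
      (ae_of_all _ fun x => ?_)
    simp only [dPhi_eq h hν hω]
    simp
    ring
  · simp [dPhi_eq h hν hω]

lemma pe_dPhi_one (h : Adm σ) (hν : 0 < ν) (hω : 0 < ω) (n : ℕ) (k : ℝ) :
    pe n k (fun x => dPhi σ ν ω x 1) = 0 := by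
  simp [pe, dPhi_eq h hν hω]

lemma pe_dPhi_zero (h : Adm σ) (hν : 0 < ν) (hω : 0 < ω) (n : ℕ) {k : ℝ} (hk : 0 < k) :
    pe n k (fun x => dPhi σ ν ω x 0)
      = ((qSol σ ν ω / (4 * σ * ω) : ℝ) : ℂ) * (n.factorial / (4 * Real.pi * ((k + √ω : ℝ) : ℂ) ^ (n + 1)))
        - ((qSol σ ν ω / (2 * √ω) : ℝ) : ℂ)
          * ((n + 1).factorial / (4 * Real.pi * ((k + √ω : ℝ) : ℂ) ^ (n + 2))) := by
  have hs : 0 < √ω := Real.sqrt_pos.2 hω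
  have e : (fun x => dPhi σ ν ω x 0) = fun x => ((qSol σ ν ω / (4 * σ * ω) : ℝ) : ℂ) * ek 0 ((√ω : ℝ) : ℂ) x
      - ((qSol σ ν ω / (2 * √ω) : ℝ) : ℂ) * ek 1 ((√ω : ℝ) : ℂ) x := by
    funext x; simp [dPhi_eq h hν hω]
  rw [e, pe_sub, pe_const_mul, pe_const_mul, pe_ek n 0 hk hs, pe_ek n 1 hk hs]
  · simp
  · simpa [mul_assoc] using (integrable_ek_mul n 0 hk hs).const_mul ((qSol σ ν ω / (4 * σ * ω) : ℝ) : ℂ)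
  · simpa [mul_assoc] using (integrable_ek_mul n 1 hk hs).const_mul ((qSol σ ν ω / (2 * √ω) : ℝ) : ℂ)

lemma pe_combo (n m : ℕ) {k a b : ℝ} (hk : 0 < k) (ha : 0 < a) (hb : 0 < b) (c d : ℂ) :
    pe n k (fun x => c * ek m (a : ℂ) x + d * ek m (b : ℂ) x)
      = (n + m).factorial / (4 * Real.pi) * (c / ((k + a : ℝ) : ℂ) ^ (n + m + 1)
        + d / ((k + b : ℝ) : ℂ) ^ (n + m + 1)) := by
  rw [pe_add, pe_const_mul, pe_const_mul, pe_ek n m hk ha, pe_ek n m hk hb]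
  · have hpi : (Real.pi : ℂ) ≠ 0 := by exact_mod_cast Real.pi_ne_zero
    push_cast
    field_simp
  · simpa [mul_assoc] using (integrable_ek_mul n m hk ha).const_mul c
  · simpa [mul_assoc] using (integrable_ek_mul n m hk hb).const_mul d

lemma pe_Psi_zero (h : Adm σ) (hω : 0 < ω) (n : ℕ) {k : ℝ} (hk : 0 < k) :
    pe n k (fun x => Psi σ ω x 0) = n.factorial / (4 * Real.pi)
      * (1 / ((k + a0 σ * √ω : ℝ) : ℂ) ^ (n + 1) - Cc σ / ((k + b0 σ * √ω : ℝ) : ℂ) ^ (n + 1)) := by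
  have hs : 0 < √ω := Real.sqrt_pos.2 hω
  have := pe_combo n 0 hk (mul_pos h.a0_pos hs) (mul_pos h.b0_pos hs) 1 (-(Cc σ : ℂ))
  rw [add_zero] at this
  rw [neg_div, ← sub_eq_add_neg] at this
  rw [← this]
  congr 1; funext x
  rw [Psi_eq h hω]; simp; ring

lemma pe_Psi_one (h : Adm σ) (hω : 0 < ω) (n : ℕ) {k : ℝ} (hk : 0 < k) :
    pe n k (fun x => Psi σ ω x 1) = I * (n.factorial / (4 * Real.pi)
      * (1 / ((k + a0 σ * √ω : ℝ) : ℂ) ^ (n + 1) + Cc σ / ((k + b0 σ * √ω : ℝ) : ℂ) ^ (n + 1))) := by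
  have hs : 0 < √ω := Real.sqrt_pos.2 hω
  have := pe_combo n 0 hk (mul_pos h.a0_pos hs) (mul_pos h.b0_pos hs) 1 (Cc σ : ℂ)
  rw [add_zero] at this
  rw [← this, ← pe_const_mul]
  congr 1; funext x
  rw [Psi_eq h hω]; simp

lemma pairable_Psi (h : Adm σ) (hω : 0 < ω) : Pairable (Psi σ ω) := by
  have hs : 0 < √ω := Real.sqrt_pos.2 hω
  intro i n k hk
  have i1 := integrable_ek_mul n 0 hk (mul_pos h.a0_pos hs)
  have i2 := (integrable_ek_mul n 0 hk (mul_pos h.b0_pos hs)).const_mul (Cc σ : ℂ)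
  fin_cases i
  · refine (i1.sub i2).congr (ae_of_all _ fun x => ?_)
    simp only [Psi_eq h hω]; simp; ring
  · refine ((i1.add i2).const_mul I).congr (ae_of_all _ fun x => ?_)
    simp only [Psi_eq h hω]; simp; ring

lemma PsiStar_eq_cj (h : Adm σ) (hω : 0 < ω) (x : E3) : PsiStar σ ω x = cj (Psi σ ω x) := by
  rw [PsiStar_eq h hω, Psi_eq h hω]
  funext i
  fin_cases i <;> simp only [cj, Fin.zero_eta, Fin.mk_one, Matrix.cons_val_zero, Matrix.cons_val_one,
    map_sub, map_add, map_mul, conj_ek_real, conj_ofReal, conj_I]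

lemma pe_PsiStar_zero (n : ℕ) {k : ℝ} :
    pe n k (fun x => PsiStar σ ω x 0) = pe n k (fun x => Psi σ ω x 0) := by
  simp [PsiStar]

lemma pe_PsiStar_one (n : ℕ) {k : ℝ} :
    pe n k (fun x => PsiStar σ ω x 1) = -pe n k (fun x => Psi σ ω x 1) := by
  have := pe_const_mul n k (-1) (fun x => Psi σ ω x 1)
  simpa [PsiStar] using this

lemma pairable_PsiStar (h : Adm σ) (hω : 0 < ω) : Pairable (PsiStar σ ω) := by
  intro i n k hk
  have := pairable_Psi h hω i n k hk
  fin_cases i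
  · simpa [PsiStar] using this
  · simpa [PsiStar] using this.neg

/-! ### Closed forms of `κ` and `Δ` -/

lemma sqrt_ne (hω : 0 < ω) : ((√ω : ℝ) : ℂ) ≠ 0 := by exact_mod_cast (Real.sqrt_pos.2 hω).ne'

lemma pi_ne : (Real.pi : ℂ) ≠ 0 := by exact_mod_cast Real.pi_ne_zero

lemma kappa_eq (h : Adm σ) (hω : 0 < ω) :
    kappa σ ω = I * (((1 / a0 σ - Cc σ ^ 2 / b0 σ) / (4 * Real.pi * √ω) : ℝ) : ℂ) := by
  have hs : 0 < √ω := Real.sqrt_pos.2 hω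
  have ha := h.a0_pos
  have hb := h.b0_pos
  rw [kappa, Om_PsiStar h hω (pairable_Psi h hω), pe_Psi_zero h hω 0 (mul_pos ha hs),
    pe_Psi_zero h hω 0 (mul_pos hb hs), pe_Psi_one h hω 0 (mul_pos ha hs), pe_Psi_one h hω 0 (mul_pos hb hs)]
  have e1 : ((a0 σ : ℝ) : ℂ) ≠ 0 := by exact_mod_cast ha.ne'
  have e2 : ((b0 σ : ℝ) : ℂ) ≠ 0 := by exact_mod_cast hb.ne'
  have e3 : (a0 σ : ℂ) + b0 σ ≠ 0 := by exact_mod_cast (add_pos ha hb).ne'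
  have e4 : (a0 σ : ℂ) * √ω + b0 σ * √ω ≠ 0 := by rw [← add_mul]; exact mul_ne_zero e3 (sqrt_ne hω)
  have e5 : (b0 σ : ℂ) * √ω + a0 σ * √ω ≠ 0 := by rw [add_comm]; exact e4
  have e6 := sqrt_ne hω
  have e7 := pi_ne
  have e8 : (a0 σ : ℂ) * √ω + a0 σ * √ω ≠ 0 := by rw [← two_mul]; simp [e1, e6]
  have e9 : (b0 σ : ℂ) * √ω + b0 σ * √ω ≠ 0 := by rw [← two_mul]; simp [e2, e6]
  have f1 : 1 / ((a0 σ : ℂ) * √ω + a0 σ * √ω) = 1 / (2 * a0 σ * √ω) := by congr 1; ring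
  have f2 : (Cc σ : ℂ) / ((b0 σ : ℂ) * √ω + b0 σ * √ω) = Cc σ / (2 * b0 σ * √ω) := by congr 1; ring
  have f3 : (1 : ℂ) / ((b0 σ : ℂ) * √ω + a0 σ * √ω) = 1 / ((a0 σ : ℂ) * √ω + b0 σ * √ω) := by rw [add_comm]
  push_cast
  simp only [pow_one, Nat.factorial_zero, Nat.cast_one]
  rw [f1, f2, f3]
  -- X is the mixed integral of the two profiles of Ψ. It occurs with opposite signs and cancels.
  generalize (1 : ℂ) / ((a0 σ : ℂ) * √ω + b0 σ * √ω) = X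
  field_simp
  ring

lemma kappa_ne (h : Adm σ) (hω : 0 < ω) : kappa σ ω ≠ 0 := by
  rw [kappa_eq h hω]
  have hs : 0 < √ω := Real.sqrt_pos.2 hω
  have := h.kappa0_pos
  have hpi := Real.pi_pos
  refine mul_ne_zero I_ne_zero ?_
  exact_mod_cast (by positivity : (1 / a0 σ - Cc σ ^ 2 / b0 σ) / (4 * Real.pi * √ω) ≠ 0)

lemma conj_kappa (h : Adm σ) (hω : 0 < ω) : conj (kappa σ ω) = -kappa σ ω := by
  rw [kappa_eq h hω, map_mul, conj_I, conj_ofReal]; ring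

lemma norm_sq_Phi (hω : 0 < ω) :
    ∫ x, ‖Phi σ ν ω x 0‖ ^ 2 = qSol σ ν ω ^ 2 / (8 * Real.pi * √ω) := by
  have hs : 0 < √ω := Real.sqrt_pos.2 hω
  have h1 : ((∫ x, ‖Phi σ ν ω x 0‖ ^ 2 : ℝ) : ℂ) = (qSol σ ν ω : ℂ) ^ 2 * pe 0 √ω (ek 0 ((√ω : ℝ) : ℂ)) := by
    rw [← integral_complex_ofReal, pe, ← integral_const_mul]
    congr 1; funext x
    rw [Phi_eq]
    simp only [Matrix.cons_val_zero, norm_mul, norm_real, ofReal_pow, ofReal_mul, mul_pow]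
    rw [norm_ek_eq_er, ofReal_re, ofReal_er, Real.norm_eq_abs, ← ofReal_pow, sq_abs]
    push_cast; ring
  rw [pe_ek 0 0 hs hs] at h1
  have h2 : ((∫ x, ‖Phi σ ν ω x 0‖ ^ 2 : ℝ) : ℂ) = ((qSol σ ν ω ^ 2 / (8 * Real.pi * √ω) : ℝ) : ℂ) := by
    rw [h1]
    have e6 := sqrt_ne hω
    have e7 := pi_ne
    push_cast
    simp only [Nat.factorial]
    rw [← two_mul]
    field_simp
    norm_num
    ring
  exact_mod_cast h2

lemma Delta_eq (h : Adm σ) (hν : 0 < ν) (hω : 0 < ω) :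
    Delta σ ν ω = qSol σ ν ω ^ 2 / (32 * Real.pi * √ω ^ 3) * (1 / σ - 1) := by
  have hs : 0 < √ω := Real.sqrt_pos.2 hω
  have hσ := h.pos
  have hpi := Real.pi_pos
  have hev : (fun s : ℝ => (1 / 2) * ∫ x, ‖Phi σ ν s x 0‖ ^ 2) =ᶠ[𝓝 ω]
      fun s => (1 / 2) * (qSol σ ν s ^ 2 / (8 * Real.pi * √s)) := by
    filter_upwards [lt_mem_nhds hω] with s hs
    rw [norm_sq_Phi hs]
  rw [Delta, hev.deriv_eq]
  have hd := ((((hasDerivAt_qSol h hν hω).pow 2).div ((hasDerivAt_sqrt' hω).const_mul (8 * Real.pi))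
    (by positivity)).const_mul (1 / 2 : ℝ)).deriv
  refine Eq.trans hd ?_
  have h2 : ω = √ω ^ 2 := (Real.sq_sqrt hω.le).symm
  rw [show qSol σ ν ω / (4 * σ * ω) = qSol σ ν ω / (4 * σ * √ω ^ 2) by rw [← h2]]
  simp
  field_simp
  ring

/-- The bound σ < 1 is the slope condition: the mass of the standing wave increases with ω. -/
lemma Delta_pos (h : Adm σ) (hν : 0 < ν) (hω : 0 < ω) : 0 < Delta σ ν ω := by
  rw [Delta_eq h hν hω]
  have hs : 0 < √ω := Real.sqrt_pos.2 hω
  have hpi := Real.pi_pos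
  have hQ := qSol_pos (σ := σ) hν hω
  have : 0 < 1 / σ - 1 := by
    rw [sub_pos, lt_div_iff₀ h.pos]; linarith [h.2]
  positivity

lemma Delta_ne (h : Adm σ) (hν : 0 < ν) (hω : 0 < ω) : (Delta σ ν ω : ℂ) ≠ 0 := by
  exact_mod_cast (Delta_pos h hν hω).ne'

/-! ### Symplectic orthogonality -/

lemma dot_J_comm (p q : Fin 2 → ℂ) : dot p (J q) = -dot q (J p) := by
  simp [dot, J]; ring

lemma Om_comm (f g : Field2) : Om f g = -Om g f := by
  simp only [Om]
  rw [← integral_neg]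
  congr 1; funext x
  exact dot_J_comm _ _

lemma Om_self (f : Field2) : Om f f = 0 := by
  have := Om_comm f f
  linear_combination (1 / 2 : ℂ) * this

lemma Om_JPhi_dPhi (h : Adm σ) (hν : 0 < ν) (hω : 0 < ω) :
    Om (fun y => J (Phi σ ν ω y)) (dPhi σ ν ω) = Delta σ ν ω := by
  have hs : 0 < √ω := Real.sqrt_pos.2 hω
  have hσ : (σ : ℂ) ≠ 0 := by exact_mod_cast h.pos.ne'
  rw [Om_dPhi h hν hω (pairable_JPhi hω), pe_JPhi_one hω 0 hs, pe_JPhi_one hω 1 hs, Delta_eq h hν hω]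
  have e6 := sqrt_ne hω
  have e7 := pi_ne
  have h2 : ω = √ω ^ 2 := (Real.sq_sqrt hω.le).symm
  rw [show qSol σ ν ω / (4 * σ * ω) = qSol σ ν ω / (4 * σ * √ω ^ 2) by rw [← h2]]
  push_cast
  simp only [Nat.factorial]
  rw [← two_mul]
  field_simp
  push_cast
  ring

lemma b_add (h : Adm σ) : b0 σ * √ω + √ω = Cc σ * (a0 σ * √ω + √ω) := by
  have := h.b0_add_one
  linear_combination √ω * this

lemma inv_b_add (h : Adm σ) (hω : 0 < ω) :
    1 / (a0 σ * √ω + √ω) = Cc σ / (b0 σ * √ω + √ω) := by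
  have hs : 0 < √ω := Real.sqrt_pos.2 hω
  have := h.Cc_pos
  have := h.a0_pos
  rw [b_add h]
  field_simp

/-- Skew orthogonality of spectral subspaces for different eigenvalues, checked on the explicit
profiles through `inv_b_add`; for dΦ/dω the same role is played by `pe_dPhi_combo`. -/
lemma Om_JPhi_Psi' (h : Adm σ) (hω : 0 < ω) :
    Om (fun y => J (Phi σ ν ω y)) (PsiStar σ ω) = 0 ∧ Om (fun y => J (Phi σ ν ω y)) (Psi σ ω) = 0 := by
  have hs : 0 < √ω := Real.sqrt_pos.2 hω
  have ha := mul_pos h.a0_pos hs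
  have hb := mul_pos h.b0_pos hs
  have hc : (1 : ℂ) / ((a0 σ * √ω + √ω : ℝ) : ℂ) = Cc σ / ((b0 σ * √ω + √ω : ℝ) : ℂ) := by
    exact_mod_cast inv_b_add h hω
  rw [Om_PsiStar h hω (pairable_JPhi hω), Om_Psi h hω (pairable_JPhi hω)]
  simp only [pe_JPhi_zero, pe_JPhi_one hω 0 ha, pe_JPhi_one hω 0 hb]
  constructor <;>
  · simp only [Nat.factorial_zero, Nat.cast_one, zero_add, pow_one, mul_zero, add_zero]
    have : (qSol σ ν ω : ℂ) / (4 * Real.pi) * (1 / ((a0 σ * √ω + √ω : ℝ) : ℂ)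
      - Cc σ / ((b0 σ * √ω + √ω : ℝ) : ℂ)) = 0 := by rw [hc, sub_self, mul_zero]
    rw [← this]
    field_simp

lemma pe_dPhi_combo (h : Adm σ) (hν : 0 < ν) (hω : 0 < ω) :
    pe 0 (a0 σ * √ω) (fun x => dPhi σ ν ω x 0) + Cc σ * pe 0 (b0 σ * √ω) (fun x => dPhi σ ν ω x 0) = 0 := by
  have hs : 0 < √ω := Real.sqrt_pos.2 hω
  have ha := mul_pos h.a0_pos hs
  have hb := mul_pos h.b0_pos hs
  have hC := h.Cc_pos
  rw [pe_dPhi_zero h hν hω 0 ha, pe_dPhi_zero h hν hω 0 hb, b_add h]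
  have hσ : (σ : ℂ) ≠ 0 := by exact_mod_cast h.pos.ne'
  have hC' : (Cc σ : ℂ) ≠ 0 := by exact_mod_cast hC.ne'
  have e6 := sqrt_ne hω
  have e7 := pi_ne
  have e8 : (a0 σ : ℂ) + 1 ≠ 0 := by exact_mod_cast (by linarith [h.a0_pos] : a0 σ + 1 ≠ 0)
  have h2 : ω = √ω ^ 2 := (Real.sq_sqrt hω.le).symm
  rw [show qSol σ ν ω / (4 * σ * ω) = qSol σ ν ω / (4 * σ * √ω ^ 2) by rw [← h2]]
  have e9 : a0 σ * √ω + √ω = (a0 σ + 1) * √ω := by ring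
  rw [e9]
  -- Both sides equal σ + √(1-σ²) + 1.
  have key : (Cc σ : ℂ) * (a0 σ + 1) = σ * (1 + Cc σ) := by
    have h1 := h.Cc_mul
    have h3 := h.b0_add_one
    have : Cc σ * (a0 σ + 1) = σ * (1 + Cc σ) := by
      rw [← h3]; unfold b0; linarith
    exact_mod_cast this
  push_cast
  simp only [Nat.factorial]
  field_simp
  push_cast
  linear_combination 4 * (qSol σ ν ω : ℂ) * key

lemma Om_dPhi_Psi' (h : Adm σ) (hν : 0 < ν) (hω : 0 < ω) :
    Om (dPhi σ ν ω) (PsiStar σ ω) = 0 ∧ Om (dPhi σ ν ω) (Psi σ ω) = 0 := by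
  rw [Om_PsiStar h hω (pairable_dPhi h hν hω), Om_Psi h hω (pairable_dPhi h hν hω)]
  simp [pe_dPhi_one h hν hω, pe_dPhi_combo h hν hω]

/-! ### Linearity and idempotency of the projections -/

/-- `Om · V` is linear on pairable fields. -/
def LinOm (V : Field2) : Prop :=
  ∀ f g : Field2, Pairable f → Pairable g → ∀ c : ℂ, Om (fun x => f x + c • g x) V = Om f V + c * Om g V

lemma Pairable.pe_add_smul {f g : Field2} (hf : Pairable f) (hg : Pairable g) (c : ℂ) (i : Fin 2) (n : ℕ)
    {k : ℝ} (hk : 0 < k) :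
    pe n k (fun x => (f x + c • g x) i) = pe n k (fun x => f x i) + c * pe n k (fun x => g x i) := by
  rw [hf.pe_add (hg.smul c) i n hk]
  congr 1
  exact pe_const_mul n k c _

lemma linOm_JPhi (hω : 0 < ω) : LinOm (fun y => J (Phi σ ν ω y)) := by
  intro f g hf hg c
  have hs : 0 < √ω := Real.sqrt_pos.2 hω
  simp only [Om_JPhi]
  rw [hf.pe_add_smul hg c 0 0 hs]; ring

lemma linOm_dPhi (h : Adm σ) (hν : 0 < ν) (hω : 0 < ω) : LinOm (dPhi σ ν ω) := by
  intro f g hf hg c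
  have hs : 0 < √ω := Real.sqrt_pos.2 hω
  rw [Om_dPhi h hν hω hf, Om_dPhi h hν hω hg, Om_dPhi h hν hω (hf.add (hg.smul c)),
    hf.pe_add_smul hg c 1 0 hs, hf.pe_add_smul hg c 1 1 hs]
  ring

lemma linOm_PsiStar (h : Adm σ) (hω : 0 < ω) : LinOm (PsiStar σ ω) := by
  intro f g hf hg c
  have hs : 0 < √ω := Real.sqrt_pos.2 hω
  have ha := mul_pos h.a0_pos hs
  have hb := mul_pos h.b0_pos hs
  rw [Om_PsiStar h hω hf, Om_PsiStar h hω hg, Om_PsiStar h hω (hf.add (hg.smul c)),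
    hf.pe_add_smul hg c 0 0 ha, hf.pe_add_smul hg c 0 0 hb, hf.pe_add_smul hg c 1 0 ha,
    hf.pe_add_smul hg c 1 0 hb]
  ring

lemma linOm_Psi (h : Adm σ) (hω : 0 < ω) : LinOm (Psi σ ω) := by
  intro f g hf hg c
  have hs : 0 < √ω := Real.sqrt_pos.2 hω
  have ha := mul_pos h.a0_pos hs
  have hb := mul_pos h.b0_pos hs
  rw [Om_Psi h hω hf, Om_Psi h hω hg, Om_Psi h hω (hf.add (hg.smul c)),
    hf.pe_add_smul hg c 0 0 ha, hf.pe_add_smul hg c 0 0 hb, hf.pe_add_smul hg c 1 0 ha,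
    hf.pe_add_smul hg c 1 0 hb]
  ring

lemma Pc_apply (f : Field2) (x : E3) : Pc σ ν ω f x = f x
    + (-(Om f (dPhi σ ν ω) / Delta σ ν ω)) • J (Phi σ ν ω x)
    + (Om f (fun y => J (Phi σ ν ω y)) / Delta σ ν ω) • dPhi σ ν ω x
    + (-(Om f (PsiStar σ ω) / kappa σ ω)) • Psi σ ω x
    + (Om f (Psi σ ω) / kappa σ ω) • PsiStar σ ω x := by
  simp only [Pc, P0, P1, neg_smul]
  abel

lemma Pc_add_smul (h : Adm σ) (hν : 0 < ν) (hω : 0 < ω) {f g : Field2} (hf : Pairable f) (hg : Pairable g)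
    (c : ℂ) : Pc σ ν ω (fun x => f x + c • g x) = fun x => Pc σ ν ω f x + c • Pc σ ν ω g x := by
  funext x
  simp only [Pc_apply, linOm_JPhi (σ := σ) (ν := ν) hω f g hf hg c, linOm_dPhi h hν hω f g hf hg c,
    linOm_PsiStar h hω f g hf hg c, linOm_Psi h hω f g hf hg c]
  funext i
  simp only [Pi.add_apply, Pi.smul_apply, smul_eq_mul]
  ring

/-- The four modes form two mutually skew orthogonal planes, on which the symplectic form takes the
values Δ and κ; these are the normalizations in the projections. Idempotency then follows by
linearity. -/
lemma Pc_basis (h : Adm σ) (hν : 0 < ν) (hω : 0 < ω) :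
    Pc σ ν ω (fun x => J (Phi σ ν ω x)) = 0 ∧ Pc σ ν ω (dPhi σ ν ω) = 0 ∧
      Pc σ ν ω (Psi σ ω) = 0 ∧ Pc σ ν ω (PsiStar σ ω) = 0 := by
  have hΔ := Delta_ne h hν hω
  have hκ := kappa_ne h hω
  obtain ⟨z1, z2⟩ := Om_JPhi_Psi' (ν := ν) h hω
  obtain ⟨z3, z4⟩ := Om_dPhi_Psi' h hν hω
  have z5 := Om_JPhi_dPhi h hν hω
  have y1 : Om (PsiStar σ ω) (fun y => J (Phi σ ν ω y)) = 0 := by rw [Om_comm, z1, neg_zero]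
  have y2 : Om (Psi σ ω) (fun y => J (Phi σ ν ω y)) = 0 := by rw [Om_comm, z2, neg_zero]
  have y3 : Om (PsiStar σ ω) (dPhi σ ν ω) = 0 := by rw [Om_comm, z3, neg_zero]
  have y4 : Om (Psi σ ω) (dPhi σ ν ω) = 0 := by rw [Om_comm, z4, neg_zero]
  have y5 : Om (dPhi σ ν ω) (fun y => J (Phi σ ν ω y)) = -Delta σ ν ω := by rw [Om_comm, z5]
  have y6 : Om (Psi σ ω) (PsiStar σ ω) = kappa σ ω := rfl
  have y7 : Om (PsiStar σ ω) (Psi σ ω) = -kappa σ ω := by rw [Om_comm, y6]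
  refine ⟨?_, ?_, ?_, ?_⟩ <;>
  · funext x i
    simp [Pc_apply, z1, z2, z3, z4, z5, y1, y2, y3, y4, y5, y6, y7, Om_self, hΔ, hκ]

lemma Pc_idem (h : Adm σ) (hν : 0 < ν) (hω : 0 < ω) {f : Field2} (hf : Pairable f) :
    Pc σ ν ω (Pc σ ν ω f) = Pc σ ν ω f := by
  obtain ⟨b1, b2, b3, b4⟩ := Pc_basis h hν hω
  have e : Pc σ ν ω f = fun x => (((f x + (-(Om f (dPhi σ ν ω) / Delta σ ν ω)) • J (Phi σ ν ω x))
    + (Om f (fun y => J (Phi σ ν ω y)) / Delta σ ν ω) • dPhi σ ν ω x)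
    + (-(Om f (PsiStar σ ω) / kappa σ ω)) • Psi σ ω x)
    + (Om f (Psi σ ω) / kappa σ ω) • PsiStar σ ω x := by
    funext x; exact Pc_apply f x
  have p1 := pairable_JPhi (σ := σ) (ν := ν) hω
  have p2 := pairable_dPhi h hν hω
  have p3 := pairable_Psi h hω
  have p4 := pairable_PsiStar h hω
  have q1 := hf.add (p1.smul (-(Om f (dPhi σ ν ω) / Delta σ ν ω)))
  have q2 := q1.add (p2.smul (Om f (fun y => J (Phi σ ν ω y)) / Delta σ ν ω))
  have q3 := q2.add (p3.smul (-(Om f (PsiStar σ ω) / kappa σ ω)))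
  conv_lhs => rw [e]
  rw [Pc_add_smul h hν hω q3 p4, Pc_add_smul h hν hω q2 p3, Pc_add_smul h hν hω q1 p2,
    Pc_add_smul h hν hω hf p1, b1, b2, b3, b4]
  funext x
  simp

lemma Om_cj (f V : Field2) : Om (fun x => cj (f x)) (fun x => cj (V x)) = conj (Om f V) := by
  simp only [Om]
  rw [← integral_conj]
  congr 1; funext x
  simp [dot, J, cj]

lemma cj_cj (p : Fin 2 → ℂ) : cj (cj p) = p := by funext i; simp [cj]

/-- Φ and dΦ/dω are real, conjugation exchanges Ψ and Ψ*, and κ is purely imaginary, so the two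
terms of P¹ are exchanged with the right sign. This gives invariance of a₀₂ under the projection
from that of a₂₀. -/
lemma Pc_cj (h : Adm σ) (hν : 0 < ν) (hω : 0 < ω) (f : Field2) :
    Pc σ ν ω (fun x => cj (f x)) = fun x => cj (Pc σ ν ω f x) := by
  have c1 : ∀ x, cj (J (Phi σ ν ω x)) = J (Phi σ ν ω x) := by
    intro x; funext i
    fin_cases i
    · simp [Phi_eq, J, cj]
    · simp [Phi_eq, J, cj, conj_ek_real]
  have c2 : ∀ x, cj (dPhi σ ν ω x) = dPhi σ ν ω x := by
    intro x; funext i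
    rw [dPhi_eq h hν hω]
    fin_cases i <;> simp only [cj, Fin.zero_eta, Fin.mk_one, Matrix.cons_val_zero, Matrix.cons_val_one,
      map_sub, map_mul, conj_ek_real, conj_ofReal, map_zero]
  have c3 : ∀ x, cj (Psi σ ω x) = PsiStar σ ω x := fun x => (PsiStar_eq_cj h hω x).symm
  have c4 : ∀ x, cj (PsiStar σ ω x) = Psi σ ω x := fun x => by rw [PsiStar_eq_cj h hω, cj_cj]
  have o1 := Om_cj f (fun x => J (Phi σ ν ω x))
  have o2 := Om_cj f (dPhi σ ν ω)
  have o3 := Om_cj f (Psi σ ω)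
  have o4 := Om_cj f (PsiStar σ ω)
  simp only [c1] at o1
  simp only [c2] at o2
  simp only [c3] at o3
  simp only [c4] at o4
  have e2 : (fun x => dPhi σ ν ω x) = dPhi σ ν ω := rfl
  have e3 : (fun x => Psi σ ω x) = Psi σ ω := rfl
  have e4 : (fun x => PsiStar σ ω x) = PsiStar σ ω := rfl
  rw [e2] at o2; rw [e4] at o3; rw [e3] at o4
  funext x i
  have d1 := congrFun (c1 x) i
  have d2 := congrFun (c2 x) i
  have d3 := congrFun (c3 x) i
  have d4 := congrFun (c4 x) i
  simp only [cj] at d1 d2 d3 d4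
  rw [Pc_apply, o1, o2, o3, o4]
  simp only [cj, Pc_apply, Pi.add_apply, Pi.smul_apply, smul_eq_mul, map_add, map_mul, map_neg, map_div₀,
    d1, d2, d3, d4, conj_kappa h hω, conj_ofReal]
  ring

/-! ### Orthogonality conditions from the projections -/

/-- The projection vanishes as a function, hence at one point where both profiles are nonzero, and
the two components separate the two coefficients. -/
lemma P0_eq_zero (h : Adm σ) (hν : 0 < ν) (hω : 0 < ω) {f : Field2} (hf : P0 σ ν ω f = 0) :
    Om f (dPhi σ ν ω) = 0 ∧ Om f (fun y => J (Phi σ ν ω y)) = 0 := by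
  have hs : 0 < √ω := Real.sqrt_pos.2 hω
  have hσ := h.pos
  have hΔ := Delta_ne h hν hω
  have hQ := qSol_pos (σ := σ) hν hω
  have hpi := Real.pi_pos
  -- At this radius the second term of dΦ/dω is exactly half of the first, so the profile does not
  -- vanish.
  set r : ℝ := √ω / (4 * σ * ω) with hr
  have hr0 : 0 < r := by positivity
  set x : E3 := EuclideanSpace.single 0 r with hx
  have hxn : ‖x‖ = r := by simp [hx, abs_of_pos hr0]
  have h0 := congrFun (congrFun hf x) 0
  have h1 := congrFun (congrFun hf x) 1
  unfold P0 at h0 h1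
  generalize Om f (fun y => J (Phi σ ν ω y)) = A at h0 h1 ⊢
  generalize Om f (dPhi σ ν ω) = B at h0 h1 ⊢
  simp only [Phi_eq, dPhi_eq h hν hω, J, Pi.sub_apply, Pi.smul_apply, Pi.zero_apply, smul_eq_mul,
    Matrix.cons_val_zero, Matrix.cons_val_one, neg_zero, mul_zero, zero_sub, sub_zero] at h0 h1
  have e0 : ek 0 ((√ω : ℝ) : ℂ) x ≠ 0 := by
    rw [← norm_ne_zero_iff, norm_ek_eq_er, ofReal_re, er, hxn]; positivity
  have e1 : ((qSol σ ν ω / (4 * σ * ω) : ℝ) : ℂ) * ek 0 ((√ω : ℝ) : ℂ) x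
      - ((qSol σ ν ω / (2 * √ω) : ℝ) : ℂ) * ek 1 ((√ω : ℝ) : ℂ) x ≠ 0 := by
    rw [← ofReal_er, ← ofReal_er, ← ofReal_mul, ← ofReal_mul, ← ofReal_sub]
    have : er 1 √ω x = r * er 0 √ω x := by simp only [er, hxn]; field_simp
    rw [this]
    have hp : 0 < er 0 √ω x := by rw [er, hxn]; positivity
    have e3 : qSol σ ν ω / (4 * σ * ω) * er 0 √ω x - qSol σ ν ω / (2 * √ω) * (r * er 0 √ω x)
        = qSol σ ν ω / (8 * σ * ω) * er 0 √ω x := by rw [hr]; field_simp; ring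
    rw [e3]
    exact_mod_cast (by positivity : qSol σ ν ω / (8 * σ * ω) * er 0 √ω x ≠ 0)
  have hQ' : (qSol σ ν ω : ℂ) ≠ 0 := by exact_mod_cast hQ.ne'
  constructor
  · rcases mul_eq_zero.1 h1 with h2 | h2
    · exact (div_eq_zero_iff.1 h2).resolve_right hΔ
    · exact absurd h2 (mul_ne_zero hQ' e0)
  · rcases mul_eq_zero.1 (neg_eq_zero.1 h0) with h2 | h2
    · exact (div_eq_zero_iff.1 h2).resolve_right hΔ
    · exact absurd h2 e1

/-- Evaluated at one point where both components of Ψ are nonzero: since Ψ* differs from Ψ by a sign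
in the second component, the two components give the difference and the sum of the coefficients. -/
lemma P1_eq_zero (h : Adm σ) (hω : 0 < ω) {f : Field2} (hf : P1 σ ω f = 0) :
    Om f (PsiStar σ ω) = 0 ∧ Om f (Psi σ ω) = 0 := by
  have hs : 0 < √ω := Real.sqrt_pos.2 hω
  have hκ := kappa_ne h hω
  have hpi := Real.pi_pos
  have hC := h.one_lt_Cc
  have hab : 0 < b0 σ - a0 σ := by unfold a0 b0; linarith [h.cs_pos]
  have hlog : 0 < Real.log (Cc σ) := Real.log_pos hC
  -- With this radius the slowly decaying profile equals e · Cc times the fast one, so the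
  -- difference in the first component of Ψ is strictly positive.
  set r : ℝ := (Real.log (Cc σ) + 1) / ((b0 σ - a0 σ) * √ω) with hr
  have hr0 : 0 < r := by positivity
  set x : E3 := EuclideanSpace.single 0 r with hx
  have hxn : ‖x‖ = r := by simp [hx, abs_of_pos hr0]
  have h0 := congrFun (congrFun hf x) 0
  have h1 := congrFun (congrFun hf x) 1
  simp only [P1, PsiStar, Pi.sub_apply, Pi.smul_apply, Pi.zero_apply, smul_eq_mul,
    Matrix.cons_val_zero, Matrix.cons_val_one] at h0 h1
  have e : er 0 (a0 σ * √ω) x = Real.exp 1 * Cc σ * er 0 (b0 σ * √ω) x := by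
    simp only [er, hxn]
    have : Real.exp (-(a0 σ * √ω) * r) = Real.exp 1 * Cc σ * Real.exp (-(b0 σ * √ω) * r) := by
      have hCe : Cc σ = Real.exp (Real.log (Cc σ)) := (Real.exp_log h.Cc_pos).symm
      conv_rhs => rw [hCe]
      rw [← Real.exp_add, ← Real.exp_add]
      congr 1
      have : (b0 σ - a0 σ) * √ω * r = Real.log (Cc σ) + 1 := by rw [hr]; field_simp
      linarith
    rw [this]; ring
  have hp : 0 < er 0 (b0 σ * √ω) x := by rw [er, hxn]; positivity
  have e0 : Psi σ ω x 0 ≠ 0 := by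
    rw [Psi_eq h hω]
    simp only [Matrix.cons_val_zero]
    rw [← ofReal_er, ← ofReal_er, ← ofReal_mul, ← ofReal_sub, e]
    have h1 : 1 < Real.exp 1 := by simp
    have : 0 < (Real.exp 1 - 1) * Cc σ * er 0 (b0 σ * √ω) x := by
      have := h.Cc_pos
      have : 0 < Real.exp 1 - 1 := by linarith
      positivity
    have h3 : Real.exp 1 * Cc σ * er 0 (b0 σ * √ω) x - Cc σ * er 0 (b0 σ * √ω) x ≠ 0 := by
      have : Real.exp 1 * Cc σ * er 0 (b0 σ * √ω) x - Cc σ * er 0 (b0 σ * √ω) x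
        = (Real.exp 1 - 1) * Cc σ * er 0 (b0 σ * √ω) x := by ring
      rw [this]; positivity
    exact_mod_cast h3
  have e1 : Psi σ ω x 1 ≠ 0 := by
    rw [Psi_eq h hω]
    simp only [Matrix.cons_val_one]
    rw [← ofReal_er, ← ofReal_er, ← ofReal_mul, ← ofReal_add]
    refine mul_ne_zero I_ne_zero ?_
    have : 0 < er 0 (a0 σ * √ω) x + Cc σ * er 0 (b0 σ * √ω) x := by
      have := h.Cc_pos
      have := er_nonneg 0 (a0 σ * √ω) x
      positivity
    exact_mod_cast this.ne'
  have f0 : Om f (PsiStar σ ω) / kappa σ ω - Om f (Psi σ ω) / kappa σ ω = 0 := by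
    apply mul_right_cancel₀ e0; rw [zero_mul, ← h0]; ring
  have f1 : Om f (PsiStar σ ω) / kappa σ ω + Om f (Psi σ ω) / kappa σ ω = 0 := by
    apply mul_right_cancel₀ e1; rw [zero_mul, ← h1]; ring
  have g0 : Om f (PsiStar σ ω) / kappa σ ω = 0 := by linear_combination (f0 + f1) / 2
  have g1 : Om f (Psi σ ω) / kappa σ ω = 0 := by linear_combination (f1 - f0) / 2
  exact ⟨(div_eq_zero_iff.1 g0).resolve_right hκ, (div_eq_zero_iff.1 g1).resolve_right hκ⟩

end ConcNLS
end


/-! ### Charges, Taylor coefficients, and uniform dependence on the frequency. -/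

noncomputable section

namespace ConcNLS

open MeasureTheory Complex ComplexConjugate Set Filter Topology

variable {σ ν ω : ℝ}

/-! ### Charges of two-component fields -/

/-- `p` is the vector of charges of the field `f`. -/
def HasChargeV (f : Field2) (p : Fin 2 → ℂ) : Prop := ∀ i, HasCharge (fun x => f x i) (p i)

lemma HasChargeV.chargeV_eq {f : Field2} {p : Fin 2 → ℂ} (h : HasChargeV f p) : chargeV f = p :=
  funext fun i => (h i).charge_eq

lemma HasChargeV.add {f g : Field2} {p q : Fin 2 → ℂ} (hf : HasChargeV f p) (hg : HasChargeV g q) :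
    HasChargeV (fun x => f x + g x) (p + q) := fun i => (hf i).add (hg i)

lemma HasChargeV.sub {f g : Field2} {p q : Fin 2 → ℂ} (hf : HasChargeV f p) (hg : HasChargeV g q) :
    HasChargeV (fun x => f x - g x) (p - q) := fun i => (hf i).sub (hg i)

lemma HasChargeV.smul {f : Field2} {p : Fin 2 → ℂ} (hf : HasChargeV f p) (c : ℂ) :
    HasChargeV (fun x => c • f x) (c • p) := fun i => (hf i).const_mul c

lemma HasChargeV.cj {f : Field2} {p : Fin 2 → ℂ} (hf : HasChargeV f p) :
    HasChargeV (fun x => cj (f x)) (cj p) := fun i => (hf i).conj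

lemma hasCharge_ek_zero_real {k : ℝ} (hk : 0 < k) : HasCharge (ek 0 (k : ℂ)) 1 :=
  hasCharge_ek_zero (by simpa using hk.le)

lemma hasCharge_ek_combo {a b : ℝ} (ha : 0 < a) (hb : 0 < b) (c d : ℂ) :
    HasCharge (fun x => c * ek 0 (a : ℂ) x + d * ek 0 (b : ℂ) x) (c + d) := by
  have := ((hasCharge_ek_zero_real ha).const_mul c).add ((hasCharge_ek_zero_real hb).const_mul d)
  simpa using this

/-- The value of `qPsi`. -/
def pPsi (σ : ℝ) : Fin 2 → ℂ := ![((1 - Cc σ : ℝ) : ℂ), I * ((1 + Cc σ : ℝ) : ℂ)]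

lemma hasChargeV_Psi (h : Adm σ) (hω : 0 < ω) : HasChargeV (Psi σ ω) (pPsi σ) := by
  have hs : 0 < √ω := Real.sqrt_pos.2 hω
  have ha := mul_pos h.a0_pos hs
  have hb := mul_pos h.b0_pos hs
  intro i
  simp only [Psi_eq h hω]
  fin_cases i
  · convert hasCharge_ek_combo ha hb 1 (-Cc σ) using 1
    · funext x; simp; ring
    · simp [pPsi]; ring
  · convert (hasCharge_ek_combo ha hb 1 (Cc σ)).const_mul I using 1
    · funext x; simp
    · simp [pPsi]

lemma hasChargeV_PsiStar (h : Adm σ) (hω : 0 < ω) : HasChargeV (PsiStar σ ω) (cj (pPsi σ)) := by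
  have := (hasChargeV_Psi h hω).cj
  rwa [show (fun x => cj (Psi σ ω x)) = PsiStar σ ω from
    funext fun x => (PsiStar_eq_cj h hω x).symm] at this

lemma qPsi_eq (h : Adm σ) (hω : 0 < ω) : qPsi σ ω = pPsi σ := (hasChargeV_Psi h hω).chargeV_eq

lemma qPsiStar_eq (h : Adm σ) (hω : 0 < ω) : qPsiStar σ ω = cj (pPsi σ) :=
  (hasChargeV_PsiStar h hω).chargeV_eq

lemma hasChargeV_Phi (hω : 0 < ω) : HasChargeV (Phi σ ν ω) ![(qSol σ ν ω : ℂ), 0] := by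
  have hs : 0 < √ω := Real.sqrt_pos.2 hω
  intro i
  simp only [Phi_eq]
  fin_cases i
  · convert (hasCharge_ek_zero_real hs).const_mul (qSol σ ν ω) using 1 <;> simp
  · simpa using HasCharge.zero

lemma hasChargeV_JPhi (hω : 0 < ω) :
    HasChargeV (fun x => J (Phi σ ν ω x)) ![0, (qSol σ ν ω : ℂ)] := by
  have hs : 0 < √ω := Real.sqrt_pos.2 hω
  intro i
  simp only [Phi_eq, J]
  fin_cases i
  · simpa using HasCharge.zero
  · convert (hasCharge_ek_zero_real hs).const_mul (qSol σ ν ω) using 1 <;> simp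

lemma hasChargeV_dPhi (h : Adm σ) (hν : 0 < ν) (hω : 0 < ω) :
    HasChargeV (dPhi σ ν ω) ![((qSol σ ν ω / (4 * σ * ω) : ℝ) : ℂ), 0] := by
  have hs : 0 < √ω := Real.sqrt_pos.2 hω
  intro i
  simp only [dPhi_eq h hν hω]
  fin_cases i
  · convert ((hasCharge_ek_zero_real hs).const_mul ((qSol σ ν ω / (4 * σ * ω) : ℝ) : ℂ)).sub
      ((hasCharge_ek_one hs).const_mul ((qSol σ ν ω / (2 * √ω) : ℝ) : ℂ)) using 1 <;> simp
  · simpa using HasCharge.zero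

lemma HasChargeV.Pc (h : Adm σ) (hν : 0 < ν) (hω : 0 < ω) {f : Field2} {p : Fin 2 → ℂ}
    (hf : HasChargeV f p) : HasChargeV (Pc σ ν ω f) (p
      + (-(Om f (dPhi σ ν ω) / Delta σ ν ω)) • ![0, (qSol σ ν ω : ℂ)]
      + (Om f (fun y => J (Phi σ ν ω y)) / Delta σ ν ω) • ![((qSol σ ν ω / (4 * σ * ω) : ℝ) : ℂ), 0]
      + (-(Om f (PsiStar σ ω) / kappa σ ω)) • pPsi σ
      + (Om f (Psi σ ω) / kappa σ ω) • ConcNLS.cj (pPsi σ)) := by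
  have := (((hf.add ((hasChargeV_JPhi (σ := σ) (ν := ν) hω).smul (-(Om f (dPhi σ ν ω) / Delta σ ν ω)))).add
    ((hasChargeV_dPhi h hν hω).smul (Om f (fun y => J (Phi σ ν ω y)) / Delta σ ν ω))).add
    ((hasChargeV_Psi h hω).smul (-(Om f (PsiStar σ ω) / kappa σ ω)))).add
    ((hasChargeV_PsiStar h hω).smul (Om f (Psi σ ω) / kappa σ ω))
  rwa [← show ConcNLS.Pc σ ν ω f = _ from funext fun x => Pc_apply f x] at this

/-! ### Explicit Taylor terms -/

/-- The stationarity relation ν q_ω^{2σ} = √ω/(4π) replaces every real power of q_ω in the Taylor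
terms by √ω and an integer power of q_ω. -/
lemma qSol_rpow (h : Adm σ) (hν : 0 < ν) (hω : 0 < ω) (n : ℕ) :
    ν * qSol σ ν ω ^ (2 * (σ - n)) = √ω / (4 * Real.pi) / qSol σ ν ω ^ (2 * n) := by
  have hQ := qSol_pos (σ := σ) hν hω
  rw [← qSol_pow h hν hω, mul_sub, Real.rpow_sub hQ, mul_div_assoc]
  norm_cast

/-- The scale `√ω / (4π)`. -/
def sS (ω : ℝ) : ℝ := √ω / (4 * Real.pi)

lemma sS_pos (hω : 0 < ω) : 0 < sS ω := by
  have := Real.sqrt_pos.2 hω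
  have := Real.pi_pos
  unfold sS; positivity

lemma N2_eq (h : Adm σ) (hν : 0 < ν) (hω : 0 < ω) (p q : Fin 2 → ℂ) :
    N2 σ ν ω p q = ![((sS ω / qSol σ ν ω : ℝ) : ℂ) * (σ * (2 * σ + 1) * (p 0 * q 0) + σ * (p 1 * q 1)),
      ((sS ω / qSol σ ν ω : ℝ) : ℂ) * (σ * (p 0 * q 1 + p 1 * q 0))] := by
  have hQ := qSol_pos (σ := σ) hν hω
  have hQ' : (qSol σ ν ω : ℂ) ≠ 0 := by exact_mod_cast hQ.ne'
  have e1 : ν * σ * qSol σ ν ω ^ (2 * (σ - 1)) = σ * sS ω / qSol σ ν ω ^ 2 := by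
    have := qSol_rpow h hν hω 1
    push_cast at this
    rw [mul_right_comm, this, sS]; ring
  have e2 : ν * (2 * (σ - 1) * σ) * qSol σ ν ω ^ (2 * (σ - 2))
      = 2 * (σ - 1) * σ * sS ω / qSol σ ν ω ^ 4 := by
    have := qSol_rpow h hν hω 2
    push_cast at this
    rw [mul_right_comm, this, sS]; ring
  simp only [N2, e1, e2, dot]
  refine funext (Fin.forall_fin_two.2 ⟨?_, ?_⟩)
  · simp only [Pi.add_apply, Pi.smul_apply, smul_eq_mul, Matrix.cons_val_zero, Matrix.cons_val_one]
    push_cast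
    field_simp
    ring
  · simp only [Pi.add_apply, Pi.smul_apply, smul_eq_mul, Matrix.cons_val_zero, Matrix.cons_val_one]
    push_cast
    field_simp
    ring

lemma N3_eq (h : Adm σ) (hν : 0 < ν) (hω : 0 < ω) (p q r : Fin 2 → ℂ) :
    N3 σ ν ω p q r = ![((sS ω / qSol σ ν ω ^ 2 : ℝ) : ℂ) * (σ * (4 * σ ^ 2 - 1) / 3 * (p 0 * q 0 * r 0)
        + σ * (2 * σ - 1) / 3 * (p 1 * q 1 * r 0 + q 1 * r 1 * p 0 + r 1 * p 1 * q 0)),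
      ((sS ω / qSol σ ν ω ^ 2 : ℝ) : ℂ) * (σ * (2 * σ - 1) / 3
        * (p 0 * q 0 * r 1 + q 0 * r 0 * p 1 + r 0 * p 0 * q 1) + σ * (p 1 * q 1 * r 1))] := by
  have hQ := qSol_pos (σ := σ) hν hω
  have hQ' : (qSol σ ν ω : ℂ) ≠ 0 := by exact_mod_cast hQ.ne'
  have e1 : ν * σ * qSol σ ν ω ^ (2 * (σ - 1)) / 3 = σ * sS ω / (3 * qSol σ ν ω ^ 2) := by
    have := qSol_rpow h hν hω 1
    push_cast at this
    rw [mul_right_comm, this, sS]; ring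
  have e2 : ν * (2 * (σ - 1) * σ) * qSol σ ν ω ^ (2 * (σ - 2)) / 3
      = 2 * (σ - 1) * σ * sS ω / (3 * qSol σ ν ω ^ 4) := by
    have := qSol_rpow h hν hω 2
    push_cast at this
    rw [mul_right_comm, this, sS]; ring
  have e3 : ν * (4 / 3 * (σ - 2) * (σ - 1) * σ) * qSol σ ν ω ^ (2 * (σ - 3))
      = 4 * (σ - 2) * (σ - 1) * σ * sS ω / (3 * qSol σ ν ω ^ 6) := by
    have := qSol_rpow h hν hω 3
    push_cast at this
    rw [mul_right_comm, this, sS]; ring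
  simp only [N3, e1, e2, e3, dot]
  refine funext (Fin.forall_fin_two.2 ⟨?_, ?_⟩)
  · simp only [Pi.add_apply, Pi.smul_apply, smul_eq_mul, Matrix.cons_val_zero, Matrix.cons_val_one]
    push_cast
    field_simp
    ring
  · simp only [Pi.add_apply, Pi.smul_apply, smul_eq_mul, Matrix.cons_val_zero, Matrix.cons_val_one]
    push_cast
    field_simp
    ring

/-! ### Families of continuously differentiable coefficients -/

/-- `F τ` is continuously differentiable on `[lo, hi]`, bounded together with its derivative
uniformly in `τ ∈ [lo, hi]`. -/
def Good (lo hi : ℝ) (F : ℝ → ℝ → ℂ) : Prop :=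
  ∃ M, ∀ τ ∈ Icc lo hi, ContDiffOn ℝ 1 (F τ) (Icc lo hi) ∧
    ∀ ω ∈ Icc lo hi, ‖F τ ω‖ ≤ M ∧ ‖derivWithin (F τ) (Icc lo hi) ω‖ ≤ M

namespace Good

variable {lo hi : ℝ} {F G : ℝ → ℝ → ℂ}

lemma congr (hF : Good lo hi F) (h : ∀ τ ∈ Icc lo hi, ∀ ω ∈ Icc lo hi, G τ ω = F τ ω) :
    Good lo hi G := by
  obtain ⟨M, hM⟩ := hF
  refine ⟨M, fun τ hτ => ⟨(hM τ hτ).1.congr (h τ hτ), fun ω hω => ?_⟩⟩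
  rw [h τ hτ ω hω, derivWithin_congr (h τ hτ) (h τ hτ ω hω)]
  exact (hM τ hτ).2 ω hω

lemma of_bounded {A : ℝ → ℂ} {M : ℝ} (hA : ∀ τ ∈ Icc lo hi, ‖A τ‖ ≤ M) :
    Good lo hi (fun τ _ => A τ) :=
  ⟨max M 0, fun τ hτ => ⟨contDiffOn_const, fun ω _ =>
    ⟨(hA τ hτ).trans (le_max_left _ _), by simp⟩⟩⟩

lemma const (c : ℂ) : Good lo hi (fun _ _ => c) := of_bounded (M := ‖c‖) fun _ _ => le_rfl

lemma of_contDiffOn (hl : lo < hi) {g : ℝ → ℂ} (hg : ContDiffOn ℝ 1 g (Icc lo hi)) :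
    Good lo hi (fun _ => g) := by
  obtain ⟨M₁, h₁⟩ := isCompact_Icc.exists_bound_of_continuousOn hg.continuousOn
  obtain ⟨M₂, h₂⟩ := isCompact_Icc.exists_bound_of_continuousOn
    (hg.continuousOn_derivWithin (uniqueDiffOn_Icc hl) le_rfl)
  exact ⟨max M₁ M₂, fun τ _ => ⟨hg, fun ω hω =>
    ⟨(h₁ ω hω).trans (le_max_left _ _), (h₂ ω hω).trans (le_max_right _ _)⟩⟩⟩

lemma add (hl : lo < hi) (hF : Good lo hi F) (hG : Good lo hi G) :
    Good lo hi (fun τ ω => F τ ω + G τ ω) := by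
  obtain ⟨M, hM⟩ := hF
  obtain ⟨N, hN⟩ := hG
  refine ⟨M + N, fun τ hτ => ⟨(hM τ hτ).1.add (hN τ hτ).1, fun ω hω =>
    ⟨norm_add_le_of_le ((hM τ hτ).2 ω hω).1 ((hN τ hτ).2 ω hω).1, ?_⟩⟩⟩
  have h1 := (hM τ hτ).1.differentiableOn one_ne_zero ω hω
  have h2 := (hN τ hτ).1.differentiableOn one_ne_zero ω hω
  change ‖derivWithin (F τ + G τ) _ _‖ ≤ _
  rw [(h1.hasDerivWithinAt.add h2.hasDerivWithinAt).derivWithin (uniqueDiffOn_Icc hl ω hω)]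
  exact norm_add_le_of_le ((hM τ hτ).2 ω hω).2 ((hN τ hτ).2 ω hω).2

lemma mul (hl : lo < hi) (hF : Good lo hi F) (hG : Good lo hi G) :
    Good lo hi (fun τ ω => F τ ω * G τ ω) := by
  obtain ⟨M, hM⟩ := hF
  obtain ⟨N, hN⟩ := hG
  refine ⟨M * N + M * N, fun τ hτ => ⟨(hM τ hτ).1.mul (hN τ hτ).1, fun ω hω => ?_⟩⟩
  obtain ⟨m1, m2⟩ := (hM τ hτ).2 ω hω
  obtain ⟨n1, n2⟩ := (hN τ hτ).2 ω hω
  have hM0 := (norm_nonneg _).trans m1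
  have hN0 := (norm_nonneg _).trans n1
  have h1 := (hM τ hτ).1.differentiableOn one_ne_zero ω hω
  have h2 := (hN τ hτ).1.differentiableOn one_ne_zero ω hω
  constructor
  · rw [norm_mul]
    calc _ ≤ M * N := mul_le_mul m1 n1 (norm_nonneg _) hM0
      _ ≤ _ := by nlinarith [mul_nonneg hM0 hN0]
  · change ‖derivWithin (F τ * G τ) _ _‖ ≤ _
    rw [(h1.hasDerivWithinAt.mul h2.hasDerivWithinAt).derivWithin (uniqueDiffOn_Icc hl ω hω)]
    refine norm_add_le_of_le ?_ ?_
    · rw [norm_mul]; exact mul_le_mul m2 n1 (norm_nonneg _) hM0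
    · rw [norm_mul]; exact mul_le_mul m1 n2 (norm_nonneg _) hM0

lemma neg (hl : lo < hi) (hF : Good lo hi F) : Good lo hi (fun τ ω => -F τ ω) :=
  ((const (-1)).mul hl hF).congr fun _ _ _ _ => by ring

lemma sub (hl : lo < hi) (hF : Good lo hi F) (hG : Good lo hi G) :
    Good lo hi (fun τ ω => F τ ω - G τ ω) :=
  (hF.add hl (hG.neg hl)).congr fun _ _ _ _ => sub_eq_add_neg _ _

lemma div_const (hl : lo < hi) (hF : Good lo hi F) (c : ℂ) : Good lo hi (fun τ ω => F τ ω / c) :=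
  (hF.mul hl (const c⁻¹)).congr fun _ _ _ _ => div_eq_mul_inv _ _

lemma star (hl : lo < hi) (hF : Good lo hi F) :
    Good lo hi (fun τ ω => starRingEnd ℂ (F τ ω)) := by
  obtain ⟨M, hM⟩ := hF
  refine ⟨M, fun τ hτ => ⟨conjCLE.contDiff.comp_contDiffOn (hM τ hτ).1, fun ω hω => ⟨?_, ?_⟩⟩⟩
  · simpa using ((hM τ hτ).2 ω hω).1
  · have h1 := ((hM τ hτ).1.differentiableOn one_ne_zero ω hω).hasDerivWithinAt
    have h2 := (conjCLE.hasFDerivAt (x := F τ ω)).comp_hasDerivWithinAt ω h1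
    have : derivWithin (fun s => starRingEnd ℂ (F τ s)) (Icc lo hi) ω = _ :=
      h2.derivWithin (uniqueDiffOn_Icc hl ω hω)
    rw [this]
    simpa using ((hM τ hτ).2 ω hω).2

lemma bound (hF : Good lo hi F) : ∃ M > 0, ∀ τ ∈ Icc lo hi, ∀ ω ∈ Icc lo hi, ‖F τ ω‖ ≤ M := by
  obtain ⟨M, hM⟩ := hF
  exact ⟨max M 1, by positivity, fun τ hτ ω hω => (((hM τ hτ).2 ω hω).1).trans (le_max_left _ _)⟩

lemma lipschitz (hF : Good lo hi F) : ∃ M > 0, ∀ τ ∈ Icc lo hi, ∀ ω ∈ Icc lo hi, ∀ ω' ∈ Icc lo hi,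
    ‖F τ ω - F τ ω'‖ ≤ M * |ω - ω'| := by
  obtain ⟨M, hM⟩ := hF
  refine ⟨max M 1, by positivity, fun τ hτ ω hω ω' hω' => ?_⟩
  have := (convex_Icc lo hi).norm_image_sub_le_of_norm_derivWithin_le (f := F τ) (C := max M 1)
    ((hM τ hτ).1.differentiableOn one_ne_zero)
    (fun x hx => ((hM τ hτ).2 x hx).2.trans (le_max_left _ _)) hω' hω
  simpa using this

lemma of_real (hl : lo < hi) {g : ℝ → ℝ} (hg : ContDiffOn ℝ 1 g (Icc lo hi)) :
    Good lo hi (fun _ ω => ((g ω : ℝ) : ℂ)) :=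
  of_contDiffOn hl (ofRealCLM.contDiff.comp_contDiffOn hg)

end Good

end ConcNLS

end


noncomputable section

namespace ConcNLS

open MeasureTheory Complex ComplexConjugate Set Filter Topology

variable {σ ν ω lo hi : ℝ}

/-! ### Smooth dependence of the coefficients on the frequency -/

lemma Icc_pos (hlo : 0 < lo) (hω : ω ∈ Icc lo hi) : 0 < ω := hlo.trans_le hω.1

lemma contDiffOn_sqrt (hlo : 0 < lo) : ContDiffOn ℝ 1 Real.sqrt (Icc lo hi) :=
  contDiffOn_id.sqrt fun _ hx => (Icc_pos hlo hx).ne'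

lemma sqrt_ne_zero' (hlo : 0 < lo) : ∀ x ∈ Icc lo hi, √x ≠ 0 := fun _ hx =>
  (Real.sqrt_pos.2 (Icc_pos hlo hx)).ne'

lemma contDiffOn_qSol (hν : 0 < ν) (hlo : 0 < lo) : ContDiffOn ℝ 1 (qSol σ ν) (Icc lo hi) := by
  unfold qSol
  refine ((contDiffOn_sqrt hlo).div_const _).rpow_const_of_ne fun x hx => ?_
  have := Real.sqrt_pos.2 (Icc_pos hlo hx)
  have := Real.pi_pos
  positivity

lemma qSol_ne (hν : 0 < ν) (hlo : 0 < lo) : ∀ x ∈ Icc lo hi, qSol σ ν x ≠ 0 := fun _ hx =>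
  (qSol_pos hν (Icc_pos hlo hx)).ne'

/-- Continuous dependence on the frequency through `√ω` and `q_ω`. -/
lemma good_scale (hν : 0 < ν) (hlo : 0 < lo) (hl : lo < hi) (m n j l : ℕ) :
    Good lo hi (fun _ ω => ((√ω ^ m / √ω ^ n * (qSol σ ν ω ^ j / qSol σ ν ω ^ l) : ℝ) : ℂ)) := by
  have h1 := contDiffOn_sqrt (hi := hi) hlo
  have h2 := contDiffOn_qSol (σ := σ) (hi := hi) hν hlo
  refine Good.of_real hl ?_
  exact ((h1.pow m).div (h1.pow n) fun x hx => pow_ne_zero _ (sqrt_ne_zero' hlo x hx)).mul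
    ((h2.pow j).div (h2.pow l) fun x hx => pow_ne_zero _ (qSol_ne hν hlo x hx))

lemma good_N2 (h : Adm σ) (hν : 0 < ν) (hlo : 0 < lo) (hl : lo < hi) (p q : Fin 2 → ℂ) (i : Fin 2) :
    Good lo hi (fun _ ω => N2 σ ν ω p q i) := by
  have h0 := good_scale (σ := σ) hν hlo hl 1 0 0 1
  revert i
  refine Fin.forall_fin_two.2 ⟨?_, ?_⟩
  · refine (h0.mul hl (Good.const ((σ * (2 * σ + 1) * (p 0 * q 0) + σ * (p 1 * q 1)) / (4 * Real.pi)))).congr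
      fun τ hτ ω hω => ?_
    rw [N2_eq h hν (Icc_pos hlo hω)]
    simp [sS]; ring
  · refine (h0.mul hl (Good.const ((σ * (p 0 * q 1 + p 1 * q 0)) / (4 * Real.pi)))).congr
      fun τ hτ ω hω => ?_
    rw [N2_eq h hν (Icc_pos hlo hω)]
    simp [sS]; ring

lemma good_N3 (h : Adm σ) (hν : 0 < ν) (hlo : 0 < lo) (hl : lo < hi) (p q r : Fin 2 → ℂ) (i : Fin 2) :
    Good lo hi (fun _ ω => N3 σ ν ω p q r i) := by
  have h0 := good_scale (σ := σ) hν hlo hl 1 0 0 2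
  revert i
  refine Fin.forall_fin_two.2 ⟨?_, ?_⟩
  · refine (h0.mul hl (Good.const ((σ * (4 * σ ^ 2 - 1) / 3 * (p 0 * q 0 * r 0)
        + σ * (2 * σ - 1) / 3 * (p 1 * q 1 * r 0 + q 1 * r 1 * p 0 + r 1 * p 1 * q 0))
        / (4 * Real.pi)))).congr fun τ hτ ω hω => ?_
    rw [N3_eq h hν (Icc_pos hlo hω)]
    simp [sS]; ring
  · refine (h0.mul hl (Good.const ((σ * (2 * σ - 1) / 3
        * (p 0 * q 0 * r 1 + q 0 * r 0 * p 1 + r 0 * p 0 * q 1) + σ * (p 1 * q 1 * r 1))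
        / (4 * Real.pi)))).congr fun τ hτ ω hω => ?_
    rw [N3_eq h hν (Icc_pos hlo hω)]
    simp [sS]; ring

/-- `κ √ω / i`. -/
def kap0 (σ : ℝ) : ℝ := (1 / a0 σ - Cc σ ^ 2 / b0 σ) / (4 * Real.pi)

lemma kap0_pos (h : Adm σ) : 0 < kap0 σ := div_pos h.kappa0_pos (by have := Real.pi_pos; positivity)

lemma kappa_eq' (h : Adm σ) (hω : 0 < ω) : kappa σ ω = I * ((kap0 σ / √ω : ℝ) : ℂ) := by
  rw [kappa_eq h hω, kap0]; congr 2; rw [div_div]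

lemma inv_kappa (h : Adm σ) (hω : 0 < ω) : 1 / kappa σ ω = -I * ((√ω / kap0 σ : ℝ) : ℂ) := by
  have h1 : (kap0 σ : ℂ) ≠ 0 := by exact_mod_cast (kap0_pos h).ne'
  have h2 := sqrt_ne hω
  rw [kappa_eq' h hω]
  push_cast
  field_simp
  rw [I_sq]; ring

lemma good_inv_kappa (h : Adm σ) (hν : 0 < ν) (hlo : 0 < lo) (hl : lo < hi) :
    Good lo hi (fun _ ω => 1 / kappa σ ω) := by
  refine ((good_scale (σ := σ) hν hlo hl 1 0 0 0).mul hl (Good.const (-I / kap0 σ))).congr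
    fun τ hτ ω hω => ?_
  rw [inv_kappa h (Icc_pos hlo hω)]
  simp; ring

lemma Delta_eq' (h : Adm σ) (hν : 0 < ν) (hω : 0 < ω) :
    Delta σ ν ω = qSol σ ν ω ^ 2 / √ω ^ 3 * ((1 / σ - 1) / (32 * Real.pi)) := by
  rw [Delta_eq h hν hω]; ring

lemma good_inv_Delta (h : Adm σ) (hν : 0 < ν) (hlo : 0 < lo) (hl : lo < hi) :
    Good lo hi (fun _ ω => 1 / (Delta σ ν ω : ℂ)) := by
  refine ((good_scale (σ := σ) hν hlo hl 3 0 0 2).mul hl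
    (Good.const (1 / ((1 / σ - 1) / (32 * Real.pi))))).congr fun τ hτ ω hω => ?_
  rw [Delta_eq' h hν (Icc_pos hlo hω)]
  push_cast
  simp only [one_div, mul_inv, inv_div, pow_zero, div_one]
  ring

lemma good_inv_xi (hν : 0 < ν) (hlo : 0 < lo) (hl : lo < hi) :
    Good lo hi (fun _ ω => 1 / (xi σ ω : ℂ)) := by
  refine ((good_scale (σ := σ) hν hlo hl 0 2 0 0).mul hl
    (Good.const (1 / (2 * σ * cs σ : ℝ)))).congr fun τ hτ ω hω => ?_
  have : xi σ ω = 2 * σ * cs σ * √ω ^ 2 := by rw [Real.sq_sqrt (Icc_pos hlo hω).le, xi, cs]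
  rw [this]
  push_cast
  simp only [one_div, mul_inv, pow_zero, div_one]
  ring

lemma good_qSol (hν : 0 < ν) (hlo : 0 < lo) (hl : lo < hi) :
    Good lo hi (fun _ ω => (qSol σ ν ω : ℂ)) := Good.of_real hl (contDiffOn_qSol hν hlo)

lemma good_dqSol (h : Adm σ) (hν : 0 < ν) (hlo : 0 < lo) (hl : lo < hi) :
    Good lo hi (fun _ ω => ((qSol σ ν ω / (4 * σ * ω) : ℝ) : ℂ)) := by
  refine Good.of_real hl ((contDiffOn_qSol hν hlo).div (contDiffOn_const.mul contDiffOn_id) ?_)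
  intro x hx
  have := Icc_pos hlo hx
  have := h.pos
  positivity

lemma J_zero (p : Fin 2 → ℂ) : J p 0 = -p 1 := rfl

lemma J_one (p : Fin 2 → ℂ) : J p 1 = p 0 := rfl

lemma cj_apply (p : Fin 2 → ℂ) (i : Fin 2) : cj p i = conj (p i) := rfl

lemma dot_J_cj_J (p q : Fin 2 → ℂ) : dot (J p) (cj (J q)) = dot p (cj q) := by
  simp only [dot, J_zero, J_one, cj_apply, map_neg]; ring

/-! ### Products of the discrete modes -/

/-- With A and B the two profiles the integrand is (A - CB)² - (A + CB)² = -4C AB, so only the mixed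
integral survives. For the norm of Ψ the sign is plus and the mixed integral cancels instead. -/
lemma ip_PsiStar_Psi (h : Adm σ) (hω : 0 < ω) :
    ip (PsiStar σ ω) (Psi σ ω) = ((-Cc σ / (Real.pi * (a0 σ + b0 σ) * √ω) : ℝ) : ℂ) := by
  have hs : 0 < √ω := Real.sqrt_pos.2 hω
  have ha := mul_pos h.a0_pos hs
  have hb := mul_pos h.b0_pos hs
  have e : ∀ x, dot (PsiStar σ ω x) (cj (Psi σ ω x)) = (-4 * Cc σ : ℂ)
      * (ek 0 ((a0 σ * √ω : ℝ) : ℂ) x * ek 0 ((b0 σ * √ω : ℝ) : ℂ) x) := by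
    intro x
    rw [← PsiStar_eq_cj h hω, PsiStar_eq h hω]
    simp only [dot, Matrix.cons_val_zero, Matrix.cons_val_one]
    linear_combination (ek 0 ((a0 σ * √ω : ℝ) : ℂ) x + Cc σ * ek 0 ((b0 σ * √ω : ℝ) : ℂ) x) ^ 2 * I_sq
  have := pe_ek 0 0 hb ha
  unfold pe at this
  simp only [ip, e]
  rw [integral_const_mul, this]
  have e6 := sqrt_ne hω
  have e7 := pi_ne
  have e8 : (a0 σ : ℂ) + b0 σ ≠ 0 := by exact_mod_cast (add_pos h.a0_pos h.b0_pos).ne'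
  have e9 : b0 σ * √ω + a0 σ * √ω = (a0 σ + b0 σ) * √ω := by ring
  rw [show ((b0 σ * √ω : ℝ) : ℂ) + ((a0 σ * √ω : ℝ) : ℂ) = (a0 σ + b0 σ) * √ω by push_cast; ring]
  push_cast
  simp only [Nat.factorial, Nat.cast_one, pow_one]
  field_simp

lemma ip_Psi_Psi (h : Adm σ) (hω : 0 < ω) :
    ip (Psi σ ω) (Psi σ ω) = (((1 / a0 σ + Cc σ ^ 2 / b0 σ) / (4 * Real.pi * √ω) : ℝ) : ℂ) := by
  have hs : 0 < √ω := Real.sqrt_pos.2 hω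
  have ha := mul_pos h.a0_pos hs
  have hb := mul_pos h.b0_pos hs
  have e : ∀ x, dot (Psi σ ω x) (cj (Psi σ ω x)) =
      2 * (ek 0 ((a0 σ * √ω : ℝ) : ℂ) x * ek 0 ((a0 σ * √ω : ℝ) : ℂ) x)
      + 2 * Cc σ ^ 2 * (ek 0 ((b0 σ * √ω : ℝ) : ℂ) x * ek 0 ((b0 σ * √ω : ℝ) : ℂ) x) := by
    intro x
    rw [← PsiStar_eq_cj h hω, PsiStar_eq h hω, Psi_eq h hω]
    simp only [dot, Matrix.cons_val_zero, Matrix.cons_val_one]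
    linear_combination -(ek 0 ((a0 σ * √ω : ℝ) : ℂ) x + Cc σ * ek 0 ((b0 σ * √ω : ℝ) : ℂ) x) ^ 2 * I_sq
  have h1 := pe_ek 0 0 ha ha
  have h2 := pe_ek 0 0 hb hb
  unfold pe at h1 h2
  simp only [ip, e]
  rw [integral_add ((integrable_ek_mul 0 0 ha ha).const_mul _) ((integrable_ek_mul 0 0 hb hb).const_mul _),
    integral_const_mul, integral_const_mul, h1, h2]
  have e6 := sqrt_ne hω
  have e7 := pi_ne
  have e8 : (a0 σ : ℂ) ≠ 0 := by exact_mod_cast h.a0_pos.ne'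
  have e9 : (b0 σ : ℂ) ≠ 0 := by exact_mod_cast h.b0_pos.ne'
  push_cast
  simp only [Nat.factorial, Nat.cast_one, pow_one]
  field_simp
  ring

lemma ip_dPsiStar_JPsi (h : Adm σ) (hω : 0 < ω) :
    ip (dPsiStar σ ω) (fun x => J (Psi σ ω x)) = Om (dPsiStar σ ω) (PsiStar σ ω) := by
  unfold ip Om
  congr 1; funext x
  rw [PsiStar_eq_cj h hω x]
  simp only [dot, J_zero, J_one, cj_apply, map_neg]

lemma ip_dPsiStar_JPsi' (h : Adm σ) (hω : 0 < ω) :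
    ip (dPsiStar σ ω) (fun x => J (Psi σ ω x))
      = I * ((Cc σ * (b0 σ - a0 σ) / (4 * Real.pi * (a0 σ + b0 σ) ^ 2 * √ω ^ 3) : ℝ) : ℂ) := by
  have hs : 0 < √ω := Real.sqrt_pos.2 hω
  have ha := mul_pos h.a0_pos hs
  have hb := mul_pos h.b0_pos hs
  rw [ip_dPsiStar_JPsi h hω, Om_comm, Om_dPsiStar h hω (pairable_PsiStar h hω), pe_PsiStar_zero,
    pe_PsiStar_one, pe_PsiStar_zero, pe_PsiStar_one, pe_Psi_zero h hω 1 ha, pe_Psi_zero h hω 1 hb,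
    pe_Psi_one h hω 1 ha, pe_Psi_one h hω 1 hb]
  have e6 := sqrt_ne hω
  have e7 := pi_ne
  have e8 : (a0 σ : ℂ) + b0 σ ≠ 0 := by exact_mod_cast (add_pos h.a0_pos h.b0_pos).ne'
  have e9 : (a0 σ : ℂ) ≠ 0 := by exact_mod_cast h.a0_pos.ne'
  have e10 : (b0 σ : ℂ) ≠ 0 := by exact_mod_cast h.b0_pos.ne'
  have e11 : b0 σ * √ω + a0 σ * √ω = (a0 σ + b0 σ) * √ω := by ring
  have e12 : a0 σ * √ω + b0 σ * √ω = (a0 σ + b0 σ) * √ω := by ring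
  have e13 : a0 σ * √ω + a0 σ * √ω = 2 * a0 σ * √ω := by ring
  have e14 : b0 σ * √ω + b0 σ * √ω = 2 * b0 σ * √ω := by ring
  rw [e11, e12, e13, e14]
  push_cast
  simp only [Nat.factorial]
  field_simp
  push_cast
  ring

lemma good_dm (hν : 0 < ν) (h : Adm σ) (hlo : 0 < lo) (hl : lo < hi) :
    Good lo hi (fun _ ω => ip (dPsiStar σ ω) (fun x => J (Psi σ ω x))) := by
  refine ((good_scale (σ := σ) hν hlo hl 0 3 0 0).mul hl
    (Good.const (I * (Cc σ * (b0 σ - a0 σ) / (4 * Real.pi * (a0 σ + b0 σ) ^ 2))))).congr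
    fun τ hτ ω hω => ?_
  have e1 : ((a0 σ : ℂ) + b0 σ) ≠ 0 := by exact_mod_cast (add_pos h.a0_pos h.b0_pos).ne'
  have e2 := sqrt_ne (Icc_pos hlo hω)
  rw [ip_dPsiStar_JPsi' h (Icc_pos hlo hω)]
  push_cast
  field_simp

lemma good_m2 (hν : 0 < ν) (h : Adm σ) (hlo : 0 < lo) (hl : lo < hi) :
    Good lo hi (fun _ ω => ip (PsiStar σ ω) (Psi σ ω)) := by
  refine ((good_scale (σ := σ) hν hlo hl 0 1 0 0).mul hl
    (Good.const (-Cc σ / (Real.pi * (a0 σ + b0 σ))))).congr fun τ hτ ω hω => ?_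
  have e1 : ((a0 σ : ℂ) + b0 σ) ≠ 0 := by exact_mod_cast (add_pos h.a0_pos h.b0_pos).ne'
  have e2 := sqrt_ne (Icc_pos hlo hω)
  rw [ip_PsiStar_Psi h (Icc_pos hlo hω)]
  push_cast
  field_simp

lemma good_m1 (hν : 0 < ν) (h : Adm σ) (hlo : 0 < lo) (hl : lo < hi) :
    Good lo hi (fun _ ω => ip (Psi σ ω) (Psi σ ω)) := by
  refine ((good_scale (σ := σ) hν hlo hl 0 1 0 0).mul hl
    (Good.const ((1 / a0 σ + Cc σ ^ 2 / b0 σ) / (4 * Real.pi)))).congr fun τ hτ ω hω => ?_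
  rw [ip_Psi_Psi h (Icc_pos hlo hω)]
  simp
  ring

lemma good_Z20 (h : Adm σ) (hν : 0 < ν) (hlo : 0 < lo) (hl : lo < hi) :
    Good lo hi (fun _ ω => Z20 σ ν ω) := by
  have n := good_N2 h hν hlo hl (pPsi σ) (pPsi σ)
  refine ((good_inv_kappa h hν hlo hl).mul hl (((n 0).mul hl (Good.const (conj (pPsi σ 0)))).add hl
    ((n 1).mul hl (Good.const (conj (pPsi σ 1)))))).congr fun τ hτ ω hω => ?_
  rw [Z20, dot_J_cj_J, qPsi_eq h (Icc_pos hlo hω)]; rfl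

lemma good_Z11 (h : Adm σ) (hν : 0 < ν) (hlo : 0 < lo) (hl : lo < hi) :
    Good lo hi (fun _ ω => Z11 σ ν ω) := by
  have n := good_N2 h hν hlo hl (pPsi σ) (cj (pPsi σ))
  refine ((good_inv_kappa h hν hlo hl).mul hl (((n 0).mul hl (Good.const (2 * conj (pPsi σ 0)))).add hl
    ((n 1).mul hl (Good.const (2 * conj (pPsi σ 1)))))).congr fun τ hτ ω hω => ?_
  rw [Z11, dot_J_cj_J, qPsi_eq h (Icc_pos hlo hω), qPsiStar_eq h (Icc_pos hlo hω)]
  simp only [dot, cj_apply]; ring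

lemma good_Z02 (h : Adm σ) (hν : 0 < ν) (hlo : 0 < lo) (hl : lo < hi) :
    Good lo hi (fun _ ω => Z02 σ ν ω) := by
  have n := good_N2 h hν hlo hl (cj (pPsi σ)) (cj (pPsi σ))
  refine ((good_inv_kappa h hν hlo hl).mul hl (((n 0).mul hl (Good.const (conj (pPsi σ 0)))).add hl
    ((n 1).mul hl (Good.const (conj (pPsi σ 1)))))).congr fun τ hτ ω hω => ?_
  rw [Z02, dot_J_cj_J, qPsi_eq h (Icc_pos hlo hω), qPsiStar_eq h (Icc_pos hlo hω)]; rfl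

lemma good_Z10' (h : Adm σ) (hν : 0 < ν) (hlo : 0 < lo) (hl : lo < hi) (i : Fin 2) :
    Good lo hi (fun _ ω => Z10' σ ν ω i) := by
  have n := good_N2 h hν hlo hl (cj (pPsi σ)) (pPsi σ) i
  refine ((good_inv_kappa h hν hlo hl).mul hl (n.mul hl (Good.const (-2)))).congr fun τ hτ ω hω => ?_
  have hω' := Icc_pos hlo hω
  rw [Z10', conj_kappa h hω', qPsi_eq h hω', qPsiStar_eq h hω', Pi.smul_apply, smul_eq_mul, div_neg]
  ring

lemma good_Z01' (h : Adm σ) (hν : 0 < ν) (hlo : 0 < lo) (hl : lo < hi) (i : Fin 2) :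
    Good lo hi (fun _ ω => Z01' σ ν ω i) := by
  have n := good_N2 h hν hlo hl (pPsi σ) (pPsi σ) i
  refine ((good_inv_kappa h hν hlo hl).mul hl (n.mul hl (Good.const (-2)))).congr fun τ hτ ω hω => ?_
  have hω' := Icc_pos hlo hω
  rw [Z01', conj_kappa h hω', qPsi_eq h hω', Pi.smul_apply, smul_eq_mul, div_neg]
  ring

lemma good_Z21 (h : Adm σ) (hν : 0 < ν) (hlo : 0 < lo) (hl : lo < hi) :
    Good lo hi (fun _ ω => Z21 σ ν ω) := by
  have n3 := good_N3 h hν hlo hl (cj (pPsi σ)) (pPsi σ) (pPsi σ)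
  have n := good_N2 h hν hlo hl (pPsi σ) (pPsi σ)
  have n' := good_N2 h hν hlo hl (pPsi σ) (cj (pPsi σ))
  have q' := good_dqSol h hν hlo hl
  refine (((good_inv_kappa h hν hlo hl).mul hl (((n3 0).mul hl (Good.const (3 * conj (pPsi σ 0)))).add hl
    ((n3 1).mul hl (Good.const (3 * conj (pPsi σ 1)))))).sub hl
    (((good_inv_Delta h hν hlo hl).mul hl (good_inv_kappa h hν hlo hl)).mul hl
      ((((good_dm hν h hlo hl).mul hl (((n 1).mul hl (good_qSol (σ := σ) hν hlo hl)).neg hl)).add hl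
        ((good_m2 hν h hlo hl).mul hl ((n 0).mul hl q'))).add hl
        (((Good.const 2).mul hl (good_m1 hν h hlo hl)).mul hl ((n' 0).mul hl q'))))).congr
      fun τ hτ ω hω => ?_
  have hω' := Icc_pos hlo hω
  rw [Z21, dot_J_cj_J, qPsi_eq h hω', qPsiStar_eq h hω', (hasChargeV_Phi hω').chargeV_eq,
    (hasChargeV_dPhi h hν hω').chargeV_eq]
  simp only [dot, cj_apply, J_zero, J_one, Matrix.cons_val_zero, Matrix.cons_val_one, one_div, mul_inv]
  ring

end ConcNLS

end


noncomputable section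

namespace ConcNLS

open MeasureTheory Complex ComplexConjugate Set Filter Topology

variable {σ ν ω lo hi : ℝ}

/-! ### Weighted bounds for the discrete modes -/

lemma er_zero_le_wt {k : ℝ} (hk : 0 ≤ k) (x : E3) : er 0 k x ≤ wt x := by
  refine (er_anti 0 hk x).trans ?_
  have hpi : 1 ≤ 4 * Real.pi := by linarith [Real.pi_gt_three]
  simp only [er, wt, pow_zero, neg_zero, zero_mul, Real.exp_zero, mul_one]
  rcases eq_or_lt_of_le (norm_nonneg x) with h | h
  · rw [← h]; simp
  · have : 1 / (4 * Real.pi * ‖x‖) ≤ 1 / ‖x‖ :=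
      one_div_le_one_div_of_le h (le_mul_of_one_le_left h.le hpi)
    linarith

lemma er_one_le_wt {k : ℝ} (hk : 0 ≤ k) (x : E3) : er 1 k x ≤ wt x := by
  refine (er_anti 1 hk x).trans ?_
  have hpi : 1 ≤ 4 * Real.pi := by linarith [Real.pi_gt_three]
  simp only [er, wt, pow_one, neg_zero, zero_mul, Real.exp_zero, mul_one]
  rcases eq_or_lt_of_le (norm_nonneg x) with h | h
  · rw [← h]; simp
  · have h1 : ‖x‖ / (4 * Real.pi * ‖x‖) ≤ 1 := by
      rw [div_le_one (by positivity)]; exact le_mul_of_one_le_left h.le hpi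
    have : 0 < 1 / ‖x‖ := by positivity
    linarith

lemma norm_ek_zero_le {k : ℂ} (hk : 0 ≤ k.re) (x : E3) : ‖ek 0 k x‖ ≤ wt x := by
  rw [norm_ek_eq_er]; exact er_zero_le_wt hk x

lemma norm_ek_one_le {k : ℂ} (hk : 0 ≤ k.re) (x : E3) : ‖ek 1 k x‖ ≤ wt x := by
  rw [norm_ek_eq_er]; exact er_one_le_wt hk x

lemma memW_of_components {f : Field2} (hm : ∀ i, Measurable (fun x => f x i)) {M : ℝ} (hM : 0 ≤ M)
    (h : ∀ i x, ‖f x i‖ ≤ M * wt x) : MemW f ∧ wNorm f ≤ M :=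
  memW_of_bound (measurable_pi_iff.2 hm).aestronglyMeasurable hM
    (ae_of_all _ fun x => (pi_norm_le_iff_of_nonneg (mul_nonneg hM (wt_pos x).le)).2 fun i => h i x)

lemma memW_Psi (h : Adm σ) (hω : 0 < ω) : MemW (Psi σ ω) ∧ wNorm (Psi σ ω) ≤ 1 + Cc σ := by
  have hs : 0 < √ω := Real.sqrt_pos.2 hω
  have ha := mul_pos h.a0_pos hs
  have hb := mul_pos h.b0_pos hs
  have hC := h.Cc_pos
  have e : ∀ x (s : ℂ), ‖s‖ = 1 → ‖ek 0 ((a0 σ * √ω : ℝ) : ℂ) x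
      + s * (Cc σ * ek 0 ((b0 σ * √ω : ℝ) : ℂ) x)‖ ≤ (1 + Cc σ) * wt x := by
    intro x s hs
    refine (norm_add_le _ _).trans ?_
    rw [norm_mul, norm_mul, hs, one_mul, norm_real, Real.norm_of_nonneg hC.le, add_mul, one_mul]
    exact add_le_add (norm_ek_zero_le ha.le x)
      (mul_le_mul_of_nonneg_left (norm_ek_zero_le hb.le x) hC.le)
  refine memW_of_components (Fin.forall_fin_two.2 ⟨?_, ?_⟩) (by positivity)
    (Fin.forall_fin_two.2 ⟨fun x => ?_, fun x => ?_⟩)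
  · simp only [Psi_eq h hω, Matrix.cons_val_zero]
    exact (measurable_ek _ _).sub ((measurable_ek _ _).const_mul _)
  · simp only [Psi_eq h hω, Matrix.cons_val_one]
    exact ((measurable_ek _ _).add ((measurable_ek _ _).const_mul _)).const_mul _
  · have := e x (-1) (by simp)
    rw [Psi_eq h hω, Matrix.cons_val_zero]
    rwa [neg_one_mul, ← sub_eq_add_neg] at this
  · have := e x 1 (by simp)
    rw [Psi_eq h hω, Matrix.cons_val_one, Matrix.cons_val_fin_one]
    rwa [norm_mul, norm_I, one_mul, ← one_mul (Cc σ * ek 0 ((b0 σ * √ω : ℝ) : ℂ) x : ℂ)]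

lemma memW_cj {f : Field2} (hf : MemW f) : MemW (fun x => cj (f x)) ∧ wNorm (fun x => cj (f x)) ≤ wNorm f := by
  refine memW_of_bound ?_ (wNorm_nonneg f) ?_
  · exact (continuous_pi fun i => continuous_conj.comp (continuous_apply i)).comp_aestronglyMeasurable hf.1
  · filter_upwards [hf.ae_le] with x hx
    refine le_trans (le_of_eq ?_) hx
    simp only [Pi.norm_def, cj]
    simp

lemma memW_PsiStar (h : Adm σ) (hω : 0 < ω) : MemW (PsiStar σ ω) ∧ wNorm (PsiStar σ ω) ≤ 1 + Cc σ := by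
  have := memW_cj (memW_Psi h hω).1
  rw [show (fun x => cj (Psi σ ω x)) = PsiStar σ ω from
    funext fun x => (PsiStar_eq_cj h hω x).symm] at this
  exact ⟨this.1, this.2.trans (memW_Psi h hω).2⟩

lemma memW_JPhi (hν : 0 < ν) (hω : 0 < ω) :
    MemW (fun x => J (Phi σ ν ω x)) ∧ wNorm (fun x => J (Phi σ ν ω x)) ≤ qSol σ ν ω := by
  have hs : 0 < √ω := Real.sqrt_pos.2 hω
  have hQ := qSol_pos (σ := σ) hν hω
  refine memW_of_components (Fin.forall_fin_two.2 ⟨?_, ?_⟩) hQ.le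
    (Fin.forall_fin_two.2 ⟨fun x => ?_, fun x => ?_⟩)
  · simp only [J_zero, Phi_eq, Matrix.cons_val_one]; exact measurable_const
  · simp only [J_one, Phi_eq, Matrix.cons_val_zero]; exact (measurable_ek _ _).const_mul _
  · simp only [J_zero, Phi_eq, Matrix.cons_val_one, Matrix.cons_val_fin_one, neg_zero, norm_zero]
    exact mul_nonneg hQ.le (wt_pos x).le
  · simp only [J_one, Phi_eq, Matrix.cons_val_zero, norm_mul, norm_real, Real.norm_of_nonneg hQ.le]
    exact mul_le_mul_of_nonneg_left (norm_ek_zero_le hs.le x) hQ.le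

lemma memW_dPhi (h : Adm σ) (hν : 0 < ν) (hω : 0 < ω) :
    MemW (dPhi σ ν ω) ∧
      wNorm (dPhi σ ν ω) ≤ qSol σ ν ω / (4 * σ * ω) + qSol σ ν ω / (2 * √ω) := by
  have hs : 0 < √ω := Real.sqrt_pos.2 hω
  have hQ := qSol_pos (σ := σ) hν hω
  have hσ := h.pos
  have h1 : 0 ≤ qSol σ ν ω / (4 * σ * ω) := by positivity
  have h2 : 0 ≤ qSol σ ν ω / (2 * √ω) := by positivity
  refine memW_of_components (Fin.forall_fin_two.2 ⟨?_, ?_⟩) (by positivity)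
    (Fin.forall_fin_two.2 ⟨fun x => ?_, fun x => ?_⟩)
  · simp only [dPhi_eq h hν hω, Matrix.cons_val_zero]
    exact ((measurable_ek _ _).const_mul _).sub ((measurable_ek _ _).const_mul _)
  · simp only [dPhi_eq h hν hω, Matrix.cons_val_one]; exact measurable_const
  · rw [dPhi_eq h hν hω, Matrix.cons_val_zero, add_mul]
    refine (norm_sub_le _ _).trans ?_
    rw [norm_mul, norm_mul, norm_real, norm_real, Real.norm_of_nonneg h1, Real.norm_of_nonneg h2]
    exact add_le_add (mul_le_mul_of_nonneg_left (norm_ek_zero_le hs.le x) h1)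
      (mul_le_mul_of_nonneg_left (norm_ek_one_le hs.le x) h2)
  · simp only [dPhi_eq h hν hω, Matrix.cons_val_one, Matrix.cons_val_fin_one, norm_zero]
    exact mul_nonneg (add_nonneg h1 h2) (wt_pos x).le

/-- A combination of the discrete modes at frequency `ω`. -/
def modes (σ ν ω : ℝ) (c₁ c₂ c₃ c₄ : ℂ) : Field2 := fun x =>
  c₁ • J (Phi σ ν ω x) + c₂ • dPhi σ ν ω x + c₃ • Psi σ ω x + c₄ • PsiStar σ ω x

lemma exists_modes_bound (h : Adm σ) (hν : 0 < ν) (hlo : 0 < lo) (hl : lo < hi) :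
    ∃ M > 0, ∀ ω ∈ Icc lo hi, ∀ c₁ c₂ c₃ c₄ : ℂ, MemW (modes σ ν ω c₁ c₂ c₃ c₄) ∧
      wNorm (modes σ ν ω c₁ c₂ c₃ c₄) ≤ M * (‖c₁‖ + ‖c₂‖ + ‖c₃‖ + ‖c₄‖) := by
  obtain ⟨A, hA, hA'⟩ := (good_qSol (σ := σ) hν hlo hl).bound
  obtain ⟨B, hB, hB'⟩ := (good_dqSol h hν hlo hl).bound
  obtain ⟨D, hD, hD'⟩ := (good_scale (σ := σ) hν hlo hl 0 1 1 0).bound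
  have hC := h.Cc_pos
  refine ⟨A + B + D + (1 + Cc σ), by positivity, fun ω hω c₁ c₂ c₃ c₄ => ?_⟩
  have hω' := Icc_pos hlo hω
  have hs : 0 < √ω := Real.sqrt_pos.2 hω'
  have hQ := qSol_pos (σ := σ) hν hω'
  have hσ := h.pos
  have a := hA' ω hω ω hω
  have b := hB' ω hω ω hω
  have d := hD' ω hω ω hω
  rw [norm_real, Real.norm_of_nonneg (by positivity)] at a b d
  have d' : qSol σ ν ω / (2 * √ω) ≤ D := by
    refine le_trans ?_ d
    rw [pow_zero, pow_one, pow_one, pow_zero, div_one, one_div_mul_eq_div]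
    gcongr
    linarith
  obtain ⟨m1, n1⟩ := memW_JPhi (σ := σ) hν hω'
  obtain ⟨m2, n2⟩ := memW_dPhi h hν hω'
  obtain ⟨m3, n3⟩ := memW_Psi h hω'
  obtain ⟨m4, n4⟩ := memW_PsiStar h hω'
  have k1 := m1.smul c₁
  have k2 := m2.smul c₂
  have k3 := m3.smul c₃
  have k4 := m4.smul c₄
  have s1 := k1.1.add k2.1
  have s2 := s1.1.add k3.1
  have s3 := s2.1.add k4.1
  refine ⟨s3.1, s3.2.trans ?_⟩
  have t1 := mul_le_mul_of_nonneg_left (n1.trans a) (norm_nonneg c₁)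
  have t2 := mul_le_mul_of_nonneg_left (n2.trans (add_le_add b d')) (norm_nonneg c₂)
  have t3 := mul_le_mul_of_nonneg_left n3 (norm_nonneg c₃)
  have t4 := mul_le_mul_of_nonneg_left n4 (norm_nonneg c₄)
  have u1 := k1.2
  have u2 := k2.2
  have u3 := k3.2
  have u4 := k4.2
  have v1 := s1.2
  have v2 := s2.2
  have p1 := norm_nonneg c₁
  have p2 := norm_nonneg c₂
  have p3 := norm_nonneg c₃
  have p4 := norm_nonneg c₄
  have q1 : ‖c₁‖ * A ≤ ‖c₁‖ * (A + B + D + (1 + Cc σ)) := mul_le_mul_of_nonneg_left (by linarith) p1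
  have q2 : ‖c₂‖ * (B + D) ≤ ‖c₂‖ * (A + B + D + (1 + Cc σ)) := mul_le_mul_of_nonneg_left (by linarith) p2
  have q3 : ‖c₃‖ * (1 + Cc σ) ≤ ‖c₃‖ * (A + B + D + (1 + Cc σ)) := mul_le_mul_of_nonneg_left (by linarith) p3
  have q4 : ‖c₄‖ * (1 + Cc σ) ≤ ‖c₄‖ * (A + B + D + (1 + Cc σ)) := mul_le_mul_of_nonneg_left (by linarith) p4
  linarith

/-! ### Functionals depending Lipschitz continuously on the frequency -/

/-- The functionals `F · ω` are bounded and Lipschitz in `ω` with respect to the weighted norm. -/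
def LipFun (lo hi : ℝ) (F : Field2 → ℝ → ℂ) : Prop :=
  ∃ M > 0, ∀ f, MemW f → ∀ ω ∈ Icc lo hi, ‖F f ω‖ ≤ M * wNorm f ∧
    ∀ ω' ∈ Icc lo hi, ‖F f ω - F f ω'‖ ≤ M * |ω - ω'| * wNorm f

namespace LipFun

variable {F G : Field2 → ℝ → ℂ}

lemma congr (hF : LipFun lo hi F) (h : ∀ f, MemW f → ∀ ω ∈ Icc lo hi, G f ω = F f ω) :
    LipFun lo hi G := by
  obtain ⟨M, hM, hF⟩ := hF
  refine ⟨M, hM, fun f hf ω hω => ?_⟩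
  rw [h f hf ω hω]
  refine ⟨(hF f hf ω hω).1, fun ω' hω' => ?_⟩
  rw [h f hf ω' hω']
  exact (hF f hf ω hω).2 ω' hω'

lemma add (hF : LipFun lo hi F) (hG : LipFun lo hi G) : LipFun lo hi (fun f ω => F f ω + G f ω) := by
  obtain ⟨M, hM, hF⟩ := hF
  obtain ⟨N, hN, hG⟩ := hG
  refine ⟨M + N, by positivity, fun f hf ω hω => ⟨?_, fun ω' hω' => ?_⟩⟩
  · rw [add_mul]; exact norm_add_le_of_le (hF f hf ω hω).1 (hG f hf ω hω).1
  · rw [add_sub_add_comm, add_mul, add_mul]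
    exact norm_add_le_of_le ((hF f hf ω hω).2 ω' hω') ((hG f hf ω hω).2 ω' hω')

lemma mul {c : ℝ → ℂ} (hF : LipFun lo hi F) (hc : Good lo hi (fun _ => c)) :
    LipFun lo hi (fun f ω => c ω * F f ω) := by
  obtain ⟨M, hM, hF⟩ := hF
  obtain ⟨A, hA, hc₁⟩ := hc.bound
  obtain ⟨B, hB, hc₂⟩ := hc.lipschitz
  refine ⟨A * M + B * M, by positivity, fun f hf ω hω => ⟨?_, fun ω' hω' => ?_⟩⟩
  · have h1 : 0 ≤ B * M * wNorm f := mul_nonneg (by positivity) (wNorm_nonneg f)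
    rw [norm_mul, add_mul]
    have := mul_le_mul (hc₁ ω hω ω hω) (hF f hf ω hω).1 (norm_nonneg _) hA.le
    linarith
  · have e : c ω * F f ω - c ω' * F f ω' = c ω * (F f ω - F f ω') + (c ω - c ω') * F f ω' := by ring
    rw [e]
    refine (norm_add_le _ _).trans ?_
    rw [norm_mul, norm_mul]
    have h1 := mul_le_mul (hc₁ ω hω ω hω) ((hF f hf ω hω).2 ω' hω') (norm_nonneg _) hA.le
    have h2 := mul_le_mul (hc₂ ω hω ω hω ω' hω') (hF f hf ω' hω').1 (norm_nonneg _) (by positivity)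
    linarith

lemma neg (hF : LipFun lo hi F) : LipFun lo hi (fun f ω => -F f ω) :=
  (hF.mul (Good.const (-1))).congr fun _ _ _ _ => by ring

lemma sub (hF : LipFun lo hi F) (hG : LipFun lo hi G) : LipFun lo hi (fun f ω => F f ω - G f ω) :=
  (hF.add hG.neg).congr fun _ _ _ _ => sub_eq_add_neg _ _

end LipFun

/-- A mean value estimate in the rate: the derivative costs one power of |x|, and the lower bound m
of both rates makes the majorant uniform. -/
lemma er_sub_le (n : ℕ) {k l m : ℝ} (hk : m ≤ k) (hl : m ≤ l) (x : E3) :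
    |er n k x - er n l x| ≤ |k - l| * er (n + 1) m x := by
  wlog h : k ≤ l generalizing k l
  · rw [abs_sub_comm, abs_sub_comm k l]; exact this hl hk (le_of_not_ge h)
  have h0 : 0 ≤ er n k x - er n l x := sub_nonneg.2 (er_anti n h x)
  rw [abs_of_nonneg h0, abs_sub_comm, abs_of_nonneg (sub_nonneg.2 h)]
  refine le_trans ?_ (mul_le_mul_of_nonneg_left (er_anti (n + 1) hk x) (sub_nonneg.2 h))
  have e : Real.exp (-l * ‖x‖) = Real.exp (-k * ‖x‖) * Real.exp (-((l - k) * ‖x‖)) := by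
    rw [← Real.exp_add]; congr 1; ring
  have h1 := Real.add_one_le_exp (-((l - k) * ‖x‖))
  have h2 : Real.exp (-k * ‖x‖) - Real.exp (-l * ‖x‖) ≤ (l - k) * ‖x‖ * Real.exp (-k * ‖x‖) := by
    rw [e]; nlinarith [Real.exp_pos (-k * ‖x‖)]
  have h3 : 0 ≤ ‖x‖ ^ n / (4 * Real.pi * ‖x‖) := by have := Real.pi_pos; positivity
  have := mul_le_mul_of_nonneg_left h2 h3
  simp only [er]
  calc _ = ‖x‖ ^ n / (4 * Real.pi * ‖x‖) * (Real.exp (-k * ‖x‖) - Real.exp (-l * ‖x‖)) := by ring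
    _ ≤ _ := this
    _ = _ := by ring

lemma MemW.pe_sub_le {f : Field2} (h : MemW f) (i : Fin 2) (n : ℕ) {k l m : ℝ} (hm : 0 < m)
    (hk : m ≤ k) (hl : m ≤ l) :
    ‖pe n k (fun x => f x i) - pe n l (fun x => f x i)‖ ≤ wNorm f * |k - l| * wInt (n + 1) m := by
  have hb : ∀ᵐ x, ‖f x i * ek n (k : ℂ) x - f x i * ek n (l : ℂ) x‖
      ≤ wNorm f * |k - l| * (wt x * er (n + 1) m x) := by
    filter_upwards [h.ae_le_apply i] with x hx
    rw [← mul_sub, norm_mul, ← ofReal_er, ← ofReal_er, ← ofReal_sub, norm_real, Real.norm_eq_abs]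
    calc _ ≤ (wNorm f * wt x) * (|k - l| * er (n + 1) m x) :=
          mul_le_mul hx (er_sub_le n hk hl x) (abs_nonneg _) (mul_nonneg (wNorm_nonneg f) (wt_pos x).le)
      _ = _ := by ring
  have := norm_integral_le_of_norm_le ((wt_er_integrable (n + 1) hm).const_mul (wNorm f * |k - l|)) hb
  rw [integral_const_mul] at this
  unfold pe
  rwa [← integral_sub (h.pairable i n k (hm.trans_le hk)) (h.pairable i n l (hm.trans_le hl))]

lemma lipFun_pe (hν : 0 < ν) (hlo : 0 < lo) (hl : lo < hi) (i : Fin 2) (n : ℕ) {c : ℝ} (hc : 0 < c) :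
    LipFun lo hi (fun f ω => pe n (c * √ω) (fun x => f x i)) := by
  obtain ⟨B, hB, hB'⟩ := (good_scale (σ := 1) hν hlo hl 1 0 0 0).lipschitz
  have hs : 0 < √lo := Real.sqrt_pos.2 hlo
  have h0 := wInt_nonneg n (c * √lo)
  have h1 := wInt_nonneg (n + 1) (c * √lo)
  refine ⟨wInt n (c * √lo) + c * B * wInt (n + 1) (c * √lo) + 1, by positivity, fun f hf ω hω => ?_⟩
  have hw := wNorm_nonneg f
  have hm : 0 < c * √lo := by positivity
  have hge : ∀ s ∈ Icc lo hi, c * √lo ≤ c * √s := fun s hs =>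
    mul_le_mul_of_nonneg_left (Real.sqrt_le_sqrt hs.1) hc.le
  have hx : 0 ≤ c * B * wInt (n + 1) (c * √lo) * wNorm f := by positivity
  have hy : 0 ≤ wInt n (c * √lo) * wNorm f := by positivity
  constructor
  · have := hf.pe_le i n (hm.trans_le (hge ω hω))
    have := this.trans (mul_le_mul_of_nonneg_left (wInt_anti n hm (hge ω hω)) hw)
    linarith
  · intro ω' hω'
    have h2 := hf.pe_sub_le i n hm (hge ω hω) (hge ω' hω')
    have h3 := hB' ω hω ω hω ω' hω'
    simp only [pow_one, pow_zero, div_one, mul_one] at h3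
    rw [← ofReal_sub, norm_real, Real.norm_eq_abs] at h3
    have h4 : |c * √ω - c * √ω'| ≤ c * (B * |ω - ω'|) := by
      rw [← mul_sub, abs_mul, abs_of_pos hc]
      exact mul_le_mul_of_nonneg_left h3 hc.le
    have h5 : wNorm f * |c * √ω - c * √ω'| * wInt (n + 1) (c * √lo)
        ≤ wNorm f * (c * (B * |ω - ω'|)) * wInt (n + 1) (c * √lo) := by gcongr
    have h6 : 0 ≤ (wInt n (c * √lo) + 1) * |ω - ω'| * wNorm f := by positivity
    linarith

lemma lipFun_pe_one (hν : 0 < ν) (hlo : 0 < lo) (hl : lo < hi) (i : Fin 2) (n : ℕ) :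
    LipFun lo hi (fun f ω => pe n √ω (fun x => f x i)) := by
  simpa using lipFun_pe hν hlo hl i n one_pos

lemma lipFun_dPhi (h : Adm σ) (hν : 0 < ν) (hlo : 0 < lo) (hl : lo < hi) :
    LipFun lo hi (fun f ω => Om f (dPhi σ ν ω) / Delta σ ν ω) := by
  refine ((((lipFun_pe_one hν hlo hl 1 0).mul (good_dqSol h hν hlo hl)).sub
    ((lipFun_pe_one hν hlo hl 1 1).mul ((good_scale (σ := σ) hν hlo hl 0 1 1 0).div_const hl 2))).mul
      (good_inv_Delta h hν hlo hl)).congr fun f hf ω hω => ?_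
  rw [Om_dPhi h hν (Icc_pos hlo hω) hf.pairable, div_eq_inv_mul, one_div]
  push_cast
  simp only [pow_zero, pow_one, div_one]
  ring

lemma lipFun_JPhi (h : Adm σ) (hν : 0 < ν) (hlo : 0 < lo) (hl : lo < hi) :
    LipFun lo hi (fun f ω => Om f (fun x => J (Phi σ ν ω x)) / Delta σ ν ω) := by
  refine ((((lipFun_pe_one hν hlo hl 0 0).mul (good_qSol (σ := σ) hν hlo hl)).neg).mul
      (good_inv_Delta h hν hlo hl)).congr fun f hf ω hω => ?_
  rw [Om_JPhi, div_eq_inv_mul, one_div]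

lemma lipFun_PsiStar (h : Adm σ) (hν : 0 < ν) (hlo : 0 < lo) (hl : lo < hi) :
    LipFun lo hi (fun f ω => Om f (PsiStar σ ω) / kappa σ ω) := by
  refine (((((lipFun_pe hν hlo hl 0 0 h.a0_pos).add ((lipFun_pe hν hlo hl 0 0 h.b0_pos).mul
    (Good.const (Cc σ)))).mul (Good.const I)).add ((lipFun_pe hν hlo hl 1 0 h.a0_pos).sub
    ((lipFun_pe hν hlo hl 1 0 h.b0_pos).mul (Good.const (Cc σ))))).mul
      (good_inv_kappa h hν hlo hl)).congr fun f hf ω hω => ?_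
  rw [Om_PsiStar h (Icc_pos hlo hω) hf.pairable, div_eq_inv_mul, one_div]

lemma lipFun_Psi (h : Adm σ) (hν : 0 < ν) (hlo : 0 < lo) (hl : lo < hi) :
    LipFun lo hi (fun f ω => Om f (Psi σ ω) / kappa σ ω) := by
  refine (((((lipFun_pe hν hlo hl 0 0 h.a0_pos).add ((lipFun_pe hν hlo hl 0 0 h.b0_pos).mul
    (Good.const (Cc σ)))).mul (Good.const (-I))).add ((lipFun_pe hν hlo hl 1 0 h.a0_pos).sub
    ((lipFun_pe hν hlo hl 1 0 h.b0_pos).mul (Good.const (Cc σ))))).mul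
      (good_inv_kappa h hν hlo hl)).congr fun f hf ω hω => ?_
  rw [Om_Psi h (Icc_pos hlo hω) hf.pairable, div_eq_inv_mul, one_div]

/-- The discrete part of a field. -/
lemma discrete_eq_modes (f : Field2) : (fun x => P0 σ ν ω f x + P1 σ ω f x)
    = modes σ ν ω (Om f (dPhi σ ν ω) / Delta σ ν ω)
      (-(Om f (fun y => J (Phi σ ν ω y)) / Delta σ ν ω)) (Om f (PsiStar σ ω) / kappa σ ω)
      (-(Om f (Psi σ ω) / kappa σ ω)) := by
  funext x
  simp only [P0, P1, modes, neg_smul]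
  abel

/-- The last clause is the source of the factor |ω_T - ω|: the four coefficients of the discrete
part are Lipschitz in the frequency, and they vanish at ω' when the two projections there vanish. -/
lemma exists_discrete_bound (h : Adm σ) (hν : 0 < ν) (hlo : 0 < lo) (hl : lo < hi) :
    ∃ M > 0, ∀ f, MemW f → ∀ ω ∈ Icc lo hi,
      MemW (fun x => P0 σ ν ω f x + P1 σ ω f x) ∧
      wNorm (fun x => P0 σ ν ω f x + P1 σ ω f x) ≤ M * wNorm f ∧
      ∀ ω' ∈ Icc lo hi, P0 σ ν ω' f = 0 → P1 σ ω' f = 0 →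
        wNorm (fun x => P0 σ ν ω f x + P1 σ ω f x) ≤ M * |ω - ω'| * wNorm f := by
  obtain ⟨M, hM, hm⟩ := exists_modes_bound h hν hlo hl
  obtain ⟨A, hA, ha⟩ := lipFun_dPhi h hν hlo hl
  obtain ⟨B, hB, hb⟩ := lipFun_JPhi h hν hlo hl
  obtain ⟨D, hD, hd⟩ := lipFun_PsiStar h hν hlo hl
  obtain ⟨E, hE, he⟩ := lipFun_Psi h hν hlo hl
  refine ⟨M * (A + B + D + E), by positivity, fun f hf ω hω => ?_⟩
  rw [discrete_eq_modes]
  obtain ⟨m1, m2⟩ := hm ω hω (Om f (dPhi σ ν ω) / Delta σ ν ω)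
      (-(Om f (fun y => J (Phi σ ν ω y)) / Delta σ ν ω)) (Om f (PsiStar σ ω) / kappa σ ω)
      (-(Om f (Psi σ ω) / kappa σ ω))
  rw [norm_neg, norm_neg] at m2
  refine ⟨m1, m2.trans ?_, fun ω' hω' h0 h1 => m2.trans ?_⟩
  · rw [mul_assoc]
    refine mul_le_mul_of_nonneg_left ?_ hM.le
    linarith [(ha f hf ω hω).1, (hb f hf ω hω).1, (hd f hf ω hω).1, (he f hf ω hω).1]
  · rw [mul_assoc, mul_assoc]
    refine mul_le_mul_of_nonneg_left ?_ hM.le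
    have hω'' := Icc_pos hlo hω'
    obtain ⟨z1, z2⟩ := P0_eq_zero h hν hω'' h0
    obtain ⟨z3, z4⟩ := P1_eq_zero h hω'' h1
    have a := (ha f hf ω hω).2 ω' hω'
    have b := (hb f hf ω hω).2 ω' hω'
    have d := (hd f hf ω hω).2 ω' hω'
    have e := (he f hf ω hω).2 ω' hω'
    simp only [z1, z2, z3, z4, zero_div, sub_zero] at a b d e
    linarith

lemma MemW.Pc_memW (h : Adm σ) (hν : 0 < ν) (hlo : 0 < lo) (hl : lo < hi) :
    ∃ M > 0, ∀ f, MemW f → ∀ ω ∈ Icc lo hi, MemW (Pc σ ν ω f) ∧ wNorm (Pc σ ν ω f) ≤ M * wNorm f := by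
  obtain ⟨M, hM, hm⟩ := exists_discrete_bound h hν hlo hl
  refine ⟨1 + M, by positivity, fun f hf ω hω => ?_⟩
  obtain ⟨m1, m2, -⟩ := hm f hf ω hω
  have e : Pc σ ν ω f = fun x => f x + (-1 : ℂ) • (P0 σ ν ω f x + P1 σ ω f x) := by
    funext x; simp only [Pc, neg_smul, one_smul]; abel
  have k := m1.smul (-1)
  have s := hf.add k.1
  rw [e]
  refine ⟨s.1, s.2.trans ?_⟩
  have := k.2
  rw [norm_neg, norm_one, one_mul] at this
  linarith

end ConcNLS

end


noncomputable section

namespace ConcNLS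

open MeasureTheory Complex ComplexConjugate Set Filter Topology

variable {σ ν ω τ lo hi : ℝ}

/-! ### The quadratic correction -/

lemma exists_chargeV_bound : ∃ C > 0, ∀ (f : Field2) (p : Fin 2 → ℂ), HasChargeV f p → MemW f →
    ‖p‖ ≤ C * wNorm f := by
  obtain ⟨C, hC, hb⟩ := exists_charge_bound
  exact ⟨C, hC, fun f p hp hf => (pi_norm_le_iff_of_nonneg (mul_nonneg hC.le (wNorm_nonneg f))).2
    fun i => hb _ _ _ (hp i) (hf.ae_le_apply i)⟩

/-- The coefficients of the outgoing field at unit frequency. -/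
def outMat (σ : ℝ) : Matrix (Fin 2) (Fin 2) ℂ :=
  (boundaryMatrix σ 1 (√(1 + 2 * xi σ 1) : ℝ) (I * (√(2 * xi σ 1 - 1) : ℝ)))⁻¹

/-- The identity also covers a singular matrix, where both inverses are zero by convention. The
bounds on the outgoing field therefore require no check of the determinant. -/
lemma smul_inv_matrix (s : ℂ) (hs : s ≠ 0) (A : Matrix (Fin 2) (Fin 2) ℂ) :
    (s • A)⁻¹ = s⁻¹ • A⁻¹ := by
  by_cases hA : IsUnit A.det
  · have := invertibleOfNonzero hs
    rw [Matrix.inv_smul A s hA, invOf_eq_inv]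
  · have hA' : ¬ IsUnit (s • A).det := by
      rw [isUnit_iff_ne_zero, not_not] at hA ⊢
      rw [Matrix.det_smul, hA, mul_zero]
    rw [Matrix.nonsing_inv_apply_not_isUnit _ hA, Matrix.nonsing_inv_apply_not_isUnit _ hA', smul_zero]

lemma xi_eq_mul (σ τ : ℝ) : xi σ τ = τ * xi σ 1 := by simp only [xi]; ring

/-- Scaling: ξ is proportional to the frequency, so the point interactions and both exponents are √τ
times their values at unit frequency. The dependence of the outgoing coefficients on τ is a scalar
factor. -/
lemma boundaryMatrix_inv (hτ : 0 < τ) :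
    (boundaryMatrix σ τ (√(τ + 2 * xi σ τ) : ℝ) (I * (√(2 * xi σ τ - τ) : ℝ)))⁻¹
      = ((√τ : ℝ) : ℂ)⁻¹ • outMat σ := by
  rw [outMat, ← smul_inv_matrix _ (sqrt_ne hτ)]
  congr 1
  rw [xi_eq_mul σ τ, show τ + 2 * (τ * xi σ 1) = τ * (1 + 2 * xi σ 1) by ring,
    show 2 * (τ * xi σ 1) - τ = τ * (2 * xi σ 1 - 1) by ring, Real.sqrt_mul hτ.le, Real.sqrt_mul hτ.le]
  simp only [boundaryMatrix, Real.sqrt_one, Matrix.smul_of, Matrix.smul_cons, smul_eq_mul,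
    Matrix.smul_empty]
  push_cast
  congr 1
  refine funext (Fin.forall_fin_two.2 ⟨funext (Fin.forall_fin_two.2 ⟨?_, ?_⟩),
    funext (Fin.forall_fin_two.2 ⟨?_, ?_⟩)⟩)
  all_goals
    simp only [Matrix.cons_val_zero, Matrix.cons_val_one]
    ring

/-- The coefficients of the outgoing field. -/
def outCoef (σ τ : ℝ) (v : Fin 2 → ℂ) (i : Fin 2) : ℂ :=
  ((√τ : ℝ) : ℂ)⁻¹ * (outMat σ i 0 * v 0 + outMat σ i 1 * v 1)

lemma outgoing_eq (hτ : 0 < τ) (v : Fin 2 → ℂ) (x : E3) :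
    outgoing σ τ v x = outCoef σ τ v 0 • ek 0 ((√(τ + 2 * xi σ τ) : ℝ) : ℂ) x • ![1, -I]
      + outCoef σ τ v 1 • ek 0 (I * ((√(2 * xi σ τ - τ) : ℝ) : ℂ)) x • ![1, I] := by
  simp only [outgoing, boundaryMatrix_inv hτ, Gk_eq, Matrix.mulVec, dotProduct, Fin.sum_univ_two,
    outCoef, Matrix.smul_apply, smul_eq_mul, mul_assoc, ← mul_add]

/-- Separates the two frequencies: the source carries ω, the fields at the two unit sources carry
only the frozen τ. -/
lemma outgoing_linear (hτ : 0 < τ) (v : Fin 2 → ℂ) :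
    outgoing σ τ v = fun x => (fun y => v 0 • outgoing σ τ ![1, 0] y) x + v 1 • outgoing σ τ ![0, 1] x := by
  funext x
  simp only [outgoing_eq hτ, outCoef, Matrix.cons_val_zero, Matrix.cons_val_one]
  funext i
  simp only [Pi.add_apply, Pi.smul_apply, smul_eq_mul]
  ring

lemma outgoing_apply (hτ : 0 < τ) (v : Fin 2 → ℂ) :
    (∀ x, outgoing σ τ v x 0 = outCoef σ τ v 0 * ek 0 ((√(τ + 2 * xi σ τ) : ℝ) : ℂ) x
      + outCoef σ τ v 1 * ek 0 (I * ((√(2 * xi σ τ - τ) : ℝ) : ℂ)) x) ∧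
    ∀ x, outgoing σ τ v x 1 = (-I * outCoef σ τ v 0) * ek 0 ((√(τ + 2 * xi σ τ) : ℝ) : ℂ) x
      + (I * outCoef σ τ v 1) * ek 0 (I * ((√(2 * xi σ τ - τ) : ℝ) : ℂ)) x := by
  constructor <;> intro x <;>
  · simp only [outgoing_eq hτ, Pi.add_apply, Pi.smul_apply, smul_eq_mul, Matrix.cons_val_zero,
      Matrix.cons_val_one, Matrix.cons_val_fin_one]
    ring

lemma re_I_mul_ofReal (r : ℝ) : (I * (r : ℂ)).re = 0 := by simp

lemma exists_hasChargeV {f : Field2} (h0 : ∃ p, HasCharge (fun x => f x 0) p)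
    (h1 : ∃ p, HasCharge (fun x => f x 1) p) : ∃ p, HasChargeV f p := by
  obtain ⟨p, hp⟩ := h0
  obtain ⟨q, hq⟩ := h1
  exact ⟨![p, q], Fin.forall_fin_two.2 ⟨hp, hq⟩⟩

lemma hasChargeV_outgoing (hτ : 0 < τ) (v : Fin 2 → ℂ) : ∃ p, HasChargeV (outgoing σ τ v) p := by
  obtain ⟨h0, h1⟩ := outgoing_apply (σ := σ) hτ v
  have c1 := hasCharge_ek_zero (k := ((√(τ + 2 * xi σ τ) : ℝ) : ℂ)) (by simp)
  have c2 := hasCharge_ek_zero (k := I * ((√(2 * xi σ τ - τ) : ℝ) : ℂ)) (re_I_mul_ofReal _).ge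
  refine exists_hasChargeV ?_ ?_
  · simp only [h0]; exact ⟨_, (c1.const_mul _).add (c2.const_mul _)⟩
  · simp only [h1]; exact ⟨_, (c1.const_mul _).add (c2.const_mul _)⟩

lemma memW_outgoing (hτ : 0 < τ) (v : Fin 2 → ℂ) : MemW (outgoing σ τ v) ∧
    wNorm (outgoing σ τ v) ≤ ‖outCoef σ τ v 0‖ + ‖outCoef σ τ v 1‖ := by
  obtain ⟨h0, h1⟩ := outgoing_apply (σ := σ) hτ v
  have e : ∀ (c d : ℂ) x, ‖c‖ = ‖outCoef σ τ v 0‖ → ‖d‖ = ‖outCoef σ τ v 1‖ →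
      ‖c * ek 0 ((√(τ + 2 * xi σ τ) : ℝ) : ℂ) x + d * ek 0 (I * ((√(2 * xi σ τ - τ) : ℝ) : ℂ)) x‖
        ≤ (‖outCoef σ τ v 0‖ + ‖outCoef σ τ v 1‖) * wt x := by
    intro c d x hc hd
    refine (norm_add_le _ _).trans ?_
    rw [norm_mul, norm_mul, hc, hd, add_mul]
    exact add_le_add (mul_le_mul_of_nonneg_left (norm_ek_zero_le (by simp) x) (norm_nonneg _))
      (mul_le_mul_of_nonneg_left (norm_ek_zero_le (re_I_mul_ofReal _).ge x) (norm_nonneg _))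
  refine memW_of_components (Fin.forall_fin_two.2 ⟨?_, ?_⟩) (by positivity)
    (Fin.forall_fin_two.2 ⟨fun x => ?_, fun x => ?_⟩)
  · simp only [h0]; exact ((measurable_ek _ _).const_mul _).add ((measurable_ek _ _).const_mul _)
  · simp only [h1]; exact ((measurable_ek _ _).const_mul _).add ((measurable_ek _ _).const_mul _)
  · rw [h0]; exact e _ _ x rfl rfl
  · rw [h1]; exact e _ _ x (by simp) (by simp)

lemma static_eq (m : ℂ) : static σ τ m = fun x => m • static σ τ 1 x := by
  funext x
  refine funext (Fin.forall_fin_two.2 ⟨?_, ?_⟩)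
  · simp only [static, Pi.smul_apply, smul_eq_mul, Matrix.cons_val_zero]; ring
  · simp only [static, Pi.smul_apply, smul_eq_mul, Matrix.cons_val_one, Matrix.cons_val_fin_one,
      mul_zero]

lemma hasChargeV_static (hτ : 0 < τ) (m : ℂ) : ∃ p, HasChargeV (static σ τ m) p := by
  refine exists_hasChargeV ?_ ?_
  · simp only [static, Gk_eq, Matrix.cons_val_zero]
    exact ⟨_, (hasCharge_ek_zero_real (Real.sqrt_pos.2 hτ)).const_mul _⟩
  · simp only [static, Matrix.cons_val_one, Matrix.cons_val_fin_one]; exact ⟨_, HasCharge.zero⟩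

lemma memW_static (m : ℂ) : MemW (static σ τ m) ∧
    wNorm (static σ τ m) ≤ ‖4 * Real.pi * m / (2 * σ * √τ : ℝ)‖ := by
  refine memW_of_components (Fin.forall_fin_two.2 ⟨?_, ?_⟩) (by positivity)
    (Fin.forall_fin_two.2 ⟨fun x => ?_, fun x => ?_⟩)
  · simp only [static, Gk_eq, Matrix.cons_val_zero]; exact (measurable_ek _ _).const_mul _
  · simp only [static, Matrix.cons_val_one, Matrix.cons_val_fin_one]; exact measurable_const
  · simp only [static, Gk_eq, Matrix.cons_val_zero]
    rw [norm_mul, norm_neg]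
    exact mul_le_mul_of_nonneg_left (norm_ek_zero_le (by simp) x) (norm_nonneg _)
  · simp only [static, Matrix.cons_val_one, Matrix.cons_val_fin_one, norm_zero]
    exact mul_nonneg (norm_nonneg _) (wt_pos x).le

lemma Pc_smul (h : Adm σ) (hν : 0 < ν) (hω : 0 < ω) {f : Field2} (hf : Pairable f) (c : ℂ) :
    Pc σ ν ω (fun x => c • f x) = fun x => c • Pc σ ν ω f x := by
  have hz : Pairable (fun _ => 0) := by simpa using hf.smul 0
  have h1 := Pc_add_smul h hν hω hz hf c
  -- Applied to the zero field with scalar -1, linearity says that the image of zero is zero.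
  have h0 := Pc_add_smul h hν hω hz hz (-1)
  simp only [zero_add, smul_zero] at h1 h0
  have h2 : ∀ x, Pc σ ν ω (fun _ => 0) x = 0 := fun x => by
    have := congrFun h0 x
    simp only [neg_smul, one_smul] at this
    rw [this]; abel
  rw [h1]
  funext x
  rw [h2, zero_add]

/-- The charges of the projected unit sources. -/
def srcCharge (σ ν τ : ℝ) (v : Fin 2 → ℂ) : Fin 2 → ℂ := chargeV (Pc σ ν τ (outgoing σ τ v))

def staticCharge (σ ν τ : ℝ) : Fin 2 → ℂ := chargeV (Pc σ ν τ (static σ τ 1))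

lemma hasChargeV_Pc_of (h : Adm σ) (hν : 0 < ν) (hτ : 0 < τ) {f : Field2} (hf : ∃ p, HasChargeV f p) :
    HasChargeV (Pc σ ν τ f) (chargeV (Pc σ ν τ f)) := by
  obtain ⟨p, hp⟩ := hf
  have := hp.Pc h hν hτ
  rwa [this.chargeV_eq]

lemma hasChargeV_a20 (h : Adm σ) (hν : 0 < ν) (hτ : 0 < τ) (v : Fin 2 → ℂ) :
    HasChargeV (Pc σ ν τ (outgoing σ τ v))
      (v 0 • srcCharge σ ν τ ![1, 0] + v 1 • srcCharge σ ν τ ![0, 1]) := by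
  have p1 := (memW_outgoing (σ := σ) hτ ![1, 0]).1.pairable
  have p2 := (memW_outgoing (σ := σ) hτ ![0, 1]).1.pairable
  rw [outgoing_linear hτ, Pc_add_smul h hν hτ (p1.smul _) p2, Pc_smul h hν hτ p1]
  exact ((hasChargeV_Pc_of h hν hτ (hasChargeV_outgoing hτ _)).smul _).add
    ((hasChargeV_Pc_of h hν hτ (hasChargeV_outgoing hτ _)).smul _)

lemma hasChargeV_a11 (h : Adm σ) (hν : 0 < ν) (hτ : 0 < τ) (m : ℂ) :
    HasChargeV (Pc σ ν τ (static σ τ m)) (m • staticCharge σ ν τ) := by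
  rw [static_eq, Pc_smul h hν hτ (memW_static 1).1.pairable]
  exact (hasChargeV_Pc_of h hν hτ (hasChargeV_static hτ _)).smul _

/-- Boundedness in τ is all that is required, because the frozen frequency never moves. It follows
from the bound of the charge by the weighted norm and the boundedness of the projection on the
weighted space. -/
lemma exists_srcCharge_bound (h : Adm σ) (hν : 0 < ν) (hlo : 0 < lo) (hl : lo < hi) (v : Fin 2 → ℂ) :
    ∃ M, ∀ τ ∈ Icc lo hi, ‖srcCharge σ ν τ v‖ ≤ M := by
  obtain ⟨C, hC, hb⟩ := exists_chargeV_bound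
  obtain ⟨A, hA, ha⟩ := MemW.Pc_memW h hν hlo hl
  obtain ⟨B, hB, hb'⟩ := (good_scale (σ := σ) hν hlo hl 0 1 0 0).bound
  set D := ‖outMat σ 0 0 * v 0 + outMat σ 0 1 * v 1‖ + ‖outMat σ 1 0 * v 0 + outMat σ 1 1 * v 1‖
  refine ⟨C * (A * (B * D)), fun τ hτ => ?_⟩
  have hτ' := Icc_pos hlo hτ
  obtain ⟨m1, m2⟩ := memW_outgoing (σ := σ) hτ' v
  obtain ⟨m3, m4⟩ := ha _ m1 τ hτ
  refine (hb _ _ (hasChargeV_Pc_of h hν hτ' (hasChargeV_outgoing hτ' v)) m3).trans ?_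
  refine mul_le_mul_of_nonneg_left (m4.trans (mul_le_mul_of_nonneg_left (m2.trans ?_) hA.le)) hC.le
  have := hb' τ hτ τ hτ
  simp only [pow_zero, pow_one, div_one, mul_one, one_div, ofReal_inv] at this
  simp only [outCoef, norm_mul, ← mul_add]
  exact mul_le_mul_of_nonneg_right this (by positivity)

lemma exists_staticCharge_bound (h : Adm σ) (hν : 0 < ν) (hlo : 0 < lo) (hl : lo < hi) :
    ∃ M, ∀ τ ∈ Icc lo hi, ‖staticCharge σ ν τ‖ ≤ M := by
  obtain ⟨C, hC, hb⟩ := exists_chargeV_bound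
  obtain ⟨A, hA, ha⟩ := MemW.Pc_memW h hν hlo hl
  obtain ⟨B, hB, hb'⟩ := (good_scale (σ := σ) hν hlo hl 0 1 0 0).bound
  refine ⟨C * (A * (B * ‖(4 * Real.pi / (2 * σ) : ℂ)‖)), fun τ hτ => ?_⟩
  have hτ' := Icc_pos hlo hτ
  obtain ⟨m1, m2⟩ := memW_static (σ := σ) (τ := τ) 1
  obtain ⟨m3, m4⟩ := ha _ m1 τ hτ
  refine (hb _ _ (hasChargeV_Pc_of h hν hτ' (hasChargeV_static hτ' 1)) m3).trans ?_
  refine mul_le_mul_of_nonneg_left (m4.trans (mul_le_mul_of_nonneg_left (m2.trans ?_) hA.le)) hC.le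
  have := hb' τ hτ τ hτ
  simp only [pow_zero, pow_one, div_one, mul_one, one_div, ofReal_inv] at this
  refine le_trans (le_of_eq ?_) (mul_le_mul_of_nonneg_right this (norm_nonneg _))
  rw [← norm_mul]
  congr 1
  push_cast
  rw [mul_one, ← div_div, div_eq_mul_inv, mul_comm]

lemma Good.of_component {A : ℝ → Fin 2 → ℂ} (hA : ∃ M, ∀ τ ∈ Icc lo hi, ‖A τ‖ ≤ M) (i : Fin 2) :
    Good lo hi (fun τ _ => A τ i) := by
  obtain ⟨M, hM⟩ := hA
  exact Good.of_bounded fun τ hτ => (norm_le_pi_norm _ i).trans (hM τ hτ)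

lemma chargeV_a20 (h : Adm σ) (hν : 0 < ν) (hτ : 0 < τ) (hω : 0 < ω) :
    HasChargeV (a20 σ ν τ ω) (chargeV (a20 σ ν τ ω)) ∧ chargeV (a20 σ ν τ ω) =
      N2 σ ν ω (pPsi σ) (pPsi σ) 0 • srcCharge σ ν τ ![1, 0]
      + N2 σ ν ω (pPsi σ) (pPsi σ) 1 • srcCharge σ ν τ ![0, 1] := by
  have := hasChargeV_a20 h hν hτ (N2 σ ν ω (pPsi σ) (pPsi σ))
  rw [a20, qPsi_eq h hω]
  rw [this.chargeV_eq]
  exact ⟨this, rfl⟩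

lemma chargeV_a11 (h : Adm σ) (hν : 0 < ν) (hτ : 0 < τ) (hω : 0 < ω) :
    HasChargeV (a11 σ ν τ ω) (chargeV (a11 σ ν τ ω)) ∧ chargeV (a11 σ ν τ ω) =
      (2 * N2 σ ν ω (pPsi σ) (cj (pPsi σ)) 0) • staticCharge σ ν τ := by
  have := hasChargeV_a11 h hν hτ (2 * N2 σ ν ω (pPsi σ) (cj (pPsi σ)) 0)
  rw [a11, qPsi_eq h hω, qPsiStar_eq h hω]
  rw [this.chargeV_eq]
  exact ⟨this, rfl⟩

lemma good_charge_a20 (h : Adm σ) (hν : 0 < ν) (hlo : 0 < lo) (hl : lo < hi) (i : Fin 2) :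
    Good lo hi (fun τ ω => chargeV (a20 σ ν τ ω) i) := by
  refine (((good_N2 h hν hlo hl (pPsi σ) (pPsi σ) 0).mul hl
      (Good.of_component (exists_srcCharge_bound h hν hlo hl ![1, 0]) i)).add hl
    ((good_N2 h hν hlo hl (pPsi σ) (pPsi σ) 1).mul hl
      (Good.of_component (exists_srcCharge_bound h hν hlo hl ![0, 1]) i))).congr fun τ hτ ω hω => ?_
  rw [(chargeV_a20 h hν (Icc_pos hlo hτ) (Icc_pos hlo hω)).2]
  rfl

lemma good_charge_a11 (h : Adm σ) (hν : 0 < ν) (hlo : 0 < lo) (hl : lo < hi) (i : Fin 2) :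
    Good lo hi (fun τ ω => chargeV (a11 σ ν τ ω) i) := by
  refine (((Good.const 2).mul hl (good_N2 h hν hlo hl (pPsi σ) (cj (pPsi σ)) 0)).mul hl
      (Good.of_component (exists_staticCharge_bound h hν hlo hl) i)).congr fun τ hτ ω hω => ?_
  rw [(chargeV_a11 h hν (Icc_pos hlo hτ) (Icc_pos hlo hω)).2]
  rfl

lemma hasChargeV_kCorr (h : Adm σ) (hν : 0 < ν) (hτ : 0 < τ) (hω : 0 < ω) (z : ℂ) :
    HasChargeV (kCorr σ ν τ ω z) (z ^ 2 • chargeV (a20 σ ν τ ω)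
      + (z * conj z) • chargeV (a11 σ ν τ ω) + conj z ^ 2 • cj (chargeV (a20 σ ν τ ω))) :=
  (((chargeV_a20 h hν hτ hω).1.smul _).add ((chargeV_a11 h hν hτ hω).1.smul _)).add
    ((chargeV_a20 h hν hτ hω).1.cj.smul _)

lemma memW_kCorr (h : Adm σ) (hν : 0 < ν) (hlo : 0 < lo) (hl : lo < hi) (hτ : τ ∈ Icc lo hi) (z : ℂ) :
    MemW (kCorr σ ν τ ω z) := by
  have hτ' := Icc_pos hlo hτ
  obtain ⟨A, hA, ha⟩ := MemW.Pc_memW h hν hlo hl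
  have m1 := (ha _ (memW_outgoing (σ := σ) hτ' (N2 σ ν ω (qPsi σ ω) (qPsi σ ω))).1 τ hτ).1
  have m2 := (ha _ (memW_static (σ := σ) (τ := τ) (2 * N2 σ ν ω (qPsi σ ω) (qPsiStar σ ω) 0)).1 τ hτ).1
  exact ((((m1.smul _).1).add ((m2.smul _).1)).1.add (((memW_cj m1).1.smul _).1)).1

/-- All three coefficients of k lie in the range of the frozen projection, by idempotency and, for
a₀₂, by compatibility with conjugation. -/
lemma Pc_kCorr (h : Adm σ) (hν : 0 < ν) (hlo : 0 < lo) (hl : lo < hi) (hτ : τ ∈ Icc lo hi) (z : ℂ) :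
    Pc σ ν τ (kCorr σ ν τ ω z) = kCorr σ ν τ ω z := by
  have hτ' := Icc_pos hlo hτ
  obtain ⟨A, hA, ha⟩ := MemW.Pc_memW h hν hlo hl
  have o1 := (memW_outgoing (σ := σ) hτ' (N2 σ ν ω (qPsi σ ω) (qPsi σ ω))).1
  have o2 := (memW_static (σ := σ) (τ := τ) (2 * N2 σ ν ω (qPsi σ ω) (qPsiStar σ ω) 0)).1
  have m1 := (ha _ o1 τ hτ).1
  have m2 := (ha _ o2 τ hτ).1
  have e1 : Pc σ ν τ (a20 σ ν τ ω) = a20 σ ν τ ω := Pc_idem h hν hτ' o1.pairable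
  have e2 : Pc σ ν τ (a11 σ ν τ ω) = a11 σ ν τ ω := Pc_idem h hν hτ' o2.pairable
  have e3 : Pc σ ν τ (a02 σ ν τ ω) = a02 σ ν τ ω := by
    unfold a02
    rw [Pc_cj h hν hτ', e1]
  have q1 : Pairable (a20 σ ν τ ω) := m1.pairable
  have q2 : Pairable (a11 σ ν τ ω) := m2.pairable
  have q3 : Pairable (a02 σ ν τ ω) := (memW_cj m1).1.pairable
  unfold kCorr
  rw [Pc_add_smul h hν hτ' ((q1.smul _).add (q2.smul _)) q3, Pc_add_smul h hν hτ' (q1.smul _) q2,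
    Pc_smul h hν hτ' q1, e1, e2, e3]

lemma good_Z21' (h : Adm σ) (hν : 0 < ν) (hlo : 0 < lo) (hl : lo < hi) :
    Good lo hi (fun τ ω => Z21' σ ν τ ω) := by
  refine ((((good_charge_a11 h hν hlo hl 0).mul hl ((good_Z10' h hν hlo hl 0).star hl)).add hl
    ((good_charge_a11 h hν hlo hl 1).mul hl ((good_Z10' h hν hlo hl 1).star hl))).add hl
    (((good_charge_a20 h hν hlo hl 0).mul hl ((good_Z01' h hν hlo hl 0).star hl)).add hl
    ((good_charge_a20 h hν hlo hl 1).mul hl ((good_Z01' h hν hlo hl 1).star hl)))).congr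
      fun τ hτ ω hω => ?_
  rfl

lemma good_iK (h : Adm σ) (hν : 0 < ν) (hlo : 0 < lo) (hl : lo < hi) :
    Good lo hi (fun τ ω => iK σ ν τ ω) := by
  have z11 := good_Z11 h hν hlo hl
  have z02 := good_Z02 h hν hlo hl
  have x := good_inv_xi (σ := σ) hν hlo hl
  refine (((((good_Z21 h hν hlo hl).add hl (good_Z21' h hν hlo hl)).add hl
    ((((Good.const I).mul hl x).mul hl (good_Z20 h hν hlo hl)).mul hl z11)).sub hl
    (((Good.const I).mul hl x).mul hl (z11.mul hl (z11.star hl)))).sub hl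
    (((Good.const (2 * I / 3)).mul hl x).mul hl (z02.mul hl (z02.star hl)))).congr fun τ hτ ω hω => ?_
  rw [iK, mul_conj', mul_conj']
  ring

end ConcNLS

end


noncomputable section

namespace ConcNLS

open MeasureTheory Complex ComplexConjugate Set Filter Topology

variable {σ ν ω lo hi : ℝ}

/-! ### Taylor expansion of the nonlinearity -/

/-- One integration of a Taylor remainder: the derivative is of order n, the function vanishes at 0,
so the function is of order n + 1. -/
lemma bound_of_deriv_bound {F E : ℝ → ℝ} {p C : ℝ} {n : ℕ}
    (hE : ∀ Y, |Y| ≤ 1 / 2 → |E Y| ≤ C * |Y| ^ n)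
    (hF : ∀ Y, |Y| ≤ 1 / 2 → HasDerivAt F (p * E Y) Y) (h0 : F 0 = 0) :
    ∀ Y, |Y| ≤ 1 / 2 → |F Y| ≤ |p| * C * |Y| ^ (n + 1) := by
  intro Y hY
  have hsub : ∀ s ∈ segment ℝ 0 Y, |s| ≤ |Y| := by
    intro s hs
    have := norm_sub_le_of_mem_segment hs
    simpa using this
  have hC : 0 ≤ C := by
    have := (abs_nonneg _).trans (hE (1 / 2) (by norm_num [abs_of_pos]))
    have h2 : 0 < |(1 / 2 : ℝ)| ^ n := by positivity
    exact nonneg_of_mul_nonneg_left this h2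
  have := (convex_segment (0 : ℝ) Y).norm_image_sub_le_of_norm_hasDerivWithin_le
    (f := F) (f' := fun s => p * E s) (C := |p| * (C * |Y| ^ n))
    (fun s hs => (hF s ((hsub s hs).trans hY)).hasDerivWithinAt) (fun s hs => ?_)
    (left_mem_segment ℝ 0 Y) (right_mem_segment ℝ 0 Y)
  · rw [h0, sub_zero, sub_zero, Real.norm_eq_abs, Real.norm_eq_abs] at this
    rw [pow_succ]
    linarith
  · rw [norm_mul, Real.norm_eq_abs, Real.norm_eq_abs]
    refine mul_le_mul_of_nonneg_left ((hE s ((hsub s hs).trans hY)).trans ?_) (abs_nonneg p)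
    have := hsub s hs
    gcongr

lemma hasDerivAt_one_add_rpow (p : ℝ) {Y : ℝ} (hY : |Y| ≤ 1 / 2) :
    HasDerivAt (fun Y : ℝ => (1 + Y) ^ p) (p * (1 + Y) ^ (p - 1)) Y := by
  have : 1 + Y ≠ 0 := by have := abs_le.1 hY; linarith
  have h1 := (hasDerivAt_id Y).const_add 1
  have := h1.rpow_const (p := p) (Or.inl this)
  simpa using this

/-- Starting from boundedness of (1+Y)^(σ-4) on |Y| ≤ 1/2, four integrations give the remainders for
the exponents σ-3, σ-2, σ-1 and σ, each remainder being up to a factor the derivative of the next.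
-/
lemma rpow_taylor (hσ : σ < 1) : ∃ C > 0, ∀ Y : ℝ, |Y| ≤ 1 / 2 →
    |(1 + Y) ^ σ - (1 + σ * Y + σ * (σ - 1) / 2 * Y ^ 2 + σ * (σ - 1) * (σ - 2) / 6 * Y ^ 3)|
      ≤ C * |Y| ^ 4 := by
  have e0 : ∀ Y : ℝ, |Y| ≤ 1 / 2 → |(1 + Y) ^ (σ - 4)| ≤ (1 / 2) ^ (σ - 4) * |Y| ^ 0 := by
    intro Y hY
    have := abs_le.1 hY
    rw [abs_of_nonneg (Real.rpow_nonneg (by linarith) _), pow_zero, mul_one]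
    exact Real.rpow_le_rpow_of_nonpos (by norm_num) (by linarith) (by linarith)
  have e1 := bound_of_deriv_bound (F := fun Y => (1 + Y) ^ (σ - 3) - 1) (p := σ - 3) e0
    (fun Y hY => by
      refine ((hasDerivAt_one_add_rpow (σ - 3) hY).sub_const 1).congr_deriv ?_
      rw [show σ - 3 - 1 = σ - 4 by ring]) (by simp)
  have e2 := bound_of_deriv_bound (F := fun Y => (1 + Y) ^ (σ - 2) - (1 + (σ - 2) * Y)) (p := σ - 2) e1
    (fun Y hY => by
      refine ((hasDerivAt_one_add_rpow (σ - 2) hY).sub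
        (((hasDerivAt_id Y).const_mul (σ - 2)).const_add 1)).congr_deriv ?_
      rw [show σ - 2 - 1 = σ - 3 by ring]; ring) (by simp)
  have e3 := bound_of_deriv_bound
    (F := fun Y => (1 + Y) ^ (σ - 1) - (1 + (σ - 1) * Y + (σ - 1) * (σ - 2) / 2 * Y ^ 2)) (p := σ - 1) e2
    (fun Y hY => by
      refine ((hasDerivAt_one_add_rpow (σ - 1) hY).sub
        ((((hasDerivAt_id Y).const_mul (σ - 1)).const_add 1).add
          (((hasDerivAt_id Y).pow 2).const_mul ((σ - 1) * (σ - 2) / 2)))).congr_deriv ?_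
      rw [show σ - 1 - 1 = σ - 2 by ring]; simp; ring) (by simp)
  have e4 := bound_of_deriv_bound
    (F := fun Y => (1 + Y) ^ σ
      - (1 + σ * Y + σ * (σ - 1) / 2 * Y ^ 2 + σ * (σ - 1) * (σ - 2) / 6 * Y ^ 3)) (p := σ) e3
    (fun Y hY => by
      refine ((hasDerivAt_one_add_rpow σ hY).sub
        (((((hasDerivAt_id Y).const_mul σ).const_add 1).add
          (((hasDerivAt_id Y).pow 2).const_mul (σ * (σ - 1) / 2))).add
          (((hasDerivAt_id Y).pow 3).const_mul (σ * (σ - 1) * (σ - 2) / 6)))).congr_deriv ?_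
      simp; ring) (by simp)
  refine ⟨_, lt_max_of_lt_right one_pos, fun Y hY => (e4 Y hY).trans
    (mul_le_mul_of_nonneg_right (le_max_left _ (1 : ℝ)) (by positivity))⟩

/-- The variable n stands for x² + y². The three expressions are the leftovers of degree at least
four in the expansions of the real and imaginary parts below. -/
lemma scaled_monomial_bounds {x y n m : ℝ} (hx : |x| ≤ m) (hy : |y| ≤ m) (hm : m ≤ 1 / 8) (hn0 : 0 ≤ n)
    (hnm : n ≤ 2 * m ^ 2) :
    |n ^ 2 + 4 * (x ^ 2 * n) + x * n ^ 2| ≤ 16 * m ^ 4 ∧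
    |12 * (x ^ 2 * n) + 6 * (x * n ^ 2) + n ^ 3 + 8 * x ^ 4
          + x * (12 * (x ^ 2 * n) + 6 * (x * n ^ 2) + n ^ 3)| ≤ 120 * m ^ 4 ∧
    |y * (4 * (x * n) + n ^ 2)| ≤ 16 * m ^ 4 := by
  have hm0 : 0 ≤ m := (abs_nonneg x).trans hx
  have m4 : 0 ≤ m ^ 4 := by positivity
  have hx2 : x ^ 2 ≤ m ^ 2 := sq_le_sq' (by linarith [(abs_le.1 hx).1]) (abs_le.1 hx).2
  have hn1 : n ≤ 1 := by
    have : m ^ 2 ≤ (1 / 8) ^ 2 := by gcongr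
    linarith
  have n2 : n ^ 2 ≤ 4 * m ^ 4 := by
    calc n ^ 2 ≤ (2 * m ^ 2) ^ 2 := by gcongr
      _ = _ := by ring
  have x2n : x ^ 2 * n ≤ 2 * m ^ 4 := by
    calc x ^ 2 * n ≤ m ^ 2 * (2 * m ^ 2) := by gcongr
      _ = _ := by ring
  have n3 : n ^ 3 ≤ 4 * m ^ 4 := by
    calc n ^ 3 = n * n ^ 2 := by ring
      _ ≤ 1 * (4 * m ^ 4) := by gcongr
      _ = _ := one_mul _
  have n30 : 0 ≤ n ^ 3 := by positivity
  have n20 : 0 ≤ n ^ 2 := by positivity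
  have x2n0 : 0 ≤ x ^ 2 * n := by positivity
  have hx1 : |x| ≤ 1 := hx.trans (by linarith)
  have x40 : 0 ≤ x ^ 4 := by positivity
  have x4 : x ^ 4 ≤ m ^ 4 := by
    calc x ^ 4 = (x ^ 2) ^ 2 := by ring
      _ ≤ (m ^ 2) ^ 2 := by gcongr
      _ = _ := by ring
  have b1 : |x * n ^ 2| ≤ 4 * m ^ 4 := by
    rw [abs_mul, abs_of_nonneg n20]
    calc |x| * n ^ 2 ≤ 1 * (4 * m ^ 4) := by gcongr
      _ = _ := one_mul _
  obtain ⟨b1l, b1r⟩ := abs_le.1 b1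
  refine ⟨?_, ?_, ?_⟩
  · rw [abs_le]; constructor <;> linarith
  · have b2 : |12 * (x ^ 2 * n) + 6 * (x * n ^ 2) + n ^ 3| ≤ 52 * m ^ 4 := by
      rw [abs_le]; constructor <;> linarith
    have b3 : |x * (12 * (x ^ 2 * n) + 6 * (x * n ^ 2) + n ^ 3)| ≤ 52 * m ^ 4 := by
      rw [abs_mul]
      calc _ ≤ 1 * (52 * m ^ 4) := by gcongr
        _ = _ := one_mul _
    obtain ⟨b2l, b2r⟩ := abs_le.1 b2
    obtain ⟨b3l, b3r⟩ := abs_le.1 b3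
    rw [abs_le]; constructor <;> linarith
  · rw [abs_mul]
    have b : |4 * (x * n) + n ^ 2| ≤ 16 * m ^ 3 := by
      refine (abs_add_le _ _).trans ?_
      rw [abs_mul, abs_mul, abs_of_nonneg hn0, abs_of_nonneg n20]
      have h1 : |x| * n ≤ m * (2 * m ^ 2) := by gcongr
      have h2 : n ^ 2 ≤ 4 * m ^ 3 := by
        calc n ^ 2 ≤ 4 * m ^ 4 := n2
          _ = 4 * m ^ 3 * m := by ring
          _ ≤ 4 * m ^ 3 * 1 := by gcongr; linarith
          _ = _ := mul_one _
      have h4 : |(4 : ℝ)| = 4 := by norm_num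
      rw [h4]
      linarith [pow_nonneg hm0 3]
    calc |y| * |4 * (x * n) + n ^ 2| ≤ m * (16 * m ^ 3) := by gcongr
      _ = _ := by ring

/-- Here e is the Taylor remainder of the power at Y = 2x + x² + y². The identity removes all
monomials of degree at most three and exhibits the rest in the form that `scaled_monomial_bounds`
estimates. -/
lemma scaled_re_identity (σ x y e : ℝ) :
    (e + (1 + σ * (2 * x + (x ^ 2 + y ^ 2)) + σ * (σ - 1) / 2 * (2 * x + (x ^ 2 + y ^ 2)) ^ 2
        + σ * (σ - 1) * (σ - 2) / 6 * (2 * x + (x ^ 2 + y ^ 2)) ^ 3)) * (1 + x)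
      - (1 + (2 * σ + 1) * x + (σ * (2 * σ + 1) * x ^ 2 + σ * y ^ 2)
      + (σ * (4 * σ ^ 2 - 1) / 3 * x ^ 3 + σ * (2 * σ - 1) * x * y ^ 2))
      = e * (1 + x) + σ * (σ - 1) / 2 * ((x ^ 2 + y ^ 2) ^ 2 + 4 * (x ^ 2 * (x ^ 2 + y ^ 2))
          + x * (x ^ 2 + y ^ 2) ^ 2)
        + σ * (σ - 1) * (σ - 2) / 6 * (12 * (x ^ 2 * (x ^ 2 + y ^ 2)) + 6 * (x * (x ^ 2 + y ^ 2) ^ 2)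
          + (x ^ 2 + y ^ 2) ^ 3 + 8 * x ^ 4
          + x * (12 * (x ^ 2 * (x ^ 2 + y ^ 2)) + 6 * (x * (x ^ 2 + y ^ 2) ^ 2) + (x ^ 2 + y ^ 2) ^ 3)) := by
  ring

lemma scaled_im_identity (σ x y e : ℝ) :
    (e + (1 + σ * (2 * x + (x ^ 2 + y ^ 2)) + σ * (σ - 1) / 2 * (2 * x + (x ^ 2 + y ^ 2)) ^ 2
        + σ * (σ - 1) * (σ - 2) / 6 * (2 * x + (x ^ 2 + y ^ 2)) ^ 3)) * y
      - (y + 2 * σ * x * y + (σ * (2 * σ - 1) * x ^ 2 * y + σ * y ^ 3))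
      = e * y + σ * (σ - 1) / 2 * (y * (4 * (x * (x ^ 2 + y ^ 2)) + (x ^ 2 + y ^ 2) ^ 2))
        + σ * (σ - 1) * (σ - 2) / 6 * ((2 * x + (x ^ 2 + y ^ 2)) ^ 3 * y) := by
  ring

/-- The nonlinearity in scaled variables. -/
lemma scaled_taylor (hσ : σ < 1) : ∃ C > 0, ∀ x y m : ℝ, |x| ≤ m → |y| ≤ m → m ≤ 1 / 8 →
    |((1 + x) ^ 2 + y ^ 2) ^ σ * (1 + x) - (1 + (2 * σ + 1) * x + (σ * (2 * σ + 1) * x ^ 2 + σ * y ^ 2)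
      + (σ * (4 * σ ^ 2 - 1) / 3 * x ^ 3 + σ * (2 * σ - 1) * x * y ^ 2))| ≤ C * m ^ 4 ∧
    |((1 + x) ^ 2 + y ^ 2) ^ σ * y - (y + 2 * σ * x * y
      + (σ * (2 * σ - 1) * x ^ 2 * y + σ * y ^ 3))| ≤ C * m ^ 4 := by
  obtain ⟨C, hC, hb⟩ := rpow_taylor hσ
  refine ⟨2 * (C * 81) + 16 * |σ * (σ - 1) / 2| + 120 * |σ * (σ - 1) * (σ - 2) / 6|, by positivity,
    fun x y m hx hy hm => ?_⟩
  have hm0 : 0 ≤ m := (abs_nonneg x).trans hx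
  have m4 : 0 ≤ m ^ 4 := by positivity
  have hx2 : x ^ 2 ≤ m ^ 2 := sq_le_sq' (by linarith [(abs_le.1 hx).1]) (abs_le.1 hx).2
  have hy2 : y ^ 2 ≤ m ^ 2 := sq_le_sq' (by linarith [(abs_le.1 hy).1]) (abs_le.1 hy).2
  have hn0 : 0 ≤ x ^ 2 + y ^ 2 := by positivity
  have hnm : x ^ 2 + y ^ 2 ≤ 2 * m ^ 2 := by linarith
  have hmm : m ^ 2 ≤ m * (1 / 8) := by rw [sq]; gcongr
  have hY3 : |2 * x + (x ^ 2 + y ^ 2)| ≤ 3 * m := by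
    refine (abs_add_le _ _).trans ?_
    rw [abs_mul, abs_two, abs_of_nonneg hn0]
    linarith
  obtain ⟨A1, A2, A3⟩ := scaled_monomial_bounds hx hy hm hn0 hnm
  have hE := hb _ (hY3.trans (by linarith))
  have hY4 : |2 * x + (x ^ 2 + y ^ 2)| ^ 4 ≤ 81 * m ^ 4 := by
    calc _ ≤ (3 * m) ^ 4 := by gcongr
      _ = _ := by ring
  rw [show (1 + x) ^ 2 + y ^ 2 = 1 + (2 * x + (x ^ 2 + y ^ 2)) by ring]
  have hE' := hE.trans (mul_le_mul_of_nonneg_left hY4 hC.le)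
  -- The remainder of the real power is made an independent variable, so that the rest is
  -- polynomial.
  obtain ⟨e, he⟩ : ∃ e, e = (1 + (2 * x + (x ^ 2 + y ^ 2))) ^ σ
    - (1 + σ * (2 * x + (x ^ 2 + y ^ 2)) + σ * (σ - 1) / 2 * (2 * x + (x ^ 2 + y ^ 2)) ^ 2
        + σ * (σ - 1) * (σ - 2) / 6 * (2 * x + (x ^ 2 + y ^ 2)) ^ 3) := ⟨_, rfl⟩
  rw [← he] at hE'
  rw [eq_comm, sub_eq_iff_eq_add] at he
  rw [he, scaled_re_identity, scaled_im_identity]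
  clear he hE hb
  have hx1 : |x| ≤ 1 := hx.trans (by linarith)
  have hy1 : |y| ≤ 1 := hy.trans (by linarith)
  constructor
  · have t1 : |e * (1 + x)| ≤ 2 * (C * 81) * m ^ 4 := by
      rw [abs_mul]
      have : |1 + x| ≤ 2 := (abs_add_le _ _).trans (by rw [abs_one]; linarith)
      calc |e| * |1 + x| ≤ (C * (81 * m ^ 4)) * 2 := by gcongr
        _ = _ := by ring
    refine (abs_add_three _ _ _).trans ?_
    rw [abs_mul (σ * (σ - 1) / 2), abs_mul (σ * (σ - 1) * (σ - 2) / 6)]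
    have t2 := mul_le_mul_of_nonneg_left A1 (abs_nonneg (σ * (σ - 1) / 2))
    have t3 := mul_le_mul_of_nonneg_left A2 (abs_nonneg (σ * (σ - 1) * (σ - 2) / 6))
    linarith
  · have t1 : |e * y| ≤ 2 * (C * 81) * m ^ 4 := by
      rw [abs_mul]
      calc |e| * |y| ≤ (C * (81 * m ^ 4)) * 2 := by gcongr; linarith
        _ = _ := by ring
    have A4 : |(2 * x + (x ^ 2 + y ^ 2)) ^ 3 * y| ≤ 120 * m ^ 4 := by
      rw [abs_mul, abs_pow]
      calc _ ≤ (3 * m) ^ 3 * m := by gcongr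
        _ = 27 * m ^ 4 := by ring
        _ ≤ _ := by linarith
    refine (abs_add_three _ _ _).trans ?_
    rw [abs_mul (σ * (σ - 1) / 2), abs_mul (σ * (σ - 1) * (σ - 2) / 6)]
    have t2 := mul_le_mul_of_nonneg_left A3 (abs_nonneg (σ * (σ - 1) / 2))
    have t3 := mul_le_mul_of_nonneg_left A4 (abs_nonneg (σ * (σ - 1) * (σ - 2) / 6))
    linarith

/-- The part of the nonlinearity of order two and higher. -/
def Nplus (σ ν ω : ℝ) (η : ℂ) : ℂ :=
  Nq σ ν (qSol σ ν ω + η) - sS ω * (qSol σ ν ω + (2 * σ + 1) * η.re + I * η.im)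

lemma Nq_scaled (h : Adm σ) (hν : 0 < ν) (hω : 0 < ω) (x y : ℝ) :
    Nq σ ν (qSol σ ν ω + qSol σ ν ω * (x + y * I)) =
      ((sS ω * qSol σ ν ω : ℝ) : ℂ) * (((((1 + x) ^ 2 + y ^ 2) ^ σ * (1 + x) : ℝ) : ℂ)
        + ((((1 + x) ^ 2 + y ^ 2) ^ σ * y : ℝ) : ℂ) * I) := by
  have hQ := qSol_pos (σ := σ) hν hω
  have e1 : (qSol σ ν ω : ℂ) + qSol σ ν ω * (x + y * I)
      = ((qSol σ ν ω : ℝ) : ℂ) * (((1 + x : ℝ) : ℂ) + ((y : ℝ) : ℂ) * I) := by push_cast; ring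
  have e2 : ‖((qSol σ ν ω : ℝ) : ℂ) * (((1 + x : ℝ) : ℂ) + ((y : ℝ) : ℂ) * I)‖ ^ (2 * σ)
      = qSol σ ν ω ^ (2 * σ) * ((1 + x) ^ 2 + y ^ 2) ^ σ := by
    rw [norm_mul, norm_real, Real.norm_of_nonneg hQ.le, Real.mul_rpow hQ.le (norm_nonneg _),
      Real.rpow_mul (norm_nonneg (((1 + x : ℝ) : ℂ) + ((y : ℝ) : ℂ) * I)), Real.rpow_two,
      ← normSq_eq_norm_sq, normSq_add_mul_I]
  rw [e1, Nq, e2, ← mul_assoc ν, qSol_pow h hν hω, ← sS]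
  push_cast
  ring

/-- By homogeneity the nonlinearity is q_ω √ω/(4π) times a fixed function of η/q_ω, to which
`scaled_taylor` applies. Undoing the scaling leaves the factor √ω/q_ω³, bounded on the frequency
interval. -/
lemma exists_Nplus_bound (h : Adm σ) (hν : 0 < ν) (hlo : 0 < lo) (hl : lo < hi) :
    ∃ C > 0, ∃ δ > 0, ∀ ω ∈ Icc lo hi, ∀ η : ℂ, ‖η‖ ≤ δ →
      ‖((Nplus σ ν ω η).re : ℂ) - (N2 σ ν ω (toVec η) (toVec η) 0
        + N3 σ ν ω (toVec η) (toVec η) (toVec η) 0)‖ ≤ C * ‖η‖ ^ 4 ∧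
      ‖((Nplus σ ν ω η).im : ℂ) - (N2 σ ν ω (toVec η) (toVec η) 1
        + N3 σ ν ω (toVec η) (toVec η) (toVec η) 1)‖ ≤ C * ‖η‖ ^ 4 := by
  obtain ⟨C, hC, hb⟩ := scaled_taylor h.2
  obtain ⟨A, hA, hA'⟩ := (good_scale (σ := σ) hν hlo hl 1 0 0 3).bound
  obtain ⟨B, hB, hB'⟩ := (good_scale (σ := σ) hν hlo hl 0 0 0 1).bound
  -- Since B bounds 1/q_ω, the radius 1/(8B) keeps |η|/q_ω below 1/8, the range of the scaled
  -- expansion.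
  refine ⟨A / (4 * Real.pi) * C, by have := Real.pi_pos; positivity, 1 / (8 * B), by positivity,
    fun ω hω η hη => ?_⟩
  have hω' := Icc_pos hlo hω
  have hQ := qSol_pos (σ := σ) hν hω'
  have hs := Real.sqrt_pos.2 hω'
  have hS := sS_pos hω'
  have a := hA' ω hω ω hω
  have b := hB' ω hω ω hω
  simp only [pow_zero, pow_one, div_one, one_mul] at a b
  rw [norm_real, Real.norm_of_nonneg (by positivity)] at a b
  set Q := qSol σ ν ω with hQdef
  obtain ⟨x, hx⟩ : ∃ x, x = η.re / Q := ⟨_, rfl⟩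
  obtain ⟨y, hy⟩ : ∃ y, y = η.im / Q := ⟨_, rfl⟩
  have hre : η.re = Q * x := by rw [hx]; field_simp
  have him : η.im = Q * y := by rw [hy]; field_simp
  have hηeq : η = Q * (x + y * I) := by
    apply Complex.ext <;> simp [hre, him]
  obtain ⟨m, hm⟩ : ∃ m, m = ‖η‖ / Q := ⟨_, rfl⟩
  have hxm : |x| ≤ m := by
    rw [hx, hm, abs_div, abs_of_pos hQ]; gcongr; exact abs_re_le_norm η
  have hym : |y| ≤ m := by
    rw [hy, hm, abs_div, abs_of_pos hQ]; gcongr; exact abs_im_le_norm η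
  have hm8 : m ≤ 1 / 8 := by
    rw [hm, div_eq_mul_one_div]
    calc ‖η‖ * (1 / Q) ≤ 1 / (8 * B) * B := by gcongr
      _ = 1 / 8 := by field_simp
  obtain ⟨r1, r2⟩ := hb x y m hxm hym hm8
  have hN := Nq_scaled h hν hω' x y
  rw [← hQdef, ← hηeq] at hN
  have hconst : sS ω * Q * (C * m ^ 4) ≤ A / (4 * Real.pi) * C * ‖η‖ ^ 4 := by
    have : sS ω * Q * (C * m ^ 4) = (√ω * (1 / Q ^ 3)) / (4 * Real.pi) * C * ‖η‖ ^ 4 := by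
      rw [hm, sS]; field_simp
    rw [this]
    gcongr
  have hQ' : (Q : ℂ) ≠ 0 := by exact_mod_cast hQ.ne'
  have hQS : |sS ω * Q| = sS ω * Q := abs_of_pos (by positivity)
  constructor
  · refine le_trans ?_ hconst
    refine le_trans (le_of_eq ?_) (mul_le_mul_of_nonneg_left r1 (by positivity : 0 ≤ sS ω * Q))
    rw [← hQS, ← abs_mul, ← Real.norm_eq_abs, ← norm_real]
    congr 1
    rw [Nplus, sub_re, ← hQdef, hN, N2_eq h hν hω', N3_eq h hν hω', ← hQdef]
    simp only [toVec, Matrix.cons_val_zero, Matrix.cons_val_one, Matrix.cons_val_fin_one, hre, him]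
    simp
    field_simp
    ring
  · refine le_trans ?_ hconst
    refine le_trans (le_of_eq ?_) (mul_le_mul_of_nonneg_left r2 (by positivity : 0 ≤ sS ω * Q))
    rw [← hQS, ← abs_mul, ← Real.norm_eq_abs, ← norm_real]
    congr 1
    rw [Nplus, sub_im, ← hQdef, hN, N2_eq h hν hω', N3_eq h hν hω', ← hQdef]
    simp only [toVec, Matrix.cons_val_zero, Matrix.cons_val_one, Matrix.cons_val_fin_one, hre, him]
    simp
    field_simp
    ring

end ConcNLS

end


/-! ### From the orthogonality conditions to exact equations for ω, γ and z. -/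

noncomputable section

namespace ConcNLS

open MeasureTheory Complex ComplexConjugate Set Filter Topology

variable {σ ν ω θ : ℝ} {z : ℂ}

/-! ### Orthogonality conditions in terms of exponential moments -/

lemma pe_re {u : E3 → ℂ} {n : ℕ} {k : ℝ} (hu : Integrable (fun x => u x * ek n (k : ℂ) x)) :
    pe n k (fun x => ((u x).re : ℂ)) = ((pe n k u).re : ℂ) := by
  have e : (fun x => ((u x).re : ℂ) * ek n (k : ℂ) x) = fun x => (((u x * ek n (k : ℂ) x).re : ℝ) : ℂ) := by
    funext x; rw [← ofReal_er, re_mul_ofReal]; push_cast; rfl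
  rw [pe, e, integral_complex_ofReal]
  congr 1
  exact integral_re hu

lemma pe_im {u : E3 → ℂ} {n : ℕ} {k : ℝ} (hu : Integrable (fun x => u x * ek n (k : ℂ) x)) :
    pe n k (fun x => ((u x).im : ℂ)) = ((pe n k u).im : ℂ) := by
  have e : (fun x => ((u x).im : ℂ) * ek n (k : ℂ) x) = fun x => (((u x * ek n (k : ℂ) x).im : ℝ) : ℂ) := by
    funext x; rw [← ofReal_er, im_mul_ofReal]; push_cast; rfl
  rw [pe, e, integral_complex_ofReal]
  congr 1
  exact integral_im hu

lemma pairable_toVec {u : E3 → ℂ} (hu : ∀ (n : ℕ) (k : ℝ), 0 < k → Integrable (fun x => u x * ek n (k : ℂ) x)) :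
    Pairable (fun x => toVec (u x)) := by
  intro i n k hk
  revert i
  refine Fin.forall_fin_two.2 ⟨?_, ?_⟩
  · refine (hu n k hk).re.ofReal.congr (ae_of_all _ fun x => ?_)
    simp only [toVec, Matrix.cons_val_zero]
    rw [← ofReal_er]
    simp
  · refine (hu n k hk).im.ofReal.congr (ae_of_all _ fun x => ?_)
    simp only [toVec, Matrix.cons_val_one, Matrix.cons_val_fin_one]
    rw [← ofReal_er]
    simp

lemma integrable_phase_ek (u : EnergySpace) (θ : ℝ) (n : ℕ) {k : ℝ} (hk : 0 < k) :
    Integrable (fun x => exp (-I * θ) * u.toFun x * ek n (k : ℂ) x) := by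
  simpa only [mul_assoc] using (integrable_mul_ek u.memLp n hk).const_mul (exp (-I * θ))

lemma pairable_Phi (hω : 0 < ω) : Pairable (Phi σ ν ω) := by
  have hs : 0 < √ω := Real.sqrt_pos.2 hω
  intro i n k hk
  revert i
  refine Fin.forall_fin_two.2 ⟨?_, ?_⟩
  · simp only [Phi_eq, Matrix.cons_val_zero, mul_assoc]
    exact (integrable_ek_mul n 0 hk hs).const_mul _
  · simp [Phi_eq]

lemma fPart_eq (u : E3 → ℂ) : fPart σ ν u θ ω z = fun x => toVec (exp (-I * θ) * u x)
    + (-1 : ℂ) • Phi σ ν ω x + (-z) • Psi σ ω x + (-conj z) • PsiStar σ ω x := by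
  funext x
  simp only [fPart, neg_smul, one_smul]
  abel

lemma pairable_fPart (h : Adm σ) (hω : 0 < ω) (u : EnergySpace) : Pairable (fPart σ ν u.toFun θ ω z) := by
  rw [fPart_eq]
  exact (((pairable_toVec fun n k hk => integrable_phase_ek u θ n hk).add
    ((pairable_Phi hω).smul _)).add ((pairable_Psi h hω).smul _)).add ((pairable_PsiStar h hω).smul _)

lemma pe_fPart (h : Adm σ) (hω : 0 < ω) (u : EnergySpace) (n : ℕ) {k : ℝ} (hk : 0 < k) :
    pe n k (fun x => fPart σ ν u.toFun θ ω z x 0) = ((mp n k θ u.toFun).re : ℂ)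
      - qSol σ ν ω * (n.factorial / (4 * Real.pi * ((k + √ω : ℝ) : ℂ) ^ (n + 1)))
      - (z + conj z) * pe n k (fun x => Psi σ ω x 0) ∧
    pe n k (fun x => fPart σ ν u.toFun θ ω z x 1) = ((mp n k θ u.toFun).im : ℂ)
      - (z - conj z) * pe n k (fun x => Psi σ ω x 1) := by
  have hs : 0 < √ω := Real.sqrt_pos.2 hω
  have h0 := pairable_toVec (u := fun x => exp (-I * θ) * u.toFun x)
    (fun n k hk => integrable_phase_ek u θ n hk)
  have h1 := h0.add ((pairable_Phi (σ := σ) (ν := ν) hω).smul (-1))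
  have h2 := h1.add ((pairable_Psi h hω).smul (-z))
  have e : ∀ i, pe n k (fun x => fPart σ ν u.toFun θ ω z x i)
      = pe n k (fun x => toVec (exp (-I * θ) * u.toFun x) i) + (-1) * pe n k (fun x => Phi σ ν ω x i)
        + (-z) * pe n k (fun x => Psi σ ω x i) + (-conj z) * pe n k (fun x => PsiStar σ ω x i) := by
    intro i
    rw [fPart_eq, h2.pe_add_smul (pairable_PsiStar h hω) _ i n hk, h1.pe_add_smul (pairable_Psi h hω) _ i n hk,
      h0.pe_add_smul (pairable_Phi hω) _ i n hk]
  have hi := integrable_phase_ek u θ n hk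
  constructor
  · rw [e]
    have e1 : pe n k (fun x => toVec (exp (-I * θ) * u.toFun x) 0) = ((mp n k θ u.toFun).re : ℂ) := by
      simp only [toVec, Matrix.cons_val_zero]
      rw [pe_re hi, pe_const_mul]; rfl
    have e2 : pe n k (fun x => Phi σ ν ω x 0)
        = qSol σ ν ω * (n.factorial / (4 * Real.pi * ((k + √ω : ℝ) : ℂ) ^ (n + 1))) := by
      simp only [Phi_eq, Matrix.cons_val_zero]
      rw [pe_const_mul, pe_ek n 0 hk hs]
      push_cast
      rfl
    rw [e1, e2, pe_PsiStar_zero]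
    ring
  · rw [e]
    have e1 : pe n k (fun x => toVec (exp (-I * θ) * u.toFun x) 1) = ((mp n k θ u.toFun).im : ℂ) := by
      simp only [toVec, Matrix.cons_val_one, Matrix.cons_val_fin_one]
      rw [pe_im hi, pe_const_mul]; rfl
    have e2 : pe n k (fun x => Phi σ ν ω x 1) = 0 := by
      simp [Phi_eq, pe]
    rw [e1, e2, pe_PsiStar_one]
    ring

lemma pe_Psi_zero_sqrt (h : Adm σ) (hω : 0 < ω) : pe 0 √ω (fun x => Psi σ ω x 0) = 0 := by
  have h1 := (Om_JPhi_Psi' (σ := σ) (ν := 1) h hω).2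
  rw [Om_comm, Om_JPhi, neg_neg, mul_eq_zero] at h1
  exact h1.resolve_left (by exact_mod_cast (qSol_pos (σ := σ) one_pos hω).ne')

/-- This is Ω(f, JΦ) = 0 with f written out. The contribution of z drops out because the first
component of Ψ is orthogonal to Φ. The constraint thus involves only ω and a moment of u, and can be
differentiated in time without knowing anything about z. -/
lemma constraint_re (h : Adm σ) (hν : 0 < ν) (hω : 0 < ω) (u : EnergySpace)
    (h0 : P0 σ ν ω (fPart σ ν u.toFun θ ω z) = 0) :
    (mp 0 √ω θ u.toFun).re = qSol σ ν ω / (8 * Real.pi * √ω) := by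
  have hs : 0 < √ω := Real.sqrt_pos.2 hω
  have h1 := (P0_eq_zero h hν hω h0).2
  rw [Om_JPhi, neg_eq_zero, mul_eq_zero] at h1
  have h2 := h1.resolve_left (by exact_mod_cast (qSol_pos (σ := σ) hν hω).ne')
  rw [(pe_fPart h hω u 0 hs).1, pe_Psi_zero_sqrt h hω, mul_zero, sub_zero, sub_eq_zero] at h2
  have h3 : ((mp 0 √ω θ u.toFun).re : ℂ) = ((qSol σ ν ω / (8 * Real.pi * √ω) : ℝ) : ℂ) := by
    rw [h2]
    have e1 := sqrt_ne hω
    have e2 := pi_ne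
    push_cast
    rw [← two_mul]
    simp only [Nat.factorial]
    field_simp
    push_cast
    ring
  exact_mod_cast h3

lemma pe_Psi_one_dPhi (h : Adm σ) (hν : 0 < ν) (hω : 0 < ω) :
    pe 0 √ω (fun x => Psi σ ω x 1) = 2 * σ * √ω * pe 1 √ω (fun x => Psi σ ω x 1) := by
  have h1 := (Om_dPhi_Psi' h hν hω).2
  rw [Om_comm, Om_dPhi h hν hω (pairable_Psi h hω), neg_eq_zero] at h1
  have e1 := sqrt_ne hω
  have e2 : (qSol σ ν ω : ℂ) ≠ 0 := by exact_mod_cast (qSol_pos (σ := σ) hν hω).ne'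
  have e3 : (σ : ℂ) ≠ 0 := by exact_mod_cast h.pos.ne'
  have e4 : (ω : ℂ) = (√ω : ℂ) ^ 2 := by exact_mod_cast (Real.sq_sqrt hω.le).symm
  push_cast at h1
  rw [e4] at h1
  field_simp at h1
  apply mul_left_cancel₀ e2
  linear_combination h1 / 2

/-- This is Ω(f, dΦ/dω) = 0. The contribution of z cancels between the two moments by
`pe_Psi_one_dPhi`, that is, by skew orthogonality of Ψ to dΦ/dω. -/
lemma constraint_im (h : Adm σ) (hν : 0 < ν) (hω : 0 < ω) (u : EnergySpace)
    (h0 : P0 σ ν ω (fPart σ ν u.toFun θ ω z) = 0) :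
    (mp 0 √ω θ u.toFun).im = 2 * σ * √ω * (mp 1 √ω θ u.toFun).im := by
  have hs : 0 < √ω := Real.sqrt_pos.2 hω
  have h1 := (P0_eq_zero h hν hω h0).1
  rw [Om_dPhi h hν hω (pairable_fPart h hω u), (pe_fPart h hω u 0 hs).2, (pe_fPart h hω u 1 hs).2] at h1
  have e1 := sqrt_ne hω
  have e2 : (qSol σ ν ω : ℂ) ≠ 0 := by exact_mod_cast (qSol_pos (σ := σ) hν hω).ne'
  have e3 : (σ : ℂ) ≠ 0 := by exact_mod_cast h.pos.ne'
  have e4 : (ω : ℂ) = (√ω : ℂ) ^ 2 := by exact_mod_cast (Real.sq_sqrt hω.le).symm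
  have e5 := pe_Psi_one_dPhi h hν hω
  push_cast at h1
  rw [e4] at h1
  field_simp at h1
  have : ((mp 0 √ω θ u.toFun).im : ℂ) = ((2 * σ * √ω * (mp 1 √ω θ u.toFun).im : ℝ) : ℂ) := by
    push_cast
    apply mul_left_cancel₀ e2
    linear_combination h1 / 2 + qSol σ ν ω * (z - conj z) * e5
  exact_mod_cast this

/-- The coordinate `z` in terms of exponential moments. -/
lemma constraint_z (h : Adm σ) (hω : 0 < ω) (u : EnergySpace)
    (h1 : P1 σ ω (fPart σ ν u.toFun θ ω z) = 0) :
    z = ((√ω / kap0 σ : ℝ) : ℂ) * (conj (mp 0 (a0 σ * √ω) θ u.toFun)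
        + Cc σ * mp 0 (b0 σ * √ω) θ u.toFun)
      - ((qSol σ ν ω / (2 * Real.pi * (a0 σ + 1) * kap0 σ) : ℝ) : ℂ) := by
  have hs : 0 < √ω := Real.sqrt_pos.2 hω
  have ha := mul_pos h.a0_pos hs
  have hb := mul_pos h.b0_pos hs
  have h2 := (P1_eq_zero h hω h1).1
  rw [Om_PsiStar h hω (pairable_fPart h hω u), (pe_fPart h hω u 0 ha).1, (pe_fPart h hω u 0 ha).2,
    (pe_fPart h hω u 0 hb).1, (pe_fPart h hω u 0 hb).2] at h2
  -- The first relation identifies the coefficient of z as κ, the second shows that the coefficient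
  -- of its conjugate is Ω(Ψ*, Ψ*) = 0.
  have k1 : kappa σ ω = _ := Om_PsiStar h hω (pairable_Psi h hω)
  have k2 := Om_self (PsiStar σ ω)
  rw [Om_PsiStar h hω (pairable_PsiStar h hω), pe_PsiStar_zero, pe_PsiStar_zero, pe_PsiStar_one,
    pe_PsiStar_one] at k2
  have e1 := sqrt_ne hω
  have e2 := pi_ne
  have e3 : (kap0 σ : ℂ) ≠ 0 := by exact_mod_cast (kap0_pos h).ne'
  have e4 : ((a0 σ + 1 : ℝ) : ℂ) ≠ 0 := by
    exact_mod_cast (by linarith [h.a0_pos] : a0 σ + 1 ≠ 0)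
  have e5 : (Cc σ : ℂ) ≠ 0 := by exact_mod_cast h.Cc_pos.ne'
  have hκ : kappa σ ω * z = I * (conj (mp 0 (a0 σ * √ω) θ u.toFun)
        + Cc σ * mp 0 (b0 σ * √ω) θ u.toFun)
        - I * qSol σ ν ω * (1 / (4 * Real.pi * ((a0 σ * √ω + √ω : ℝ) : ℂ))
          + Cc σ * (1 / (4 * Real.pi * ((b0 σ * √ω + √ω : ℝ) : ℂ)))) := by
    have ca : conj (mp 0 (a0 σ * √ω) θ u.toFun) = ((mp 0 (a0 σ * √ω) θ u.toFun).re : ℂ)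
      - ((mp 0 (a0 σ * √ω) θ u.toFun).im : ℂ) * I := by
      conv_lhs => rw [← re_add_im (mp 0 (a0 σ * √ω) θ u.toFun)]
      simp only [map_add, map_mul, conj_ofReal, conj_I]; ring
    have cb := re_add_im (mp 0 (b0 σ * √ω) θ u.toFun)
    rw [ca, ← cb]
    simp only [Nat.factorial, Nat.cast_one, zero_add, pow_one] at h2
    rw [k1]
    linear_combination -h2 - conj z * k2 + (((mp 0 (a0 σ * √ω) θ u.toFun).im : ℂ)
      - Cc σ * ((mp 0 (b0 σ * √ω) θ u.toFun).im : ℂ)) * I_sq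
  rw [b_add h, show a0 σ * √ω + √ω = (a0 σ + 1) * √ω by ring, kappa_eq' h hω] at hκ
  push_cast at hκ e4 ⊢
  have hκ' := congrArg (fun w => w * (√ω / (I * kap0 σ) : ℂ)) hκ
  have hI := I_ne_zero
  rw [show I * ((kap0 σ : ℂ) / √ω) * z * (√ω / (I * kap0 σ) : ℂ) = z by field_simp] at hκ'
  rw [hκ']
  field_simp
  ring

end ConcNLS

end


noncomputable section

namespace ConcNLS

open MeasureTheory Complex ComplexConjugate Set Filter Topology

variable {σ ν T t ω' γ' : ℝ} {u : ℝ → EnergySpace} {ω γ : ℝ → ℝ} {z : ℝ → ℂ}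

/-! ### Modulation equations -/

/-- The fluctuation of the charge. -/
def etaC (σ ν : ℝ) (u : EnergySpace) (θ ω : ℝ) : ℂ := exp (-I * θ) * u.charge - qSol σ ν ω

lemma phase_charge (u : EnergySpace) (θ ω : ℝ) :
    exp (-I * θ) * u.charge = qSol σ ν ω + etaC σ ν u θ ω := by rw [etaC]; ring

lemma Nq_eq_Nplus (ω : ℝ) (η : ℂ) : Nq σ ν (qSol σ ν ω + η)
    = sS ω * (qSol σ ν ω + (2 * σ + 1) * η.re + I * η.im) + Nplus σ ν ω η := by
  rw [Nplus]; ring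

lemma hasDerivWithinAt_mul_sqrt {S : Set ℝ} (c : ℝ) (hω : 0 < ω t) (hd : HasDerivWithinAt ω ω' S t) :
    HasDerivWithinAt (fun s => c * √(ω s)) (c * (ω' / (2 * √(ω t)))) S t :=
  (hd.sqrt hω.ne').const_mul c

lemma HasDerivWithinAt.complex_re {f : ℝ → ℂ} {f' : ℂ} {S : Set ℝ} (hf : HasDerivWithinAt f f' S t) :
    HasDerivWithinAt (fun s => (f s).re) f'.re S t :=
  reCLM.hasFDerivAt.comp_hasDerivWithinAt t hf

lemma HasDerivWithinAt.complex_im {f : ℝ → ℂ} {f' : ℂ} {S : Set ℝ} (hf : HasDerivWithinAt f f' S t) :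
    HasDerivWithinAt (fun s => (f s).im) f'.im S t :=
  imCLM.hasFDerivAt.comp_hasDerivWithinAt t hf

lemma HasDerivWithinAt.complex_conj {f : ℝ → ℂ} {f' : ℂ} {S : Set ℝ} (hf : HasDerivWithinAt f f' S t) :
    HasDerivWithinAt (fun s => conj (f s)) (conj f') S t :=
  conjCLE.hasFDerivAt.comp_hasDerivWithinAt t hf

lemma HasDerivWithinAt.to_complex {f : ℝ → ℝ} {f' : ℝ} {S : Set ℝ} (hf : HasDerivWithinAt f f' S t) :
    HasDerivWithinAt (fun s => (f s : ℂ)) (f' : ℂ) S t :=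
  ofRealCLM.hasFDerivAt.comp_hasDerivWithinAt t hf

lemma hasDerivWithinAt_qSol_comp (h : Adm σ) (hν : 0 < ν) {S : Set ℝ} (hω : 0 < ω t)
    (hd : HasDerivWithinAt ω ω' S t) :
    HasDerivWithinAt (fun s => qSol σ ν (ω s)) (qSol σ ν (ω t) / (4 * σ * ω t) * ω') S t :=
  (hasDerivAt_qSol h hν hω).comp_hasDerivWithinAt t hd

/-- Derivative of the zeroth moment with the charge written as a perturbation. -/
lemma hasDerivWithinAt_moment_zero (hs : IsSolution σ ν T u) {c θ' : ℝ} {θ : ℝ → ℝ} (hc : 0 < c)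
    (ht : t ∈ Icc 0 T) (hω : 0 < ω t) (hd : HasDerivWithinAt ω ω' (Icc 0 T) t)
    (hθ : HasDerivWithinAt θ θ' (Icc 0 T) t) :
    HasDerivWithinAt (fun s => mp 0 (c * √(ω s)) (θ s) (u s).toFun)
      (-I * θ' * mp 0 (c * √(ω t)) (θ t) (u t).toFun
        - I * (-(c * √(ω t)) ^ 2 * mp 0 (c * √(ω t)) (θ t) (u t).toFun
          + (qSol σ ν (ω t) + etaC σ ν (u t) (θ t) (ω t)) * ((c * √(ω t)) / (4 * Real.pi))
          - (sS (ω t) * (qSol σ ν (ω t) + (2 * σ + 1) * (etaC σ ν (u t) (θ t) (ω t)).re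
            + I * (etaC σ ν (u t) (θ t) (ω t)).im) + Nplus σ ν (ω t) (etaC σ ν (u t) (θ t) (ω t))))
        - c * (ω' / (2 * √(ω t))) * mp 1 (c * √(ω t)) (θ t) (u t).toFun) (Icc 0 T) t := by
  have hk : 0 < c * √(ω t) := mul_pos hc (Real.sqrt_pos.2 hω)
  have := hasDerivWithinAt_mp_zero hs ht (k := fun s => c * √(ω s)) hk
    (hasDerivWithinAt_mul_sqrt c hω hd) hθ
  simp only [phase_charge (σ := σ) (ν := ν) (u t) (θ t) (ω t), Nq_eq_Nplus] at this
  refine this.congr_deriv ?_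
  push_cast
  ring

/-- The real and imaginary part of the derivative of the resonant moment. -/
lemma moment_deriv_parts (m0 m1 N η : ℂ) (Q k w γ' ω' σ : ℝ) (hw : w = k ^ 2) :
    (-I * ((w + γ' : ℝ) : ℂ) * m0 - I * (-(k : ℂ) ^ 2 * m0 + (Q + η) * (k / (4 * Real.pi))
      - (((k / (4 * Real.pi) : ℝ) : ℂ) * (Q + (2 * σ + 1) * η.re + I * η.im) + N))
      - ω' / (2 * k) * m1).re = γ' * m0.im - N.im - ω' / (2 * k) * m1.re ∧
    (-I * ((w + γ' : ℝ) : ℂ) * m0 - I * (-(k : ℂ) ^ 2 * m0 + (Q + η) * (k / (4 * Real.pi))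
      - (((k / (4 * Real.pi) : ℝ) : ℂ) * (Q + (2 * σ + 1) * η.re + I * η.im) + N))
      - ω' / (2 * k) * m1).im = -γ' * m0.re + 2 * σ * (k / (4 * Real.pi)) * η.re + N.re
        - ω' / (2 * k) * m1.im := by
  have e : (-I * ((w + γ' : ℝ) : ℂ) * m0 - I * (-(k : ℂ) ^ 2 * m0 + (Q + η) * (k / (4 * Real.pi))
      - (((k / (4 * Real.pi) : ℝ) : ℂ) * (Q + (2 * σ + 1) * η.re + I * η.im) + N))
      - ω' / (2 * k) * m1) = ((γ' * m0.im - N.im - ω' / (2 * k) * m1.re : ℝ) : ℂ)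
        + ((-γ' * m0.re + 2 * σ * (k / (4 * Real.pi)) * η.re + N.re - ω' / (2 * k) * m1.im : ℝ) : ℂ) * I := by
    rw [hw]
    conv_lhs => rw [← re_add_im m0, ← re_add_im m1, ← re_add_im N]
    conv_lhs => rw [show (Q : ℂ) + η = Q + (η.re + η.im * I) by rw [re_add_im]]
    push_cast
    linear_combination (-γ' * (m0.im : ℂ) + N.im) * I_sq
  rw [e]
  exact ⟨by rw [add_re, ofReal_re, re_ofReal_mul, I_re, mul_zero, add_zero],
    by rw [add_im, ofReal_im, im_ofReal_mul, I_im, mul_one, zero_add]⟩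

/-- `constraint_re` is differentiated in two ways: through the moment equation and through its
explicit right-hand side. At the rate √ω the free evolution and the terms linear in the charge
cancel in the real part, so the source is the nonlinear remainder. The explicit side yields the
coefficient Δ/q_ω of ω', up to the fluctuation of a moment. -/
lemma modulation_eq_re (h : Adm σ) (hν : 0 < ν) (hT : 0 < T) (hM : IsModulated σ ν T u ω γ z)
    (ht : t ∈ Icc 0 T) (hd : HasDerivWithinAt ω ω' (Icc 0 T) t)
    (hγ : HasDerivWithinAt γ γ' (Icc 0 T) t) :
    ω' * (Delta σ ν (ω t) / qSol σ ν (ω t) + ((mp 1 √(ω t) (phase ω γ t) (u t).toFun).re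
        - qSol σ ν (ω t) / (16 * Real.pi * √(ω t) ^ 2)) / (2 * √(ω t)))
      = -(Nplus σ ν (ω t) (etaC σ ν (u t) (phase ω γ t) (ω t))).im
        + γ' * (mp 0 √(ω t) (phase ω γ t) (u t).toFun).im := by
  have hω := hM.omega_pos t ht
  have hk := Real.sqrt_pos.2 hω
  have hσ := h.pos
  have hpi := Real.pi_pos
  have hQ := qSol_pos (σ := σ) hν hω
  have hθ := hasDerivWithinAt_phase hM.omega_C1.continuousOn ht hγ
  have d1 := HasDerivWithinAt.complex_re (hasDerivWithinAt_moment_zero hM.sol one_pos ht hω hd hθ)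
  simp only [one_mul, ofReal_one, sS] at d1
  rw [(moment_deriv_parts _ _ _ _ _ _ _ _ _ _ (Real.sq_sqrt hω.le).symm).1] at d1
  have d2 : HasDerivWithinAt (fun s => qSol σ ν (ω s) / (8 * Real.pi * √(ω s))) _ (Icc 0 T) t :=
    (hasDerivWithinAt_qSol_comp h hν hω hd).div ((hd.sqrt hω.ne').const_mul (8 * Real.pi))
      (by positivity)
  have d3 := d2.congr (f₁ := fun s => (mp 0 √(ω s) (phase ω γ s) (u s).toFun).re)
    (fun s hs => constraint_re h hν (hM.omega_pos s hs) (u s) (hM.orth0 s hs))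
    (constraint_re h hν hω (u t) (hM.orth0 t ht))
  have e := (uniqueDiffOn_Icc hT t ht).eq_deriv _ d1 d3
  rw [Delta_eq h hν hω]
  have hω2 : ω t = √(ω t) ^ 2 := (Real.sq_sqrt hω.le).symm
  set k := √(ω t) with hkdef
  clear_value k
  generalize mp 0 k (phase ω γ t) (u t).toFun = m0 at *
  generalize mp 1 k (phase ω γ t) (u t).toFun = m1 at *
  generalize Nplus σ ν (ω t) (etaC σ ν (u t) (phase ω γ t) (ω t)) = N at *
  generalize qSol σ ν (ω t) = Q at *
  rw [hω2] at e
  field_simp at e ⊢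
  linear_combination -16 * e

lemma hasDerivWithinAt_moment_one (hs : IsSolution σ ν T u) {c θ' : ℝ} {θ : ℝ → ℝ} (hc : 0 < c)
    (ht : t ∈ Icc 0 T) (hω : 0 < ω t) (hd : HasDerivWithinAt ω ω' (Icc 0 T) t)
    (hθ : HasDerivWithinAt θ θ' (Icc 0 T) t) :
    HasDerivWithinAt (fun s => mp 1 (c * √(ω s)) (θ s) (u s).toFun)
      (-I * θ' * mp 1 (c * √(ω t)) (θ t) (u t).toFun
        - I * (2 * (c * √(ω t)) * mp 0 (c * √(ω t)) (θ t) (u t).toFun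
          - (c * √(ω t)) ^ 2 * mp 1 (c * √(ω t)) (θ t) (u t).toFun
          - (qSol σ ν (ω t) + etaC σ ν (u t) (θ t) (ω t)) / (4 * Real.pi))
        - c * (ω' / (2 * √(ω t))) * mp 2 (c * √(ω t)) (θ t) (u t).toFun) (Icc 0 T) t := by
  have hk : 0 < c * √(ω t) := mul_pos hc (Real.sqrt_pos.2 hω)
  have := hasDerivWithinAt_mp_one hs ht (k := fun s => c * √(ω s)) hk
    (hasDerivWithinAt_mul_sqrt c hω hd) hθ
  simp only [phase_charge (σ := σ) (ν := ν) (u t) (θ t) (ω t)] at this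
  refine this.congr_deriv ?_
  push_cast
  ring

lemma moment_one_deriv_im (m0 m1 m2 η : ℂ) (Q k w γ' ω' : ℝ) (hw : w = k ^ 2) :
    (-I * ((w + γ' : ℝ) : ℂ) * m1 - I * (2 * (k : ℂ) * m0 - (k : ℂ) ^ 2 * m1 - (Q + η) / (4 * Real.pi))
      - ω' / (2 * k) * m2).im = -γ' * m1.re - (2 * k * m0.re - (Q + η.re) / (4 * Real.pi))
        - ω' / (2 * k) * m2.im := by
  have e : (-I * ((w + γ' : ℝ) : ℂ) * m1 - I * (2 * (k : ℂ) * m0 - (k : ℂ) ^ 2 * m1 - (Q + η) / (4 * Real.pi))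
      - ω' / (2 * k) * m2) = ((γ' * m1.im + 2 * k * m0.im - η.im / (4 * Real.pi)
        - ω' / (2 * k) * m2.re : ℝ) : ℂ)
        + ((-γ' * m1.re - (2 * k * m0.re - (Q + η.re) / (4 * Real.pi))
        - ω' / (2 * k) * m2.im : ℝ) : ℂ) * I := by
    rw [hw]
    conv_lhs => rw [← re_add_im m0, ← re_add_im m1, ← re_add_im m2, ← re_add_im η]
    push_cast
    linear_combination (-γ' * (m1.im : ℂ) - 2 * k * m0.im + η.im / (4 * Real.pi)) * I_sq
  rw [e, add_im, ofReal_im, im_ofReal_mul, I_im, mul_one, zero_add]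

/-- `constraint_im` is differentiated. The zeroth moment produces a term 2σ√ω Re η/(4π), which the
first moment, multiplied by 2σ√ω, compensates; `constraint_re` removes the remaining zeroth moment.
The factor 1 - σ is what makes the coefficient of γ' invertible. -/
lemma modulation_eq_im (h : Adm σ) (hν : 0 < ν) (hT : 0 < T) (hM : IsModulated σ ν T u ω γ z)
    (ht : t ∈ Icc 0 T) (hd : HasDerivWithinAt ω ω' (Icc 0 T) t)
    (hγ : HasDerivWithinAt γ γ' (Icc 0 T) t) :
    γ' * (qSol σ ν (ω t) * (1 - σ) / (8 * Real.pi * √(ω t))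
        - 2 * σ * √(ω t) * ((mp 1 √(ω t) (phase ω γ t) (u t).toFun).re
          - qSol σ ν (ω t) / (16 * Real.pi * √(ω t) ^ 2)))
      = (Nplus σ ν (ω t) (etaC σ ν (u t) (phase ω γ t) (ω t))).re
        - ω' * ((1 + 2 * σ) / (2 * √(ω t))) * (mp 1 √(ω t) (phase ω γ t) (u t).toFun).im
        + ω' * σ * (mp 2 √(ω t) (phase ω γ t) (u t).toFun).im := by
  have hω := hM.omega_pos t ht
  have hk := Real.sqrt_pos.2 hω
  have hσ := h.pos
  have hpi := Real.pi_pos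
  have hθ := hasDerivWithinAt_phase hM.omega_C1.continuousOn ht hγ
  have d1 := HasDerivWithinAt.complex_im (hasDerivWithinAt_moment_zero hM.sol one_pos ht hω hd hθ)
  simp only [one_mul, ofReal_one, sS] at d1
  rw [(moment_deriv_parts _ _ _ _ _ _ _ _ _ _ (Real.sq_sqrt hω.le).symm).2] at d1
  have d2 := HasDerivWithinAt.complex_im
    (hasDerivWithinAt_moment_one (ν := ν) hM.sol one_pos ht hω hd hθ)
  simp only [one_mul, ofReal_one] at d2
  rw [moment_one_deriv_im _ _ _ _ _ _ _ _ _ (Real.sq_sqrt hω.le).symm] at d2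
  have d3 : HasDerivWithinAt (fun s => 2 * σ * √(ω s) * (mp 1 √(ω s) (phase ω γ s) (u s).toFun).im) _
    (Icc 0 T) t := ((hd.sqrt hω.ne').const_mul (2 * σ)).mul d2
  have d4 := d3.congr (f₁ := fun s => (mp 0 √(ω s) (phase ω γ s) (u s).toFun).im)
    (fun s hs => constraint_im h hν (hM.omega_pos s hs) (u s) (hM.orth0 s hs))
    (constraint_im h hν hω (u t) (hM.orth0 t ht))
  have e := (uniqueDiffOn_Icc hT t ht).eq_deriv _ d1 d4
  have c0 := constraint_re h hν hω (u t) (hM.orth0 t ht)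
  have hω2 : ω t = √(ω t) ^ 2 := (Real.sq_sqrt hω.le).symm
  set k := √(ω t) with hkdef
  clear_value k
  generalize mp 0 k (phase ω γ t) (u t).toFun = m0 at *
  generalize mp 1 k (phase ω γ t) (u t).toFun = m1 at *
  generalize mp 2 k (phase ω γ t) (u t).toFun = m2 at *
  generalize Nplus σ ν (ω t) (etaC σ ν (u t) (phase ω γ t) (ω t)) = N at *
  generalize qSol σ ν (ω t) = Q at *
  rw [c0] at e
  field_simp at e ⊢
  linear_combination -4 * e

/-- The algebra behind the equation of `z`: `A`, `B` are the moments at the two exponents. -/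
lemma z_equation_algebra {A B A1 B1 σ c C a b d iC iσ k ik P R S n1 n2 γ' ω' : ℂ}
    (hk : k * ik = 1) (hd : d * (a + 1) = 1) (hC : C * iC = 1)
    (F1 : 1 - a ^ 2 = 2 * σ * c) (F2 : b ^ 2 - 1 = 2 * σ * c) (F3 : a - C * b = (2 * σ + 1) * (1 - C))
    (F4 : a + C * b = 1 + C) (F5 : (C - 1) * (a + 1) = 2 * c)
    (F6 : a + b * iC = (a + 1) * (2 - iσ)) :
    ω' * ik ^ 2 / 2 * (A + C * B)
      + (I * (k ^ 2 + γ') * A + I * (-(a * k) ^ 2 * A + (P + R - I * S) * (a * k)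
          - (k * (P + (2 * σ + 1) * R - I * S) + (n1 - I * n2))) - a * (ω' * ik / 2) * A1)
      + C * (-I * (k ^ 2 + γ') * B - I * (-(b * k) ^ 2 * B + (P + R + I * S) * (b * k)
          - (k * (P + (2 * σ + 1) * R + I * S) + (n1 + I * n2))) - b * (ω' * ik / 2) * B1)
      - P * d * ω' * ik ^ 3 * iσ / 2
    = I * (2 * σ * c * k ^ 2) * (A + C * B - 2 * P * d * ik)
      + ω' * ik ^ 2 / 2 * (A + C * B - 2 * P * d * ik)
      - I * (n1 * (1 - C) + n2 * (-I * (1 + C))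
        - γ' * ((A - P * d * ik) - C * (B - P * d * iC * ik))
        - I * (ω' * ik / 2) * (a * (A1 - P * d ^ 2 * ik ^ 2)
          + C * b * (B1 - P * d ^ 2 * iC ^ 2 * ik ^ 2))) := by
  -- F1 and F2 turn the free evolution of the two moments into iξ. F3 and F4 are the boundary
  -- conditions of Ψ, which cancel the terms linear in the charge. F5 and F6 account for the
  -- subtracted contribution of the standing wave.
  linear_combination (I * k ^ 2 * A) * F1 + (I * C * k ^ 2 * B) * F2
    + (4 * I * σ * c * P * d * k) * hk + (I * k * P + I * k * R) * F3 - (I * k * P * 2 * σ * d) * F5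
    + (I * k * P * 2 * σ * (C - 1)) * hd + (k * S) * F4 - (I * γ' * P * d * ik) * hC
    - (ω' / 2 * P * d ^ 2 * ik ^ 3 * b * iC) * hC - (ω' / 2 * P * d ^ 2 * ik ^ 3) * F6
    - (P * d * ω' * ik ^ 3 * (1 - iσ / 2)) * hd
    + (ω' * ik * (-1 / 2) * (C * b * B1 + a * A1) + ω' * ik ^ 3 * P * d ^ 2 / 2 * (C * b * iC ^ 2 + a)
      + k * S * (C - C * b - a + 1)) * I_sq

end ConcNLS

end


noncomputable section

namespace ConcNLS

open MeasureTheory Complex ComplexConjugate Set Filter Topology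

variable {σ ν T t ω' γ' : ℝ} {u : ℝ → EnergySpace} {ω γ : ℝ → ℝ} {z : ℝ → ℂ}

/-! ### The equation of the discrete mode -/

/-- The part of the phase term of the equation of `z` that comes from `f`. -/
def phasePair (σ ω : ℝ) (f : Field2) : ℂ :=
  (pe 0 (a0 σ * √ω) (fun x => f x 0) - I * pe 0 (a0 σ * √ω) (fun x => f x 1))
    - Cc σ * (pe 0 (b0 σ * √ω) (fun x => f x 0) + I * pe 0 (b0 σ * √ω) (fun x => f x 1))

/-- The part of the frequency term of the equation of `z` that comes from `f`. -/
def freqPair (σ ω : ℝ) (f : Field2) : ℂ :=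
  a0 σ * (pe 1 (a0 σ * √ω) (fun x => f x 0) - I * pe 1 (a0 σ * √ω) (fun x => f x 1))
    + Cc σ * b0 σ * (pe 1 (b0 σ * √ω) (fun x => f x 0) + I * pe 1 (b0 σ * √ω) (fun x => f x 1))

/-- The coefficient of `z` in the frequency term. -/
def freqC1 (σ ω : ℝ) : ℂ :=
  (((1 / a0 σ - Cc σ ^ 2 / b0 σ) / (8 * Real.pi * √ω ^ 2) : ℝ) : ℂ)

/-- The coefficient of `conj z` in the frequency term. -/
def freqC2 (σ ω : ℝ) : ℂ :=
  ((Cc σ * (b0 σ - a0 σ) / (2 * Real.pi * (a0 σ + b0 σ) ^ 2 * √ω ^ 2) : ℝ) : ℂ)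

/-- The subtracted constants are the moments of the standing wave. What is left of the moments is
the contribution of z and its conjugate, computed from the pairings of Ψ, and that of f. -/
lemma moment_pair (h : Adm σ) {w θ : ℝ} {ζ : ℂ} (hω : 0 < w) (u : EnergySpace) :
    ((conj (mp 0 (a0 σ * √w) θ u.toFun) - qSol σ ν w / (4 * Real.pi) * (1 / (a0 σ + 1)) * (1 / √w))
      - Cc σ * (mp 0 (b0 σ * √w) θ u.toFun
        - qSol σ ν w / (4 * Real.pi) * (1 / (a0 σ + 1)) * (1 / Cc σ) * (1 / √w))
      = ip (Psi σ w) (Psi σ w) * ζ + ip (PsiStar σ w) (Psi σ w) * conj ζ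
        + phasePair σ w (fPart σ ν u.toFun θ w ζ)) ∧
    (a0 σ * (conj (mp 1 (a0 σ * √w) θ u.toFun)
        - qSol σ ν w / (4 * Real.pi) * (1 / (a0 σ + 1)) ^ 2 * (1 / √w) ^ 2)
      + Cc σ * b0 σ * (mp 1 (b0 σ * √w) θ u.toFun
        - qSol σ ν w / (4 * Real.pi) * (1 / (a0 σ + 1)) ^ 2 * (1 / Cc σ) ^ 2 * (1 / √w) ^ 2)
      = freqC1 σ w * ζ + freqC2 σ w * conj ζ + freqPair σ w (fPart σ ν u.toFun θ w ζ)) := by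
  have hs : 0 < √w := Real.sqrt_pos.2 hω
  have ha := mul_pos h.a0_pos hs
  have hb := mul_pos h.b0_pos hs
  have e1 := sqrt_ne hω
  have e2 := pi_ne
  have e4 : (a0 σ + 1 : ℂ) ≠ 0 := by
    exact_mod_cast (by linarith [h.a0_pos] : a0 σ + 1 ≠ 0)
  have e5 : (Cc σ : ℂ) ≠ 0 := by exact_mod_cast h.Cc_pos.ne'
  have e6 : (a0 σ : ℂ) ≠ 0 := by exact_mod_cast h.a0_pos.ne'
  have e7 : (b0 σ : ℂ) ≠ 0 := by exact_mod_cast h.b0_pos.ne'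
  have e8 : (a0 σ + b0 σ : ℂ) ≠ 0 := by exact_mod_cast (add_pos h.a0_pos h.b0_pos).ne'
  have e9 : (b0 σ + a0 σ : ℂ) ≠ 0 := by rwa [add_comm]
  have cc : ∀ m : ℂ, conj m = (m.re : ℂ) - (m.im : ℂ) * I := fun m => by
    conv_lhs => rw [← re_add_im m]
    simp only [map_add, map_mul, conj_ofReal, conj_I]; ring
  have key : ∀ n : ℕ, ∀ k : ℝ, 0 < k →
    ((mp n k θ u.toFun).re : ℂ) = pe n k (fun x => fPart σ ν u.toFun θ w ζ x 0)
      + qSol σ ν w * (n.factorial / (4 * Real.pi * ((k + √w : ℝ) : ℂ) ^ (n + 1)))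
      + (ζ + conj ζ) * pe n k (fun x => Psi σ w x 0) ∧
    ((mp n k θ u.toFun).im : ℂ) = pe n k (fun x => fPart σ ν u.toFun θ w ζ x 1)
      + (ζ - conj ζ) * pe n k (fun x => Psi σ w x 1) := fun n k hk => by
    rw [(pe_fPart h hω u n hk).1, (pe_fPart h hω u n hk).2]; constructor <;> ring
  have fa : a0 σ * √w + √w = (a0 σ + 1) * √w := by ring
  have fb : b0 σ * √w + √w = Cc σ * ((a0 σ + 1) * √w) := by rw [b_add h, fa]
  have g1 : a0 σ * √w + a0 σ * √w = 2 * a0 σ * √w := by ring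
  have g2 : b0 σ * √w + b0 σ * √w = 2 * b0 σ * √w := by ring
  have g3 : a0 σ * √w + b0 σ * √w = (a0 σ + b0 σ) * √w := by ring
  have g4 : b0 σ * √w + a0 σ * √w = (a0 σ + b0 σ) * √w := by ring
  have bb : ∀ n k, mp n k θ u.toFun = _ := fun n k => (re_add_im (mp n k θ u.toFun)).symm
  constructor
  · rw [cc, bb 0 (b0 σ * √w), (key 0 _ ha).1, (key 0 _ ha).2, (key 0 _ hb).1, (key 0 _ hb).2,
      ip_Psi_Psi h hω, ip_PsiStar_Psi h hω, phasePair, pe_Psi_zero h hω 0 ha, pe_Psi_zero h hω 0 hb,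
      pe_Psi_one h hω 0 ha, pe_Psi_one h hω 0 hb, fa, fb, g1, g2, g3, g4]
    simp only [Nat.factorial]
    push_cast
    field_simp
    ring_nf
    simp only [I_sq]
    ring
  · rw [cc, bb 1 (b0 σ * √w), (key 1 _ ha).1, (key 1 _ ha).2, (key 1 _ hb).1, (key 1 _ hb).2,
      freqC1, freqC2, freqPair, pe_Psi_zero h hω 1 ha, pe_Psi_zero h hω 1 hb,
      pe_Psi_one h hω 1 ha, pe_Psi_one h hω 1 hb, fa, fb, g1, g2, g3, g4]
    simp only [Nat.factorial]
    push_cast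
    field_simp
    ring_nf
    simp only [I_sq]
    ring

/-- `constraint_z` writes z as an explicit function of ω and two moments, so differentiability of z
is a conclusion. The derivative is put into this shape by `z_equation_algebra`, and `moment_pair`
then returns from moments to z and f. -/
lemma hasDerivWithinAt_z_moments (h : Adm σ) (hν : 0 < ν) (hM : IsModulated σ ν T u ω γ z)
    (ht : t ∈ Icc 0 T) (hd : HasDerivWithinAt ω ω' (Icc 0 T) t)
    (hγ : HasDerivWithinAt γ γ' (Icc 0 T) t) :
    HasDerivWithinAt z (I * xi σ (ω t) * z t + ω' / (2 * ω t) * z t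
      - I * ((√(ω t) / kap0 σ : ℝ) : ℂ) *
        ((Nplus σ ν (ω t) (etaC σ ν (u t) (phase ω γ t) (ω t))).re * (1 - Cc σ)
          + (Nplus σ ν (ω t) (etaC σ ν (u t) (phase ω γ t) (ω t))).im * (-I * (1 + Cc σ))
          - γ' * (ip (Psi σ (ω t)) (Psi σ (ω t)) * z t + ip (PsiStar σ (ω t)) (Psi σ (ω t)) * conj (z t)
            + phasePair σ (ω t) (fPart σ ν (u t).toFun (phase ω γ t) (ω t) (z t)))
          - I * (ω' * (1 / √(ω t)) / 2) * (freqC1 σ (ω t) * z t + freqC2 σ (ω t) * conj (z t)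
            + freqPair σ (ω t) (fPart σ ν (u t).toFun (phase ω γ t) (ω t) (z t))))) (Icc 0 T) t := by
  have hω := hM.omega_pos t ht
  have hk := Real.sqrt_pos.2 hω
  have hσ := h.pos
  have hkap := kap0_pos h
  have hθ := hasDerivWithinAt_phase hM.omega_C1.continuousOn ht hγ
  have dA := HasDerivWithinAt.complex_conj
    (hasDerivWithinAt_moment_zero (ν := ν) hM.sol h.a0_pos ht hω hd hθ)
  have dB := hasDerivWithinAt_moment_zero (ν := ν) hM.sol h.b0_pos ht hω hd hθ
  have dk := HasDerivWithinAt.to_complex ((hd.sqrt hω.ne').div_const (kap0 σ))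
  have dQ := HasDerivWithinAt.to_complex ((hasDerivWithinAt_qSol_comp h hν hω hd).div_const
    (2 * Real.pi * (a0 σ + 1) * kap0 σ))
  have d3 := (dk.mul (dA.add (dB.const_mul (Cc σ : ℂ)))).sub dQ
  have d4 := d3.congr (f₁ := z)
    (fun s hs => constraint_z h (hM.omega_pos s hs) (u s) (hM.orth1 s hs))
    (constraint_z h hω (u t) (hM.orth1 t ht))
  refine d4.congr_deriv ?_
  have mpair := moment_pair (ν := ν) h (θ := phase ω γ t) (ζ := z t) hω (u t)
  rw [← mpair.1, ← mpair.2]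
  have hz := constraint_z h hω (u t) (hM.orth1 t ht)
  have hω2 : (ω t : ℂ) = (√(ω t) : ℂ) ^ 2 := by exact_mod_cast (Real.sq_sqrt hω.le).symm
  have ek : (√(ω t) : ℂ) ≠ 0 := sqrt_ne hω
  have epi := pi_ne
  have e3 : (kap0 σ : ℂ) ≠ 0 := by exact_mod_cast hkap.ne'
  have e4 : (a0 σ + 1 : ℂ) ≠ 0 := by
    exact_mod_cast (by linarith [h.a0_pos] : a0 σ + 1 ≠ 0)
  have e5 : (Cc σ : ℂ) ≠ 0 := by exact_mod_cast h.Cc_pos.ne'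
  have eσ : (σ : ℂ) ≠ 0 := by exact_mod_cast hσ.ne'
  have ecs : (cs σ : ℂ) ^ 2 = 1 - (σ : ℂ) ^ 2 := by exact_mod_cast h.cs_sq
  have ea : (a0 σ : ℂ) = σ - cs σ := by rw [a0]; push_cast; ring
  have eb : (b0 σ : ℂ) = σ + cs σ := by rw [b0]; push_cast; ring
  have eb1 : (b0 σ : ℂ) + 1 = Cc σ * (a0 σ + 1) := by exact_mod_cast h.b0_add_one
  have eCm : (Cc σ : ℂ) * σ = 1 + cs σ := by exact_mod_cast h.Cc_mul
  have hA := z_equation_algebra (A := conj (mp 0 (a0 σ * √(ω t)) (phase ω γ t) (u t).toFun))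
    (B := mp 0 (b0 σ * √(ω t)) (phase ω γ t) (u t).toFun)
    (A1 := conj (mp 1 (a0 σ * √(ω t)) (phase ω γ t) (u t).toFun))
    (B1 := mp 1 (b0 σ * √(ω t)) (phase ω γ t) (u t).toFun)
    (σ := σ) (c := cs σ) (C := Cc σ) (a := a0 σ) (b := b0 σ) (d := 1 / (a0 σ + 1))
    (iC := 1 / Cc σ) (iσ := 1 / σ) (k := √(ω t)) (ik := 1 / √(ω t))
    (P := qSol σ ν (ω t) / (4 * Real.pi))
    (R := (etaC σ ν (u t) (phase ω γ t) (ω t)).re / (4 * Real.pi))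
    (S := (etaC σ ν (u t) (phase ω γ t) (ω t)).im / (4 * Real.pi))
    (n1 := (Nplus σ ν (ω t) (etaC σ ν (u t) (phase ω γ t) (ω t))).re)
    (n2 := (Nplus σ ν (ω t) (etaC σ ν (u t) (phase ω γ t) (ω t))).im) (γ' := γ') (ω' := ω')
    (by field_simp) (by field_simp) (by field_simp)
    (by rw [ea]; linear_combination -ecs) (by rw [eb]; linear_combination ecs)
    (by exact_mod_cast h.a0_sub) (by exact_mod_cast h.a0_add)
    (by rw [ea]; apply mul_left_cancel₀ eσ; linear_combination (σ - cs σ + 1) * eCm - ecs)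
    (by
      rw [mul_one_div, ← sub_eq_zero]
      field_simp
      linear_combination (σ - 1) * eb1 - eCm + eb)
  simp only [Pi.add_apply]
  have cr : ∀ m : ℂ, conj m = (m.re : ℂ) - (m.im : ℂ) * I := fun m => by
    conv_lhs => rw [← re_add_im m]
    simp only [map_add, map_mul, conj_ofReal, conj_I]; ring
  have hxi : (xi σ (ω t) : ℂ) = 2 * σ * cs σ * (√(ω t)) ^ 2 := by rw [← hω2, xi, cs]; push_cast; ring
  have hη := re_add_im (etaC σ ν (u t) (phase ω γ t) (ω t))
  have hN := re_add_im (Nplus σ ν (ω t) (etaC σ ν (u t) (phase ω γ t) (ω t)))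
  rw [hxi]
  generalize (etaC σ ν (u t) (phase ω γ t) (ω t)).re = η1 at *
  generalize (etaC σ ν (u t) (phase ω γ t) (ω t)).im = η2 at *
  generalize (Nplus σ ν (ω t) (etaC σ ν (u t) (phase ω γ t) (ω t))).re = n1 at *
  generalize (Nplus σ ν (ω t) (etaC σ ν (u t) (phase ω γ t) (ω t))).im = n2 at *
  rw [← hN, ← hη]
  simp only [map_add, map_sub, map_mul, map_neg, map_pow, map_div₀, conj_ofReal, conj_I, map_one, map_ofNat]
  generalize conj (mp 0 (a0 σ * √(ω t)) (phase ω γ t) (u t).toFun) = A at *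
  generalize mp 0 (b0 σ * √(ω t)) (phase ω γ t) (u t).toFun = B at *
  generalize conj (mp 1 (a0 σ * √(ω t)) (phase ω γ t) (u t).toFun) = A1 at *
  generalize mp 1 (b0 σ * √(ω t)) (phase ω γ t) (u t).toFun = B1 at *
  simp only [sS]
  push_cast at hz ⊢
  have hz' : A + Cc σ * B - 2 * (qSol σ ν (ω t) / (4 * Real.pi)) * (1 / (a0 σ + 1)) * (1 / √(ω t))
      = z t * (kap0 σ / √(ω t)) := by
    rw [hz]; field_simp; ring
  rw [hz'] at hA
  clear hz hz' d4 d3 dA dB dk dQ hM hθ mpair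
  rw [hω2]
  generalize z t = ζ at *
  generalize qSol σ ν (ω t) = Q at *
  generalize √(ω t) = k at *
  have hA' := congrArg (fun x => (k / kap0 σ : ℂ) * x) hA
  refine Eq.trans (Eq.trans ?_ hA') ?_
  · field_simp
    ring
  · field_simp


end ConcNLS

end


/-! ### Orders in ρ, the abstract normal form, and the expansion of the exact equations. -/

noncomputable section

namespace ConcNLS

open MeasureTheory Complex ComplexConjugate Set Filter Topology

/-! ### Weighted orders of magnitude -/

section
variable {X : Type*} {ρ : X → ℝ} {F G : X → ℂ} {m n : ℕ}

/-- `F` is of order `ρ ^ n` as `ρ` tends to zero. -/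
def Wt (ρ : X → ℝ) (n : ℕ) (F : X → ℂ) : Prop :=
  Asymptotics.IsBigO (comap ρ (𝓝 0)) F (fun x => ρ x ^ n)

namespace Wt

lemma of_bound (C : ℝ) (hρ : ∀ x, 0 ≤ ρ x) (h : ∀ x, ‖F x‖ ≤ C * ρ x ^ n) : Wt ρ n F :=
  Asymptotics.IsBigO.of_bound C (Eventually.of_forall fun x => by
    rw [Real.norm_of_nonneg (pow_nonneg (hρ x) n)]; exact h x)

lemma of_bound_zero (C : ℝ) (h : ∀ x, ‖F x‖ ≤ C) : Wt ρ 0 F :=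
  Asymptotics.IsBigO.of_bound C (Eventually.of_forall fun x => by simpa using h x)

lemma congr (hF : Wt ρ n F) (h : ∀ x, G x = F x) : Wt ρ n G := by
  rwa [show G = F from funext h]

lemma add (hF : Wt ρ n F) (hG : Wt ρ n G) : Wt ρ n (fun x => F x + G x) := Asymptotics.IsBigO.add hF hG

lemma sub (hF : Wt ρ n F) (hG : Wt ρ n G) : Wt ρ n (fun x => F x - G x) := Asymptotics.IsBigO.sub hF hG

lemma mul (hF : Wt ρ m F) (hG : Wt ρ n G) : Wt ρ (m + n) (fun x => F x * G x) := by
  simpa only [Wt, pow_add] using Asymptotics.IsBigO.mul hF hG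

lemma const_mul (c : ℂ) (hF : Wt ρ n F) : Wt ρ n (fun x => c * F x) :=
  Asymptotics.IsBigO.const_mul_left hF c

lemma coef_mul (hF : Wt ρ 0 F) (hG : Wt ρ n G) : Wt ρ n (fun x => F x * G x) := by
  simpa only [zero_add] using hF.mul hG

lemma star (hF : Wt ρ n F) : Wt ρ n (fun x => conj (F x)) :=
  Asymptotics.isBigO_norm_left.1
    ((Asymptotics.isBigO_norm_left.2 hF).congr_left fun x => (RCLike.norm_conj (F x)).symm)

lemma mono (hF : Wt ρ n F) (h : m ≤ n) : Wt ρ m F := by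
  refine Asymptotics.IsBigO.trans hF ?_
  have ht : Tendsto ρ (comap ρ (𝓝 0)) (𝓝 0) := tendsto_comap
  have h1 := (ht.pow (n - m)).isBigO_one ℝ
  have h2 := h1.mul (Asymptotics.isBigO_refl (fun x => ρ x ^ m) (comap ρ (𝓝 0)))
  simp only [one_mul, ← pow_add, Nat.sub_add_cancel h] at h2
  exact h2

lemma pow (hF : Wt ρ m F) (k : ℕ) : Wt ρ (k * m) (fun x => F x ^ k) := by
  have := Asymptotics.IsBigO.pow hF k
  simpa only [Wt, ← pow_mul, mul_comm] using this

/-- The filter is pulled back along ρ from the neighbourhoods of zero, so an order statement is one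
constant and one threshold for all points with ρ small. For states this is uniformity in the
solution, the time and the frozen frequency. -/
lemma exists_bound (hρ : ∀ x, 0 ≤ ρ x) (hF : Wt ρ n F) :
    ∃ C > 0, ∃ δ > 0, ∀ x, ρ x ≤ δ → ‖F x‖ ≤ C * ρ x ^ n := by
  obtain ⟨C, hC, hb⟩ := Asymptotics.IsBigO.exists_pos hF
  rw [Asymptotics.isBigOWith_iff, eventually_comap] at hb
  obtain ⟨δ, hδ, h⟩ := Metric.eventually_nhds_iff.1 hb
  refine ⟨C, hC, δ / 2, by positivity, fun x hx => ?_⟩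
  have := h (y := ρ x) (by rw [Real.dist_eq, sub_zero, abs_of_nonneg (hρ x)]; linarith) x rfl
  rwa [Real.norm_of_nonneg (pow_nonneg (hρ x) n)] at this

lemma of_exists_bound {δ C : ℝ} (hδ : 0 < δ) (hρ : ∀ x, 0 ≤ ρ x)
    (h : ∀ x, ρ x ≤ δ → ‖F x‖ ≤ C * ρ x ^ n) : Wt ρ n F := by
  refine Asymptotics.IsBigO.of_bound C ?_
  rw [eventually_comap]
  filter_upwards [Metric.ball_mem_nhds (0 : ℝ) hδ] with y hy x hx
  rw [Real.norm_of_nonneg (pow_nonneg (hρ x) n)]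
  refine h x ?_
  rw [Metric.mem_ball, Real.dist_eq, sub_zero, ← hx] at hy
  exact (le_abs_self _).trans hy.le

end Wt

/-- A perturbed diagonal linear system. -/
lemma wt_linear_system (hρ : ∀ x, 0 ≤ ρ x) {a b iA iB e₁ e₂ e₃ e₄ N₀ N₁ : X → ℂ}
    (ha : ∀ x, a x = iA x * (-N₁ x + b x * e₂ x - a x * e₁ x))
    (hb : ∀ x, b x = iB x * (N₀ x + a x * e₄ x - b x * e₃ x))
    (hA : Wt ρ 0 iA) (hB : Wt ρ 0 iB) (h₁ : Wt ρ 1 e₁) (h₂ : Wt ρ 1 e₂) (h₃ : Wt ρ 1 e₃)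
    (h₄ : Wt ρ 1 e₄) (hN₀ : Wt ρ 2 N₀) (hN₁ : Wt ρ 2 N₁) :
    Wt ρ 2 a ∧ Wt ρ 2 b ∧ Wt ρ 3 (fun x => a x + iA x * N₁ x) ∧ Wt ρ 3 (fun x => b x - iB x * N₀ x) := by
  have key : Wt ρ 2 a ∧ Wt ρ 2 b := by
    obtain ⟨C₁, c₁, d₁, p₁, k₁⟩ := (hA.coef_mul h₁).exists_bound hρ
    obtain ⟨C₂, c₂, d₂, p₂, k₂⟩ := (hA.coef_mul h₂).exists_bound hρ
    obtain ⟨C₃, c₃, d₃, p₃, k₃⟩ := (hB.coef_mul h₃).exists_bound hρ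
    obtain ⟨C₄, c₄, d₄, p₄, k₄⟩ := (hB.coef_mul h₄).exists_bound hρ
    obtain ⟨C₅, c₅, d₅, p₅, k₅⟩ := (hA.coef_mul hN₁).exists_bound hρ
    obtain ⟨C₆, c₆, d₆, p₆, k₆⟩ := (hB.coef_mul hN₀).exists_bound hρ
    set S := C₁ + C₂ + C₃ + C₄ with hS
    have hS0 : 0 < S := by positivity
    have main : ∀ x, ρ x ≤ min (min (min d₁ d₂) (min d₃ d₄)) (min (min d₅ d₆) (1 / (2 * S))) →
        ‖a x‖ + ‖b x‖ ≤ (2 * (C₅ + C₆)) * ρ x ^ 2 := by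
      intro x hx
      simp only [le_min_iff] at hx
      obtain ⟨⟨⟨x1, x2⟩, x3, x4⟩, ⟨x5, x6⟩, x7⟩ := hx
      have ea : a x = -(iA x * N₁ x) + (iA x * e₂ x) * b x - (iA x * e₁ x) * a x := by
        conv_lhs => rw [ha x]
        ring
      have eb : b x = (iB x * N₀ x) + (iB x * e₄ x) * a x - (iB x * e₃ x) * b x := by
        conv_lhs => rw [hb x]
        ring
      have na : ‖a x‖ ≤ C₅ * ρ x ^ 2 + C₂ * ρ x ^ 1 * ‖b x‖ + C₁ * ρ x ^ 1 * ‖a x‖ := by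
        conv_lhs => rw [ea]
        refine (norm_sub_le _ _).trans (add_le_add ((norm_add_le _ _).trans (add_le_add ?_ ?_)) ?_)
        · rw [norm_neg]; exact k₅ x x5
        · rw [norm_mul]; exact mul_le_mul_of_nonneg_right (k₂ x x2) (norm_nonneg _)
        · rw [norm_mul]; exact mul_le_mul_of_nonneg_right (k₁ x x1) (norm_nonneg _)
      have nb : ‖b x‖ ≤ C₆ * ρ x ^ 2 + C₄ * ρ x ^ 1 * ‖a x‖ + C₃ * ρ x ^ 1 * ‖b x‖ := by
        conv_lhs => rw [eb]
        refine (norm_sub_le _ _).trans (add_le_add ((norm_add_le _ _).trans (add_le_add ?_ ?_)) ?_)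
        · exact k₆ x x6
        · rw [norm_mul]; exact mul_le_mul_of_nonneg_right (k₄ x x4) (norm_nonneg _)
        · rw [norm_mul]; exact mul_le_mul_of_nonneg_right (k₃ x x3) (norm_nonneg _)
      -- With this smallness the off-diagonal and diagonal perturbations are absorbed into half of
      -- |a| + |b|.
      have hSρ : S * ρ x ≤ 1 / 2 := by
        rw [le_div_iff₀ (by positivity)] at x7
        linarith
      have hle : ∀ c, c ≤ S → c * ρ x ≤ 1 / 2 := fun c hc =>
        (mul_le_mul_of_nonneg_right hc (hρ x)).trans hSρ
      have q1 : (C₁ + C₄) * ρ x * ‖a x‖ ≤ 1 / 2 * ‖a x‖ :=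
        mul_le_mul_of_nonneg_right (hle _ (by linarith)) (norm_nonneg _)
      have q2 : (C₂ + C₃) * ρ x * ‖b x‖ ≤ 1 / 2 * ‖b x‖ :=
        mul_le_mul_of_nonneg_right (hle _ (by linarith)) (norm_nonneg _)
      rw [pow_one] at na nb
      linarith
    have hpos : 0 < min (min (min d₁ d₂) (min d₃ d₄)) (min (min d₅ d₆) (1 / (2 * S))) := by
      have : 0 < 1 / (2 * S) := by positivity
      simp only [lt_min_iff]
      exact ⟨⟨⟨p₁, p₂⟩, p₃, p₄⟩, ⟨p₅, p₆⟩, this⟩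
    exact ⟨Wt.of_exists_bound (C := 2 * (C₅ + C₆)) hpos hρ fun x hx => by linarith [main x hx, norm_nonneg (b x)],
      Wt.of_exists_bound (C := 2 * (C₅ + C₆)) hpos hρ fun x hx => by linarith [main x hx, norm_nonneg (a x)]⟩
  refine ⟨key.1, key.2, ?_, ?_⟩
  · refine (hA.coef_mul ((key.2.mul h₂).sub (key.1.mul h₁))).congr fun x => ?_
    linear_combination ha x
  · refine (hB.coef_mul ((key.1.mul h₄).sub (key.2.mul h₃))).congr fun x => ?_
    linear_combination hb x

/-- The normal form computation. -/
lemma wt_normal_form {ω' z z' Z20 Z11 Z02 Z30 Z21 Z12 Z03 ξ iξ l c20 c11 c02 c30 c12 c03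
    d20 d11 d02 d30 d12 d03 K : X → ℂ}
    (hz : Wt ρ 1 z) (hω : Wt ρ 2 ω') (hl : Wt ρ 3 l)
    (h20 : Wt ρ 0 Z20) (h11 : Wt ρ 0 Z11) (h02 : Wt ρ 0 Z02) (h30 : Wt ρ 0 Z30) (h21 : Wt ρ 0 Z21)
    (h12 : Wt ρ 0 Z12) (h03 : Wt ρ 0 Z03) (hc20 : Wt ρ 0 c20) (hc11 : Wt ρ 0 c11) (hc02 : Wt ρ 0 c02)
    (hc30 : Wt ρ 0 c30) (hc12 : Wt ρ 0 c12) (hc03 : Wt ρ 0 c03) (hd20 : Wt ρ 0 d20) (hd11 : Wt ρ 0 d11)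
    (hd02 : Wt ρ 0 d02) (hd30 : Wt ρ 0 d30) (hd12 : Wt ρ 0 d12) (hd03 : Wt ρ 0 d03) (hK : Wt ρ 0 K)
    (hξ : ∀ x, iξ x * ξ x = 1) (hξr : ∀ x, conj (ξ x) = ξ x)
    (e20 : ∀ x, c20 x = I * iξ x * Z20 x) (e11 : ∀ x, c11 x = -I * iξ x * Z11 x)
    (e02 : ∀ x, c02 x = -I * iξ x * Z02 x / 3)
    (e30 : ∀ x, c30 x = I * iξ x * (Z30 x + 2 * c20 x * Z20 x + c11 x * conj (Z02 x)) / 2)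
    (e12 : ∀ x, c12 x = -I * iξ x * (Z12 x + 2 * c20 x * Z02 x + c11 x * Z11 x
      + c11 x * conj (Z20 x) + 2 * c02 x * conj (Z11 x)) / 2)
    (e03 : ∀ x, c03 x = -I * iξ x * (Z03 x + c11 x * Z02 x + 2 * c02 x * conj (Z20 x)) / 4)
    (eK : ∀ x, K x = Z21 x + 2 * c20 x * Z11 x + c11 x * Z20 x + c11 x * conj (Z11 x)
      + 2 * c02 x * conj (Z02 x))
    (hR : Wt ρ 4 (fun x => z' x - (I * ξ x * z x + (Z20 x * z x ^ 2 + Z11 x * (z x * conj (z x))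
      + Z02 x * conj (z x) ^ 2) + (Z30 x * z x ^ 3 + Z21 x * (z x ^ 2 * conj (z x))
      + Z12 x * (z x * conj (z x) ^ 2) + Z03 x * conj (z x) ^ 3) + l x))) :
    Wt ρ 4 (fun x => (z' x + (d20 x * ω' x * z x ^ 2 + c20 x * (2 * z x * z' x))
      + (d11 x * ω' x * (z x * conj (z x)) + c11 x * (z' x * conj (z x) + z x * conj (z' x)))
      + (d02 x * ω' x * conj (z x) ^ 2 + c02 x * (2 * conj (z x) * conj (z' x)))
      + (d30 x * ω' x * z x ^ 3 + c30 x * (3 * z x ^ 2 * z' x))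
      + (d12 x * ω' x * (z x * conj (z x) ^ 2) + c12 x * (z' x * conj (z x) ^ 2
        + z x * (2 * conj (z x) * conj (z' x))))
      + (d03 x * ω' x * conj (z x) ^ 3 + c03 x * (3 * conj (z x) ^ 2 * conj (z' x))))
      - (I * ξ x * newVar (c20 x) (c11 x) (c02 x) (c30 x) (c12 x) (c03 x) (z x)
        + K x * (newVar (c20 x) (c11 x) (c02 x) (c30 x) (c12 x) (c03 x) (z x)
          * conj (newVar (c20 x) (c11 x) (c02 x) (c30 x) (c12 x) (c03 x) (z x)))
          * newVar (c20 x) (c11 x) (c02 x) (c30 x) (c12 x) (c03 x) (z x) + l x)) := by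
  set R : X → ℂ := fun x => z' x - (I * ξ x * z x + (Z20 x * z x ^ 2 + Z11 x * (z x * conj (z x))
      + Z02 x * conj (z x) ^ 2) + (Z30 x * z x ^ 3 + Z21 x * (z x ^ 2 * conj (z x))
      + Z12 x * (z x * conj (z x) ^ 2) + Z03 x * conj (z x) ^ 3) + l x) with hRdef
  have hzb := hz.star
  have z2 : Wt ρ 2 (fun x => z x ^ 2) := hz.pow 2
  have zz : Wt ρ 2 (fun x => z x * conj (z x)) := hz.mul hzb
  have b2 : Wt ρ 2 (fun x => conj (z x) ^ 2) := hzb.pow 2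
  have z3 : Wt ρ 3 (fun x => z x ^ 3) := hz.pow 3
  have z2b : Wt ρ 3 (fun x => z x ^ 2 * conj (z x)) := z2.mul hzb
  have zb2 : Wt ρ 3 (fun x => z x * conj (z x) ^ 2) := hz.mul b2
  have b3 : Wt ρ 3 (fun x => conj (z x) ^ 3) := hzb.pow 3
  have S2 := ((h20.coef_mul z2).add (h11.coef_mul zz)).add (h02.coef_mul b2)
  have S3 := (((h30.coef_mul z3).add (h21.coef_mul z2b)).add (h12.coef_mul zb2)).add (h03.coef_mul b3)
  have E3 := ((S3.add hl).add (hR.mono (by norm_num : 3 ≤ 4)))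
  have E2 := S2.add (E3.mono (by norm_num : 2 ≤ 3))
  set s2 : X → ℂ := fun x => Z20 x * z x ^ 2 + Z11 x * (z x * conj (z x)) + Z02 x * conj (z x) ^ 2 with hs2
  set s3 : X → ℂ := fun x => Z30 x * z x ^ 3 + Z21 x * (z x ^ 2 * conj (z x))
      + Z12 x * (z x * conj (z x) ^ 2) + Z03 x * conj (z x) ^ 3 with hs3
  set y : X → ℂ := fun x => c20 x * z x ^ 2 + c11 x * (z x * conj (z x)) + c02 x * conj (z x) ^ 2
    + c30 x * z x ^ 3 + c12 x * (z x * conj (z x) ^ 2) + c03 x * conj (z x) ^ 3 with hy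
  have Y : Wt ρ 2 y := ((((((hc20.coef_mul z2).add (hc11.coef_mul zz)).add (hc02.coef_mul b2)).add
    ((hc30.coef_mul z3).mono (by norm_num))).add ((hc12.coef_mul zb2).mono (by norm_num))).add
    ((hc03.coef_mul b3).mono (by norm_num)))
  have hV : ∀ x, newVar (c20 x) (c11 x) (c02 x) (c30 x) (c12 x) (c03 x) (z x) = z x + y x := fun x => by
    simp only [newVar, hy]; ring
  have hz1 := hz.add (Y.mono (by norm_num : 1 ≤ 2))
  set e3 : X → ℂ := fun x => s3 x + l x + R x with he3
  set e2 : X → ℂ := fun x => s2 x + e3 x with he2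
  -- The derivative of z is split exactly into orders one, two, and at least three, so that the
  -- chain rule can be sorted by order.
  have hz' : ∀ x, z' x = I * ξ x * z x + s2 x + e3 x := fun x => by simp only [he3, hRdef, hs2, hs3]; ring
  have hzb' : ∀ x, conj (z' x) = -I * ξ x * conj (z x) + conj (s2 x) + conj (e3 x) := fun x => by
    rw [hz']; simp only [map_add, map_mul, conj_I, hξr]
  have hs2b : ∀ x, conj (s2 x) = conj (Z20 x) * conj (z x) ^ 2 + conj (Z11 x) * (z x * conj (z x))
      + conj (Z02 x) * z x ^ 2 := fun x => by
    simp only [hs2, map_add, map_mul, map_pow, conj_conj]; ring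
  -- The errors of order at least four. The T terms come from the part of z' not used in the chain
  -- rule, the D terms from the motion of the coefficients, where ω' has order two. The term `TK`
  -- comes from replacing z by the new variable in the cubic term.
  have T20 := (hc20.coef_mul (hz.mul E3)).const_mul 2
  have T11 := hc11.coef_mul ((E3.mul hzb).add (hz.mul E3.star))
  have T02 := (hc02.coef_mul (hzb.mul E3.star)).const_mul 2
  have T30 := (hc30.coef_mul (z2.mul E2)).const_mul 3
  have T12 := hc12.coef_mul ((E2.mul b2).add ((zz.mul E2.star).const_mul 2))
  have T03 := (hc03.coef_mul (b2.mul E2.star)).const_mul 3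
  have D20 := hd20.coef_mul (hω.mul z2)
  have D11 := hd11.coef_mul (hω.mul zz)
  have D02 := hd02.coef_mul (hω.mul b2)
  have D30 := (hd30.coef_mul (hω.mul z3)).mono (by norm_num : 4 ≤ 2 + 3)
  have D12 := (hd12.coef_mul (hω.mul zb2)).mono (by norm_num : 4 ≤ 2 + 3)
  have D03 := (hd03.coef_mul (hω.mul b3)).mono (by norm_num : 4 ≤ 2 + 3)
  have TK := hK.coef_mul (((((hz.mul Y).const_mul 2).add ((Y.pow 2).mono (by norm_num : 3 ≤ 2 * 2))).mul
    hz1.star).add (z2.mul Y.star))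
  have tot := (((((((((((((T20.add T11).add T02).add T30).add T12).add T03).add hR).add D20).add D11).add
    D02).add D30).add D12).add D03).sub TK)
  refine tot.congr fun x => ?_
  -- The homological equations. The monomial z^m z̄^n is multiplied by i(m-n)ξ along the linear
  -- flow, while the new equation contributes iξ; the difference m-n-1 takes the values 1, -1, -3,
  -- 2, -2, -4 for the six removed monomials and vanishes only for z²z̄.
  have A20 : 2 * I * ξ x * c20 x + Z20 x = I * ξ x * c20 x := by
    rw [e20]; linear_combination (I ^ 2 * Z20 x) * hξ x + Z20 x * I_sq
  have A11 : Z11 x = I * ξ x * c11 x := by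
    rw [e11]; linear_combination (I ^ 2 * Z11 x) * hξ x + Z11 x * I_sq
  have A02 : Z02 x - 2 * I * ξ x * c02 x = I * ξ x * c02 x := by
    rw [e02]; linear_combination (I ^ 2 * Z02 x) * hξ x + Z02 x * I_sq
  have A30 : Z30 x + 2 * c20 x * Z20 x + c11 x * conj (Z02 x) + 3 * I * ξ x * c30 x = I * ξ x * c30 x := by
    rw [e30]
    linear_combination (I ^ 2 * (Z30 x + 2 * c20 x * Z20 x + c11 x * conj (Z02 x))) * hξ x
      + (Z30 x + 2 * c20 x * Z20 x + c11 x * conj (Z02 x)) * I_sq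
  have A12 : Z12 x + 2 * c20 x * Z02 x + c11 x * Z11 x + c11 x * conj (Z20 x) + 2 * c02 x * conj (Z11 x)
      - I * ξ x * c12 x = I * ξ x * c12 x := by
    rw [e12]
    linear_combination (I ^ 2 * (Z12 x + 2 * c20 x * Z02 x + c11 x * Z11 x + c11 x * conj (Z20 x)
      + 2 * c02 x * conj (Z11 x))) * hξ x + (Z12 x + 2 * c20 x * Z02 x + c11 x * Z11 x
      + c11 x * conj (Z20 x) + 2 * c02 x * conj (Z11 x)) * I_sq
  have A03 : Z03 x + c11 x * Z02 x + 2 * c02 x * conj (Z20 x) - 3 * I * ξ x * c03 x = I * ξ x * c03 x := by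
    rw [e03]
    linear_combination (I ^ 2 * (Z03 x + c11 x * Z02 x + 2 * c02 x * conj (Z20 x))) * hξ x
      + (Z03 x + c11 x * Z02 x + 2 * c02 x * conj (Z20 x)) * I_sq
  simp only [hV]
  have eR : R x = e3 x - s3 x - l x := by simp only [he3]; ring
  have es2 : s2 x = Z20 x * z x ^ 2 + Z11 x * (z x * conj (z x)) + Z02 x * conj (z x) ^ 2 := rfl
  have es3 : s3 x = Z30 x * z x ^ 3 + Z21 x * (z x ^ 2 * conj (z x))
      + Z12 x * (z x * conj (z x) ^ 2) + Z03 x * conj (z x) ^ 3 := rfl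
  have ey : y x = c20 x * z x ^ 2 + c11 x * (z x * conj (z x)) + c02 x * conj (z x) ^ 2
    + c30 x * z x ^ 3 + c12 x * (z x * conj (z x) ^ 2) + c03 x * conj (z x) ^ 3 := rfl
  have ee2 : e2 x = s2 x + e3 x := rfl
  clear_value e2 e3 R s2 s3 y
  rw [hzb', hz', eR, ee2]
  simp only [map_add]
  linear_combination z x ^ 2 * A20 + z x * conj (z x) * A11 + conj (z x) ^ 2 * A02 + z x ^ 3 * A30
    + z x * conj (z x) ^ 2 * A12 + conj (z x) ^ 3 * A03 - z x ^ 2 * conj (z x) * eK x - I * ξ x * ey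
    + (1 + 2 * c20 x * z x + c11 x * conj (z x)) * es2 + es3
    + (c11 x * z x + 2 * c02 x * conj (z x)) * hs2b x
end

end ConcNLS

end


noncomputable section

namespace ConcNLS

open MeasureTheory Complex ComplexConjugate Set Filter Topology

variable {σ ν lo hi : ℝ}

/-! ### Orders of magnitude of the modulation parameters -/

/-- A modulated solution at a given time, together with a frozen frequency `τ`. -/
structure State (σ ν lo hi : ℝ) where
  T : ℝ
  t : ℝ
  τ : ℝ
  u : ℝ → EnergySpace
  ω : ℝ → ℝ
  γ : ℝ → ℝ
  z : ℝ → ℂ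
  T_pos : 0 < T
  modulated : IsModulated σ ν T u ω γ z
  mem : ∀ s ∈ Icc 0 T, ω s ∈ Icc lo hi
  ht : t ∈ Icc 0 T
  hτ : τ ∈ Icc lo hi
  memW : MemW (fPart σ ν (u t).toFun (phase ω γ t) (ω t) (z t))

namespace State

variable (s : State σ ν lo hi)

/-- The frequency. -/
def w : ℝ := s.ω s.t
/-- The discrete coordinate. -/
def ζ : ℂ := s.z s.t
/-- The dispersive component. -/
def f : Field2 := fPart σ ν (s.u s.t).toFun (phase s.ω s.γ s.t) s.w s.ζ
/-- The weighted size. -/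
def ρ : ℝ := √(‖s.ζ‖ ^ 2 + wNorm s.f)
/-- The fluctuation of the charge. -/
def η : ℂ := etaC σ ν (s.u s.t) (phase s.ω s.γ s.t) s.w
/-- The nonlinear remainder. -/
def N : ℂ := Nplus σ ν s.w s.η
/-- The derivative of the frequency. -/
def dω : ℝ := derivWithin s.ω (Icc 0 s.T) s.t
/-- The derivative of the phase correction. -/
def dγ : ℝ := derivWithin s.γ (Icc 0 s.T) s.t
/-- The charge of the dispersive component. -/
def q : Fin 2 → ℂ := chargeV s.f

lemma hw : s.w ∈ Icc lo hi := s.mem _ s.ht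

lemma memW_f : MemW s.f := s.memW

lemma ρ_nonneg : 0 ≤ s.ρ := Real.sqrt_nonneg _

lemma ρ_sq : s.ρ ^ 2 = ‖s.ζ‖ ^ 2 + wNorm s.f :=
  Real.sq_sqrt (by have := wNorm_nonneg s.f; positivity)

lemma hasDeriv_ω : HasDerivWithinAt s.ω s.dω (Icc 0 s.T) s.t :=
  ((s.modulated.omega_C1.differentiableOn one_ne_zero) _ s.ht).hasDerivWithinAt

lemma hasDeriv_γ : HasDerivWithinAt s.γ s.dγ (Icc 0 s.T) s.t :=
  ((s.modulated.gamma_C1.differentiableOn one_ne_zero) _ s.ht).hasDerivWithinAt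

/-- Linearity of the charge, applied to the decomposition of u. It also shows that f possesses a
charge, which is needed before its weighted bound can be used. -/
lemma toVec_eta (h : Adm σ) (hlo : 0 < lo) : HasChargeV s.f s.q ∧
    toVec s.η = s.ζ • pPsi σ + conj s.ζ • cj (pPsi σ) + s.q := by
  have hw := Icc_pos hlo s.hw
  have hc := (s.u s.t).hasCharge.const_mul (exp (-I * phase s.ω s.γ s.t))
  have h1 : HasChargeV (fun x => toVec (exp (-I * phase s.ω s.γ s.t) * (s.u s.t).toFun x))
      (toVec (exp (-I * phase s.ω s.γ s.t) * (s.u s.t).charge)) :=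
    Fin.forall_fin_two.2 ⟨by simpa [toVec] using hc.re, by simpa [toVec] using hc.im⟩
  have h2 : HasChargeV s.f _ := (h1.sub (hasChargeV_Phi (σ := σ) (ν := ν) hw)).sub
    (((hasChargeV_Psi h hw).smul s.ζ).add ((hasChargeV_PsiStar h hw).smul (conj s.ζ)))
  have e := h2.chargeV_eq
  refine ⟨by rw [q, e]; exact h2, ?_⟩
  rw [q, e]
  have e0 : toVec s.η = toVec (exp (-I * phase s.ω s.γ s.t) * (s.u s.t).charge) - ![(qSol σ ν s.w : ℂ), 0] :=
    funext (Fin.forall_fin_two.2 ⟨by simp [toVec, η, etaC], by simp [toVec, η, etaC]⟩)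
  rw [e0]
  abel

lemma wt_of_good {F : ℝ → ℝ → ℂ} (hF : Good lo hi F) :
    Wt (ρ (σ := σ) (ν := ν)) 0 (fun s : State σ ν lo hi => F s.τ s.w) := by
  obtain ⟨M, _, hM⟩ := hF.bound
  exact Wt.of_bound_zero M fun s => hM _ s.hτ _ s.hw

lemma wt_ζ : Wt ρ 1 (fun s : State σ ν lo hi => s.ζ) := by
  refine Wt.of_bound 1 ρ_nonneg fun s => ?_
  rw [one_mul, pow_one]
  exact Real.le_sqrt_of_sq_le (by linarith [wNorm_nonneg s.f])

lemma wNorm_le : wNorm s.f ≤ s.ρ ^ 2 := by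
  rw [ρ_sq]; linarith [sq_nonneg ‖s.ζ‖]

lemma wt_of_wNorm {F : State σ ν lo hi → ℂ} (C : ℝ) (hC : 0 ≤ C) (h : ∀ s, ‖F s‖ ≤ C * wNorm s.f) : Wt ρ 2 F :=
  Wt.of_bound C ρ_nonneg fun s => (h s).trans (mul_le_mul_of_nonneg_left s.wNorm_le hC)

lemma wt_q (h : Adm σ) (hlo : 0 < lo) (i : Fin 2) : Wt ρ 2 (fun s : State σ ν lo hi => s.q i) := by
  obtain ⟨C, hC, hb⟩ := exists_chargeV_bound
  exact wt_of_wNorm C hC.le fun s =>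
    (norm_le_pi_norm _ i).trans (hb _ _ (s.toVec_eta h hlo).1 s.memW_f)

lemma wt_pe (hν : 0 < ν) (hlo : 0 < lo) (hl : lo < hi) (i : Fin 2) (n : ℕ) {c : ℝ} (hc : 0 < c) :
    Wt ρ 2 (fun s : State σ ν lo hi => pe n (c * √s.w) (fun x => s.f x i)) := by
  obtain ⟨A, hA, ha⟩ := lipFun_pe hν hlo hl i n hc
  exact wt_of_wNorm A hA.le fun s => (ha _ s.memW_f _ s.hw).1

lemma wt_pe_Psi (h : Adm σ) (hν : 0 < ν) (hlo : 0 < lo) (hl : lo < hi) (i : Fin 2) (n : ℕ) :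
    Wt ρ 0 (fun s : State σ ν lo hi => pe n √s.w (fun x => Psi σ s.w x i)) := by
  obtain ⟨A, hA, ha⟩ := lipFun_pe hν hlo hl i n one_pos
  refine Wt.of_bound_zero (A * (1 + Cc σ)) fun s => ?_
  have hm := memW_Psi h (Icc_pos hlo s.hw)
  have := (ha _ hm.1 _ s.hw).1
  simp only [one_mul] at this
  exact this.trans (mul_le_mul_of_nonneg_left hm.2 hA.le)

/-- The first order part of the charge fluctuation. -/
def v : Fin 2 → ℂ := s.ζ • pPsi σ + conj s.ζ • cj (pPsi σ)

lemma wt_v (i : Fin 2) : Wt ρ 1 (fun s : State σ ν lo hi => s.v i) :=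
  ((wt_ζ.const_mul (pPsi σ i)).add (wt_ζ.star.const_mul (cj (pPsi σ) i))).congr fun s => by
    simp [v, mul_comm]

lemma toVec_eta_apply (h : Adm σ) (hlo : 0 < lo) (i : Fin 2) : toVec s.η i = s.v i + s.q i := by
  rw [(s.toVec_eta h hlo).2]; rfl

lemma wt_toVec (h : Adm σ) (hlo : 0 < lo) (i : Fin 2) : Wt ρ 1 (fun s : State σ ν lo hi => toVec s.η i) :=
  ((wt_v i).add ((wt_q h hlo i).mono one_le_two)).congr fun s => s.toVec_eta_apply h hlo i

lemma wt_η (h : Adm σ) (hlo : 0 < lo) : Wt ρ 1 (fun s : State σ ν lo hi => s.η) :=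
  ((wt_toVec h hlo 0).add ((wt_toVec h hlo 1).const_mul I)).congr fun s => by
    simp only [toVec, Matrix.cons_val_zero, Matrix.cons_val_one, Matrix.cons_val_fin_one]
    rw [mul_comm, re_add_im]

/-- The quadratic and cubic terms at the first order part, and the mixed quadratic term. -/
def A (i : Fin 2) : ℂ := N2 σ ν s.w s.v s.v i + 2 * N2 σ ν s.w s.v s.q i + N3 σ ν s.w s.v s.v s.v i

lemma wt_N2_of {F G : State σ ν lo hi → Fin 2 → ℂ} {m n : ℕ} (h : Adm σ) (hν : 0 < ν) (hlo : 0 < lo)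
    (hl : lo < hi) (hF : ∀ i, Wt ρ m (fun s => F s i)) (hG : ∀ i, Wt ρ n (fun s => G s i)) (i : Fin 2) :
    Wt ρ (m + n) (fun s => N2 σ ν s.w (F s) (G s) i) := by
  have g := wt_of_good (σ := σ) (ν := ν) (((good_scale (σ := σ) hν hlo hl 1 0 0 1).mul hl
    (Good.const (1 / (4 * Real.pi)))))
  have e : ∀ s : State σ ν lo hi, ((sS s.w / qSol σ ν s.w : ℝ) : ℂ) = _ := fun s => by
    have : sS s.w / qSol σ ν s.w = √s.w ^ 1 / √s.w ^ 0 * (qSol σ ν s.w ^ 0 / qSol σ ν s.w ^ 1)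
        * (1 / (4 * Real.pi)) := by rw [sS]; simp; ring
    rw [this]
  revert i
  refine Fin.forall_fin_two.2 ⟨?_, ?_⟩
  · refine (g.coef_mul ((((hF 0).mul (hG 0)).const_mul (σ * (2 * σ + 1))).add
      (((hF 1).mul (hG 1)).const_mul σ))).congr fun s => ?_
    rw [N2_eq h hν (Icc_pos hlo s.hw), Matrix.cons_val_zero, e]
    push_cast; rfl
  · refine (g.coef_mul (((((hF 0).mul (hG 1))).add ((hF 1).mul (hG 0))).const_mul σ)).congr fun s => ?_
    rw [N2_eq h hν (Icc_pos hlo s.hw), Matrix.cons_val_one, Matrix.cons_val_fin_one, e]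
    push_cast; rfl

lemma wt_N3_of {F G H : State σ ν lo hi → Fin 2 → ℂ} {l m n : ℕ} (h : Adm σ) (hν : 0 < ν) (hlo : 0 < lo)
    (hl : lo < hi) (hF : ∀ i, Wt ρ l (fun s => F s i)) (hG : ∀ i, Wt ρ m (fun s => G s i))
    (hH : ∀ i, Wt ρ n (fun s => H s i)) (i : Fin 2) :
    Wt ρ (l + m + n) (fun s => N3 σ ν s.w (F s) (G s) (H s) i) := by
  have g := wt_of_good (σ := σ) (ν := ν) (((good_scale (σ := σ) hν hlo hl 1 0 0 2).mul hl
    (Good.const (1 / (4 * Real.pi)))))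
  have e : ∀ s : State σ ν lo hi, ((sS s.w / qSol σ ν s.w ^ 2 : ℝ) : ℂ) = _ := fun s => by
    have : sS s.w / qSol σ ν s.w ^ 2 = √s.w ^ 1 / √s.w ^ 0 * (qSol σ ν s.w ^ 0 / qSol σ ν s.w ^ 2)
        * (1 / (4 * Real.pi)) := by rw [sS]; simp; ring
    rw [this]
  have t : ∀ i j k, Wt ρ (l + m + n) (fun s => F s i * G s j * H s k) := fun i j k =>
    ((hF i).mul (hG j)).mul (hH k)
  revert i
  refine Fin.forall_fin_two.2 ⟨?_, ?_⟩
  · refine (g.coef_mul (((t 0 0 0).const_mul (σ * (4 * σ ^ 2 - 1) / 3)).add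
      (((((t 1 1 0).add (t 0 1 1))).add (t 1 0 1)).const_mul (σ * (2 * σ - 1) / 3)))).congr fun s => ?_
    rw [N3_eq h hν (Icc_pos hlo s.hw), Matrix.cons_val_zero, e]
    push_cast; ring
  · refine (g.coef_mul (((((t 0 0 1).add (t 1 0 0)).add (t 0 1 0)).const_mul (σ * (2 * σ - 1) / 3)).add
      ((t 1 1 1).const_mul σ))).congr fun s => ?_
    rw [N3_eq h hν (Icc_pos hlo s.hw), Matrix.cons_val_one, Matrix.cons_val_fin_one, e]
    push_cast; ring

/-- The charge fluctuation is v + q with v of order one and q of order two. Relative to the retained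
terms, N₂(q, q) and every N₃ containing q have order at least four, as has the Taylor remainder. -/
lemma wt_N (h : Adm σ) (hν : 0 < ν) (hlo : 0 < lo) (hl : lo < hi) :
    Wt ρ 4 (fun s : State σ ν lo hi => (s.N.re : ℂ) - s.A 0) ∧
    Wt ρ 4 (fun s : State σ ν lo hi => (s.N.im : ℂ) - s.A 1) := by
  obtain ⟨C, hC, δ, hδ, hb⟩ := exists_Nplus_bound h hν hlo hl
  obtain ⟨C', hC', δ', hδ', hb'⟩ := (wt_η (ν := ν) (hi := hi) h hlo).exists_bound ρ_nonneg
  have R : ∀ r : State σ ν lo hi → ℂ, (∀ s, ‖s.η‖ ≤ δ → ‖r s‖ ≤ C * ‖s.η‖ ^ 4) → Wt ρ 4 r := fun r hr => by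
    refine Wt.of_exists_bound (δ := min δ' (δ / C')) (C := C * C' ^ 4) (by positivity) ρ_nonneg fun s hs => ?_
    have h1 := hb' s (hs.trans (min_le_left _ _))
    rw [pow_one] at h1
    have h2 : C' * s.ρ ≤ δ := by
      have := hs.trans (min_le_right _ _)
      rwa [le_div_iff₀' hC'] at this
    calc _ ≤ C * ‖s.η‖ ^ 4 := hr s (h1.trans h2)
      _ ≤ C * (C' * s.ρ) ^ 4 := by gcongr
      _ = _ := by ring
  have Q2 := fun i => wt_N2_of h hν hlo hl (wt_q (ν := ν) (hi := hi) h hlo) (wt_q (ν := ν) h hlo) i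
  have V := wt_toVec (ν := ν) (hi := hi) h hlo
  have Q := wt_q (ν := ν) (hi := hi) h hlo
  have P := wt_v (σ := σ) (ν := ν) (lo := lo) (hi := hi)
  have C3 := fun i => ((wt_N3_of h hν hlo hl V V Q i).add (wt_N3_of h hν hlo hl V Q P i)).add
    (wt_N3_of h hν hlo hl Q P P i)
  have hN2 : ∀ (s : State σ ν lo hi) i, N2 σ ν s.w (toVec s.η) (toVec s.η) i
      = N2 σ ν s.w s.v s.v i + 2 * N2 σ ν s.w s.v s.q i + N2 σ ν s.w s.q s.q i := fun s => by
    have e0 := s.toVec_eta_apply h hlo 0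
    have e1 := s.toVec_eta_apply h hlo 1
    refine Fin.forall_fin_two.2 ⟨?_, ?_⟩
    · simp only [N2_eq h hν (Icc_pos hlo s.hw), Matrix.cons_val_zero, e0, e1]; ring
    · simp only [N2_eq h hν (Icc_pos hlo s.hw), Matrix.cons_val_one, Matrix.cons_val_fin_one, e0, e1]; ring
  have hN3 : ∀ (s : State σ ν lo hi) i, N3 σ ν s.w (toVec s.η) (toVec s.η) (toVec s.η) i
      = N3 σ ν s.w s.v s.v s.v i + (N3 σ ν s.w (toVec s.η) (toVec s.η) s.q i
        + N3 σ ν s.w (toVec s.η) s.q s.v i + N3 σ ν s.w s.q s.v s.v i) := fun s => by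
    have e0 := s.toVec_eta_apply h hlo 0
    have e1 := s.toVec_eta_apply h hlo 1
    refine Fin.forall_fin_two.2 ⟨?_, ?_⟩
    · simp only [N3_eq h hν (Icc_pos hlo s.hw), Matrix.cons_val_zero, e0, e1]; ring
    · simp only [N3_eq h hν (Icc_pos hlo s.hw), Matrix.cons_val_one, Matrix.cons_val_fin_one, e0, e1]; ring
  constructor
  · refine (((R _ fun s hs => (hb s.w s.hw s.η hs).1).add (Q2 0)).add (C3 0)).congr fun s => ?_
    rw [hN2, hN3, A, N]; ring
  · refine (((R _ fun s hs => (hb s.w s.hw s.η hs).2).add (Q2 1)).add (C3 1)).congr fun s => ?_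
    rw [hN2, hN3, A, N]; ring

end State

end ConcNLS

end


noncomputable section

namespace ConcNLS

open MeasureTheory Complex ComplexConjugate Set Filter Topology

variable {σ ν lo hi ω : ℝ}

/-! ### The expanded equation of the discrete mode -/

/-- The coefficient relating the derivative of the frequency to the source. -/
def freqCoef (σ ν ω : ℝ) : ℂ := qSol σ ν ω * (1 / (Delta σ ν ω : ℂ))

/-- The coefficient relating the derivative of the phase to the source. -/
def phaseCoef (σ ν ω : ℝ) : ℂ := ((qSol σ ν ω / (4 * σ * ω) : ℝ) : ℂ) * (1 / (Delta σ ν ω : ℂ))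

/-- The real and imaginary parts of the source of the equation of `z` produced by the motion of
the parameters, for quadratic source `M`. -/
def driftTerm (σ ν ω : ℝ) (M : Fin 2 → ℂ) (m n : ℂ) : ℂ :=
  -(1 / kappa σ ω) * (phaseCoef σ ν ω * M 0 * m - I * (1 / √ω : ℝ) / 2 * (freqCoef σ ν ω * M 1) * n)

/-- The coefficient of `z³`. -/
def Z30 (σ ν ω : ℝ) : ℂ :=
  (1 / kappa σ ω) * dot (N3 σ ν ω (pPsi σ) (pPsi σ) (pPsi σ)) (cj (pPsi σ))
    - freqCoef σ ν ω * N2 σ ν ω (pPsi σ) (pPsi σ) 1 / 2 * (1 / ω : ℝ)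
    + driftTerm σ ν ω (N2 σ ν ω (pPsi σ) (pPsi σ)) (ip (Psi σ ω) (Psi σ ω)) (freqC1 σ ω)

/-- The coefficient of `z (conj z)²`. -/
def Z12 (σ ν ω : ℝ) : ℂ :=
  (1 / kappa σ ω) * (3 * dot (N3 σ ν ω (pPsi σ) (cj (pPsi σ)) (cj (pPsi σ))) (cj (pPsi σ)))
    - freqCoef σ ν ω * N2 σ ν ω (cj (pPsi σ)) (cj (pPsi σ)) 1 / 2 * (1 / ω : ℝ)
    + driftTerm σ ν ω (N2 σ ν ω (cj (pPsi σ)) (cj (pPsi σ))) (ip (Psi σ ω) (Psi σ ω)) (freqC1 σ ω)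
    + driftTerm σ ν ω (2 • N2 σ ν ω (pPsi σ) (cj (pPsi σ))) (ip (PsiStar σ ω) (Psi σ ω)) (freqC2 σ ω)

/-- The coefficient of `(conj z)³`. -/
def Z03 (σ ν ω : ℝ) : ℂ :=
  (1 / kappa σ ω) * dot (N3 σ ν ω (cj (pPsi σ)) (cj (pPsi σ)) (cj (pPsi σ))) (cj (pPsi σ))
    + driftTerm σ ν ω (N2 σ ν ω (cj (pPsi σ)) (cj (pPsi σ))) (ip (PsiStar σ ω) (Psi σ ω)) (freqC2 σ ω)

lemma pPsi_conj (σ : ℝ) : cj (pPsi σ) = ![pPsi σ 0, -pPsi σ 1] :=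
  funext (Fin.forall_fin_two.2 ⟨by simp [cj, pPsi], by simp [cj, pPsi]⟩)

/-- Here ω' and γ' have been replaced by their leading terms, which are linear in N₂(v, v). The
products of these with z and its conjugate give the bracket in Z₂₁. Part of the terms proportional
to z²z̄ is absent because the second component of N₂(q_Ψ, q_Ψ*) is zero. -/
lemma mode_algebra (h : Adm σ) (hν : 0 < ν) (hω : 0 < ω) (z : ℂ) (q v : Fin 2 → ℂ)
    (hv : v = z • pPsi σ + conj z • cj (pPsi σ)) :
    -(freqCoef σ ν ω * N2 σ ν ω v v 1) * z / 2 * (1 / ω : ℝ)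
      + (1 / kappa σ ω) * dot (fun i => N2 σ ν ω v v i + 2 * N2 σ ν ω v q i + N3 σ ν ω v v v i) (cj (pPsi σ))
      - (1 / kappa σ ω) * (phaseCoef σ ν ω * N2 σ ν ω v v 0
          * (ip (Psi σ ω) (Psi σ ω) * z + ip (PsiStar σ ω) (Psi σ ω) * conj z)
        - I * (1 / √ω : ℝ) / 2 * (freqCoef σ ν ω * N2 σ ν ω v v 1) * (freqC1 σ ω * z + freqC2 σ ω * conj z))
    = (Z20 σ ν ω * z ^ 2 + Z11 σ ν ω * (z * conj z) + Z02 σ ν ω * conj z ^ 2)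
      + (Z30 σ ν ω * z ^ 3 + Z21 σ ν ω * (z ^ 2 * conj z) + Z12 σ ν ω * (z * conj z ^ 2)
        + Z03 σ ν ω * conj z ^ 3)
      + (dot q (cj (Z10' σ ν ω)) * z + dot q (cj (Z01' σ ν ω)) * conj z) := by
  have hip : ip (dPsiStar σ ω) (fun x => J (Psi σ ω x)) = I * (1 / √ω : ℝ) / 2 * freqC2 σ ω := by
    rw [ip_dPsiStar_JPsi' h hω, freqC2]
    have := sqrt_ne hω
    have := pi_ne
    have e8 : (a0 σ + b0 σ : ℂ) ≠ 0 := by exact_mod_cast (add_pos h.a0_pos h.b0_pos).ne'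
    push_cast
    field_simp
    ring
  have hc0 : conj (pPsi σ 0) = pPsi σ 0 := by simp [pPsi]
  have hc1 : conj (pPsi σ 1) = -pPsi σ 1 := by simp [pPsi]
  have hs2 : conj ((sS ω / qSol σ ν ω : ℝ) : ℂ) = ((sS ω / qSol σ ν ω : ℝ) : ℂ) := conj_ofReal _
  have e1 : cj (Z10' σ ν ω) = (2 * (1 / kappa σ ω)) • N2 σ ν ω (pPsi σ) (cj (pPsi σ)) := by
    rw [Z10', qPsi_eq h hω, qPsiStar_eq h hω, pPsi_conj]
    refine funext (Fin.forall_fin_two.2 ⟨?_, ?_⟩)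
    all_goals
      simp only [cj_apply, N2_eq h hν hω, Pi.smul_apply, smul_eq_mul, Matrix.cons_val_zero,
        Matrix.cons_val_one, Matrix.cons_val_fin_one, map_mul, map_div₀, map_add, map_neg, conj_conj,
        conj_ofReal, hc0, hc1, map_ofNat, map_one]
      ring
  have e2 : cj (Z01' σ ν ω) = (2 * (1 / kappa σ ω)) • N2 σ ν ω (cj (pPsi σ)) (cj (pPsi σ)) := by
    rw [Z01', qPsi_eq h hω, pPsi_conj]
    refine funext (Fin.forall_fin_two.2 ⟨?_, ?_⟩)
    all_goals
      simp only [cj_apply, N2_eq h hν hω, Pi.smul_apply, smul_eq_mul, Matrix.cons_val_zero,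
        Matrix.cons_val_one, Matrix.cons_val_fin_one, map_mul, map_div₀, map_add, conj_conj,
        conj_ofReal, hc0, hc1, map_ofNat, map_one]
      ring
  rw [e1, e2, Z20, Z11, Z02, Z21, dot_J_cj_J, dot_J_cj_J, dot_J_cj_J, dot_J_cj_J, hip,
    (hasChargeV_Phi hω).chargeV_eq, (hasChargeV_dPhi h hν hω).chargeV_eq, qPsi_eq h hω, qPsiStar_eq h hω,
    Z30, Z12, Z03, driftTerm, driftTerm, driftTerm, driftTerm, phaseCoef, freqCoef, hv, pPsi_conj]
  simp only [dot, J_zero, J_one, N2_eq h hν hω, N3_eq h hν hω, Pi.smul_apply, Pi.add_apply, smul_eq_mul,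
    Matrix.cons_val_zero, Matrix.cons_val_one, Matrix.cons_val_fin_one, nsmul_eq_mul, Nat.cast_ofNat]
  generalize kappa σ ω = κ
  generalize pPsi σ 0 = p
  generalize pPsi σ 1 = r
  generalize ((sS ω / qSol σ ν ω : ℝ) : ℂ) = s2
  generalize ((sS ω / qSol σ ν ω ^ 2 : ℝ) : ℂ) = s3
  generalize ((qSol σ ν ω / (4 * σ * ω) : ℝ) : ℂ) = Q'
  rw [show (1 / ((Delta σ ν ω : ℂ) * κ)) = 1 / (Delta σ ν ω : ℂ) * (1 / κ) by rw [one_div_mul_one_div]]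
  rw [show 2 / κ = 2 * (1 / κ) by ring, show 3 / κ = 3 * (1 / κ) by ring]
  generalize (1 / (Delta σ ν ω : ℂ)) = iD
  generalize 1 / κ = iκ
  generalize ((1 / √ω : ℝ) : ℂ) = ik
  generalize ((1 / ω : ℝ) : ℂ) = iω
  generalize conj z = w
  ring

namespace State

lemma moment_values (h : Adm σ) (hlo : 0 < lo) (s : State σ ν lo hi) (n : ℕ) :
    ((mp n √s.w (phase s.ω s.γ s.t) (s.u s.t).toFun).re : ℂ)
      = pe n √s.w (fun x => s.f x 0) + (s.ζ + conj s.ζ) * pe n √s.w (fun x => Psi σ s.w x 0)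
        + qSol σ ν s.w * (n.factorial / (4 * Real.pi * ((√s.w + √s.w : ℝ) : ℂ) ^ (n + 1))) ∧
    ((mp n √s.w (phase s.ω s.γ s.t) (s.u s.t).toFun).im : ℂ)
      = pe n √s.w (fun x => s.f x 1) + (s.ζ - conj s.ζ) * pe n √s.w (fun x => Psi σ s.w x 1) := by
  have hw := Icc_pos hlo s.hw
  have := pe_fPart (ν := ν) (θ := phase s.ω s.γ s.t) (z := s.ζ) h hw (s.u s.t) n (Real.sqrt_pos.2 hw)
  rw [f, this.1, this.2]
  constructor <;> ring

/-- The two modulation equations are a linear system for ω' and γ', diagonal with entries Δ/q_ω and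
q_ω(1-σ)/(8π√ω) up to moments of order one. The source has order two, so `wt_linear_system` gives
both the size and the leading terms. -/
lemma wt_modulation (h : Adm σ) (hν : 0 < ν) (hlo : 0 < lo) (hl : lo < hi) :
    Wt ρ 2 (fun s : State σ ν lo hi => (s.dω : ℂ)) ∧ Wt ρ 2 (fun s : State σ ν lo hi => (s.dγ : ℂ)) ∧
    Wt ρ 3 (fun s : State σ ν lo hi => (s.dω : ℂ) + freqCoef σ ν s.w * s.N.im) ∧
    Wt ρ 3 (fun s : State σ ν lo hi => (s.dγ : ℂ) - phaseCoef σ ν s.w * s.N.re) := by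
  have hf : ∀ i n, Wt ρ 1 (fun s : State σ ν lo hi => pe n √s.w (fun x => s.f x i)) := fun i n =>
    ((wt_pe hν hlo hl i n one_pos).mono one_le_two).congr fun s => by rw [one_mul]
  have hp := wt_pe_Psi (σ := σ) (ν := ν) h hν hlo hl
  have hre : ∀ n, Wt ρ 1 (fun s : State σ ν lo hi => pe n √s.w (fun x => s.f x 0)
      + (s.ζ + conj s.ζ) * pe n √s.w (fun x => Psi σ s.w x 0)) := fun n =>
    (hf 0 n).add ((wt_ζ.add wt_ζ.star).mul (hp 0 n))
  have him : ∀ n, Wt ρ 1 (fun s : State σ ν lo hi => pe n √s.w (fun x => s.f x 1)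
      + (s.ζ - conj s.ζ) * pe n √s.w (fun x => Psi σ s.w x 1)) := fun n =>
    (hf 1 n).add ((wt_ζ.sub wt_ζ.star).mul (hp 1 n))
  have hk := wt_of_good (σ := σ) (ν := ν) (good_scale (σ := σ) hν hlo hl 1 0 0 0)
  have hik := wt_of_good (σ := σ) (ν := ν) (good_scale (σ := σ) hν hlo hl 0 1 0 0)
  have hA := wt_of_good (σ := σ) (ν := ν) ((good_qSol (σ := σ) hν hlo hl).mul hl (good_inv_Delta h hν hlo hl))
  have hB := wt_of_good (σ := σ) (ν := ν) ((good_dqSol h hν hlo hl).mul hl (good_inv_Delta h hν hlo hl))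
  have hN := wt_N (σ := σ) (ν := ν) h hν hlo hl
  have hV := wt_v (σ := σ) (ν := ν) (lo := lo) (hi := hi)
  have hq := wt_q (ν := ν) (hi := hi) h hlo
  have hS : ∀ i, Wt ρ 2 (fun s : State σ ν lo hi => s.A i) := fun i =>
    ((wt_N2_of h hν hlo hl hV hV i).add (((wt_N2_of h hν hlo hl hV hq i).const_mul 2).mono (by norm_num))).add
      ((wt_N3_of h hν hlo hl hV hV hV i).mono (by norm_num))
  have N0 : Wt ρ 2 (fun s : State σ ν lo hi => (s.N.re : ℂ)) :=
    ((hN.1.mono (by norm_num)).add (hS 0)).congr fun s => by ring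
  have N1 : Wt ρ 2 (fun s : State σ ν lo hi => (s.N.im : ℂ)) :=
    ((hN.2.mono (by norm_num)).add (hS 1)).congr fun s => by ring
  refine wt_linear_system ρ_nonneg (iA := fun s : State σ ν lo hi => freqCoef σ ν s.w)
    (iB := fun s => phaseCoef σ ν s.w) (N₀ := fun s => (s.N.re : ℂ)) (N₁ := fun s => (s.N.im : ℂ))
    (fun s => ?_) (fun s => ?_) hA hB (((hre 1).mul hik).const_mul (1 / 2)) (him 0)
    ((hk.coef_mul (hre 1)).const_mul (-2 * σ))
    (((hik.coef_mul (him 1)).const_mul (-(1 + 2 * σ) / 2)).add ((him 2).const_mul σ)) N0 N1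
  · have hw := Icc_pos hlo s.hw
    have e : s.dω * (Delta σ ν s.w / qSol σ ν s.w + ((mp 1 √s.w (phase s.ω s.γ s.t) (s.u s.t).toFun).re
          - qSol σ ν s.w / (16 * Real.pi * √s.w ^ 2)) / (2 * √s.w))
        = -s.N.im + s.dγ * (mp 0 √s.w (phase s.ω s.γ s.t) (s.u s.t).toFun).im :=
      modulation_eq_re h hν s.T_pos s.modulated s.ht s.hasDeriv_ω s.hasDeriv_γ
    have e' := congrArg (fun x : ℝ => (x : ℂ)) e
    push_cast at e'
    rw [(s.moment_values h hlo 1).1, (s.moment_values h hlo 0).2] at e'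
    have ek := sqrt_ne hw
    have epi := pi_ne
    have eQ : (qSol σ ν s.w : ℂ) ≠ 0 := by exact_mod_cast (qSol_pos (σ := σ) hν hw).ne'
    have eD := Delta_ne h hν hw
    rw [freqCoef]
    generalize pe 1 √s.w (fun x => s.f x 0) + (s.ζ + conj s.ζ) * pe 1 √s.w (fun x => Psi σ s.w x 0) = X at *
    generalize pe 0 √s.w (fun x => s.f x 1) + (s.ζ - conj s.ζ) * pe 0 √s.w (fun x => Psi σ s.w x 1) = Y at *
    simp only [Nat.factorial] at e'
    push_cast at e' ⊢
    field_simp at e' ⊢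
    apply mul_left_cancel₀ (mul_ne_zero epi (pow_ne_zero 2 ek))
    linear_combination (1 / 256) * e'
  · have hw := Icc_pos hlo s.hw
    have e : s.dγ * (qSol σ ν s.w * (1 - σ) / (8 * Real.pi * √s.w)
        - 2 * σ * √s.w * ((mp 1 √s.w (phase s.ω s.γ s.t) (s.u s.t).toFun).re
          - qSol σ ν s.w / (16 * Real.pi * √s.w ^ 2)))
        = s.N.re - s.dω * ((1 + 2 * σ) / (2 * √s.w)) * (mp 1 √s.w (phase s.ω s.γ s.t) (s.u s.t).toFun).im
          + s.dω * σ * (mp 2 √s.w (phase s.ω s.γ s.t) (s.u s.t).toFun).im :=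
      modulation_eq_im h hν s.T_pos s.modulated s.ht s.hasDeriv_ω s.hasDeriv_γ
    have e' := congrArg (fun x : ℝ => (x : ℂ)) e
    push_cast at e'
    rw [(s.moment_values h hlo 1).1, (s.moment_values h hlo 1).2, (s.moment_values h hlo 2).2] at e'
    have ek := sqrt_ne hw
    have epi := pi_ne
    have eQ : (qSol σ ν s.w : ℂ) ≠ 0 := by exact_mod_cast (qSol_pos (σ := σ) hν hw).ne'
    have eσ : (σ : ℂ) ≠ 0 := by exact_mod_cast h.pos.ne'
    have eσ1 : (1 - σ : ℂ) ≠ 0 := by exact_mod_cast (sub_pos.2 h.2).ne'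
    have ew : (s.w : ℂ) = (√s.w : ℂ) ^ 2 := by exact_mod_cast (Real.sq_sqrt hw.le).symm
    -- The inverse of the second diagonal entry, identified with the coefficient defined through Δ.
    have eG : phaseCoef σ ν s.w = 8 * Real.pi * √s.w / (qSol σ ν s.w * (1 - σ)) := by
      rw [phaseCoef, Delta_eq h hν hw]
      have : (1 / (σ : ℂ) - 1) ≠ 0 := by
        rw [show (1 / (σ : ℂ) - 1) = (1 - σ) / σ by field_simp]; exact div_ne_zero eσ1 eσ
      push_cast
      rw [ew]
      field_simp
      ring
    rw [eG]
    generalize pe 1 √s.w (fun x => s.f x 0) + (s.ζ + conj s.ζ) * pe 1 √s.w (fun x => Psi σ s.w x 0) = X at *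
    generalize pe 1 √s.w (fun x => s.f x 1) + (s.ζ - conj s.ζ) * pe 1 √s.w (fun x => Psi σ s.w x 1) = Y at *
    generalize pe 2 √s.w (fun x => s.f x 1) + (s.ζ - conj s.ζ) * pe 2 √s.w (fun x => Psi σ s.w x 1) = Y2 at *
    simp only [Nat.factorial] at e'
    push_cast at e' ⊢
    field_simp at e' ⊢
    linear_combination (1 / 256) * e'

end State

end ConcNLS

end


/-! ### Regularity of the cubic coefficients and the expanded equation of z. -/

noncomputable section

namespace ConcNLS

open MeasureTheory Complex ComplexConjugate Set Filter Topology

variable {σ ν lo hi : ℝ}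

lemma good_freqCoef (h : Adm σ) (hν : 0 < ν) (hlo : 0 < lo) (hl : lo < hi) :
    Good lo hi (fun _ ω => freqCoef σ ν ω) := (good_qSol hν hlo hl).mul hl (good_inv_Delta h hν hlo hl)

lemma good_phaseCoef (h : Adm σ) (hν : 0 < ν) (hlo : 0 < lo) (hl : lo < hi) :
    Good lo hi (fun _ ω => phaseCoef σ ν ω) := (good_dqSol h hν hlo hl).mul hl (good_inv_Delta h hν hlo hl)

lemma good_inv_sqrt (hlo : 0 < lo) (hl : lo < hi) :
    Good lo hi (fun _ ω => ((1 / √ω : ℝ) : ℂ)) :=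
  (good_scale (σ := 1) one_pos hlo hl 0 1 0 0).congr fun _ _ _ _ => by simp

lemma good_inv_id (hlo : 0 < lo) (hl : lo < hi) : Good lo hi (fun _ ω => ((1 / ω : ℝ) : ℂ)) :=
  (good_scale (σ := 1) one_pos hlo hl 0 2 0 0).congr fun _ _ ω hω => by
    rw [pow_zero, pow_zero, div_one, mul_one, Real.sq_sqrt (Icc_pos hlo hω).le]

lemma good_freqC1 (σ : ℝ) (hlo : 0 < lo) (hl : lo < hi) : Good lo hi (fun _ ω => freqC1 σ ω) :=
  ((good_scale (σ := 1) one_pos hlo hl 0 2 0 0).mul hl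
    (Good.const (((1 / a0 σ - Cc σ ^ 2 / b0 σ) / (8 * Real.pi) : ℝ) : ℂ))).congr fun _ _ ω hω => by
      rw [← ofReal_mul, freqC1]; congr 1; ring

lemma good_freqC2 (σ : ℝ) (hlo : 0 < lo) (hl : lo < hi) : Good lo hi (fun _ ω => freqC2 σ ω) :=
  ((good_scale (σ := 1) one_pos hlo hl 0 2 0 0).mul hl
    (Good.const ((Cc σ * (b0 σ - a0 σ) / (2 * Real.pi * (a0 σ + b0 σ) ^ 2) : ℝ) : ℂ))).congr
      fun _ _ ω hω => by rw [← ofReal_mul, freqC2]; congr 1; generalize (a0 σ + b0 σ) ^ 2 = S; ring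

lemma good_driftTerm {M : ℝ → Fin 2 → ℂ} {m n : ℝ → ℂ} (h : Adm σ) (hν : 0 < ν) (hlo : 0 < lo) (hl : lo < hi)
    (hM : ∀ i, Good lo hi (fun _ ω => M ω i)) (hm : Good lo hi (fun _ => m)) (hn : Good lo hi (fun _ => n)) :
    Good lo hi (fun _ ω => driftTerm σ ν ω (M ω) (m ω) (n ω)) :=
  ((good_inv_kappa h hν hlo hl).neg hl).mul hl
    ((((good_phaseCoef h hν hlo hl).mul hl (hM 0)).mul hl hm).sub hl
      (((((Good.const I).mul hl (good_inv_sqrt hlo hl)).div_const hl 2).mul hl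
        ((good_freqCoef h hν hlo hl).mul hl (hM 1))).mul hl hn))

lemma good_dot_const {M : ℝ → ℝ → Fin 2 → ℂ} (hl : lo < hi) (hM : ∀ i, Good lo hi (fun τ ω => M τ ω i))
    (p : Fin 2 → ℂ) : Good lo hi (fun τ ω => dot (M τ ω) p) :=
  ((hM 0).mul hl (Good.const (p 0))).add hl ((hM 1).mul hl (Good.const (p 1)))

lemma good_dot {M N : ℝ → ℝ → Fin 2 → ℂ} (hl : lo < hi) (hM : ∀ i, Good lo hi (fun τ ω => M τ ω i))
    (hN : ∀ i, Good lo hi (fun τ ω => N τ ω i)) : Good lo hi (fun τ ω => dot (M τ ω) (N τ ω)) :=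
  ((hM 0).mul hl (hN 0)).add hl ((hM 1).mul hl (hN 1))

lemma good_Z30 (h : Adm σ) (hν : 0 < ν) (hlo : 0 < lo) (hl : lo < hi) : Good lo hi (fun _ ω => Z30 σ ν ω) := by
  have N := good_N2 h hν hlo hl (pPsi σ) (pPsi σ)
  exact (((good_inv_kappa h hν hlo hl).mul hl (good_dot_const hl (good_N3 h hν hlo hl _ _ _) _)).sub hl
    ((((good_freqCoef h hν hlo hl).mul hl (N 1)).div_const hl 2).mul hl (good_inv_id hlo hl))).add hl
    (good_driftTerm h hν hlo hl N (good_m1 hν h hlo hl) (good_freqC1 σ hlo hl))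

lemma good_Z12 (h : Adm σ) (hν : 0 < ν) (hlo : 0 < lo) (hl : lo < hi) : Good lo hi (fun _ ω => Z12 σ ν ω) := by
  have N := good_N2 h hν hlo hl (cj (pPsi σ)) (cj (pPsi σ))
  have N' := good_N2 h hν hlo hl (pPsi σ) (cj (pPsi σ))
  refine ((((good_inv_kappa h hν hlo hl).mul hl ((Good.const 3).mul hl
    (good_dot_const hl (good_N3 h hν hlo hl _ _ _) _))).sub hl
    ((((good_freqCoef h hν hlo hl).mul hl (N 1)).div_const hl 2).mul hl (good_inv_id hlo hl))).add hl
    (good_driftTerm h hν hlo hl N (good_m1 hν h hlo hl) (good_freqC1 σ hlo hl))).add hl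
    (good_driftTerm h hν hlo hl (fun i => ((Good.const 2).mul hl (N' i)).congr fun _ _ ω _ => ?_)
      (good_m2 hν h hlo hl) (good_freqC2 σ hlo hl))
  simp

lemma good_Z03 (h : Adm σ) (hν : 0 < ν) (hlo : 0 < lo) (hl : lo < hi) : Good lo hi (fun _ ω => Z03 σ ν ω) := by
  have N := good_N2 h hν hlo hl (cj (pPsi σ)) (cj (pPsi σ))
  exact ((good_inv_kappa h hν hlo hl).mul hl (good_dot_const hl (good_N3 h hν hlo hl _ _ _) _)).add hl
    (good_driftTerm h hν hlo hl N (good_m2 hν h hlo hl) (good_freqC2 σ hlo hl))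

namespace State

/-- The derivative of the discrete coordinate. -/
def dz (s : State σ ν lo hi) : ℂ := derivWithin s.z (Icc 0 s.T) s.t

lemma dz_eq (h : Adm σ) (hν : 0 < ν) (hlo : 0 < lo) (s : State σ ν lo hi) :
    HasDerivWithinAt s.z s.dz (Icc 0 s.T) s.t ∧
    s.dz = I * xi σ s.w * s.ζ + s.dω * s.ζ / 2 * (1 / s.w : ℝ) + (1 / kappa σ s.w) *
      (dot (toVec s.N) (cj (pPsi σ))
        - s.dγ * (ip (Psi σ s.w) (Psi σ s.w) * s.ζ + ip (PsiStar σ s.w) (Psi σ s.w) * conj s.ζ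
            + phasePair σ s.w s.f)
        - I * (s.dω * (1 / √s.w : ℝ) / 2) * (freqC1 σ s.w * s.ζ + freqC2 σ s.w * conj s.ζ
            + freqPair σ s.w s.f)) := by
  have hd := hasDerivWithinAt_z_moments h hν s.modulated s.ht s.hasDeriv_ω s.hasDeriv_γ
  have e := hd.derivWithin (uniqueDiffOn_Icc s.T_pos _ s.ht)
  refine ⟨hd.differentiableWithinAt.hasDerivWithinAt, ?_⟩
  rw [dz, e, inv_kappa h (Icc_pos hlo s.hw), pPsi_conj]
  simp only [dot, toVec, pPsi, N, η, ζ, f, w, Matrix.cons_val_zero, Matrix.cons_val_one,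
    Matrix.cons_val_fin_one]
  push_cast
  ring

/-- The four errors are all of order four: corrections to ω' and γ' have order three and are
multiplied by z, while the pairings with f have order two and are multiplied by ω' or γ'.
`mode_algebra` identifies the rest. -/
lemma wt_z_equation (h : Adm σ) (hν : 0 < ν) (hlo : 0 < lo) (hl : lo < hi) :
    Wt ρ 4 (fun s : State σ ν lo hi => s.dz - (I * xi σ s.w * s.ζ
      + (Z20 σ ν s.w * s.ζ ^ 2 + Z11 σ ν s.w * (s.ζ * conj s.ζ) + Z02 σ ν s.w * conj s.ζ ^ 2)
      + (Z30 σ ν s.w * s.ζ ^ 3 + Z21 σ ν s.w * (s.ζ ^ 2 * conj s.ζ) + Z12 σ ν s.w * (s.ζ * conj s.ζ ^ 2)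
        + Z03 σ ν s.w * conj s.ζ ^ 3)
      + (dot s.q (cj (Z10' σ ν s.w)) * s.ζ + dot s.q (cj (Z01' σ ν s.w)) * conj s.ζ))) := by
  have hN := wt_N (σ := σ) (ν := ν) h hν hlo hl
  obtain ⟨hω, hγ, hω', hγ'⟩ := wt_modulation (σ := σ) (ν := ν) h hν hlo hl
  have hV := wt_v (σ := σ) (ν := ν) (lo := lo) (hi := hi)
  have hq := wt_q (ν := ν) (hi := hi) h hlo
  have cub : ∀ i, Wt ρ 3 (fun s : State σ ν lo hi => 2 * N2 σ ν s.w s.v s.q i + N3 σ ν s.w s.v s.v s.v i) :=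
    fun i => ((wt_N2_of h hν hlo hl hV hq i).const_mul 2).add (wt_N3_of h hν hlo hl hV hV hV i)
  have fC := wt_of_good (σ := σ) (ν := ν) (good_freqCoef h hν hlo hl)
  have pC := wt_of_good (σ := σ) (ν := ν) (good_phaseCoef h hν hlo hl)
  have iκ := wt_of_good (σ := σ) (ν := ν) (good_inv_kappa h hν hlo hl)
  have m1 := wt_of_good (σ := σ) (ν := ν) (good_m1 hν h hlo hl)
  have m2 := wt_of_good (σ := σ) (ν := ν) (good_m2 hν h hlo hl)
  have n1 := wt_of_good (σ := σ) (ν := ν) (good_freqC1 σ hlo hl)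
  have n2 := wt_of_good (σ := σ) (ν := ν) (good_freqC2 σ hlo hl)
  have ik := wt_of_good (σ := σ) (ν := ν) (good_inv_sqrt hlo hl)
  have iω := wt_of_good (σ := σ) (ν := ν) (good_inv_id hlo hl)
  have pa := fun i n => wt_pe (σ := σ) (ν := ν) hν hlo hl i n h.a0_pos
  have pb := fun i n => wt_pe (σ := σ) (ν := ν) hν hlo hl i n h.b0_pos
  have φ0 : Wt ρ 2 (fun s : State σ ν lo hi => phasePair σ s.w s.f) :=
    ((pa 0 0).sub ((pa 1 0).const_mul I)).sub (((pb 0 0).add ((pb 1 0).const_mul I)).const_mul (Cc σ))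
  have φ1 : Wt ρ 2 (fun s : State σ ν lo hi => freqPair σ s.w s.f) :=
    (((pa 0 1).sub ((pa 1 1).const_mul I)).const_mul (a0 σ)).add
      (((pb 0 1).add ((pb 1 1).const_mul I)).const_mul (Cc σ * b0 σ))
  have Eω : Wt ρ 3 (fun s : State σ ν lo hi => s.dω + freqCoef σ ν s.w * N2 σ ν s.w s.v s.v 1) :=
    (hω'.sub (fC.coef_mul ((hN.2.mono (by norm_num : 3 ≤ 4)).add (cub 1)))).congr fun s => by
      simp only [A]; ring
  have Eγ : Wt ρ 3 (fun s : State σ ν lo hi => s.dγ - phaseCoef σ ν s.w * N2 σ ν s.w s.v s.v 0) :=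
    (hγ'.add (pC.coef_mul ((hN.1.mono (by norm_num : 3 ≤ 4)).add (cub 0)))).congr fun s => by
      simp only [A]; ring
  have M := (m1.coef_mul wt_ζ).add (m2.coef_mul wt_ζ.star)
  have Nn := (n1.coef_mul wt_ζ).add (n2.coef_mul wt_ζ.star)
  have R1 := ((iω.coef_mul (Eω.mul wt_ζ)).const_mul (1 / 2))
  have R2 := iκ.coef_mul ((hN.1.const_mul (cj (pPsi σ) 0)).add (hN.2.const_mul (cj (pPsi σ) 1)))
  have R3 := iκ.coef_mul ((Eγ.mul M).add (hγ.mul φ0))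
  have R4 := iκ.coef_mul ((ik.coef_mul ((Eω.mul Nn).add (hω.mul φ1))).const_mul (I / 2))
  refine (((R1.add R2).sub R3).sub R4).congr fun s => ?_
  have key := mode_algebra h hν (Icc_pos hlo s.hw) s.ζ s.q s.v rfl
  rw [(s.dz_eq h hν hlo).2]
  simp only [A] at *
  rw [dot] at key ⊢
  simp only [toVec, Matrix.cons_val_zero, Matrix.cons_val_one, Matrix.cons_val_fin_one]
  linear_combination key

end State

end ConcNLS

end


noncomputable section

namespace ConcNLS

open MeasureTheory Complex ComplexConjugate Set Filter Topology

variable {σ ν lo hi τ ω : ℝ}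

/-! ### Coefficients of the normal form -/

/-- The coefficient of `z³` including the contribution of the quadratic correction. -/
def Zk30 (σ ν τ ω : ℝ) : ℂ := Z30 σ ν ω + dot (chargeV (a20 σ ν τ ω)) (cj (Z10' σ ν ω))

/-- The coefficient of `z (conj z)²` including the contribution of the quadratic correction. -/
def Zk12 (σ ν τ ω : ℝ) : ℂ := Z12 σ ν ω + (dot (cj (chargeV (a20 σ ν τ ω))) (cj (Z10' σ ν ω))
  + dot (chargeV (a11 σ ν τ ω)) (cj (Z01' σ ν ω)))

/-- The coefficient of `(conj z)³` including the contribution of the quadratic correction. -/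
def Zk03 (σ ν τ ω : ℝ) : ℂ := Z03 σ ν ω + dot (cj (chargeV (a20 σ ν τ ω))) (cj (Z01' σ ν ω))

def nf20 (σ ν ω : ℝ) : ℂ := I * (1 / (xi σ ω : ℂ)) * Z20 σ ν ω

def nf11 (σ ν ω : ℝ) : ℂ := -I * (1 / (xi σ ω : ℂ)) * Z11 σ ν ω

def nf02 (σ ν ω : ℝ) : ℂ := -I * (1 / (xi σ ω : ℂ)) * Z02 σ ν ω / 3

def nf30 (σ ν τ ω : ℝ) : ℂ := I * (1 / (xi σ ω : ℂ)) *
  (Zk30 σ ν τ ω + 2 * nf20 σ ν ω * Z20 σ ν ω + nf11 σ ν ω * conj (Z02 σ ν ω)) / 2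

def nf12 (σ ν τ ω : ℝ) : ℂ := -I * (1 / (xi σ ω : ℂ)) *
  (Zk12 σ ν τ ω + 2 * nf20 σ ν ω * Z02 σ ν ω + nf11 σ ν ω * Z11 σ ν ω + nf11 σ ν ω * conj (Z20 σ ν ω)
    + 2 * nf02 σ ν ω * conj (Z11 σ ν ω)) / 2

def nf03 (σ ν τ ω : ℝ) : ℂ := -I * (1 / (xi σ ω : ℂ)) *
  (Zk03 σ ν τ ω + nf11 σ ν ω * Z02 σ ν ω + 2 * nf02 σ ν ω * conj (Z20 σ ν ω)) / 4

/-- With the chosen quadratic coefficients the products collapse: Z₂₀Z₁₁ occurs twice with c₂₀ and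
once, with opposite sign, with c₁₁; the other two products give the squared moduli. -/
lemma iK_eq (h : Adm σ) (hω : 0 < ω) : iK σ ν τ ω = (Z21 σ ν ω + Z21' σ ν τ ω) + 2 * nf20 σ ν ω * Z11 σ ν ω
    + nf11 σ ν ω * Z20 σ ν ω + nf11 σ ν ω * conj (Z11 σ ν ω) + 2 * nf02 σ ν ω * conj (Z02 σ ν ω) := by
  have hξ : (xi σ ω : ℂ) ≠ 0 := by exact_mod_cast (xi_pos h hω).ne'
  rw [iK, nf20, nf11, nf02, ← mul_conj', ← mul_conj']
  field_simp
  ring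

lemma good_cj_Z10' (h : Adm σ) (hν : 0 < ν) (hlo : 0 < lo) (hl : lo < hi) (i : Fin 2) :
    Good lo hi (fun _ ω => cj (Z10' σ ν ω) i) := (good_Z10' h hν hlo hl i).star hl

lemma good_cj_Z01' (h : Adm σ) (hν : 0 < ν) (hlo : 0 < lo) (hl : lo < hi) (i : Fin 2) :
    Good lo hi (fun _ ω => cj (Z01' σ ν ω) i) := (good_Z01' h hν hlo hl i).star hl

lemma good_cj_charge_a20 (h : Adm σ) (hν : 0 < ν) (hlo : 0 < lo) (hl : lo < hi) (i : Fin 2) :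
    Good lo hi (fun τ ω => cj (chargeV (a20 σ ν τ ω)) i) :=
  (good_charge_a20 h hν hlo hl i).star hl

lemma good_nf20 (h : Adm σ) (hν : 0 < ν) (hlo : 0 < lo) (hl : lo < hi) :
    Good lo hi (fun _ ω => nf20 σ ν ω) :=
  ((Good.const I).mul hl (good_inv_xi hν hlo hl)).mul hl (good_Z20 h hν hlo hl)

lemma good_nf11 (h : Adm σ) (hν : 0 < ν) (hlo : 0 < lo) (hl : lo < hi) :
    Good lo hi (fun _ ω => nf11 σ ν ω) :=
  ((Good.const (-I)).mul hl (good_inv_xi hν hlo hl)).mul hl (good_Z11 h hν hlo hl)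

lemma good_nf02 (h : Adm σ) (hν : 0 < ν) (hlo : 0 < lo) (hl : lo < hi) :
    Good lo hi (fun _ ω => nf02 σ ν ω) :=
  (((Good.const (-I)).mul hl (good_inv_xi hν hlo hl)).mul hl (good_Z02 h hν hlo hl)).div_const hl 3

lemma good_Zk30 (h : Adm σ) (hν : 0 < ν) (hlo : 0 < lo) (hl : lo < hi) :
    Good lo hi (Zk30 σ ν) := (good_Z30 h hν hlo hl).add hl
  (good_dot hl (good_charge_a20 h hν hlo hl) (good_cj_Z10' h hν hlo hl))

lemma good_Zk12 (h : Adm σ) (hν : 0 < ν) (hlo : 0 < lo) (hl : lo < hi) :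
    Good lo hi (Zk12 σ ν) := (good_Z12 h hν hlo hl).add hl
  ((good_dot hl (good_cj_charge_a20 h hν hlo hl) (good_cj_Z10' h hν hlo hl)).add hl
    (good_dot hl (good_charge_a11 h hν hlo hl) (good_cj_Z01' h hν hlo hl)))

lemma good_Zk03 (h : Adm σ) (hν : 0 < ν) (hlo : 0 < lo) (hl : lo < hi) :
    Good lo hi (Zk03 σ ν) := (good_Z03 h hν hlo hl).add hl
  (good_dot hl (good_cj_charge_a20 h hν hlo hl) (good_cj_Z01' h hν hlo hl))

lemma good_nf30 (h : Adm σ) (hν : 0 < ν) (hlo : 0 < lo) (hl : lo < hi) :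
    Good lo hi (nf30 σ ν) :=
  (((Good.const I).mul hl (good_inv_xi hν hlo hl)).mul hl (((good_Zk30 h hν hlo hl).add hl
    (((Good.const 2).mul hl (good_nf20 h hν hlo hl)).mul hl (good_Z20 h hν hlo hl))).add hl
    ((good_nf11 h hν hlo hl).mul hl ((good_Z02 h hν hlo hl).star hl)))).div_const hl 2

lemma good_nf12 (h : Adm σ) (hν : 0 < ν) (hlo : 0 < lo) (hl : lo < hi) :
    Good lo hi (nf12 σ ν) :=
  (((Good.const (-I)).mul hl (good_inv_xi hν hlo hl)).mul hl (((((good_Zk12 h hν hlo hl).add hl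
    (((Good.const 2).mul hl (good_nf20 h hν hlo hl)).mul hl (good_Z02 h hν hlo hl))).add hl
    ((good_nf11 h hν hlo hl).mul hl (good_Z11 h hν hlo hl))).add hl
    ((good_nf11 h hν hlo hl).mul hl ((good_Z20 h hν hlo hl).star hl))).add hl
    (((Good.const 2).mul hl (good_nf02 h hν hlo hl)).mul hl ((good_Z11 h hν hlo hl).star hl)))).div_const hl 2

lemma good_nf03 (h : Adm σ) (hν : 0 < ν) (hlo : 0 < lo) (hl : lo < hi) :
    Good lo hi (nf03 σ ν) :=
  (((Good.const (-I)).mul hl (good_inv_xi hν hlo hl)).mul hl (((good_Zk03 h hν hlo hl).add hl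
    ((good_nf11 h hν hlo hl).mul hl (good_Z02 h hν hlo hl))).add hl
    (((Good.const 2).mul hl (good_nf02 h hν hlo hl)).mul hl ((good_Z20 h hν hlo hl).star hl)))).div_const hl 4

lemma hasDerivWithinAt_newVar {c20 c11 c02 c30 c12 c03 z : ℝ → ℂ} {d20 d11 d02 d30 d12 d03 z' : ℂ}
    {S : Set ℝ} {t : ℝ} (h20 : HasDerivWithinAt c20 d20 S t) (h11 : HasDerivWithinAt c11 d11 S t)
    (h02 : HasDerivWithinAt c02 d02 S t) (h30 : HasDerivWithinAt c30 d30 S t)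
    (h12 : HasDerivWithinAt c12 d12 S t) (h03 : HasDerivWithinAt c03 d03 S t)
    (hz : HasDerivWithinAt z z' S t) :
    HasDerivWithinAt (fun s => newVar (c20 s) (c11 s) (c02 s) (c30 s) (c12 s) (c03 s) (z s))
      (z' + (d20 * z t ^ 2 + c20 t * (2 * z t * z'))
      + (d11 * (z t * conj (z t)) + c11 t * (z' * conj (z t) + z t * conj z'))
      + (d02 * conj (z t) ^ 2 + c02 t * (2 * conj (z t) * conj z'))
      + (d30 * z t ^ 3 + c30 t * (3 * z t ^ 2 * z'))
      + (d12 * (z t * conj (z t) ^ 2) + c12 t * (z' * conj (z t) ^ 2 + z t * (2 * conj (z t) * conj z')))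
      + (d03 * conj (z t) ^ 3 + c03 t * (3 * conj (z t) ^ 2 * conj z'))) S t := by
  have hb := HasDerivWithinAt.complex_conj hz
  refine ((((((hz.add (h20.mul (hz.pow 2))).add (h11.mul (hz.mul hb))).add (h02.mul (hb.pow 2))).add
    (h30.mul (hz.pow 3))).add (h12.mul (hz.mul (hb.pow 2)))).add (h03.mul (hb.pow 3))).congr_deriv ?_
  simp

lemma Good.wt_derivWithin {F : ℝ → ℝ → ℂ} (hF : Good lo hi F) :
    Wt State.ρ 0 (fun s : State σ ν lo hi => derivWithin (F s.τ) (Icc lo hi) s.w) := by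
  obtain ⟨M, hM⟩ := hF
  exact Wt.of_bound_zero M fun s => ((hM _ s.hτ).2 _ s.hw).2

lemma Good.hasDerivWithinAt_comp {F : ℝ → ℝ → ℂ} (hF : Good lo hi F) (s : State σ ν lo hi) :
    HasDerivWithinAt (fun r => F s.τ (s.ω r)) (derivWithin (F s.τ) (Icc lo hi) s.w * s.dω)
      (Icc 0 s.T) s.t := by
  obtain ⟨M, hM⟩ := hF
  have h1 := (((hM _ s.hτ).1.differentiableOn one_ne_zero) _ s.hw).hasDerivWithinAt
  have := HasDerivWithinAt.scomp s.t h1 s.hasDeriv_ω (fun r hr => s.mem r hr)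
  refine this.congr_deriv ?_
  rw [real_smul, mul_comm]

namespace State

/-- The charge of the remainder of the dispersive component. -/
def qr (s : State σ ν lo hi) : Fin 2 → ℂ := s.q - (s.ζ ^ 2 • chargeV (a20 σ ν s.τ s.w)
  + (s.ζ * conj s.ζ) • chargeV (a11 σ ν s.τ s.w) + conj s.ζ ^ 2 • cj (chargeV (a20 σ ν s.τ s.w)))

/-- The terms of the equation that are linear in the remainder. -/
def ell (s : State σ ν lo hi) : ℂ :=
  dot s.qr (cj (Z10' σ ν s.w)) * s.ζ + dot s.qr (cj (Z01' σ ν s.w)) * conj s.ζ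

/-- The new variable. -/
def z1 (s : State σ ν lo hi) : ℂ := newVar (nf20 σ ν s.w) (nf11 σ ν s.w) (nf02 σ ν s.w) (nf30 σ ν s.τ s.w)
  (nf12 σ ν s.τ s.w) (nf03 σ ν s.τ s.w) s.ζ

/-- The derivative of the new variable. -/
def dz1 (s : State σ ν lo hi) : ℂ := derivWithin (fun r => newVar (nf20 σ ν (s.ω r)) (nf11 σ ν (s.ω r))
  (nf02 σ ν (s.ω r)) (nf30 σ ν s.τ (s.ω r)) (nf12 σ ν s.τ (s.ω r)) (nf03 σ ν s.τ (s.ω r)) (s.z r)) (Icc 0 s.T) s.t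

lemma wt_qr (h : Adm σ) (hν : 0 < ν) (hlo : 0 < lo) (hl : lo < hi) (i : Fin 2) :
    Wt ρ 2 (fun s : State σ ν lo hi => s.qr i) := by
  have a := wt_of_good (σ := σ) (ν := ν) (good_charge_a20 h hν hlo hl i)
  have a' := wt_of_good (σ := σ) (ν := ν) (good_cj_charge_a20 h hν hlo hl i)
  have b := wt_of_good (σ := σ) (ν := ν) (good_charge_a11 h hν hlo hl i)
  exact ((wt_q h hlo i).sub ((((wt_ζ.pow 2).mul a).add ((wt_ζ.mul wt_ζ.star).mul b)).add
    ((wt_ζ.star.pow 2).mul a'))).congr fun s => by simp [qr]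

lemma wt_ell (h : Adm σ) (hν : 0 < ν) (hlo : 0 < lo) (hl : lo < hi) :
    Wt ρ 3 (fun s : State σ ν lo hi => s.ell) := by
  have a := fun i => (wt_qr (ν := ν) h hν hlo hl i).mul (wt_of_good (good_cj_Z10' h hν hlo hl i))
  have b := fun i => (wt_qr (ν := ν) h hν hlo hl i).mul (wt_of_good (good_cj_Z01' h hν hlo hl i))
  exact (((a 0).add (a 1)).mul wt_ζ).add (((b 0).add (b 1)).mul wt_ζ.star)

/-- The charge of k is quadratic in z, so inserting q_f = q_k + q_r into the terms linear in q_f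
adds to each cubic coefficient; the addition at z²z̄ is Z'₂₁. The terms with q_r have order three
and pass through the change of variable with errors of order four. -/
lemma wt_new_equation (h : Adm σ) (hν : 0 < ν) (hlo : 0 < lo) (hl : lo < hi) :
    (∀ s : State σ ν lo hi, HasDerivWithinAt (fun r => newVar (nf20 σ ν (s.ω r)) (nf11 σ ν (s.ω r))
      (nf02 σ ν (s.ω r)) (nf30 σ ν s.τ (s.ω r)) (nf12 σ ν s.τ (s.ω r)) (nf03 σ ν s.τ (s.ω r)) (s.z r))
      s.dz1 (Icc 0 s.T) s.t) ∧
    Wt ρ 4 (fun s : State σ ν lo hi => s.dz1 - (I * xi σ s.w * s.z1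
      + iK σ ν s.τ s.w * (‖s.z1‖ : ℂ) ^ 2 * s.z1 + s.ell)) := by
  have g20 := good_nf20 h hν hlo hl
  have g11 := good_nf11 h hν hlo hl
  have g02 := good_nf02 h hν hlo hl
  have g30 := good_nf30 h hν hlo hl
  have g12 := good_nf12 h hν hlo hl
  have g03 := good_nf03 h hν hlo hl
  have hd := fun s : State σ ν lo hi => hasDerivWithinAt_newVar (g20.hasDerivWithinAt_comp s)
    (g11.hasDerivWithinAt_comp s) (g02.hasDerivWithinAt_comp s) (g30.hasDerivWithinAt_comp s)
    (g12.hasDerivWithinAt_comp s) (g03.hasDerivWithinAt_comp s) (s.dz_eq h hν hlo).1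
  refine ⟨fun s => (hd s).differentiableWithinAt.hasDerivWithinAt, ?_⟩
  refine (wt_normal_form (ρ := ρ) (z' := fun s : State σ ν lo hi => s.dz) wt_ζ
    (wt_modulation h hν hlo hl).1 (wt_ell h hν hlo hl) (wt_of_good (good_Z20 h hν hlo hl))
    (wt_of_good (good_Z11 h hν hlo hl)) (wt_of_good (good_Z02 h hν hlo hl))
    (wt_of_good (good_Zk30 h hν hlo hl))
    (wt_of_good ((good_Z21 h hν hlo hl).add hl (good_Z21' h hν hlo hl)))
    (wt_of_good (good_Zk12 h hν hlo hl)) (wt_of_good (good_Zk03 h hν hlo hl))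
    (wt_of_good g20) (wt_of_good g11) (wt_of_good g02) (wt_of_good g30) (wt_of_good g12) (wt_of_good g03)
    g20.wt_derivWithin g11.wt_derivWithin g02.wt_derivWithin g30.wt_derivWithin g12.wt_derivWithin
    g03.wt_derivWithin (wt_of_good (good_iK h hν hlo hl)) (ξ := fun s => (xi σ s.w : ℂ))
    (iξ := fun s => 1 / (xi σ s.w : ℂ)) (fun s => ?_) (fun s => conj_ofReal _) (fun s => rfl)
    (fun s => rfl) (fun s => rfl) (fun s => rfl) (fun s => rfl) (fun s => rfl)
    (fun s => iK_eq h (Icc_pos hlo s.hw)) ?_).congr fun s => ?_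
  · exact one_div_mul_cancel (by exact_mod_cast (xi_pos h (Icc_pos hlo s.hw)).ne')
  · refine (wt_z_equation h hν hlo hl).congr fun s => ?_
    simp only [Zk30, Zk12, Zk03, Z21', ell, qr, dot, Pi.sub_apply, Pi.add_apply, Pi.smul_apply, smul_eq_mul]
    ring
  · have e := (hd s).derivWithin (uniqueDiffOn_Icc s.T_pos _ s.ht)
    rw [dz1, e, z1, ← mul_conj']
    simp only [w, ζ]

end State

end ConcNLS

end


/-! ### The frozen decomposition and the final estimates. -/

noncomputable section

namespace ConcNLS

open MeasureTheory Complex ComplexConjugate Set Filter Topology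

variable {σ ν lo hi τ ω : ℝ}

lemma norm_dot_le (p q : Fin 2 → ℂ) : ‖dot p q‖ ≤ 2 * (‖p‖ * ‖q‖) := by
  have h : ∀ i, ‖p i * q i‖ ≤ ‖p‖ * ‖q‖ := fun i => by
    rw [norm_mul]
    exact mul_le_mul (norm_le_pi_norm p i) (norm_le_pi_norm q i) (norm_nonneg _) (norm_nonneg _)
  calc _ ≤ ‖p 0 * q 0‖ + ‖p 1 * q 1‖ := norm_add_le _ _
    _ ≤ _ := by linarith [h 0, h 1]

lemma norm_newVar_le {c20 c11 c02 c30 c12 c03 z : ℂ} {C : ℝ} (hz : ‖z‖ ≤ 1)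
    (hc : ∀ c ∈ [c20, c11, c02, c30, c12, c03], ‖c‖ ≤ C) :
    ‖newVar c20 c11 c02 c30 c12 c03 z‖ ≤ (1 + 6 * C) * ‖z‖ := by
  have h2 : ‖z‖ ^ 2 ≤ ‖z‖ := by
    simpa using pow_le_pow_of_le_one (norm_nonneg z) hz one_le_two
  have h3 : ‖z‖ ^ 3 ≤ ‖z‖ := by
    simpa using pow_le_pow_of_le_one (norm_nonneg z) hz (by norm_num : 1 ≤ 3)
  have key : ∀ c ∈ [c20, c11, c02, c30, c12, c03], ∀ w : ℂ, ‖w‖ ≤ ‖z‖ → ‖c * w‖ ≤ C * ‖z‖ := fun c hm w hw => by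
    rw [norm_mul]
    exact mul_le_mul (hc c hm) hw (norm_nonneg _) ((norm_nonneg _).trans (hc c hm))
  have k20 := key c20 (by simp) (z ^ 2) (by rwa [norm_pow])
  have k11 := key c11 (by simp) (z * conj z) (by rwa [norm_mul, RCLike.norm_conj, ← sq])
  have k02 := key c02 (by simp) (conj z ^ 2) (by rwa [norm_pow, RCLike.norm_conj])
  have k30 := key c30 (by simp) (z ^ 3) (by rwa [norm_pow])
  have k12 := key c12 (by simp) (z * conj z ^ 2) (by
    rwa [norm_mul, norm_pow, RCLike.norm_conj, ← pow_succ'])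
  have k03 := key c03 (by simp) (conj z ^ 3) (by rwa [norm_pow, RCLike.norm_conj])
  rw [newVar]
  refine (norm_add_le_of_le (norm_add_le_of_le (norm_add_le_of_le (norm_add_le_of_le (norm_add_le_of_le
    (norm_add_le_of_le le_rfl k20) k11) k02) k30) k12) k03).trans (le_of_eq ?_)
  ring

/-- Membership of the six coefficients of the normal form in the class of uniform `C¹` families. -/
lemma good_coefficients (h : Adm σ) (hν : 0 < ν) (hlo : 0 < lo) (hl : lo < hi) :
    ∃ M > 0, ∀ τ ∈ Icc lo hi, ∀ c ∈ [nf20 σ ν, nf11 σ ν, nf02 σ ν, nf30 σ ν τ, nf12 σ ν τ, nf03 σ ν τ],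
      ContDiffOn ℝ 1 c (Icc lo hi) ∧ ∀ s ∈ Icc lo hi, ‖c s‖ ≤ M := by
  obtain ⟨M1, h1⟩ := good_nf20 h hν hlo hl
  obtain ⟨M2, h2⟩ := good_nf11 h hν hlo hl
  obtain ⟨M3, h3⟩ := good_nf02 h hν hlo hl
  obtain ⟨M4, h4⟩ := good_nf30 h hν hlo hl
  obtain ⟨M5, h5⟩ := good_nf12 h hν hlo hl
  obtain ⟨M6, h6⟩ := good_nf03 h hν hlo hl
  refine ⟨1 + |M1| + |M2| + |M3| + |M4| + |M5| + |M6|, by positivity, fun τ hτ => ?_⟩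
  have n1 := abs_nonneg M1
  have n2 := abs_nonneg M2
  have n3 := abs_nonneg M3
  have n4 := abs_nonneg M4
  have n5 := abs_nonneg M5
  have n6 := abs_nonneg M6
  simp only [List.mem_cons, List.not_mem_nil, or_false, forall_eq_or_imp, forall_eq]
  exact ⟨⟨(h1 τ hτ).1, fun s hs => (((h1 τ hτ).2 s hs).1.trans (le_abs_self _)).trans (by linarith)⟩,
    ⟨(h2 τ hτ).1, fun s hs => (((h2 τ hτ).2 s hs).1.trans (le_abs_self _)).trans (by linarith)⟩,
    ⟨(h3 τ hτ).1, fun s hs => (((h3 τ hτ).2 s hs).1.trans (le_abs_self _)).trans (by linarith)⟩,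
    ⟨(h4 τ hτ).1, fun s hs => (((h4 τ hτ).2 s hs).1.trans (le_abs_self _)).trans (by linarith)⟩,
    ⟨(h5 τ hτ).1, fun s hs => (((h5 τ hτ).2 s hs).1.trans (le_abs_self _)).trans (by linarith)⟩,
    ⟨(h6 τ hτ).1, fun s hs => (((h6 τ hτ).2 s hs).1.trans (le_abs_self _)).trans (by linarith)⟩⟩

/-- The decomposition of the remainder of the dispersive component. -/
lemma remainder_decomposition (h : Adm σ) (hν : 0 < ν) (hlo : 0 < lo) (hl : lo < hi) (hτ : τ ∈ Icc lo hi)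
    {f h₁ k₁ : Field2} {z : ℂ} (hf : MemW f) (hk : MemW k₁)
    (e : Pc σ ν τ f = fun x => h₁ x + kCorr σ ν τ ω z x + k₁ x) :
    MemW h₁ ∧ (fun x => (P0 σ ν τ f x + P1 σ τ f x) + Pc σ ν τ h₁ x + Pc σ ν τ k₁ x)
      = fun x => f x - kCorr σ ν τ ω z x := by
  have hτ' := Icc_pos hlo hτ
  obtain ⟨A, _, hA⟩ := MemW.Pc_memW h hν hlo hl
  have mP := (hA f hf τ hτ).1
  have mk := memW_kCorr (ω := ω) h hν hlo hl hτ z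
  have e1 : h₁ = fun x => (Pc σ ν τ f x + (-1 : ℂ) • kCorr σ ν τ ω z x) + (-1 : ℂ) • k₁ x := by
    rw [e]; funext x; simp only [neg_smul, one_smul]; abel
  have m1 := (mP.add (mk.smul (-1)).1).1
  refine ⟨by rw [e1]; exact (m1.add (hk.smul (-1)).1).1, ?_⟩
  -- Applied to h₁ = P^c f - k - k₁, the projection fixes the first two terms; adding P^c k₁ and g
  -- then leaves f - k, whatever k₁ was.
  have e2 : Pc σ ν τ h₁ = fun x => (Pc σ ν τ f x + (-1 : ℂ) • kCorr σ ν τ ω z x) + (-1 : ℂ) • Pc σ ν τ k₁ x := by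
    rw [e1, Pc_add_smul h hν hτ' m1.pairable hk.pairable, Pc_add_smul h hν hτ' mP.pairable mk.pairable,
      Pc_idem h hν hτ' hf.pairable, Pc_kCorr h hν hlo hl hτ z]
  funext x
  rw [e2]
  simp only [Pc, neg_smul, one_smul]
  abel

lemma exists_norm_bound {F : ℝ → Fin 2 → ℂ} (hF : ∀ i, Good lo hi (fun _ ω => F ω i)) :
    ∃ B > 0, ∀ ω ∈ Icc lo hi, ‖F ω‖ ≤ B := by
  obtain ⟨B₀, h₀, b₀⟩ := (hF 0).bound
  obtain ⟨B₁, h₁, b₁⟩ := (hF 1).bound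
  refine ⟨B₀ + B₁, by positivity, fun ω hω => (pi_norm_le_iff_of_nonneg (by positivity)).2 ?_⟩
  exact Fin.forall_fin_two.2 ⟨by linarith [b₀ ω hω ω hω], by linarith [b₁ ω hω ω hω]⟩

/-- The terms linear in the remainder, estimated through the frozen decomposition. -/
lemma norm_ell_le {z : ℂ} {p a b : Fin 2 → ℂ} {B Cq Md wg w₁ w₂ wf wh d : ℝ} (hCq : 0 ≤ Cq)
    (ha : ‖a‖ ≤ B) (hb : ‖b‖ ≤ B) (hp : ‖p‖ ≤ Cq * (wg + w₁ + w₂)) (hg : wg ≤ Md * d * wf)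
    (hMd : 0 ≤ Md) (hd : Md * d ≤ 1 / 2) (hd0 : 0 ≤ d) (hwf : wf ≤ wg + wh) (hwf0 : 0 ≤ wf) :
    ‖dot p a * z + dot p b * conj z‖ ≤ 4 * B * Cq * (‖z‖ * (2 * Md * d * wh + w₁ + w₂)) := by
  -- The discrete part is at most half of f, so f is controlled by h and the estimate of g can be
  -- stated with h.
  have e1 : wf ≤ 2 * wh := by
    have := mul_le_mul_of_nonneg_right hd hwf0
    linarith
  have e2 : wg ≤ 2 * Md * d * wh :=
    hg.trans (by have := mul_le_mul_of_nonneg_left e1 (mul_nonneg hMd hd0); linarith)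
  have e3 : ‖p‖ ≤ Cq * (2 * Md * d * wh + w₁ + w₂) :=
    hp.trans (mul_le_mul_of_nonneg_left (by linarith) hCq)
  have key : ∀ c : Fin 2 → ℂ, ‖c‖ ≤ B → ‖dot p c‖ ≤ 2 * ((Cq * (2 * Md * d * wh + w₁ + w₂)) * B) := fun c hc =>
    (norm_dot_le p c).trans (mul_le_mul_of_nonneg_left
      (mul_le_mul e3 hc (norm_nonneg _) ((norm_nonneg p).trans e3)) zero_le_two)
  calc _ ≤ ‖dot p a‖ * ‖z‖ + ‖dot p b‖ * ‖z‖ := by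
        refine (norm_add_le _ _).trans (le_of_eq ?_)
        rw [norm_mul, norm_mul, RCLike.norm_conj]
    _ ≤ 2 * ((Cq * (2 * Md * d * wh + w₁ + w₂)) * B) * ‖z‖
        + 2 * ((Cq * (2 * Md * d * wh + w₁ + w₂)) * B) * ‖z‖ :=
      add_le_add (mul_le_mul_of_nonneg_right (key a ha) (norm_nonneg _))
        (mul_le_mul_of_nonneg_right (key b hb) (norm_nonneg _))
    _ = _ := by ring

lemma norm_cubic_le {K K' ζ : ℂ} {L M d r : ℝ} (hK : ‖K - K'‖ ≤ L * d) (hL : 0 ≤ L) (hd : 0 ≤ d)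
    (hζ : ‖ζ‖ ≤ (1 + 6 * M) * r) :
    ‖K * (‖ζ‖ : ℂ) ^ 2 * ζ - K' * (‖ζ‖ : ℂ) ^ 2 * ζ‖ ≤ L * (1 + 6 * M) ^ 3 * (r * d * r ^ 2) := by
  rw [← sub_mul, ← sub_mul, norm_mul, norm_mul, norm_pow, norm_real, norm_norm]
  calc _ = ‖K - K'‖ * ‖ζ‖ ^ 3 := by ring
    _ ≤ (L * d) * ((1 + 6 * M) * r) ^ 3 := by gcongr
    _ = _ := by ring

lemma final_sum_le {C4 L B Md M S r d W wh w₁ w₂ Wf : ℝ} (hM : 0 ≤ M) (hC4 : 0 ≤ C4) (hL : 0 ≤ L)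
    (hB : 0 ≤ B) (hMd : 0 ≤ Md) (hr : 0 ≤ r) (hd : 0 ≤ d) (hwh : 0 ≤ wh) (h₁ : 0 ≤ w₁) (h₂ : 0 ≤ w₂)
    (hWf : 0 ≤ Wf) (hS : S = M + C4 + L + B * (2 * Md + 1))
    (hW : W ≤ L * (r * d * r ^ 2) + B * (r * (2 * Md * d * wh + w₁ + w₂)) + C4 * Wf) :
    W ≤ S * (Wf + r * d * (r ^ 2 + wh) + r * w₂ + r * w₁) := by
  subst hS
  refine hW.trans ?_
  have p1 : 0 ≤ r * d * r ^ 2 := by positivity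
  have p2 : 0 ≤ r * d * wh := by positivity
  have p3 : 0 ≤ r * w₁ := by positivity
  have p4 : 0 ≤ r * w₂ := by positivity
  rw [← sub_nonneg]
  have e : (M + C4 + L + B * (2 * Md + 1)) * (Wf + r * d * (r ^ 2 + wh) + r * w₂ + r * w₁)
      - (L * (r * d * r ^ 2) + B * (r * (2 * Md * d * wh + w₁ + w₂)) + C4 * Wf)
      = (M + L + B * (2 * Md + 1)) * Wf + (M + C4 + B * (2 * Md + 1)) * (r * d * r ^ 2)
        + (M + C4 + L + B) * (r * d * wh) + (M + C4 + L + 2 * Md * B) * (r * w₁ + r * w₂) := by ring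
  rw [e]
  positivity

end ConcNLS

end

theorem mainTheorem9 (σ ν : ℝ) (hσ₁ : 1 / √2 < σ) (hσ₂ : σ < (√3 + 1) / (2 * √2)) (hν : 0 < ν)
    (ωlo ωhi : ℝ) (hlo : 0 < ωlo) (hlohi : ωlo < ωhi) :
    ∃ δ > (0 : ℝ), ∃ C > (0 : ℝ), ∀ ωT ∈ Set.Icc ωlo ωhi,
      ∃ c20 c11 c02 c30 c12 c03 : ℝ → ℂ,
        (∀ c ∈ [c20, c11, c02, c30, c12, c03],
          ContDiffOn ℝ 1 c (Set.Icc ωlo ωhi) ∧ ∀ s ∈ Set.Icc ωlo ωhi, ‖c s‖ ≤ C) ∧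
        ∀ (T : ℝ) (u : ℝ → EnergySpace) (ω γ : ℝ → ℝ) (z : ℝ → ℂ), 0 < T →
          IsModulated σ ν T u ω γ z → (∀ t ∈ Set.Icc 0 T, ω t ∈ Set.Icc ωlo ωhi) → ω T = ωT →
          ∀ t ∈ Set.Icc 0 T, ∀ f g h k k₁ h₁ : Field2,
            f = fPart σ ν (u t).toFun (phase ω γ t) (ω t) (z t) →
            MemW f → ‖z t‖ + wNorm f ≤ δ →
            g = (fun x => P0 σ ν ωT f x + P1 σ ωT f x) →
            h = Pc σ ν ωT f →
            k = kCorr σ ν ωT (ω t) (z t) →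
            MemW k₁ → h = (fun x => h₁ x + k x + k₁ x) →
            ∀ z₁ : ℝ → ℂ,
              z₁ = (fun s => newVar (c20 (ω s)) (c11 (ω s)) (c02 (ω s)) (c30 (ω s))
                (c12 (ω s)) (c03 (ω s)) (z s)) →
              ∃ D ZR : ℂ,
                HasDerivWithinAt z₁ D (Set.Icc 0 T) t ∧
                D = Complex.I * xi σ (ω t) * z₁ t
                    + iK σ ν ωT (ω t) * (‖z₁ t‖ : ℂ) ^ 2 * z₁ t
                    + dot (chargeV (fun x => g x + Pc σ ν ωT h₁ x + Pc σ ν ωT k₁ x))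
                        (cj (Z10' σ ν (ω t))) * z t
                    + dot (chargeV (fun x => g x + Pc σ ν ωT h₁ x + Pc σ ν ωT k₁ x))
                        (cj (Z01' σ ν (ω t))) * starRingEnd ℂ (z t)
                    + ZR ∧
                ‖ZR‖ ≤ C * (‖z t‖ ^ 2 + wNorm f) ^ 2 ∧
                (|ωT - ω t| ≤ δ →
                  ‖D - Complex.I * xi σ (ω t) * z₁ t
                      - iK σ ν ωT ωT * (‖z₁ t‖ : ℂ) ^ 2 * z₁ t‖
                    ≤ C * ((‖z t‖ ^ 2 + wNorm f) ^ 2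
                      + ‖z t‖ * |ωT - ω t| * (‖z t‖ ^ 2 + wNorm h)
                      + ‖z t‖ * wNorm (Pc σ ν ωT k₁)
                      + ‖z t‖ * wNorm (Pc σ ν ωT h₁))) := by
  have h := adm_of_range hσ₁ hσ₂
  obtain ⟨M, hM, hc⟩ := good_coefficients h hν hlo hlohi
  obtain ⟨hderiv, hwt⟩ := State.wt_new_equation (σ := σ) (ν := ν) h hν hlo hlohi
  obtain ⟨C4, hC4, δ4, hδ4, hb⟩ := hwt.exists_bound State.ρ_nonneg
  obtain ⟨L, hL, hlip⟩ := (good_iK h hν hlo hlohi).lipschitz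
  obtain ⟨Md, hMd, hdisc⟩ := exists_discrete_bound h hν hlo hlohi
  obtain ⟨A, hA, hPc⟩ := MemW.Pc_memW h hν hlo hlohi
  obtain ⟨Cq, hCq, hcharge⟩ := exists_chargeV_bound
  obtain ⟨B₁, hB₁, hb₁⟩ := exists_norm_bound (good_cj_Z10' h hν hlo hlohi)
  obtain ⟨B₂, hB₂, hb₂⟩ := exists_norm_bound (good_cj_Z01' h hν hlo hlohi)
  -- The bound 1 gives |z|² ≤ |z|, hence ρ² ≤ |z| + ‖f‖, and δ4² then gives ρ ≤ δ4. The bound 1/(2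
  -- Md) on |ω_T - ω| allows f to be estimated by h.
  refine ⟨min (min 1 (δ4 ^ 2)) (1 / (2 * Md)), by positivity,
    M + C4 + L * (1 + 6 * M) ^ 3 + 4 * (B₁ + B₂) * Cq * (2 * Md + 1), by positivity, fun ωT hωT =>
    ⟨nf20 σ ν, nf11 σ ν, nf02 σ ν, nf30 σ ν ωT, nf12 σ ν ωT, nf03 σ ν ωT, fun c hcm =>
      ⟨(hc ωT hωT c hcm).1, fun s hs => ((hc ωT hωT c hcm).2 s hs).trans ?_⟩, ?_⟩⟩
  · have : 0 ≤ C4 + L * (1 + 6 * M) ^ 3 + 4 * (B₁ + B₂) * Cq * (2 * Md + 1) := by positivity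
    linarith
  intro T u ω γ z hT hmod hω _ t ht f g hh k k₁ h₁ hf hfW hsmall hg hhe hk hk₁ hsplit z₁ hz₁
  -- The order estimates hold for all states at once; this is the state of the given solution at
  -- time t with frozen frequency ω_T.
  set s : State σ ν ωlo ωhi := ⟨T, t, ωT, u, ω, γ, z, hT, hmod, hω, ht, hωT, hf ▸ hfW⟩ with hs
  have hsf : s.f = f := hf.symm
  have hωt := hω t ht
  have hwf := wNorm_nonneg f
  have hz1 : z₁ t = s.z1 := by rw [hz₁]; rfl
  simp only [le_min_iff] at hsmall
  obtain ⟨⟨hs1, hs2⟩, hs3⟩ := hsmall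
  have hzle : ‖z t‖ ≤ 1 := by linarith
  have hρ2 : s.ρ ^ 2 = ‖z t‖ ^ 2 + wNorm f := by rw [State.ρ_sq, hsf]; rfl
  have hρ : s.ρ ≤ δ4 := by
    refine le_of_sq_le_sq ?_ hδ4.le
    have : ‖z t‖ ^ 2 ≤ ‖z t‖ := by
      simpa using pow_le_pow_of_le_one (norm_nonneg (z t)) hzle one_le_two
    linarith
  have hZR := hb s hρ
  rw [show s.ρ ^ 4 = (‖z t‖ ^ 2 + wNorm f) ^ 2 by rw [← hρ2]; ring] at hZR
  obtain ⟨mh₁, hdec⟩ := remainder_decomposition (ω := ω t) (z := z t) h hν hlo hlohi hωT hfW hk₁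
    (by rw [← hhe, hsplit, hk])
  have hgsum : (fun x => g x + Pc σ ν ωT h₁ x + Pc σ ν ωT k₁ x) = fun x => f x - kCorr σ ν ωT (ω t) (z t) x := by
    rw [hg]; exact hdec
  have hqr : HasChargeV (fun x => g x + Pc σ ν ωT h₁ x + Pc σ ν ωT k₁ x) s.qr := by
    rw [hgsum]
    exact (hsf ▸ (s.toVec_eta h hlo).1).sub
      (hasChargeV_kCorr h hν (Icc_pos hlo hωT) (Icc_pos hlo hωt) (z t))
  rw [hqr.chargeV_eq]
  refine ⟨s.dz1, s.dz1 - (Complex.I * xi σ s.w * s.z1 + iK σ ν s.τ s.w * (‖s.z1‖ : ℂ) ^ 2 * s.z1 + s.ell),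
    ?_, ?_, ?_, ?_⟩
  · rw [hz₁]; exact hderiv s
  · rw [hz1]
    simp only [State.ell]
    change s.dz1 = Complex.I * xi σ s.w * s.z1 + iK σ ν s.τ s.w * (‖s.z1‖ : ℂ) ^ 2 * s.z1
      + dot s.qr (cj (Z10' σ ν s.w)) * s.ζ + dot s.qr (cj (Z01' σ ν s.w)) * (starRingEnd ℂ) s.ζ + _
    ring
  · refine hZR.trans (mul_le_mul_of_nonneg_right ?_ (by positivity))
    have : 0 ≤ M + L * (1 + 6 * M) ^ 3 + 4 * (B₁ + B₂) * Cq * (2 * Md + 1) := by positivity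
    linarith
  · intro hdist
    simp only [le_min_iff] at hdist
    have mg := hdisc f hfW ωT hωT
    have mP₁ := (hPc h₁ mh₁ ωT hωT).1
    have mP₂ := (hPc k₁ hk₁ ωT hωT).1
    rw [← hg] at mg
    have mgh := (mg.1.add mP₁)
    have msum := mgh.1.add mP₂
    have hPf := (hPc f hfW ωT hωT).1
    have hfsum : wNorm f ≤ wNorm g + wNorm hh := by
      have := (mg.1.add hPf).2
      rw [← hhe] at this
      rwa [show (fun x => g x + hh x) = f by rw [hg, hhe]; funext x; simp only [Pc]; abel] at this
    -- Vanishing of both projections of f at ω(t) makes g of size |ω_T - ω| ‖f‖.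
    have o0 := hmod.orth0 t ht
    have o1 := hmod.orth1 t ht
    rw [← hf] at o0 o1
    have hell : ‖s.ell‖ ≤ _ := norm_ell_le (z := z t) (p := s.qr) (a := cj (Z10' σ ν (ω t)))
      (b := cj (Z01' σ ν (ω t))) (B := B₁ + B₂) (Cq := Cq) (Md := Md) (d := |ωT - ω t|) (wf := wNorm f)
      (wh := wNorm hh) (wg := wNorm g) (w₁ := wNorm (Pc σ ν ωT h₁)) (w₂ := wNorm (Pc σ ν ωT k₁))
      hCq.le ((hb₁ _ hωt).trans (by linarith)) ((hb₂ _ hωt).trans (by linarith))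
      ((hcharge _ _ hqr msum.1).trans (mul_le_mul_of_nonneg_left
        (msum.2.trans (add_le_add mgh.2 le_rfl)) hCq.le))
      (mg.2.2 _ hωt o0 o1) hMd.le
      (by have := hdist.2; rw [le_div_iff₀ (by positivity)] at this; linarith) (abs_nonneg _) hfsum hwf
    have hcub := norm_cubic_le (hlip ωT hωT (ω t) hωt ωT hωT) hL.le (abs_nonneg _)
      (norm_newVar_le hzle (C := M) (c20 := nf20 σ ν (ω t)) (c11 := nf11 σ ν (ω t)) (c02 := nf02 σ ν (ω t))
        (c30 := nf30 σ ν ωT (ω t)) (c12 := nf12 σ ν ωT (ω t)) (c03 := nf03 σ ν ωT (ω t)) (by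
          have := hc ωT hωT
          simp only [List.mem_cons, List.not_mem_nil, or_false, forall_eq_or_imp, forall_eq] at this ⊢
          exact ⟨this.1.2 _ hωt, this.2.1.2 _ hωt, this.2.2.1.2 _ hωt, this.2.2.2.1.2 _ hωt,
            this.2.2.2.2.1.2 _ hωt, this.2.2.2.2.2.2 _ hωt⟩))
    rw [abs_sub_comm] at hcub
    refine final_sum_le (M := M) (C4 := C4) (L := L * (1 + 6 * M) ^ 3) (B := 4 * (B₁ + B₂) * Cq) (Md := Md)
      hM.le hC4.le (by positivity) (by positivity) hMd.le (norm_nonneg _) (abs_nonneg _) (wNorm_nonneg _)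
      (wNorm_nonneg _) (wNorm_nonneg _) (by positivity) rfl ?_
    -- Three contributions: the change of K between ω(t) and ω_T, the terms linear in the remainder,
    -- and the error of order four.
    have e : s.dz1 - Complex.I * xi σ (ω t) * z₁ t - iK σ ν ωT ωT * (‖z₁ t‖ : ℂ) ^ 2 * z₁ t
        = (iK σ ν ωT (ω t) * (‖s.z1‖ : ℂ) ^ 2 * s.z1 - iK σ ν ωT ωT * (‖s.z1‖ : ℂ) ^ 2 * s.z1) + s.ell
          + (s.dz1 - (Complex.I * xi σ s.w * s.z1 + iK σ ν s.τ s.w * (‖s.z1‖ : ℂ) ^ 2 * s.z1 + s.ell)) := by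
      have ew : s.w = ω t := rfl
      have eτ : s.τ = ωT := rfl
      rw [hz1, ew, eτ]
      ring
    rw [e]
    exact norm_add_le_of_le (norm_add_le_of_le hcub hell) hZR
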